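/- **Setting.** Let $B=\{(x,y,z)\in\mathbb R^3: z<0\}$, identify $\partial B$ with $\mathbb R^2$, and let $\mathbf k=(0,0,1)$. For a transformation $\varphi$ of $\bar B$ let $\Phi$ be its restriction to $\partial B$; for a vector field $\mathbf v$ on $\bar B$ with $\mathbf v\cdot\mathbf k=0$ on $\partial B$ let $\mathbf V$ be its trace on $\partial B$. *Domains.* A smooth domain $\Omega\subset\mathbb R^2$ is a bounded open set whose boundary is a disjoint union of finitely many $C^\infty$ regular simple closed curves, with $\Omega$ lying on exactly one side of each. $\mathbf n$ is its unit outward normal, $\kappa$ its curvature with the sign for which $\kappa<0$ for convex $\Omega$ (so $\kappa\mathbf n$ is the arc-length derivative of the unit tangent), and $\mathrm{Per}(\Omega)$ is the length ($\mathcal H^1$-measure) of $\partial\Omega$. *Velocity fields.* For a closed set $\Gamma\subset\partial B$ let $d(x)=\mathrm{dist}(x,\Gamma)$. A field $\mathbf v:\bar B\to\mathbb R^3$ is *regular with interface $\Gamma$ and constant $C$* if it is continuous on $\bar B$, $C^\infty$ on $\bar B\setminus\Gamma$ (up to the boundary), and $$|\mathbf v|\le \frac{C}{1+|x|},\qquad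 |\nabla\mathbf v|\le \frac{C\,(1+\log(1+1/d))}{(1+|x|)^2},\qquad |\nabla^2\mathbf v|\le\frac{C\,(1+1/d)}{(1+|x|)^3},$$ the factors containing $d$ being replaced by $1$ if $\Gamma=\emptyset$. Let $\mathcal V_\Gamma$ be the set of fields that are regular with interface $\Gamma$ (for some $C$) and satisfy $\nabla\cdot\mathbf v=0$ in $B$, $\mathbf V\cdot\mathbf k=0$ on $\partial B$, and $\nabla_\perp\cdot\mathbf V=0$ on $\partial B\setminus\Gamma$. Put $\mathcal V=\mathcal V_\emptyset$: the decaying divergence free fields, $C^\infty$ on $\bar B$ and tangent to $\partial B$, with divergence free trace. *Manifold, metric, energy.* $\mathcal M$ is the set of homeomorphisms $\varphi$ of $\bar B$ that restrict to $C^\infty$ diffeomorphisms of $B$ with $\det D\varphi=1$ (orientation and volume are preserved) and for which $\Phi$ preserves area on $\partial B$. For $\mathbf v_\varphi=\mathbf v\circ\varphi$ and $\mathbf w_\varphi=\mathbf w\circ\varphi$, $$g_\varphi(\mathbf v_\varphi,\mathbf w_\varphi)=\int_B\mathrm{Tr}(\nabla\mathbf v^T\nabla\mathbf w)\,dx .$$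 Fix a smooth domain $\Omega_0$ and let $\mathcal E(\varphi)=\mathrm{Per}(\Phi(\Omega_0))$. For $\mathbf v\in\mathcal V$ with flow $\varphi_{\mathbf v}(\tau)$ let $\langle d\mathcal E(\varphi),\mathbf v_\varphi\rangle=\frac{d}{d\tau}\big|_{\tau=0}\mathcal E(\varphi_{\mathbf v}(\tau)\circ\varphi)$. *Motion.* Let $T>0$, and let $\varphi(t)$, $0\le t<T$, be the motion generated by a velocity field $\mathbf u(t)$ on $\bar B$: $$\partial_t\varphi=\mathbf u\circ\varphi\ \text{ on }\bar B,\qquad \varphi(0)=\mathrm{Id}$$ (hence $\partial_t\Phi=\mathbf U\circ\Phi$, $\Phi(0)=\mathrm{Id}$). Each $\varphi(t)$ is a homeomorphism of $\bar B$ restricting to a $C^\infty$ diffeomorphism of $B$; $\varphi$ is $C^\infty$ in $(t,x)$ on $[0,T)\times B$, and $\Phi$ is so on $[0,T)\times(\partial B\setminus\partial\Omega_0)$; each $\Phi(t)$ carries the boundary curves of $\Omega_0$ to $C^\infty$ regular curves; and $\mathbf u(t)$ is regular with interface $\Gamma_t=\Phi(t)(\partial\Omega_0)$, with a constant that is uniform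 for $t$ in compact subintervals of $[0,T)$. (No incompressibility is assumed.) **Theorem.** For every family $(\Omega_t)_{0\le t<T}$ of subsets of $\mathbb R^2$ the following are equivalent. (A) *Gradient flow.* $\Omega_t=\Phi(t)(\Omega_0)$ for all $t\in[0,T)$, and for each such $t$: $\varphi(t)\in\mathcal M$, $\partial_t\varphi(t)=\mathbf v\circ\varphi(t)$ for some $\mathbf v\in\mathcal V_{\Gamma_t}$, and for every $\mathbf v\in\mathcal V$ the derivative $\langle d\mathcal E(\varphi),\mathbf v_\varphi\rangle$ exists and $$g_{\varphi}(\partial_t\varphi,\mathbf v_\varphi)=-\langle d\mathcal E(\varphi),\mathbf v_\varphi\rangle .$$ (B) *ILLSS model.* $\Omega_{t}$ equals $\Omega_0$ at $t=0$, and there are pressures $P(t)\in C^\infty(B)$, surface pressures $\Pi(t)\in L^1_{\rm loc}(\mathbb R^2)$ and boundary points $\mathbf\Gamma(t,\cdot)$ such that for all $t\in[0,T)$: $\Omega_t$ is a smooth domain whose boundary curves are parametrized by $\mathbf\Gamma(t,\cdot)$; $$\nabla\cdot\mathbf u=0,\quad \triangle\mathbf u=\nabla P\ \text{ in }B,\qquad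 \mathbf u\cdot\mathbf k=0\ \text{ on }\partial B,\qquad \nabla_\perp\cdot\mathbf U=0\ \text{ on }\partial B\setminus\partial\Omega_t;$$ the force balance $$\nabla_\perp\Pi=\mathbf F_s+\mathbf F_l,\qquad \mathbf F_s=-\partial_z(u_1,u_2)\big|_{z=0},\qquad \mathbf F_l=\kappa\,\mathbf n\,\mathcal H^1|_{\partial\Omega_t},$$ holds in the sense of distributions on $\mathbb R^2$; and each boundary point is advected by the surface velocity, $\partial_t\mathbf\Gamma=\mathbf U(t,\mathbf\Gamma)$, where $\mathbf U(x,y)=\mathbf u(x,y,0)$. -/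

import Mathlib

open Set Filter Topology MeasureTheory
open scoped ContDiff

noncomputable section

namespace ILLSS

/-! ### The half-space and its boundary -/

/-- Three-dimensional Euclidean space. -/
abbrev Space : Type := EuclideanSpace ℝ (Fin 3)

/-- The Euclidean plane, identified with the boundary `z = 0` of the half-space. -/
abbrev Plane : Type := EuclideanSpace ℝ (Fin 2)

/-- The open half-space `B = {z < 0}`. -/
def halfSpace : Set Space := {x | x 2 < 0}

/-- The closed half-space `{z ≤ 0}`. -/
def closedHalfSpace : Set Space := {x | x 2 ≤ 0}

/-- The inclusion `(x, y) ↦ (x, y, 0)` of the plane as the boundary of the half-space. -/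
def embed (p : Plane) : Space := !₂[p 0, p 1, 0]

/-- The horizontal part `(x, y)` of a vector `(x, y, z)`. -/
def horizontal (x : Space) : Plane := !₂[x 0, x 1]

/-- The vertical unit vector. -/
def vertical : Space := !₂[0, 0, 1]

/-- The restriction `Φ` of a transformation `φ` of the half-space to the boundary. The same
operation turns a velocity field `v` with `v · k = 0` on the boundary into its trace `V`. -/
def trace (φ : Space → Space) (p : Plane) : Plane := horizontal (φ (embed p))

/-- The divergence of a vector field in space. -/
def divergence (v : Space → Space) (x : Space) : ℝ :=
  ∑ i : Fin 3, fderiv ℝ v x (EuclideanSpace.single i 1) i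

/-- The surface divergence of a vector field in the plane. -/
def surfaceDivergence (V : Plane → Plane) (p : Plane) : ℝ :=
  ∑ i : Fin 2, fderiv ℝ V p (EuclideanSpace.single i 1) i

/-! ### Plane domains with smooth boundary -/

/-- The unit tangent of a regular plane curve. -/
def unitTangent (γ : ℝ → Plane) (s : ℝ) : Plane := ‖deriv γ s‖⁻¹ • deriv γ s

/-- The unit tangent turned clockwise by a right angle. -/
def rightNormal (γ : ℝ → Plane) (s : ℝ) : Plane :=
  !₂[unitTangent γ s 1, -(unitTangent γ s 0)]

/-- The vector `n`, attached at `p`, points out of `Ω`, and `-n` points into `Ω`. -/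
def PointsOutward (Ω : Set Plane) (p n : Plane) : Prop :=
  ∀ᶠ ε : ℝ in 𝓝[>] 0, p + ε • n ∉ Ω ∧ p - ε • n ∈ Ω

/-- `Ω` is a bounded open set of the plane whose boundary is the disjoint union of the finitely
many smooth regular simple closed curves `γ i` (of period one), and `Ω` lies on exactly one side
of each of them. -/
structure IsSmoothDomain (Ω : Set Plane) {m : ℕ} (γ : Fin m → ℝ → Plane) : Prop where
  isOpen : IsOpen Ω
  isBounded : Bornology.IsBounded Ω
  smooth : ∀ i, ContDiff ℝ ∞ (γ i)
  periodic : ∀ i, Function.Periodic (γ i) 1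
  regular : ∀ i s, deriv (γ i) s ≠ 0
  simple : ∀ i j, ∀ s ∈ Ico (0 : ℝ) 1, ∀ r ∈ Ico (0 : ℝ) 1, γ i s = γ j r → i = j ∧ s = r
  frontier_eq : frontier Ω = ⋃ i, range (γ i)
  oneSided : ∀ i s, PointsOutward Ω (γ i s) (rightNormal (γ i) s) ∨
    PointsOutward Ω (γ i s) (-rightNormal (γ i) s)

open Classical in
/-- The unit outward normal of `Ω` at the point `γ s` of a boundary curve `γ`. -/
def outwardNormal (Ω : Set Plane) (γ : ℝ → Plane) (s : ℝ) : Plane :=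
  if PointsOutward Ω (γ s) (rightNormal γ s) then rightNormal γ s else -rightNormal γ s

/-- The curvature of the boundary of `Ω` at `γ s`: the component along the outward normal of the
derivative of the unit tangent with respect to arc length. It is negative for convex `Ω`. -/
def curvature (Ω : Set Plane) (γ : ℝ → Plane) (s : ℝ) : ℝ :=
  inner ℝ (‖deriv γ s‖⁻¹ • deriv (unitTangent γ) s) (outwardNormal Ω γ s)

/-- The line tension `F_l = κ n δ(d)`, a vector-valued measure carried by `∂Ω`: its value
`∫_{∂Ω} f κ n` (integral in arc length) at a scalar test function `f`. -/
def lineTension (Ω : Set Plane) {m : ℕ} (γ : Fin m → ℝ → Plane) (f : Plane → ℝ) : Plane :=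
  ∑ i, ∫ s in (0 : ℝ)..1,
    (f (γ i s) * curvature Ω (γ i) s * ‖deriv (γ i) s‖) • outwardNormal Ω (γ i) s

/-- The perimeter: the length (one-dimensional Hausdorff measure) of the boundary. -/
def perimeter (Ω : Set Plane) : ℝ := (Measure.hausdorffMeasure 1 (frontier Ω)).toReal

/-! ### Velocity fields -/

/-- The distance to the interface `Γ`, a subset of the boundary plane of the half-space. -/
def interfaceDist (Γ : Set Plane) (x : Space) : ℝ := Metric.infDist x (embed '' Γ)

/-- A vector field on the closed half-space which is continuous, smooth up to the boundary away
from the interface `Γ`, and which decays at infinity together with its derivatives. At the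
interface the first derivatives may have a logarithmic singularity and the second derivatives
one of order `1 / d`. For `Γ = ∅` one has `interfaceDist Γ = 0` and the factors describing the
singularity are equal to one: the field is smooth up to the boundary everywhere. -/
structure IsRegularField (Γ : Set Plane) (C : ℝ) (v : Space → Space) : Prop where
  continuousOn : ContinuousOn v closedHalfSpace
  smooth : ContDiffOn ℝ ∞ v (closedHalfSpace \ embed '' Γ)
  bound_zero : ∀ x ∈ closedHalfSpace, ‖v x‖ ≤ C * (1 + ‖x‖)⁻¹
  bound_one : ∀ x ∈ closedHalfSpace \ embed '' Γ,
    ‖fderivWithin ℝ v closedHalfSpace x‖ ≤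
      C * (1 + ‖x‖)⁻¹ ^ 2 * (1 + Real.log (1 + (interfaceDist Γ x)⁻¹))
  bound_two : ∀ x ∈ closedHalfSpace \ embed '' Γ,
    ‖iteratedFDerivWithin ℝ 2 v closedHalfSpace x‖ ≤
      C * (1 + ‖x‖)⁻¹ ^ 3 * (1 + (interfaceDist Γ x)⁻¹)

/-- The Eulerian velocity fields with interface `Γ`: regular, divergence free fields, tangent to
the boundary, with divergence free trace. -/
structure IsVelocityField (Γ : Set Plane) (v : Space → Space) : Prop where
  regular : ∃ C, IsRegularField Γ C v
  divergence_eq_zero : ∀ x ∈ halfSpace, divergence v x = 0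
  normal_eq_zero : ∀ p, v (embed p) 2 = 0
  surfaceDivergence_eq_zero : ∀ p ∉ Γ, surfaceDivergence (trace v) p = 0

/-- The space `𝒱` of decaying divergence free vector fields, smooth on the closed half-space and
tangent to the boundary, with divergence free trace. -/
def eulerFields : Set (Space → Space) := {v | IsVelocityField ∅ v}

/-! ### The manifold, the metric and the energy -/

/-- A homeomorphism of the closed half-space which restricts to a smooth diffeomorphism of the
open half-space (and hence to a homeomorphism of the boundary plane). -/
structure IsHalfSpaceDiffeo (φ : Space → Space) : Prop where
  bijOn_closed : BijOn φ closedHalfSpace closedHalfSpace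
  bijOn_open : BijOn φ halfSpace halfSpace
  continuousOn : ContinuousOn φ closedHalfSpace
  continuousOn_inv : ContinuousOn (Function.invFunOn φ closedHalfSpace) closedHalfSpace
  smooth : ContDiffOn ℝ ∞ φ halfSpace
  smooth_inv : ContDiffOn ℝ ∞ (Function.invFunOn φ closedHalfSpace) halfSpace

/-- The manifold `ℳ`: diffeomorphisms of the half-space that preserve orientation and volume
(the Jacobian determinant is one), and the surface area on the boundary. -/
structure IsConfiguration (φ : Space → Space) : Prop where
  diffeo : IsHalfSpaceDiffeo φ
  det_eq_one : ∀ x ∈ halfSpace, (fderiv ℝ φ x).det = 1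
  area : MeasurePreserving (trace φ) (volume : Measure Plane) volume

/-- The metric `g_φ(a, b) = ∫_B Tr(∇vᵀ ∇w)`, where `a = v ∘ φ` and `b = w ∘ φ`. -/
def metric (φ a b : Space → Space) : ℝ :=
  ∫ x in halfSpace, ∑ i : Fin 3,
    inner ℝ
      (fderiv ℝ (a ∘ Function.invFunOn φ closedHalfSpace) x (EuclideanSpace.single i 1))
      (fderiv ℝ (b ∘ Function.invFunOn φ closedHalfSpace) x (EuclideanSpace.single i 1))

/-- The energy of `φ`: the perimeter of the image of the initial domain `Ω₀`. -/
def energy (Ω₀ : Set Plane) (φ : Space → Space) : ℝ := perimeter (trace φ '' Ω₀)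

/-- `ψ` is the flow of the autonomous vector field `v` on the closed half-space. -/
structure IsFlow (v : Space → Space) (ψ : ℝ → Space → Space) : Prop where
  mapsTo : ∀ τ, MapsTo (ψ τ) closedHalfSpace closedHalfSpace
  init : ∀ x ∈ closedHalfSpace, ψ 0 x = x
  hasDerivAt : ∀ τ, ∀ x ∈ closedHalfSpace, HasDerivAt (fun σ => ψ σ x) (v (ψ τ x)) τ

/-- The energy is differentiable at `φ` in the direction `v ∘ φ`, with derivative
`⟨dℰ(φ), v ∘ φ⟩ = ℓ`. The direction is realised by the curve `τ ↦ φ_v(τ) ∘ φ`, where `φ_v` is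
the flow of `v`. -/
def HasEnergyDifferential (Ω₀ : Set Plane) (φ v : Space → Space) (ℓ : ℝ) : Prop :=
  ∃ ψ, IsFlow v ψ ∧ HasDerivAt (fun τ => energy Ω₀ (ψ τ ∘ φ)) ℓ 0

/-- The time derivative `∂_t φ` of a curve of transformations, on the time interval `[0, T)`. -/
def timeDeriv (T : ℝ) (φ : ℝ → Space → Space) (t : ℝ) (x : Space) : Space :=
  derivWithin (fun τ => φ τ x) (Ico 0 T) t

/-- The interface `∂Ω_t = Φ(t)(∂Ω₀)` transported by a motion. -/
def interface (Ω₀ : Set Plane) (φ : ℝ → Space → Space) (t : ℝ) : Set Plane :=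
  trace (φ t) '' frontier Ω₀

/-- `φ` is a curve in the manifold `ℳ` whose velocity is tangent to `ℳ`, and it satisfies the
weak gradient flow equation
`g_φ(∂_t φ, v ∘ φ) = -⟨dℰ(φ), v ∘ φ⟩` for all `v ∈ 𝒱`, at all times in `[0, T)`. -/
structure IsGradientFlow (T : ℝ) (Ω₀ : Set Plane) (φ : ℝ → Space → Space) : Prop where
  mem : ∀ t ∈ Ico 0 T, IsConfiguration (φ t)
  tangent : ∀ t ∈ Ico 0 T, ∃ v, IsVelocityField (interface Ω₀ φ t) v ∧
    ∀ x ∈ closedHalfSpace, timeDeriv T φ t x = v (φ t x)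
  weak : ∀ t ∈ Ico 0 T, ∀ v ∈ eulerFields,
    HasEnergyDifferential Ω₀ (φ t) v (-metric (φ t) (timeDeriv T φ t) (v ∘ φ t))

/-! ### Motions -/

/-- `φ` is the motion of the half-space generated by the velocity field `u` during the time
interval `[0, T)`: `φ(0) = Id`, `∂_t φ = u ∘ φ`. It is smooth away from the interface, and
carries the boundary curves `γ₀` of `Ω₀` to smooth regular curves. -/
structure IsMotion (T : ℝ) (Ω₀ : Set Plane) {m : ℕ} (γ₀ : Fin m → ℝ → Plane)
    (φ u : ℝ → Space → Space) : Prop where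
  diffeo : ∀ t ∈ Ico 0 T, IsHalfSpaceDiffeo (φ t)
  init : ∀ x ∈ closedHalfSpace, φ 0 x = x
  flow : ∀ t ∈ Ico 0 T, ∀ x ∈ closedHalfSpace,
    HasDerivWithinAt (fun τ => φ τ x) (u t (φ t x)) (Ico 0 T) t
  smooth : ContDiffOn ℝ ∞ (fun q : ℝ × Space => φ q.1 q.2) (Ico 0 T ×ˢ halfSpace)
  smooth_trace : ContDiffOn ℝ ∞ (fun q : ℝ × Plane => trace (φ q.1) q.2)
    (Ico 0 T ×ˢ (frontier Ω₀)ᶜ)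
  smooth_interface : ∀ t ∈ Ico 0 T, ∀ i, ContDiff ℝ ∞ (trace (φ t) ∘ γ₀ i)
  regular_interface : ∀ t ∈ Ico 0 T, ∀ i s, deriv (trace (φ t) ∘ γ₀ i) s ≠ 0
  velocity : ∀ t₁ < T, ∃ C, ∀ t ∈ Icc 0 t₁, IsRegularField (interface Ω₀ φ t) C (u t)

/-! ### The free boundary model -/

/-- The tangential surface stress `F_s = -(∂_z u, ∂_z v)` at `z = 0`. -/
def surfaceStress (u : Space → Space) (p : Plane) : Plane :=
  -horizontal (fderivWithin ℝ u closedHalfSpace (embed p) vertical)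

/-- The force balance `∇_⊥ ϖ = F_s + F_l` in the sense of distributions on the plane. -/
def ForceBalance (ϖ : Plane → ℝ) (u : Space → Space) (Ω : Set Plane) {m : ℕ}
    (γ : Fin m → ℝ → Plane) : Prop :=
  ∀ f : Plane → ℝ, ContDiff ℝ ∞ f → HasCompactSupport f → ∀ i : Fin 2,
    -∫ p, ϖ p * fderiv ℝ f p (EuclideanSpace.single i 1) =
      (∫ p, surfaceStress u p i * f p) + lineTension Ω γ f i

/-- The inviscid Langmuir layer Stokesian subfluid model on the time interval `[0, T)`, for the
subfluid velocity `u` and pressure `P`, the surface pressure `ϖ`, the Langmuir layer domains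
`Ω t`, and the points `Γ t i s` of their boundaries. The surface velocity is `trace (u t)`. -/
structure IsSolution (T : ℝ) (u : ℝ → Space → Space) (P : ℝ → Space → ℝ) (ϖ : ℝ → Plane → ℝ)
    (Ω : ℝ → Set Plane) {m : ℕ} (Γ : ℝ → Fin m → ℝ → Plane) : Prop where
  domain : ∀ t ∈ Ico 0 T, IsSmoothDomain (Ω t) (Γ t)
  pressure_smooth : ∀ t ∈ Ico 0 T, ContDiffOn ℝ ∞ (P t) halfSpace
  incompressible : ∀ t ∈ Ico 0 T, ∀ x ∈ halfSpace, divergence (u t) x = 0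
  stokes : ∀ t ∈ Ico 0 T, ∀ x ∈ halfSpace, Laplacian.laplacian (u t) x = gradient (P t) x
  normal_velocity : ∀ t ∈ Ico 0 T, ∀ p, u t (embed p) 2 = 0
  surfacePressure : ∀ t ∈ Ico 0 T, LocallyIntegrable (ϖ t)
  force_balance : ∀ t ∈ Ico 0 T, ForceBalance (ϖ t) (u t) (Ω t) (Γ t)
  surface_incompressible : ∀ t ∈ Ico 0 T, ∀ p ∉ frontier (Ω t),
    surfaceDivergence (trace (u t)) p = 0
  kinematic : ∀ t ∈ Ico 0 T, ∀ i s,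
    HasDerivWithinAt (fun τ => Γ τ i s) (trace (u t) (Γ t i s)) (Ico 0 T) t

end ILLSS

end

noncomputable section

namespace ILLSS

/-! ### Geometry of the half-space -/

/-! Two identities carry the equivalence. Let `V` be the trace of a test field `v ∈ eulerFields`.
For a Stokes flow `u`, integration by parts turns the metric into work done at the boundary, `∫_B ∇u
: ∇v = -∫ F_s · V` (`integral_inner_fderiv_eq`): the pressure drops out because `v` is divergence
free in `B` and tangent to `∂B`. The first variation of the perimeter along the flow of `v` is
`-F_l(V)`, where `F_l` is the line tension (`hasDerivAt_perimeter`). Hence, for a Stokes flow, the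
weak gradient flow equation says that `F_s + F_l` does no work on the traces of test fields, which
are divergence free. The rest consists in exchanging such orthogonality relations for pressures, and
in transporting the domains.

From (B) to (A). A force `∇Π` does no work on compactly supported divergence free fields. To reach
the merely decaying traces, their stream functions are cut off (`ForceBalance.integral_inner_eq`);
the decay of the stress leaves enough room for the error of the cutoff. The surface velocity is only
log-Lipschitz near the interface, but Osgood's criterion still makes trajectories unique
(`IsMotion.eq_trace_of_hasDerivWithinAt`). So the boundary points of `Ω_t` move with `Φ`, and since
a smooth domain is determined by its boundary (`IsSmoothDomain.eq_of_frontier_eq`), `Ω_t =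
Φ(t)(Ω₀)`. Conservation of volume and area is Liouville's theorem (`det_fderiv_eq_one`), applied on
the plane away from the interface, which is a null set.

From (A) to (B). Test fields supported inside `B` produce the bulk pressure: `Δu` is orthogonal to
curls, hence a closed form on a convex set (`exists_pressure`). Now the first identity is available,
and test fields that extend a rotated gradient from the plane (`exists_extension`) show that `F_s +
F_l` annihilates every compactly supported rotated gradient. The delicate point is that the
resulting potential `Π` must be a locally integrable function although `F_l` is a measure on curves.
It is built from explicit homotopy operators (`antideriv`, `meanAntideriv`) that spread the force
along horizontal lines. Spreading a measure carried by a curve in this way gives a density as long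
as the curve is transversal to the lines. Where it is not, the tangent is horizontal, and the
component of `κ n` that has to be spread, the horizontal one, vanishes
(`exists_density_force_antideriv`). Then `exists_surfacePressure` verifies the force balance.

The perimeter is a Hausdorff measure, so its variation is computed by comparing maps: on the compact
interface the flow differs from `id + τ V` by a map with Lipschitz constant `O(τ²)`. The two images
therefore have the same length to first order (`hasDerivAt_hausdorffMeasure_flow`), and the length
of `γ + τ V ∘ γ` is an explicit integral. -/

/-- The inclusion of the plane as a continuous linear map. -/
def embedCLM : Plane →L[ℝ] Space :=
  LinearMap.toContinuousLinearMap
    { toFun := embed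
      map_add' := fun p q => by ext i; fin_cases i <;> simp [embed]
      map_smul' := fun c p => by ext i; fin_cases i <;> simp [embed] }

/-- The horizontal part as a continuous linear map. -/
def horizontalCLM : Space →L[ℝ] Plane :=
  LinearMap.toContinuousLinearMap
    { toFun := horizontal
      map_add' := fun p q => by ext i; fin_cases i <;> simp [horizontal]
      map_smul' := fun c p => by ext i; fin_cases i <;> simp [horizontal] }

@[simp] lemma embedCLM_apply (p : Plane) : embedCLM p = embed p := rfl

@[simp] lemma horizontalCLM_apply (x : Space) : horizontalCLM x = horizontal x := rfl

@[simp] lemma embed_apply_zero (p : Plane) : embed p 0 = p 0 := rfl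

@[simp] lemma embed_apply_one (p : Plane) : embed p 1 = p 1 := rfl

@[simp] lemma embed_apply_two (p : Plane) : embed p 2 = 0 := rfl

@[simp] lemma horizontal_apply_zero (x : Space) : horizontal x 0 = x 0 := rfl

@[simp] lemma horizontal_apply_one (x : Space) : horizontal x 1 = x 1 := rfl

@[simp] lemma vertical_apply_zero : vertical 0 = 0 := rfl

@[simp] lemma vertical_apply_one : vertical 1 = 0 := rfl

@[simp] lemma vertical_apply_two : vertical 2 = 1 := rfl

lemma vertical_eq_single : vertical = EuclideanSpace.single 2 1 := by
  ext i; fin_cases i <;> simp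

@[simp] lemma norm_vertical : ‖vertical‖ = 1 := by
  rw [vertical_eq_single]; simp

lemma continuous_embed : Continuous embed := embedCLM.continuous

lemma continuous_horizontal : Continuous horizontal := horizontalCLM.continuous

lemma contDiff_embed {n : WithTop ℕ∞} : ContDiff ℝ n embed := embedCLM.contDiff

lemma contDiff_horizontal {n : WithTop ℕ∞} : ContDiff ℝ n horizontal := horizontalCLM.contDiff

lemma embed_sub (p q : Plane) : embed (p - q) = embed p - embed q := embedCLM.map_sub p q

lemma horizontal_add (x y : Space) : horizontal (x + y) = horizontal x + horizontal y :=
  horizontalCLM.map_add x y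

lemma horizontal_sub (x y : Space) : horizontal (x - y) = horizontal x - horizontal y :=
  horizontalCLM.map_sub x y

lemma horizontal_smul (c : ℝ) (x : Space) : horizontal (c • x) = c • horizontal x :=
  horizontalCLM.map_smul c x

@[simp] lemma horizontal_embed (p : Plane) : horizontal (embed p) = p := by
  ext i; fin_cases i <;> simp

@[simp] lemma horizontal_vertical : horizontal vertical = 0 := by
  ext i; fin_cases i <;> simp

lemma embed_horizontal {x : Space} (hx : x 2 = 0) : embed (horizontal x) = x := by
  ext i; fin_cases i <;> simp [hx]

lemma embed_horizontal_add (x : Space) : embed (horizontal x) + x 2 • vertical = x := by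
  ext i; fin_cases i <;> simp

lemma embed_injective : Function.Injective embed :=
  Function.LeftInverse.injective horizontal_embed

lemma norm_sq_eq (x : Space) : ‖x‖ ^ 2 = x 0 ^ 2 + x 1 ^ 2 + x 2 ^ 2 := by
  rw [EuclideanSpace.norm_sq_eq, Fin.sum_univ_three]; simp

lemma norm_sq_eq_plane (p : Plane) : ‖p‖ ^ 2 = p 0 ^ 2 + p 1 ^ 2 := by
  rw [EuclideanSpace.norm_sq_eq, Fin.sum_univ_two]; simp

@[simp] lemma norm_embed (p : Plane) : ‖embed p‖ = ‖p‖ := by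
  rw [← sq_eq_sq₀ (norm_nonneg _) (norm_nonneg _), norm_sq_eq, norm_sq_eq_plane]; simp

lemma norm_horizontal_le (x : Space) : ‖horizontal x‖ ≤ ‖x‖ := by
  rw [← sq_le_sq₀ (norm_nonneg _) (norm_nonneg _), norm_sq_eq, norm_sq_eq_plane]
  simp only [horizontal_apply_zero, horizontal_apply_one]
  nlinarith [sq_nonneg (x 2)]

lemma abs_coord_le {n : ℕ} (x : EuclideanSpace ℝ (Fin n)) (i : Fin n) : |x i| ≤ ‖x‖ :=
  PiLp.norm_apply_le x i

lemma isometry_embed : Isometry embed :=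
  AddMonoidHomClass.isometry_of_norm embedCLM norm_embed

lemma isOpen_halfSpace : IsOpen halfSpace :=
  isOpen_lt (EuclideanSpace.proj (𝕜 := ℝ) (2 : Fin 3)).continuous continuous_const

lemma convex_halfSpace : Convex ℝ halfSpace :=
  convex_halfSpace_lt (EuclideanSpace.proj (𝕜 := ℝ) (2 : Fin 3)).isLinear 0

lemma convex_closedHalfSpace : Convex ℝ closedHalfSpace :=
  convex_halfSpace_le (EuclideanSpace.proj (𝕜 := ℝ) (2 : Fin 3)).isLinear 0

lemma halfSpace_subset : halfSpace ⊆ closedHalfSpace := fun x (hx : x 2 < 0) => hx.le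

lemma embed_mem (p : Plane) : embed p ∈ closedHalfSpace := by simp [closedHalfSpace]

lemma closedHalfSpace_mem_nhds {x : Space} (hx : x ∈ halfSpace) : closedHalfSpace ∈ 𝓝 x :=
  mem_of_superset (isOpen_halfSpace.mem_nhds hx) halfSpace_subset

lemma uniqueDiffOn_closedHalfSpace : UniqueDiffOn ℝ closedHalfSpace := by
  refine uniqueDiffOn_convex convex_closedHalfSpace ⟨-vertical, ?_⟩
  refine mem_interior.2 ⟨halfSpace, halfSpace_subset, isOpen_halfSpace, ?_⟩
  simp [halfSpace]

lemma mem_halfSpace_or {x : Space} (hx : x ∈ closedHalfSpace) :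
    x ∈ halfSpace ∨ ∃ p, x = embed p := by
  rcases lt_or_eq_of_le (show x 2 ≤ 0 from hx) with h | h
  · exact Or.inl h
  · exact Or.inr ⟨horizontal x, (embed_horizontal h).symm⟩

lemma embed_notMem_halfSpace (p : Plane) : embed p ∉ halfSpace := by simp [halfSpace]

lemma notMem_embed_image {Γ : Set Plane} {x : Space} (hx : x ∈ halfSpace) : x ∉ embed '' Γ := by
  rintro ⟨p, -, rfl⟩
  exact embed_notMem_halfSpace p hx

lemma mem_diff_of_mem_halfSpace {Γ : Set Plane} {x : Space} (hx : x ∈ halfSpace) :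
    x ∈ closedHalfSpace \ embed '' Γ := ⟨halfSpace_subset hx, notMem_embed_image hx⟩

lemma embed_mem_diff {Γ : Set Plane} {p : Plane} (hp : p ∉ Γ) :
    embed p ∈ closedHalfSpace \ embed '' Γ :=
  ⟨embed_mem p, fun ⟨_, hq, h⟩ => hp (embed_injective h ▸ hq)⟩

/-! ### Transformations of the half-space and their traces -/

namespace IsHalfSpaceDiffeo

variable {φ : Space → Space}

/-- A boundary point cannot be sent inside: every interior point is already the image of an interior
point, and `φ` is injective on the closed half-space. -/
lemma embed_trace (hφ : IsHalfSpaceDiffeo φ) (p : Plane) : embed (trace φ p) = φ (embed p) := by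
  have h1 : φ (embed p) ∈ closedHalfSpace := hφ.bijOn_closed.mapsTo (embed_mem p)
  rcases mem_halfSpace_or h1 with h | ⟨q, hq⟩
  · obtain ⟨y, hy, hyx⟩ := hφ.bijOn_open.surjOn h
    have := hφ.bijOn_closed.injOn (halfSpace_subset hy) (embed_mem p) hyx
    exact absurd (this ▸ hy) (embed_notMem_halfSpace p)
  · rw [trace, hq, horizontal_embed]

lemma invFunOn_apply (hφ : IsHalfSpaceDiffeo φ) {x : Space} (hx : x ∈ closedHalfSpace) :
    Function.invFunOn φ closedHalfSpace (φ x) = x :=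
  hφ.bijOn_closed.injOn.leftInvOn_invFunOn hx

lemma apply_invFunOn (hφ : IsHalfSpaceDiffeo φ) {x : Space} (hx : x ∈ closedHalfSpace) :
    φ (Function.invFunOn φ closedHalfSpace x) = x :=
  hφ.bijOn_closed.invOn_invFunOn.2 hx

lemma invFunOn_mem (hφ : IsHalfSpaceDiffeo φ) {x : Space} (hx : x ∈ closedHalfSpace) :
    Function.invFunOn φ closedHalfSpace x ∈ closedHalfSpace :=
  hφ.bijOn_closed.surjOn.mapsTo_invFunOn hx

lemma invFunOn_embed (hφ : IsHalfSpaceDiffeo φ) (p : Plane) :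
    embed (trace (Function.invFunOn φ closedHalfSpace) p) =
      Function.invFunOn φ closedHalfSpace (embed p) := by
  rcases mem_halfSpace_or (hφ.invFunOn_mem (embed_mem p)) with h | ⟨q, hq⟩
  · have := hφ.bijOn_open.mapsTo h
    rw [hφ.apply_invFunOn (embed_mem p)] at this
    exact absurd this (embed_notMem_halfSpace p)
  · rw [trace, hq, horizontal_embed]

/-- The homeomorphism of the boundary plane induced by a homeomorphism of the half-space. -/
def traceHomeomorph (hφ : IsHalfSpaceDiffeo φ) : Plane ≃ₜ Plane where
  toFun := trace φ
  invFun := trace (Function.invFunOn φ closedHalfSpace)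
  left_inv p := by
    apply embed_injective
    rw [hφ.invFunOn_embed, hφ.embed_trace, hφ.invFunOn_apply (embed_mem p)]
  right_inv p := by
    apply embed_injective
    rw [hφ.embed_trace, hφ.invFunOn_embed, hφ.apply_invFunOn (embed_mem p)]
  continuous_toFun := continuous_horizontal.comp
    (hφ.continuousOn.comp_continuous continuous_embed embed_mem)
  continuous_invFun := continuous_horizontal.comp
    (hφ.continuousOn_inv.comp_continuous continuous_embed embed_mem)

@[simp] lemma coe_traceHomeomorph (hφ : IsHalfSpaceDiffeo φ) : ⇑hφ.traceHomeomorph = trace φ := rfl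

lemma frontier_image (hφ : IsHalfSpaceDiffeo φ) (s : Set Plane) :
    frontier (trace φ '' s) = trace φ '' frontier s := by
  rw [← hφ.coe_traceHomeomorph, hφ.traceHomeomorph.image_frontier]

end IsHalfSpaceDiffeo

/-! ### Systems of closed curves and the domains they bound -/

/-- Finitely many disjoint smooth regular simple closed curves of period one. -/
structure IsCurveSystem {m : ℕ} (γ : Fin m → ℝ → Plane) : Prop where
  smooth : ∀ i, ContDiff ℝ ∞ (γ i)
  periodic : ∀ i, Function.Periodic (γ i) 1
  regular : ∀ i s, deriv (γ i) s ≠ 0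
  simple : ∀ i j, ∀ s ∈ Ico (0 : ℝ) 1, ∀ r ∈ Ico (0 : ℝ) 1, γ i s = γ j r → i = j ∧ s = r

lemma IsSmoothDomain.curves {Ω : Set Plane} {m : ℕ} {γ : Fin m → ℝ → Plane}
    (h : IsSmoothDomain Ω γ) : IsCurveSystem γ :=
  ⟨h.smooth, h.periodic, h.regular, h.simple⟩

lemma fract_periodic {E : Type*} {f : ℝ → E} (hf : Function.Periodic f 1) (s : ℝ) :
    f (Int.fract s) = f s := by
  have : f (s - ⌊s⌋ • (1 : ℝ)) = f s := hf.sub_zsmul_eq ⌊s⌋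
  rwa [zsmul_one] at this

namespace IsCurveSystem

variable {m : ℕ} {γ : Fin m → ℝ → Plane}

lemma eq_imp (hγ : IsCurveSystem γ) {i j : Fin m} {s r : ℝ} (h : γ i s = γ j r) :
    i = j ∧ ∃ k : ℤ, s = r + k := by
  have := hγ.simple i j (Int.fract s) ⟨Int.fract_nonneg s, Int.fract_lt_one s⟩
    (Int.fract r) ⟨Int.fract_nonneg r, Int.fract_lt_one r⟩
    (by rw [fract_periodic (hγ.periodic i), fract_periodic (hγ.periodic j), h])
  obtain ⟨h1, h2⟩ := this
  obtain ⟨k, hk⟩ := Int.fract_eq_fract.1 h2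
  exact ⟨h1, k, by linarith⟩

lemma isCompact_range (hγ : IsCurveSystem γ) (i : Fin m) : IsCompact (range (γ i)) := by
  have : range (γ i) = γ i '' Icc 0 1 := by
    have := (hγ.periodic i).image_Icc one_pos 0
    rw [← this, zero_add]
  rw [this]
  exact isCompact_Icc.image (hγ.smooth i).continuous

lemma isCompact_iUnion_range (hγ : IsCurveSystem γ) : IsCompact (⋃ i, range (γ i)) :=
  isCompact_iUnion hγ.isCompact_range

/-- The map `(a, b) ↦ γ (s + a) + b n` straightening the curve `γ` near `γ s`. -/
def straighten (c : ℝ → Plane) (s : ℝ) (p : ℝ × ℝ) : Plane :=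
  c (s + p.1) + p.2 • rightNormal c s

/-- The derivative at the origin sends the coordinate vectors to the velocity and the normal of the
curve, which are nonzero and orthogonal. Invertibility makes the inverse function theorem available.
-/
lemma exists_straighten_hasStrictFDerivAt {c : ℝ → Plane} (hc : ContDiff ℝ ∞ c) {s : ℝ}
    (hreg : deriv c s ≠ 0) :
    ∃ L : (ℝ × ℝ) ≃L[ℝ] Plane,
      HasStrictFDerivAt (straighten c s) (L : (ℝ × ℝ) →L[ℝ] Plane) (0, 0) := by
  set L₀ : (ℝ × ℝ) →L[ℝ] Plane :=
    (ContinuousLinearMap.fst ℝ ℝ ℝ).smulRight (deriv c s) +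
      (ContinuousLinearMap.snd ℝ ℝ ℝ).smulRight (rightNormal c s) with hL₀
  have hstr : HasStrictFDerivAt (straighten c s) L₀ (0, 0) := by
    have h1 : HasStrictDerivAt c (deriv c s) (s + (0, (0 : ℝ)).1) := by
      simpa using (hc.contDiffAt (x := s)).hasStrictDerivAt (by simp)
    have h2 : HasStrictFDerivAt (fun p : ℝ × ℝ => s + p.1) (ContinuousLinearMap.fst ℝ ℝ ℝ)
        ((0 : ℝ), (0 : ℝ)) := by
      simpa using (hasStrictFDerivAt_fst (𝕜 := ℝ) (p := ((0 : ℝ), (0 : ℝ)))).const_add s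
    have h3 : HasStrictFDerivAt (fun p : ℝ × ℝ => c (s + p.1))
        ((ContinuousLinearMap.fst ℝ ℝ ℝ).smulRight (deriv c s)) ((0 : ℝ), (0 : ℝ)) := by
      refine (h1.hasStrictFDerivAt.comp ((0 : ℝ), (0 : ℝ)) h2).congr_fderiv ?_
      ext <;> simp
    have h4 : HasStrictFDerivAt (fun p : ℝ × ℝ => p.2 • rightNormal c s)
        ((ContinuousLinearMap.snd ℝ ℝ ℝ).smulRight (rightNormal c s)) ((0 : ℝ), (0 : ℝ)) :=
      (hasStrictFDerivAt_snd (𝕜 := ℝ) (p := ((0 : ℝ), (0 : ℝ)))).smul_const _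
    exact h3.add h4
  have hinj : Function.Injective L₀.toLinearMap := by
    rw [injective_iff_map_eq_zero]
    rintro ⟨a, b⟩ hab
    have hn : ‖deriv c s‖⁻¹ ≠ 0 := by simpa using hreg
    have h0 : a * deriv c s 0 + b * (‖deriv c s‖⁻¹ * deriv c s 1) = 0 := by
      have := congrArg (fun v : Plane => v 0) hab
      simpa [hL₀, rightNormal, unitTangent] using this
    have h1 : a * deriv c s 1 - b * (‖deriv c s‖⁻¹ * deriv c s 0) = 0 := by
      have := congrArg (fun v : Plane => v 1) hab
      simpa [hL₀, rightNormal, unitTangent, sub_eq_add_neg] using this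
    have hpos : 0 < deriv c s 0 ^ 2 + deriv c s 1 ^ 2 := by
      rw [← norm_sq_eq_plane]; positivity
    have ha : a * (deriv c s 0 ^ 2 + deriv c s 1 ^ 2) = 0 := by
      linear_combination deriv c s 0 * h0 + deriv c s 1 * h1
    have hb : b * ‖deriv c s‖⁻¹ * (deriv c s 0 ^ 2 + deriv c s 1 ^ 2) = 0 := by
      linear_combination deriv c s 1 * h0 - deriv c s 0 * h1
    have ha' : a = 0 := by simpa [hpos.ne'] using ha
    have hb' : b = 0 := by
      rcases mul_eq_zero.1 hb with h | h
      · simpa [hreg] using h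
      · exact absurd h hpos.ne'
    simp [ha', hb']
  have hdim : Module.finrank ℝ (ℝ × ℝ) = Module.finrank ℝ Plane := by simp
  refine ⟨(LinearEquiv.ofInjectiveOfFinrankEq L₀.toLinearMap hinj hdim).toContinuousLinearEquiv, ?_⟩
  exact hstr.congr_fderiv (ContinuousLinearMap.ext fun p => rfl)

/-- Straightening of the interface near one of its points. -/
theorem exists_straighten (hγ : IsCurveSystem γ) (i : Fin m) (s : ℝ) :
    ∃ δ > 0, ContinuousOn (straighten (γ i) s) (Ioo (-δ) δ ×ˢ Ioo (-δ) δ) ∧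
      InjOn (straighten (γ i) s) (Ioo (-δ) δ ×ˢ Ioo (-δ) δ) ∧
      IsOpen (straighten (γ i) s '' (Ioo (-δ) δ ×ˢ Ioo (-δ) δ)) ∧
      ∀ p ∈ Ioo (-δ) δ ×ˢ Ioo (-δ) δ,
        (straighten (γ i) s p ∈ ⋃ j, range (γ j) ↔ p.2 = 0) := by
  obtain ⟨L, hL⟩ := exists_straighten_hasStrictFDerivAt (hγ.smooth i) (hγ.regular i s)
  set e := hL.toOpenPartialHomeomorph (straighten (γ i) s) with he
  have hecoe : ∀ p, e p = straighten (γ i) s p := fun p => rfl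
  have h0 : ((0 : ℝ), (0 : ℝ)) ∈ e.source := hL.mem_toOpenPartialHomeomorph_source
  have hbox : ∀ S ∈ 𝓝 ((0 : ℝ), (0 : ℝ)), ∃ δ > 0, Ioo (-δ) δ ×ˢ Ioo (-δ) δ ⊆ S := by
    intro S hS
    obtain ⟨δ, hδ, h⟩ := Metric.mem_nhds_iff.1 hS
    refine ⟨δ, hδ, fun p hp => h ?_⟩
    rw [Metric.mem_ball, Prod.dist_eq, max_lt_iff]
    simp only [mem_prod, mem_Ioo] at hp
    simp only [Real.dist_eq, sub_zero, abs_lt]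
    exact hp
  obtain ⟨δ₁, hδ₁, hsub₁⟩ := hbox _ (e.open_source.mem_nhds h0)
  -- `C` is the part of the interface away from `γ i s`: one period of each curve, centred at `s`,
  -- without the window of width `δ₁` on the curve `i` itself. It is compact and misses `γ i s`, so
  -- a smaller box meets the interface only in the axis `p.2 = 0`.
  set C : Set Plane := ⋃ j, γ j '' (Icc (s - 1 / 2) (s + 1 / 2) ∩ {r | j = i → δ₁ ≤ |r - s|})
    with hC
  have hCc : IsCompact C := by
    refine isCompact_iUnion fun j => IsCompact.image ?_ (hγ.smooth j).continuous
    refine isCompact_Icc.inter_right ?_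
    by_cases hj : j = i
    · simp only [hj, forall_const]
      exact isClosed_le continuous_const (by fun_prop)
    · simp [hj]
  have hqC : straighten (γ i) s (0, 0) ∉ C := by
    simp only [hC, mem_iUnion, not_exists]
    rintro j ⟨r, ⟨hr, hr'⟩, hjr⟩
    have : γ j r = γ i s := by simpa [straighten] using hjr
    obtain ⟨hji, k, hk⟩ := hγ.eq_imp this
    have hk0 : k = 0 := by
      have h1 : ((k : ℤ) : ℝ) ≤ 1 / 2 := by linarith [hr.2]
      have h2 : (-1 / 2 : ℝ) ≤ k := by linarith [hr.1]
      have h3 : k < 1 := by exact_mod_cast (lt_of_le_of_lt h1 (by norm_num : (1 / 2 : ℝ) < 1))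
      have h4 : -1 < k := by exact_mod_cast (lt_of_lt_of_le (by norm_num : (-1 : ℝ) < -1 / 2) h2)
      omega
    have := hr' hji
    rw [hk, hk0] at this
    simp at this
    linarith
  have hnhds : straighten (γ i) s ⁻¹' Cᶜ ∈ 𝓝 ((0 : ℝ), (0 : ℝ)) :=
    hL.continuousAt.preimage_mem_nhds (hCc.isClosed.isOpen_compl.mem_nhds hqC)
  obtain ⟨δ₂, hδ₂, hsub₂⟩ := hbox _ hnhds
  set δ := min δ₁ δ₂ with hδ
  have hsubset : Ioo (-δ) δ ×ˢ Ioo (-δ) δ ⊆ Ioo (-δ₁) δ₁ ×ˢ Ioo (-δ₁) δ₁ := by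
    have : Ioo (-δ) δ ⊆ Ioo (-δ₁) δ₁ :=
      Ioo_subset_Ioo (by simp [hδ]) (by simp [hδ])
    exact prod_mono this this
  have hsubset₂ : Ioo (-δ) δ ×ˢ Ioo (-δ) δ ⊆ Ioo (-δ₂) δ₂ ×ˢ Ioo (-δ₂) δ₂ := by
    have : Ioo (-δ) δ ⊆ Ioo (-δ₂) δ₂ :=
      Ioo_subset_Ioo (by simp [hδ]) (by simp [hδ])
    exact prod_mono this this
  refine ⟨δ, by simp [hδ, hδ₁, hδ₂], e.continuousOn.mono (hsubset.trans hsub₁),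
    e.injOn.mono (hsubset.trans hsub₁),
    e.isOpen_image_of_subset_source (isOpen_Ioo.prod isOpen_Ioo) (hsubset.trans hsub₁), ?_⟩
  intro p hp
  constructor
  · intro hpF
    obtain ⟨j, r, hr⟩ := mem_iUnion.1 hpF
    -- Shifting by the nearest integer brings the parameter into the period centred at `s`, as in
    -- the definition of `C`.
    set r' := r - round (r - s) with hr'
    have hr'j : γ j r' = γ j r := by
      have := (hγ.periodic j).sub_zsmul_eq (x := r) (round (r - s))
      simpa using this
    have hround : |r' - s| ≤ 1 / 2 := by
      have := abs_sub_round (r - s)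
      rwa [show r - s - round (r - s) = r' - s by rw [hr']; ring] at this
    have hpC : straighten (γ i) s p ∉ C := hsub₂ (hsubset₂ hp)
    have hcase : ¬ (j = i → δ₁ ≤ |r' - s|) := by
      intro hcon
      refine hpC (mem_iUnion.2 ⟨j, r', ⟨?_, hcon⟩, by rw [hr'j, hr]⟩)
      rw [abs_le] at hround
      exact ⟨by linarith, by linarith⟩
    push Not at hcase
    obtain ⟨rfl, hlt⟩ := hcase
    have hq : (r' - s, (0 : ℝ)) ∈ Ioo (-δ₁) δ₁ ×ˢ Ioo (-δ₁) δ₁ := by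
      rw [abs_lt] at hlt
      exact ⟨hlt, by simpa using hδ₁⟩
    have heq : e p = e (r' - s, 0) := by
      rw [hecoe, hecoe]
      simp [straighten, hr'j, hr]
    have := e.injOn (hsub₁ (hsubset hp)) (hsub₁ hq) heq
    rw [this]
  · intro hp2
    refine mem_iUnion.2 ⟨i, s + p.1, ?_⟩
    simp [straighten, hp2]

/-- Near one of its points the interface has exactly two sides. -/
theorem exists_sides (hγ : IsCurveSystem γ) (i : Fin m) (s : ℝ) :
    ∃ U U₁ U₂ : Set Plane, IsOpen U ∧ γ i s ∈ U ∧ IsPreconnected U₁ ∧ IsPreconnected U₂ ∧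
      Disjoint U₁ U₂ ∧ U \ (⋃ j, range (γ j)) = U₁ ∪ U₂ ∧
      (∀ᶠ ε : ℝ in 𝓝[>] 0, γ i s + ε • rightNormal (γ i) s ∈ U₁) ∧
      (∀ᶠ ε : ℝ in 𝓝[>] 0, γ i s - ε • rightNormal (γ i) s ∈ U₂) := by
  obtain ⟨δ, hδ, hcont, hinj, hopen, hF⟩ := hγ.exists_straighten i s
  set e := straighten (γ i) s with he
  have hmem : ∀ a ∈ Ioo (-δ) δ, ((0 : ℝ), a) ∈ Ioo (-δ) δ ×ˢ Ioo (-δ) δ := fun a ha =>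
    ⟨by simpa using hδ, ha⟩
  have h₁ : Ioo (-δ) δ ×ˢ Ioo 0 δ ⊆ Ioo (-δ) δ ×ˢ Ioo (-δ) δ :=
    prod_mono le_rfl (Ioo_subset_Ioo (by linarith) le_rfl)
  have h₂ : Ioo (-δ) δ ×ˢ Ioo (-δ) 0 ⊆ Ioo (-δ) δ ×ˢ Ioo (-δ) δ :=
    prod_mono le_rfl (Ioo_subset_Ioo le_rfl hδ.le)
  have hev : ∀ᶠ ε : ℝ in 𝓝[>] 0, ε ∈ Ioo 0 δ := Ioo_mem_nhdsGT hδ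
  refine ⟨e '' (Ioo (-δ) δ ×ˢ Ioo (-δ) δ), e '' (Ioo (-δ) δ ×ˢ Ioo 0 δ),
    e '' (Ioo (-δ) δ ×ˢ Ioo (-δ) 0), hopen, ⟨(0, 0), hmem 0 (by simpa using hδ), ?_⟩,
    ?_, ?_, ?_, ?_, ?_, ?_⟩
  · simp [he, straighten]
  · exact ((isPreconnected_Ioo.prod isPreconnected_Ioo).image _ (hcont.mono h₁))
  · exact ((isPreconnected_Ioo.prod isPreconnected_Ioo).image _ (hcont.mono h₂))
  · rw [disjoint_left]
    rintro _ ⟨p, hp, rfl⟩ ⟨q, hq, hpq⟩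
    have := hinj (h₂ hq) (h₁ hp) hpq
    have hp2 := hp.2.1
    have hq2 := hq.2.2
    rw [this] at hq2
    linarith
  · ext x
    constructor
    · rintro ⟨⟨p, hp, rfl⟩, hx⟩
      have hne : p.2 ≠ 0 := fun h => hx ((hF p hp).2 h)
      rcases lt_or_gt_of_ne hne with h | h
      · exact Or.inr ⟨p, ⟨hp.1, hp.2.1, h⟩, rfl⟩
      · exact Or.inl ⟨p, ⟨hp.1, h, hp.2.2⟩, rfl⟩
    · rintro (⟨p, hp, rfl⟩ | ⟨p, hp, rfl⟩)
      · exact ⟨⟨p, h₁ hp, rfl⟩, fun h => hp.2.1.ne' ((hF p (h₁ hp)).1 h)⟩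
      · exact ⟨⟨p, h₂ hp, rfl⟩, fun h => hp.2.2.ne ((hF p (h₂ hp)).1 h)⟩
  · filter_upwards [hev] with ε hε
    exact ⟨(0, ε), ⟨by simpa using hδ, hε⟩, by simp [he, straighten]⟩
  · filter_upwards [hev] with ε hε
    refine ⟨(0, -ε), ⟨by simpa using hδ, by simpa using hε.2, by simpa using hε.1⟩, ?_⟩
    simp [he, straighten, sub_eq_add_neg]

end IsCurveSystem

/-- Off the frontier, the interior and the complement of the closure form an open cover by disjoint
sets, and a connected set lies in one of them. -/
lemma subset_or_disjoint_of_frontier {X : Type*} [TopologicalSpace X] {Ω S : Set X}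
    (hS : IsPreconnected S) (hd : Disjoint S (frontier Ω)) :
    S ⊆ Ω ∨ Disjoint S Ω := by
  have hsub : S ⊆ interior Ω ∪ (closure Ω)ᶜ := by
    intro x hx
    by_cases h : x ∈ closure Ω
    · left
      by_contra h'
      exact disjoint_left.1 hd hx ⟨h, h'⟩
    · exact Or.inr h
  rcases hS.subset_or_subset isOpen_interior isClosed_closure.isOpen_compl
    (disjoint_compl_right.mono_left (interior_subset.trans subset_closure)) hsub with h | h
  · exact Or.inl (h.trans interior_subset)
  · exact Or.inr ((subset_compl_iff_disjoint_right.1 h).mono_right subset_closure)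

/-- If both sides were in `Ω`, no exterior point would be near `q`; if neither were, no point of `Ω`
would be. The hypothesis `hext` is what rules out slits, where `Ω` lies on both sides. -/
lemma one_sided_of_sides {Ω F U U₁ U₂ : Set Plane} {q : Plane}
    (hΩ : IsOpen Ω) (hF : frontier Ω = F) (hU : IsOpen U) (hq : q ∈ U) (hqF : q ∈ F)
    (hext : q ∈ closure (closure Ω)ᶜ)
    (h₁ : IsPreconnected U₁) (h₂ : IsPreconnected U₂) (hsides : U \ F = U₁ ∪ U₂) :
    (U₁ ⊆ Ω ∧ Disjoint U₂ Ω) ∨ (U₂ ⊆ Ω ∧ Disjoint U₁ Ω) := by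
  have hd : ∀ S ⊆ U \ F, Disjoint S (frontier Ω) := fun S hS =>
    hF ▸ disjoint_left.2 fun x hx => (hS hx).2
  have hs₁ : U₁ ⊆ U \ F := hsides ▸ subset_union_left
  have hs₂ : U₂ ⊆ U \ F := hsides ▸ subset_union_right
  have hqc : q ∈ closure Ω := frontier_subset_closure (hF ▸ hqF)
  have hFΩ : ∀ x ∈ Ω, x ∉ F := fun x hx hxF => by
    have := hΩ.inter_frontier_eq
    exact (this ▸ (⟨hx, hF ▸ hxF⟩ : x ∈ Ω ∩ frontier Ω) : x ∈ (∅ : Set Plane))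
  rcases subset_or_disjoint_of_frontier h₁ (hd _ hs₁) with h1 | h1 <;>
  rcases subset_or_disjoint_of_frontier h₂ (hd _ hs₂) with h2 | h2
  · exfalso
    obtain ⟨x, hxU, hx⟩ := mem_closure_iff.1 hext U hU hq
    have hxF : x ∉ F := fun h => hx (frontier_subset_closure (hF ▸ h))
    have : x ∈ U₁ ∪ U₂ := hsides ▸ ⟨hxU, hxF⟩
    exact hx (subset_closure (this.elim (fun h => h1 h) fun h => h2 h))
  · exact Or.inl ⟨h1, h2⟩
  · exact Or.inr ⟨h2, h1⟩
  · exfalso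
    obtain ⟨x, hxU, hx⟩ := mem_closure_iff.1 hqc U hU hq
    have : x ∈ U₁ ∪ U₂ := hsides ▸ ⟨hxU, hFΩ x hx⟩
    exact this.elim (fun h => disjoint_left.1 h1 h hx) fun h => disjoint_left.1 h2 h hx

lemma frontier_notMem {Ω : Set Plane} (hΩ : IsOpen Ω) {x : Plane} (hx : x ∈ frontier Ω) :
    x ∉ Ω := fun h => by
  have := hΩ.inter_frontier_eq
  exact (this ▸ (⟨h, hx⟩ : x ∈ Ω ∩ frontier Ω) : x ∈ (∅ : Set Plane))

/-- Boundary points of a smooth domain are limits of exterior points. -/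
lemma IsSmoothDomain.frontier_subset_closure_exterior {Ω : Set Plane} {m : ℕ}
    {γ : Fin m → ℝ → Plane} (h : IsSmoothDomain Ω γ) :
    frontier Ω ⊆ closure (closure Ω)ᶜ := by
  intro q hq
  rw [h.frontier_eq] at hq
  obtain ⟨i, s, rfl⟩ := mem_iUnion.1 hq
  obtain ⟨U, U₁, U₂, -, -, -, -, -, hU, h1, h2⟩ := h.curves.exists_sides i s
  -- Outside `Ω` and off the curves means outside the closure, because the curves are the frontier.
  -- The outward normal, whichever of the two it is, provides such points.
  have key : ∀ n : Plane, (∀ᶠ ε : ℝ in 𝓝[>] 0, γ i s + ε • n ∉ ⋃ j, range (γ j)) →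
      (∀ᶠ ε : ℝ in 𝓝[>] 0, γ i s + ε • n ∉ Ω) → γ i s ∈ closure (closure Ω)ᶜ := by
    intro n hn1 hn2
    have hlim : Tendsto (fun ε : ℝ => γ i s + ε • n) (𝓝[>] 0) (𝓝 (γ i s)) := by
      have : Continuous fun ε : ℝ => γ i s + ε • n := by fun_prop
      simpa using (this.tendsto 0).mono_left nhdsWithin_le_nhds
    refine mem_closure_of_tendsto hlim ?_
    filter_upwards [hn1, hn2] with ε he1 he2
    rw [mem_compl_iff, closure_eq_self_union_frontier, h.frontier_eq]
    exact fun hc => hc.elim he2 he1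
  have hU' : ∀ x ∈ U₁ ∪ U₂, x ∉ ⋃ j, range (γ j) := fun x hx => by
    rw [← hU] at hx; exact hx.2
  rcases h.oneSided i s with ho | ho
  · exact key _ (h1.mono fun ε hε => hU' _ (Or.inl hε)) (ho.mono fun ε hε => hε.1)
  · refine key _ (h2.mono fun ε hε => ?_) (ho.mono fun ε hε => hε.1)
    rw [smul_neg, ← sub_eq_add_neg]
    exact hU' _ (Or.inr hε)

/-- A bounded open set whose boundary is a system of curves, each point of which is a limit of
exterior points, is a smooth domain. -/
theorem IsCurveSystem.isSmoothDomain {Ω : Set Plane} {m : ℕ} {γ : Fin m → ℝ → Plane}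
    (hγ : IsCurveSystem γ) (hΩ : IsOpen Ω) (hb : Bornology.IsBounded Ω)
    (hF : frontier Ω = ⋃ i, range (γ i)) (hext : frontier Ω ⊆ closure (closure Ω)ᶜ) :
    IsSmoothDomain Ω γ := by
  refine ⟨hΩ, hb, hγ.smooth, hγ.periodic, hγ.regular, hγ.simple, hF, fun i s => ?_⟩
  obtain ⟨U, U₁, U₂, hUo, hq, hp₁, hp₂, -, hU, h1, h2⟩ := hγ.exists_sides i s
  have hqF : γ i s ∈ ⋃ i, range (γ i) := mem_iUnion.2 ⟨i, s, rfl⟩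
  rcases one_sided_of_sides hΩ hF hUo hq hqF (hext (hF ▸ hqF)) hp₁ hp₂ hU with ⟨ha, hb⟩ | ⟨ha, hb⟩
  · right
    filter_upwards [h1, h2] with ε he1 he2
    rw [smul_neg, sub_neg_eq_add, ← sub_eq_add_neg]
    exact ⟨disjoint_left.1 hb he2, ha he1⟩
  · left
    filter_upwards [h1, h2] with ε he1 he2
    exact ⟨disjoint_left.1 hb he1, ha he2⟩

/-- A smooth domain is determined by its boundary. -/
theorem IsSmoothDomain.eq_of_frontier_eq {Ω Ω' : Set Plane} {m : ℕ} {γ : Fin m → ℝ → Plane}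
    (h : IsSmoothDomain Ω γ) (h' : IsSmoothDomain Ω' γ) : Ω = Ω' := by
  set F := ⋃ i, range (γ i) with hFdef
  have hFc : IsClosed F := h.curves.isCompact_iUnion_range.isClosed
  -- `D` is the symmetric difference. Crossing the common boundary switches membership in both
  -- domains, so off `F` membership in `D` is locally constant even near points of `F`.
  -- Connectedness of the plane makes it constant, and boundedness of the domains decides the
  -- constant.
  set D : Set Plane := {x | ¬ (x ∈ Ω ↔ x ∈ Ω')} with hD
  have hloc : ∀ x ∉ F, (∃ U, IsOpen U ∧ x ∈ U ∧ U \ F ⊆ D) ∨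
      ∃ U, IsOpen U ∧ x ∈ U ∧ U \ F ⊆ Dᶜ := by
    intro x hx
    obtain ⟨r, hr, hball⟩ := Metric.isOpen_iff.1 hFc.isOpen_compl x hx
    have hd : Disjoint (Metric.ball x r) F :=
      disjoint_left.2 fun y hy => hball hy
    have hpc : IsPreconnected (Metric.ball x r) := (convex_ball x r).isPreconnected
    have hxr := Metric.mem_ball_self hr (x := x)
    rcases subset_or_disjoint_of_frontier hpc (by rw [h.frontier_eq]; exact hd) with h1 | h1 <;>
    rcases subset_or_disjoint_of_frontier hpc (by rw [h'.frontier_eq]; exact hd) with h2 | h2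
    · exact Or.inr ⟨_, Metric.isOpen_ball, hxr, fun y hy hn =>
        hn (iff_of_true (h1 hy.1) (h2 hy.1))⟩
    · exact Or.inl ⟨_, Metric.isOpen_ball, hxr, fun y hy hn =>
        disjoint_left.1 h2 hy.1 (hn.1 (h1 hy.1))⟩
    · exact Or.inl ⟨_, Metric.isOpen_ball, hxr, fun y hy hn =>
        disjoint_left.1 h1 hy.1 (hn.2 (h2 hy.1))⟩
    · exact Or.inr ⟨_, Metric.isOpen_ball, hxr, fun y hy hn =>
        hn (iff_of_false (disjoint_left.1 h1 hy.1) (disjoint_left.1 h2 hy.1))⟩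
  have hlocF : ∀ x ∈ F, (∃ U, IsOpen U ∧ x ∈ U ∧ U \ F ⊆ D) ∨
      ∃ U, IsOpen U ∧ x ∈ U ∧ U \ F ⊆ Dᶜ := by
    intro x hx
    obtain ⟨i, s, rfl⟩ := mem_iUnion.1 hx
    obtain ⟨U, U₁, U₂, hUo, hq, hp₁, hp₂, -, hU, -, -⟩ := h.curves.exists_sides i s
    have e1 := one_sided_of_sides h.isOpen h.frontier_eq hUo hq hx
      (h.frontier_subset_closure_exterior (h.frontier_eq ▸ hx)) hp₁ hp₂ hU
    have e2 := one_sided_of_sides h'.isOpen h'.frontier_eq hUo hq hx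
      (h'.frontier_subset_closure_exterior (h'.frontier_eq ▸ hx)) hp₁ hp₂ hU
    rcases e1 with ⟨a, b⟩ | ⟨a, b⟩ <;> rcases e2 with ⟨a', b'⟩ | ⟨a', b'⟩
    · refine Or.inr ⟨U, hUo, hq, fun y hy => ?_⟩
      rw [hU] at hy
      rcases hy with hy | hy
      · exact fun hn => hn (iff_of_true (a hy) (a' hy))
      · exact fun hn => hn (iff_of_false (disjoint_left.1 b hy) (disjoint_left.1 b' hy))
    · refine Or.inl ⟨U, hUo, hq, fun y hy => ?_⟩
      rw [hU] at hy
      rcases hy with hy | hy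
      · exact fun hn => disjoint_left.1 b' hy (hn.1 (a hy))
      · exact fun hn => disjoint_left.1 b hy (hn.2 (a' hy))
    · refine Or.inl ⟨U, hUo, hq, fun y hy => ?_⟩
      rw [hU] at hy
      rcases hy with hy | hy
      · exact fun hn => disjoint_left.1 b hy (hn.2 (a' hy))
      · exact fun hn => disjoint_left.1 b' hy (hn.1 (a hy))
    · refine Or.inr ⟨U, hUo, hq, fun y hy => ?_⟩
      rw [hU] at hy
      rcases hy with hy | hy
      · exact fun hn => hn (iff_of_false (disjoint_left.1 b hy) (disjoint_left.1 b' hy))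
      · exact fun hn => hn (iff_of_true (a hy) (a' hy))
  -- Density makes the open sets `A` and `A'` below disjoint: an overlap would contain a point off
  -- `F`, which cannot be both in `D` and outside it.
  have hdense : Dense Fᶜ := by
    rw [← interior_eq_empty_iff_dense_compl, hFdef, ← h.frontier_eq, ← frontier_compl]
    exact interior_frontier h.isOpen.isClosed_compl
  set A := ⋃₀ {U : Set Plane | IsOpen U ∧ U \ F ⊆ D} with hA
  set A' := ⋃₀ {U : Set Plane | IsOpen U ∧ U \ F ⊆ Dᶜ} with hA'
  have hAo : IsOpen A := isOpen_sUnion fun U hU => hU.1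
  have hAo' : IsOpen A' := isOpen_sUnion fun U hU => hU.1
  have hcover : ∀ x, x ∈ A ∨ x ∈ A' := by
    intro x
    have : (∃ U, IsOpen U ∧ x ∈ U ∧ U \ F ⊆ D) ∨ ∃ U, IsOpen U ∧ x ∈ U ∧ U \ F ⊆ Dᶜ := by
      by_cases hx : x ∈ F
      · exact hlocF x hx
      · exact hloc x hx
    rcases this with ⟨U, h1, h2, h3⟩ | ⟨U, h1, h2, h3⟩
    · exact Or.inl ⟨U, ⟨h1, h3⟩, h2⟩
    · exact Or.inr ⟨U, ⟨h1, h3⟩, h2⟩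
  have hdisj : Disjoint A A' := by
    rw [disjoint_left]
    rintro x ⟨U, ⟨hU1, hU2⟩, hxU⟩ ⟨V, ⟨hV1, hV2⟩, hxV⟩
    obtain ⟨y, hy, hyF⟩ := hdense.inter_open_nonempty (U ∩ V) (hU1.inter hV1) ⟨x, hxU, hxV⟩
    exact hV2 ⟨hy.2, hyF⟩ (hU2 ⟨hy.1, hyF⟩)
  have hclopen : IsClopen A := by
    refine ⟨⟨?_⟩, hAo⟩
    have : Aᶜ = A' := by
      ext x
      exact ⟨fun hx => (hcover x).resolve_left hx, fun hx hx' => disjoint_left.1 hdisj hx' hx⟩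
    rw [this]; exact hAo'
  have hAempty : A = ∅ := by
    rcases isClopen_iff.1 hclopen with h0 | h0
    · exact h0
    · exfalso
      have hbdd : Bornology.IsBounded (Ω ∪ Ω' ∪ F) :=
        (h.isBounded.union h'.isBounded).union h.curves.isCompact_iUnion_range.isBounded
      obtain ⟨x, hx⟩ : ∃ x, x ∉ Ω ∪ Ω' ∪ F := by
        by_contra hcon
        push Not at hcon
        exact NormedSpace.unbounded_univ ℝ Plane (hbdd.subset fun x _ => hcon x)
      simp only [mem_union, not_or] at hx
      obtain ⟨U, ⟨-, hU⟩, hxU⟩ : x ∈ A := h0 ▸ mem_univ x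
      exact hU ⟨hxU, hx.2⟩ (iff_of_false hx.1.1 hx.1.2)
  ext x
  by_cases hx : x ∈ F
  · exact iff_of_false (frontier_notMem h.isOpen (h.frontier_eq ▸ hx))
      (frontier_notMem h'.isOpen (h'.frontier_eq ▸ hx))
  · have hxA : x ∈ A' := (hcover x).resolve_left (by simp [hAempty])
    obtain ⟨U, ⟨-, hU⟩, hxU⟩ := hxA
    have := hU ⟨hxU, hx⟩
    simpa [hD] using this

/-- The image of a smooth domain under a homeomorphism that carries its boundary curves to smooth
regular curves. -/
theorem IsSmoothDomain.image {Ω : Set Plane} {m : ℕ} {γ : Fin m → ℝ → Plane}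
    (h : IsSmoothDomain Ω γ) (e : Plane ≃ₜ Plane) (hs : ∀ i, ContDiff ℝ ∞ (e ∘ γ i))
    (hr : ∀ i s, deriv (e ∘ γ i) s ≠ 0) : IsSmoothDomain (e '' Ω) fun i => e ∘ γ i := by
  have hc : IsCurveSystem fun i => e ∘ γ i := by
    refine ⟨hs, fun i s => ?_, hr, fun i j s hs r hr hsr => ?_⟩
    · simp [h.periodic i s]
    · exact h.simple i j s hs r hr (e.injective hsr)
  -- A homeomorphism need not respect normals, so one-sidedness is transported in its topological
  -- form: boundary points are limits of exterior points.
  refine hc.isSmoothDomain (e.isOpenMap _ h.isOpen) ?_ ?_ ?_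
  · have hcomp : IsCompact (closure Ω) := h.isBounded.isCompact_closure
    exact (hcomp.image e.continuous).isBounded.subset (image_mono subset_closure)
  · rw [← e.image_frontier, h.frontier_eq, image_iUnion]
    simp [range_comp]
  · rw [← e.image_frontier, ← e.image_closure, ← e.image_compl, ← e.image_closure]
    exact image_mono h.frontier_subset_closure_exterior

/-! ### The length of curves -/

/-- The inequality forces `f` to factor on `S` through `g` by a `K`-Lipschitz map, even when `g` is
not injective. -/
lemma hausdorffMeasure_image_le_mul {α E : Type*} [MetricSpace E] [MeasurableSpace E]
    [BorelSpace E] {E' : Type*} [MetricSpace E'] [MeasurableSpace E'] [BorelSpace E']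
    {S : Set α} {f : α → E} {g : α → E'} {K : NNReal}
    (h : ∀ x ∈ S, ∀ y ∈ S, dist (f x) (f y) ≤ K * dist (g x) (g y)) :
    Measure.hausdorffMeasure 1 (f '' S) ≤ K * Measure.hausdorffMeasure 1 (g '' S) := by
  rcases S.eq_empty_or_nonempty with rfl | ⟨x₀, hx₀⟩
  · simp
  have : Nonempty α := ⟨x₀⟩
  set k : E' → E := fun y => f (Function.invFunOn g S y) with hk
  have hmem : ∀ x ∈ S, Function.invFunOn g S (g x) ∈ S ∧ g (Function.invFunOn g S (g x)) = g x :=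
    fun x hx => ⟨Function.invFunOn_apply_mem hx, Function.invFunOn_apply_eq hx⟩
  have hfk : ∀ x ∈ S, k (g x) = f x := by
    intro x hx
    have := h _ (hmem x hx).1 x hx
    rw [(hmem x hx).2, dist_self, mul_zero] at this
    exact dist_le_zero.1 this
  have hlip : LipschitzOnWith K k (g '' S) := by
    refine LipschitzOnWith.of_dist_le_mul ?_
    rintro _ ⟨x, hx, rfl⟩ _ ⟨y, hy, rfl⟩
    rw [hfk x hx, hfk y hy]
    exact h x hx y hy
  have := hlip.hausdorffMeasure_image_le zero_le_one
  have himg : k '' (g '' S) = f '' S := by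
    rw [image_image]
    exact image_congr hfk
  rwa [himg, ENNReal.rpow_one] at this

lemma length_le_of_lipschitz {c : ℝ → Plane} {a b K : ℝ} (hK : 0 ≤ K)
    (h : ∀ x ∈ Ico a b, ∀ y ∈ Ico a b, dist (c x) (c y) ≤ K * dist x y) :
    Measure.hausdorffMeasure 1 (c '' Ico a b) ≤ ENNReal.ofReal (K * (b - a)) := by
  have := hausdorffMeasure_image_le_mul (g := (id : ℝ → ℝ)) (K := ⟨K, hK⟩) h
  rw [image_id, hausdorffMeasure_real, Real.volume_Ico] at this
  refine this.trans_eq ?_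
  rw [ENNReal.ofReal_mul hK, ENNReal.ofReal_eq_coe_nnreal hK]
  rfl

lemma le_length_of_antilipschitz {c : ℝ → Plane} {a b K : ℝ} (hK : 0 < K)
    (h : ∀ x ∈ Ico a b, ∀ y ∈ Ico a b, K * dist x y ≤ dist (c x) (c y)) :
    ENNReal.ofReal (K * (b - a)) ≤ Measure.hausdorffMeasure 1 (c '' Ico a b) := by
  have h' : ∀ x ∈ Ico a b, ∀ y ∈ Ico a b,
      dist (id x) (id y) ≤ (⟨K⁻¹, by positivity⟩ : NNReal) * dist (c x) (c y) := by
    intro x hx y hy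
    show dist x y ≤ K⁻¹ * _
    rw [inv_mul_eq_div, le_div_iff₀ hK, mul_comm]
    exact h x hx y hy
  have := hausdorffMeasure_image_le_mul h'
  rw [image_id, hausdorffMeasure_real, Real.volume_Ico] at this
  rw [ENNReal.ofReal_mul hK.le]
  calc ENNReal.ofReal K * ENNReal.ofReal (b - a)
      ≤ ENNReal.ofReal K * (ENNReal.ofReal K⁻¹ * Measure.hausdorffMeasure 1 (c '' Ico a b)) := by
        gcongr
        rwa [ENNReal.ofReal_eq_coe_nnreal (by positivity : (0 : ℝ) ≤ K⁻¹)]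
    _ = _ := by
        rw [← mul_assoc, ← ENNReal.ofReal_mul hK.le, mul_inv_cancel₀ hK.ne', ENNReal.ofReal_one,
          one_mul]

/-- The length of a simple curve of class `C¹`. -/
theorem hausdorffMeasure_image_Ico {c : ℝ → Plane} (hc : ContDiff ℝ 1 c)
    (hinj : InjOn c (Ico 0 1)) :
    Measure.hausdorffMeasure 1 (c '' Ico 0 1) = ENNReal.ofReal (∫ s in (0 : ℝ)..1, ‖deriv c s‖) := by
  have hdc : Continuous fun s => ‖deriv c s‖ := (hc.continuous_deriv le_rfl).norm
  obtain ⟨K₀, hK₀⟩ : ∃ K, LipschitzOnWith K c (Icc 0 1) :=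
    hc.locallyLipschitz.locallyLipschitzOn.exists_lipschitzOnWith_of_compact isCompact_Icc
  set μ : Measure Plane := Measure.hausdorffMeasure 1 with hμ
  -- `F b` is the length of the arc over `[0, b)`. It is continuous with right derivative `‖deriv c
  -- b‖`, so it coincides with the integral of the speed, which has the same right derivative and
  -- the same value at `0`.
  set F : ℝ → ℝ := fun b => (μ (c '' Ico 0 b)).toReal with hF
  have hle : ∀ a b, 0 ≤ a → a ≤ b → b ≤ 1 → μ (c '' Ico a b) ≤ ENNReal.ofReal (K₀ * (b - a)) := by
    intro a b ha hab hb
    refine length_le_of_lipschitz K₀.2 fun x hx y hy => ?_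
    have h1 : x ∈ Icc (0 : ℝ) 1 := ⟨ha.trans hx.1, hx.2.le.trans hb⟩
    have h2 : y ∈ Icc (0 : ℝ) 1 := ⟨ha.trans hy.1, hy.2.le.trans hb⟩
    exact hK₀.dist_le_mul x h1 y h2
  have hfin : ∀ a b, 0 ≤ a → a ≤ b → b ≤ 1 → μ (c '' Ico a b) ≠ ⊤ := fun a b ha hab hb =>
    ((hle a b ha hab hb).trans_lt ENNReal.ofReal_lt_top).ne
  have hadd : ∀ a b, 0 ≤ a → a ≤ b → b ≤ 1 → F b = F a + (μ (c '' Ico a b)).toReal := by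
    intro a b ha hab hb
    have hmeas : MeasurableSet (c '' Ico a b) := by
      refine measurableSet_Ico.image_of_continuousOn_injOn hc.continuous.continuousOn ?_
      exact hinj.mono (Ico_subset_Ico ha hb)
    have hdisj : Disjoint (c '' Ico 0 a) (c '' Ico a b) := by
      rw [disjoint_left]
      rintro _ ⟨x, hx, rfl⟩ ⟨y, hy, hxy⟩
      have := hinj ⟨ha.trans hy.1, hy.2.trans_le hb⟩ ⟨hx.1, hx.2.trans_le (hab.trans hb)⟩ hxy
      linarith [hx.2, hy.1]
    rw [hF]
    dsimp only
    rw [← Ico_union_Ico_eq_Ico ha hab, image_union, measure_union hdisj hmeas,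
      ENNReal.toReal_add (hfin 0 a le_rfl ha (hab.trans hb)) (hfin a b ha hab hb)]
  have hcont : ContinuousOn F (Icc 0 1) := by
    have : LipschitzOnWith K₀ F (Icc 0 1) := by
      refine LipschitzOnWith.of_le_add_mul K₀ fun x (hx : x ∈ Icc 0 1) y (hy : y ∈ Icc 0 1) => ?_
      rcases le_total x y with h | h
      · rw [hadd x y hx.1 h hy.2]
        have : 0 ≤ (μ (c '' Ico x y)).toReal := ENNReal.toReal_nonneg
        have : (0 : ℝ) ≤ K₀ * dist x y := by positivity
        linarith
      · rw [hadd y x hy.1 h hx.2, Real.dist_eq, abs_of_nonneg (sub_nonneg.2 h)]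
        have := ENNReal.toReal_mono ENNReal.ofReal_ne_top (hle y x hy.1 h hx.2)
        rw [ENNReal.toReal_ofReal (mul_nonneg K₀.coe_nonneg (sub_nonneg.2 h))] at this
        linarith
    exact this.continuousOn
  have hderiv : ∀ b ∈ Ico (0 : ℝ) 1, HasDerivWithinAt F ‖deriv c b‖ (Ici b) b := by
    intro b hb
    rw [hasDerivWithinAt_iff_isLittleO, Asymptotics.isLittleO_iff]
    intro ε hε
    -- By strict differentiability, `c` multiplies distances near `b` by factors within `ε` of
    -- `‖deriv c b‖`. Length scales accordingly, which squeezes the difference quotient of `F`.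
    have hstr : HasStrictDerivAt c (deriv c b) b := (hc.contDiffAt).hasStrictDerivAt one_ne_zero
    have h1 : (fun p : ℝ × ℝ => c p.1 - c p.2 - (p.1 - p.2) • deriv c b) =o[𝓝 (b, b)]
        fun p => p.1 - p.2 := by
      simpa using hstr.hasStrictFDerivAt.isLittleO
    rw [Asymptotics.isLittleO_iff] at h1
    have h1 := h1 hε
    rw [nhds_prod_eq, Metric.nhds_basis_ball.prod_self.eventually_iff] at h1
    obtain ⟨δ, hδ, h1⟩ := h1
    have hev : ∀ᶠ y in 𝓝[≥] b, y ∈ Ico b (min (b + δ) 1) :=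
      Ico_mem_nhdsGE (lt_min (by linarith) hb.2)
    filter_upwards [hev] with y hy
    have hy1 : y < b + δ := hy.2.trans_le (min_le_left _ _)
    have hy2 : y < 1 := hy.2.trans_le (min_le_right _ _)
    have hyb : 0 ≤ y - b := sub_nonneg.2 hy.1
    rw [hadd b y hb.1 hy.1 hy2.le, smul_eq_mul, Real.norm_eq_abs, Real.norm_eq_abs,
      abs_of_nonneg hyb]
    have hball : ∀ x ∈ Ico b y, x ∈ Metric.ball b δ := fun x hx => by
      rw [Metric.mem_ball, Real.dist_eq, abs_lt]
      constructor <;> linarith [hx.1, hx.2]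
    have h2 : ∀ x ∈ Ico b y, ∀ z ∈ Ico b y,
        ‖c x - c z - (x - z) • deriv c b‖ ≤ ε * ‖x - z‖ := fun x hx z hz =>
      h1 (x := (x, z)) ⟨hball x hx, hball z hz⟩
    have hup : (μ (c '' Ico b y)).toReal ≤ (‖deriv c b‖ + ε) * (y - b) := by
      have := length_le_of_lipschitz (c := c) (a := b) (b := y) (K := ‖deriv c b‖ + ε)
        (by positivity)
        fun x hx z hz => by
          rw [dist_eq_norm, Real.dist_eq, ← Real.norm_eq_abs]
          have h3 := h2 x hx z hz
          have h4 := norm_sub_norm_le (c x - c z) ((x - z) • deriv c b)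
          rw [norm_smul] at h4
          linarith
      have := ENNReal.toReal_mono ENNReal.ofReal_ne_top this
      rwa [ENNReal.toReal_ofReal (by positivity)] at this
    have hlow : (‖deriv c b‖ - ε) * (y - b) ≤ (μ (c '' Ico b y)).toReal := by
      rcases le_or_gt ‖deriv c b‖ ε with hle' | hgt
      · exact (mul_nonpos_of_nonpos_of_nonneg (by linarith) hyb).trans ENNReal.toReal_nonneg
      · have := le_length_of_antilipschitz (c := c) (a := b) (b := y) (K := ‖deriv c b‖ - ε)
          (by linarith) fun x hx z hz => by
            rw [dist_eq_norm, dist_eq_norm]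
            have h3 := h2 x hx z hz
            have h4 := norm_sub_norm_le ((x - z) • deriv c b) (c x - c z)
            rw [norm_smul, norm_sub_rev ((x - z) • deriv c b)] at h4
            linarith
        have := ENNReal.toReal_mono (hfin b y hb.1 hy.1 hy2.le) this
        rwa [ENNReal.toReal_ofReal (mul_nonneg (by linarith) hyb)] at this
    rw [abs_le]
    constructor <;> nlinarith
  have hint : ∀ b, HasDerivAt (fun b => ∫ s in (0 : ℝ)..b, ‖deriv c s‖) ‖deriv c b‖ b := fun b =>
    intervalIntegral.integral_hasDerivAt_right (hdc.intervalIntegrable _ _)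
      hdc.aestronglyMeasurable.stronglyMeasurableAtFilter hdc.continuousAt
  have hconst := constant_of_has_deriv_right_zero (a := 0) (b := 1)
    (f := fun b => F b - ∫ s in (0 : ℝ)..b, ‖deriv c s‖)
    (hcont.sub fun b _ => (hint b).continuousAt.continuousWithinAt)
    (fun b hb => ((hderiv b hb).fun_sub (hint b).hasDerivWithinAt).congr_deriv (sub_self _))
    1 (right_mem_Icc.2 zero_le_one)
  have hF1 : F 1 = ∫ s in (0 : ℝ)..1, ‖deriv c s‖ := by
    have : F 0 = 0 := by simp [hF]
    simp only [this, intervalIntegral.integral_same, sub_zero] at hconst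
    linarith
  rw [← hF1, hF]
  exact (ENNReal.ofReal_toReal (hfin 0 1 le_rfl zero_le_one le_rfl)).symm

lemma range_eq_image_Ico {c : ℝ → Plane} (hp : Function.Periodic c 1) :
    range c = c '' Ico 0 1 := by
  refine (image_subset_range _ _).antisymm' ?_
  rintro _ ⟨s, rfl⟩
  exact ⟨Int.fract s, ⟨Int.fract_nonneg s, Int.fract_lt_one s⟩, fract_periodic hp s⟩

/-- The total length of a system of disjoint simple closed curves of class `C¹`. -/
theorem hausdorffMeasure_iUnion_range {m : ℕ} {c : Fin m → ℝ → Plane}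
    (hc : ∀ i, ContDiff ℝ 1 (c i)) (hp : ∀ i, Function.Periodic (c i) 1)
    (hs : ∀ i j, ∀ s ∈ Ico (0 : ℝ) 1, ∀ r ∈ Ico (0 : ℝ) 1, c i s = c j r → i = j ∧ s = r) :
    (Measure.hausdorffMeasure 1 (⋃ i, range (c i))).toReal =
      ∑ i, ∫ s in (0 : ℝ)..1, ‖deriv (c i) s‖ := by
  have hinj : ∀ i, InjOn (c i) (Ico 0 1) := fun i s hs' r hr h => (hs i i s hs' r hr h).2
  have hmeas : ∀ i, MeasurableSet (range (c i)) := fun i => by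
    rw [range_eq_image_Ico (hp i)]
    exact measurableSet_Ico.image_of_continuousOn_injOn (hc i).continuous.continuousOn (hinj i)
  have hdisj : Pairwise (Function.onFun Disjoint fun i => range (c i)) := by
    intro i j hij
    rw [Function.onFun, disjoint_left, range_eq_image_Ico (hp i), range_eq_image_Ico (hp j)]
    rintro _ ⟨s, hs', rfl⟩ ⟨r, hr, h⟩
    exact hij (hs i j s hs' r hr h.symm).1
  rw [measure_iUnion hdisj hmeas, tsum_fintype, ENNReal.toReal_sum]
  · refine Finset.sum_congr rfl fun i _ => ?_
    rw [range_eq_image_Ico (hp i), hausdorffMeasure_image_Ico (hc i) (hinj i),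
      ENNReal.toReal_ofReal]
    exact intervalIntegral.integral_nonneg zero_le_one fun s _ => norm_nonneg _
  · intro i _
    rw [range_eq_image_Ico (hp i), hausdorffMeasure_image_Ico (hc i) (hinj i)]
    exact ENNReal.ofReal_ne_top

/-! ### Line tension -/

lemma unitTangent_sq {c : ℝ → Plane} {s : ℝ} (h : deriv c s ≠ 0) :
    unitTangent c s 0 ^ 2 + unitTangent c s 1 ^ 2 = 1 := by
  rw [← norm_sq_eq_plane, unitTangent, norm_smul, norm_inv, norm_norm,
    inv_mul_cancel₀ (norm_ne_zero_iff.2 h), one_pow]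

lemma contDiff_unitTangent {c : ℝ → Plane} (hc : ContDiff ℝ ∞ c) (h : ∀ s, deriv c s ≠ 0) :
    ContDiff ℝ ∞ (unitTangent c) := by
  have hd : ContDiff ℝ ∞ (deriv c) := (contDiff_infty_iff_deriv.1 hc).2
  exact ((hd.norm ℝ h).inv fun s => norm_ne_zero_iff.2 (h s)).smul hd

lemma hasDerivAt_coord {n : ℕ} {f : ℝ → EuclideanSpace ℝ (Fin n)} {f' : EuclideanSpace ℝ (Fin n)}
    {s : ℝ} (h : HasDerivAt f f' s) (i : Fin n) : HasDerivAt (fun s => f s i) (f' i) s := by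
  exact (EuclideanSpace.proj (𝕜 := ℝ) i).hasFDerivAt.comp_hasDerivAt s h

lemma unitTangent_mul_deriv {c : ℝ → Plane} (hc : ContDiff ℝ ∞ c) (h : ∀ s, deriv c s ≠ 0)
    (s : ℝ) : unitTangent c s 0 * deriv (unitTangent c) s 0 +
      unitTangent c s 1 * deriv (unitTangent c) s 1 = 0 := by
  have hT : HasDerivAt (unitTangent c) (deriv (unitTangent c) s) s :=
    ((contDiff_unitTangent hc h).differentiable (by simp) s).hasDerivAt
  have h1 := ((hasDerivAt_coord hT 0).pow 2).add ((hasDerivAt_coord hT 1).pow 2)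
  have h2 : ((fun s => unitTangent c s 0) ^ 2 + (fun s => unitTangent c s 1) ^ 2) =
      fun _ => (1 : ℝ) := by
    funext s; exact unitTangent_sq (h s)
  rw [h2] at h1
  have := h1.unique (hasDerivAt_const s 1)
  simp at this
  linarith

/-- The signed curvature of a plane curve times its speed. -/
def turning (c : ℝ → Plane) (s : ℝ) : ℝ :=
  deriv (unitTangent c) s 0 * unitTangent c s 1 - deriv (unitTangent c) s 1 * unitTangent c s 0

/-- Differentiating `|T|² = 1` shows that `T'` is orthogonal to `T`, hence a multiple of the normal.
-/
lemma deriv_unitTangent_eq {c : ℝ → Plane} (hc : ContDiff ℝ ∞ c) (h : ∀ s, deriv c s ≠ 0)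
    (s : ℝ) : deriv (unitTangent c) s = turning c s • rightNormal c s := by
  have h1 := unitTangent_sq (h s)
  have h2 := unitTangent_mul_deriv hc h s
  ext i
  fin_cases i
  · simp only [rightNormal, turning, Fin.zero_eta, PiLp.smul_apply, smul_eq_mul]
    show deriv (unitTangent c) s 0 = _ * unitTangent c s 1
    linear_combination (-(deriv (unitTangent c) s 0)) * h1 + unitTangent c s 0 * h2
  · simp only [rightNormal, turning, Fin.mk_one, PiLp.smul_apply, smul_eq_mul]
    show deriv (unitTangent c) s 1 = _ * -(unitTangent c s 0)
    linear_combination (-(deriv (unitTangent c) s 1)) * h1 + unitTangent c s 1 * h2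

lemma inner_plane (p q : Plane) : inner ℝ p q = p 0 * q 0 + p 1 * q 1 := by
  rw [PiLp.inner_apply, Fin.sum_univ_two]; simp [mul_comm]

/-- The product `κ n` is quadratic in the normal, so the choice of side cancels and only the
derivative of the tangent is left. This frees the line tension from any reference to `Ω`. -/
lemma curvature_smul_outwardNormal {Ω : Set Plane} {c : ℝ → Plane} (hc : ContDiff ℝ ∞ c)
    (h : ∀ s, deriv c s ≠ 0) (s : ℝ) :
    (curvature Ω c s * ‖deriv c s‖) • outwardNormal Ω c s = deriv (unitTangent c) s := by
  have hn : inner ℝ (rightNormal c s) (rightNormal c s) = (1 : ℝ) := by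
    rw [inner_plane, ← unitTangent_sq (h s), rightNormal]
    simp only [Matrix.cons_val_zero, Matrix.cons_val_one]
    ring
  have hd : ‖deriv c s‖ ≠ 0 := norm_ne_zero_iff.2 (h s)
  have hkey : ∀ n : Plane, n = rightNormal c s ∨ n = -rightNormal c s →
      (inner ℝ (‖deriv c s‖⁻¹ • deriv (unitTangent c) s) n * ‖deriv c s‖) • n =
        deriv (unitTangent c) s := by
    rintro n (rfl | rfl)
    · rw [deriv_unitTangent_eq hc h, inner_smul_left, inner_smul_left, hn]
      simp only [conj_trivial, mul_one]
      congr 1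
      field_simp
    · rw [deriv_unitTangent_eq hc h, inner_smul_left, inner_smul_left, inner_neg_right, hn]
      simp only [conj_trivial, mul_neg, mul_one, neg_mul, smul_neg, neg_smul, neg_neg]
      congr 1
      field_simp
  rw [curvature]
  apply hkey
  rw [outwardNormal]
  split_ifs <;> simp

lemma lineTension_eq {Ω : Set Plane} {m : ℕ} {γ : Fin m → ℝ → Plane} (hγ : IsCurveSystem γ)
    (f : Plane → ℝ) :
    lineTension Ω γ f = ∑ i, ∫ s in (0 : ℝ)..1, f (γ i s) • deriv (unitTangent (γ i)) s := by
  refine Finset.sum_congr rfl fun i _ => ?_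
  congr 1
  funext s
  rw [← curvature_smul_outwardNormal (Ω := Ω) (hγ.smooth i) (hγ.regular i), smul_smul, mul_assoc]

lemma lineTension_apply {Ω : Set Plane} {m : ℕ} {γ : Fin m → ℝ → Plane} (hγ : IsCurveSystem γ)
    {f : Plane → ℝ} (hf : Continuous f) (j : Fin 2) :
    lineTension Ω γ f j =
      ∑ i, ∫ s in (0 : ℝ)..1, f (γ i s) * deriv (unitTangent (γ i)) s j := by
  rw [lineTension_eq hγ, WithLp.ofLp_sum, Finset.sum_apply]
  refine Finset.sum_congr rfl fun i _ => ?_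
  have hT := contDiff_unitTangent (hγ.smooth i) (hγ.regular i)
  have hc : Continuous fun s => f (γ i s) • deriv (unitTangent (γ i)) s :=
    (hf.comp (hγ.smooth i).continuous).smul (hT.continuous_deriv (by simp))
  have := (EuclideanSpace.proj (𝕜 := ℝ) j).intervalIntegral_comp_comm
    (hc.intervalIntegrable (μ := volume) 0 1)
  simpa using this.symm

lemma sum_lineTension_apply {Ω : Set Plane} {m : ℕ} {γ : Fin m → ℝ → Plane} (hγ : IsCurveSystem γ)
    {V : Plane → Plane} (hV : Continuous V) :
    ∑ j, lineTension Ω γ (fun p => V p j) j =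
      ∑ i, ∫ s in (0 : ℝ)..1, inner ℝ (deriv (unitTangent (γ i)) s) (V (γ i s)) := by
  have hc : ∀ j, Continuous fun p => V p j := fun j =>
    (EuclideanSpace.proj (𝕜 := ℝ) j).continuous.comp hV
  simp_rw [fun j => lineTension_apply (Ω := Ω) hγ (hc j) j]
  rw [Finset.sum_comm]
  refine Finset.sum_congr rfl fun i _ => ?_
  have hT := contDiff_unitTangent (hγ.smooth i) (hγ.regular i)
  rw [← intervalIntegral.integral_finsetSum]
  · congr 1
  · intro j _
    refine Continuous.intervalIntegrable ?_ _ _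
    exact ((hc j).comp (hγ.smooth i).continuous).mul
      ((EuclideanSpace.proj (𝕜 := ℝ) j).continuous.comp (hT.continuous_deriv (by simp)))

/-! ### The first variation of the length -/

lemma hasDerivAt_norm_add_smul {E : Type*} [NormedAddCommGroup E] [InnerProductSpace ℝ E]
    {a w : E} (ha : a ≠ 0) :
    HasDerivAt (fun τ : ℝ => ‖a + τ • w‖) (inner ℝ (‖a‖⁻¹ • a) w) 0 := by
  have h1 : HasDerivAt (fun τ : ℝ => a + τ • w) w 0 := by
    simpa using ((hasDerivAt_id (0 : ℝ)).smul_const w).const_add a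
  have h2 := h1.norm_sq
  have h3 := h2.sqrt (by simpa using ha)
  have h4 : (fun τ : ℝ => √(‖a + τ • w‖ ^ 2)) = fun τ : ℝ => ‖a + τ • w‖ := by
    funext τ; exact Real.sqrt_sq (norm_nonneg _)
  rw [h4] at h3
  refine h3.congr_deriv ?_
  simp only [zero_smul, add_zero, Real.sqrt_sq (norm_nonneg a), inner_smul_left, conj_trivial]
  have : ‖a‖ ≠ 0 := norm_ne_zero_iff.2 ha
  field_simp

/-- Differentiation under the integral sign: the integrand is Lipschitz in `τ` with constant `‖w
s‖`, and it is differentiable at `τ = 0` because the curve is regular. -/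
lemma hasDerivAt_integral_norm_add_smul {c : ℝ → Plane} {w : ℝ → Plane}
    (hdc : Continuous (deriv c)) (hw : Continuous w) (hT : Continuous (unitTangent c))
    (hr : ∀ s, deriv c s ≠ 0) :
    HasDerivAt (fun τ : ℝ => ∫ s in (0 : ℝ)..1, ‖deriv c s + τ • w s‖)
      (∫ s in (0 : ℝ)..1, inner ℝ (unitTangent c s) (w s)) 0 := by
  have hF : ∀ τ : ℝ, Continuous fun s => ‖deriv c s + τ • w s‖ := fun τ => by fun_prop
  refine (intervalIntegral.hasDerivAt_integral_of_dominated_loc_of_lip (μ := volume)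
    (bound := fun s => ‖w s‖) univ_mem
    (Eventually.of_forall fun τ => (hF τ).aestronglyMeasurable)
    ((hF 0).intervalIntegrable _ _) (hT.inner hw).aestronglyMeasurable
    (Eventually.of_forall fun s _ => ?_) (hw.norm.intervalIntegrable _ _)
    (Eventually.of_forall fun s _ => hasDerivAt_norm_add_smul (hr s))).2
  refine LipschitzOnWith.of_dist_le_mul fun τ _ σ _ => ?_
  rw [Real.coe_nnabs, abs_of_nonneg (norm_nonneg _), Real.dist_eq]
  refine (abs_norm_sub_norm_le _ _).trans_eq ?_
  rw [add_sub_add_left_eq_sub, ← sub_smul, norm_smul, Real.dist_eq, Real.norm_eq_abs, mul_comm]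

/-- The derivative of the length of the curves `γ + τ V ∘ γ` at `τ = 0`. -/
lemma hasDerivAt_length {m : ℕ} {γ : Fin m → ℝ → Plane} (hγ : IsCurveSystem γ)
    {V : Plane → Plane} (hV : ContDiff ℝ ∞ V) :
    HasDerivAt (fun τ : ℝ => ∑ i, ∫ s in (0 : ℝ)..1, ‖deriv (fun s => γ i s + τ • V (γ i s)) s‖)
      (-∑ i, ∫ s in (0 : ℝ)..1, inner ℝ (deriv (unitTangent (γ i)) s) (V (γ i s))) 0 := by
  rw [← Finset.sum_neg_distrib]
  refine HasDerivAt.fun_sum fun i _ => ?_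
  have hg : ContDiff ℝ ∞ (γ i) := hγ.smooth i
  have hw : ContDiff ℝ ∞ fun s => V (γ i s) := hV.comp hg
  have hdg : Continuous (deriv (γ i)) := hg.continuous_deriv (by simp)
  have hdw : Continuous (deriv fun s => V (γ i s)) := hw.continuous_deriv (by simp)
  have hT := contDiff_unitTangent hg (hγ.regular i)
  have hdT : Continuous (deriv (unitTangent (γ i))) := hT.continuous_deriv (by simp)
  have hder : ∀ τ s : ℝ, deriv (fun s => γ i s + τ • V (γ i s)) s =
      deriv (γ i) s + τ • deriv (fun s => V (γ i s)) s := fun τ s =>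
    (((hg.differentiable (by simp) s).hasDerivAt).add
      (((hw.differentiable (by simp) s).hasDerivAt).const_smul τ)).deriv
  simp_rw [hder]
  have hmain : HasDerivAt
      (fun τ : ℝ => ∫ s in (0 : ℝ)..1, ‖deriv (γ i) s + τ • deriv (fun s => V (γ i s)) s‖)
      (∫ s in (0 : ℝ)..1, inner ℝ (unitTangent (γ i) s) (deriv (fun s => V (γ i s)) s)) 0 :=
    hasDerivAt_integral_norm_add_smul hdg hdw hT.continuous (hγ.regular i)
  refine hmain.congr_deriv ?_
  have hprod : ∀ s, HasDerivAt (fun s => inner ℝ (unitTangent (γ i) s) (V (γ i s)))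
      (inner ℝ (unitTangent (γ i) s) (deriv (fun s => V (γ i s)) s) +
        inner ℝ (deriv (unitTangent (γ i)) s) (V (γ i s))) s := fun s =>
    ((hT.differentiable (by simp) s).hasDerivAt).inner ℝ
      ((hw.differentiable (by simp) s).hasDerivAt)
  have hi1 : Continuous fun s => inner ℝ (unitTangent (γ i) s) (deriv (fun s => V (γ i s)) s) :=
    hT.continuous.inner hdw
  have hi2 : Continuous fun s => inner ℝ (deriv (unitTangent (γ i)) s) (V (γ i s)) :=
    hdT.inner hw.continuous
  -- Integration by parts over one period moves the derivative from `V ∘ γ` to the tangent. The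
  -- boundary terms cancel by periodicity.
  have hftc := intervalIntegral.integral_eq_sub_of_hasDerivAt (a := 0) (b := 1)
    (fun s _ => hprod s) ((hi1.add hi2).intervalIntegrable _ _)
  have hper : Function.Periodic (deriv (γ i)) 1 := by
    intro s
    have : (fun r => γ i (r + 1)) = γ i := funext (hγ.periodic i)
    rw [← deriv_comp_add_const, this]
  have hends : unitTangent (γ i) 1 = unitTangent (γ i) 0 ∧ γ i 1 = γ i 0 := by
    have h1 := hper 0
    have h2 := hγ.periodic i 0
    rw [zero_add] at h1 h2
    exact ⟨by rw [unitTangent, unitTangent, h1], h2⟩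
  rw [hends.1, hends.2, sub_self, intervalIntegral.integral_add (hi1.intervalIntegrable _ _)
    (hi2.intervalIntegrable _ _)] at hftc
  linarith

/-! ### Flows of Lipschitz fields -/

section Flow

variable {E : Type*} [NormedAddCommGroup E] [NormedSpace ℝ E]

/-- A bounded Lipschitz vector field has global integral curves. -/
theorem exists_integralCurve [CompleteSpace E] {f : E → E} {K L : NNReal} (hf : LipschitzWith K f)
    (hL : ∀ x, ‖f x‖ ≤ L) (x : E) :
    ∃ α : ℝ → E, α 0 = x ∧ ∀ t, HasDerivAt α (f (α t)) t := by
  -- Since the field is bounded by `L`, a solution cannot leave the ball of radius `L (n + 1)`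
  -- within time `n + 1`, so Picard–Lindelöf works on the whole interval. The pieces agree by
  -- uniqueness.
  have hloc : ∀ n : ℕ, ∃ α : ℝ → E, α 0 = x ∧
      ∀ t ∈ Ioo (-(n + 1 : ℝ)) (n + 1), HasDerivAt α (f (α t)) t := by
    intro n
    have h0 : (0 : ℝ) ∈ Icc (-(n + 1 : ℝ)) (n + 1) := ⟨by linarith [n.cast_nonneg (α := ℝ)],
      by positivity⟩
    have hpl : IsPicardLindelof (fun _ : ℝ => f) (⟨0, h0⟩ : Icc (-(n + 1 : ℝ)) (n + 1)) x
        (L * (n + 1)) 0 L K := by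
      refine .of_time_independent (fun y _ => hL y) hf.lipschitzOnWith ?_
      simp
    obtain ⟨α, hα0, hα⟩ := hpl.exists_eq_forall_mem_Icc_hasDerivWithinAt₀
    exact ⟨α, hα0, fun t ht => (hα t (Ioo_subset_Icc_self ht)).hasDerivAt
      (Icc_mem_nhds ht.1 ht.2)⟩
  choose α hα0 hα using hloc
  have hagree : ∀ m n : ℕ, m ≤ n → EqOn (α m) (α n) (Ioo (-(m + 1 : ℝ)) (m + 1)) := by
    intro m n hmn
    have hmn' : (m : ℝ) ≤ n := by exact_mod_cast hmn
    refine ODE_solution_unique_of_mem_Ioo (v := fun _ => f) (s := fun _ => univ) (K := K) (t₀ := 0)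
      (fun t _ => hf.lipschitzOnWith) ⟨by linarith [m.cast_nonneg (α := ℝ)], by positivity⟩
      (fun t ht => ⟨hα m t ht, mem_univ _⟩) (fun t ht => ⟨hα n t ⟨?_, ?_⟩, mem_univ _⟩)
      (by rw [hα0, hα0])
    · linarith [ht.1]
    · linarith [ht.2]
  have hceil : ∀ t : ℝ, t ∈ Ioo (-((⌈|t|⌉₊ : ℝ) + 1)) ((⌈|t|⌉₊ : ℝ) + 1) := fun t => by
    have := Nat.le_ceil |t|
    have h1 := neg_abs_le t
    have h2 := le_abs_self t
    constructor <;> linarith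
  refine ⟨fun t => α ⌈|t|⌉₊ t, by simp [hα0], fun t => ?_⟩
  -- Near `t` the index `⌈|·|⌉₊` may jump; one fixed piece with a larger index represents the glued
  -- curve on a whole neighbourhood.
  set N := ⌈|t|⌉₊ + 1 with hN
  have hmem : Ioo (-((⌈|t|⌉₊ : ℝ) + 1)) ((⌈|t|⌉₊ : ℝ) + 1) ∈ 𝓝 t :=
    Ioo_mem_nhds (hceil t).1 (hceil t).2
  have heq : (fun t => α ⌈|t|⌉₊ t) =ᶠ[𝓝 t] α N := by
    filter_upwards [hmem] with s hs
    refine hagree _ N ?_ (hceil s)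
    have : |s| ≤ (⌈|t|⌉₊ + 1 : ℕ) := by
      push_cast
      exact abs_le.2 ⟨hs.1.le, hs.2.le⟩
    exact Nat.ceil_le.2 this
  have hval : α ⌈|t|⌉₊ t = α N t := heq.eq_of_nhds
  simp only [hval]
  refine (hα N t ⟨?_, ?_⟩).congr_of_eventuallyEq heq
  · have := (hceil t).1
    rw [hN]; push_cast; linarith
  · have := (hceil t).2
    rw [hN]; push_cast; linarith

lemma dist_flow_le_of_nonneg {f : E → E} {K : NNReal} (hf : LipschitzWith K f) {α β : ℝ → E}
    (hα : ∀ t, HasDerivAt α (f (α t)) t) (hβ : ∀ t, HasDerivAt β (f (β t)) t) {t : ℝ}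
    (ht : 0 ≤ t) : dist (α t) (β t) ≤ dist (α 0) (β 0) * Real.exp (K * t) := by
  have := dist_le_of_trajectories_ODE (v := fun _ => f) (fun _ => hf) (a := 0) (b := t)
    (fun s _ => (hα s).continuousAt.continuousWithinAt) (fun s _ => (hα s).hasDerivWithinAt)
    (fun s _ => (hβ s).continuousAt.continuousWithinAt) (fun s _ => (hβ s).hasDerivWithinAt)
    le_rfl t ⟨ht, le_rfl⟩
  simpa using this

lemma hasDerivAt_reverse {f : E → E} {α : ℝ → E} (hα : ∀ t, HasDerivAt α (f (α t)) t) (t : ℝ) :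
    HasDerivAt (fun s => α (-s)) ((fun x => -f x) (α (-t))) t := by
  exact ((hα (-t)).scomp t (hasDerivAt_neg t)).congr_deriv (by simp)

lemma dist_flow_le {f : E → E} {K : NNReal} (hf : LipschitzWith K f) {α β : ℝ → E}
    (hα : ∀ t, HasDerivAt α (f (α t)) t) (hβ : ∀ t, HasDerivAt β (f (β t)) t) (t : ℝ) :
    dist (α t) (β t) ≤ dist (α 0) (β 0) * Real.exp (K * |t|) := by
  rcases le_total 0 t with h | h
  · rw [abs_of_nonneg h]; exact dist_flow_le_of_nonneg hf hα hβ h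
  · rw [abs_of_nonpos h]
    have := dist_flow_le_of_nonneg (f := fun x => -f x) hf.neg (hasDerivAt_reverse hα)
      (hasDerivAt_reverse hβ) (neg_nonneg.2 h)
    simpa using this

lemma integralCurve_unique {f : E → E} {K : NNReal} {s : Set E} (hf : LipschitzOnWith K f s)
    {α β : ℝ → E} (hα : ∀ t, HasDerivAt α (f (α t)) t) (hαs : ∀ t, α t ∈ s)
    (hβ : ∀ t, HasDerivAt β (f (β t)) t) (hβs : ∀ t, β t ∈ s) {t₀ : ℝ} (h : α t₀ = β t₀) :
    α = β :=
  ODE_solution_unique_univ (v := fun _ => f) (s := fun _ => s) (fun _ => hf)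
    (fun t => ⟨hα t, hαs t⟩) (fun t => ⟨hβ t, hβs t⟩) h

/-- The time-`τ` map of the flow of a Lipschitz field is a homeomorphism. -/
lemma exists_homeomorph_flow {f : E → E} {K : NNReal} (hf : LipschitzWith K f)
    {Ψ : ℝ → E → E} (h0 : ∀ p, Ψ 0 p = p) (hΨ : ∀ t p, HasDerivAt (fun s => Ψ s p) (f (Ψ t p)) t)
    (τ : ℝ) : ∃ e : E ≃ₜ E, ⇑e = Ψ τ := by
  have hlip : ∀ τ p q, dist (Ψ τ p) (Ψ τ q) ≤ Real.exp (K * |τ|) * dist p q := fun τ p q => by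
    have := dist_flow_le hf (fun t => hΨ t p) (fun t => hΨ t q) τ
    rwa [h0, h0, mul_comm] at this
  have hcont : ∀ τ, Continuous (Ψ τ) := fun τ =>
    (LipschitzWith.of_dist_le_mul (K := ⟨Real.exp (K * |τ|), (Real.exp_pos _).le⟩)
      (hlip τ)).continuous
  -- Both sides are integral curves in `τ` with the same value at time zero; this is the group law
  -- that makes `Ψ (-τ)` the inverse.
  have hinv : ∀ τ p, Ψ τ (Ψ (-τ) p) = p := by
    intro τ p
    have h1 : ∀ s, HasDerivAt (fun s => Ψ (s - τ) p) (f (Ψ (s - τ) p)) s := fun s =>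
      HasDerivAt.comp_sub_const s τ (hΨ (s - τ) p)
    have := integralCurve_unique (hf.lipschitzOnWith (s := univ)) (fun t => hΨ t (Ψ (-τ) p))
      (fun _ => mem_univ _) h1 (fun _ => mem_univ _) (t₀ := 0) (by simp [h0])
    have := congrFun this τ
    simpa [h0] using this
  exact ⟨⟨⟨Ψ τ, Ψ (-τ), fun p => by simpa using hinv (-τ) p, hinv τ⟩, hcont τ, hcont (-τ)⟩, rfl⟩

end Flow

/-! ### Fields without interface -/

/-- Together with `0⁻¹ = 0` this value turns the singular factors in `IsRegularField` into `1` when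
there is no interface. -/
lemma interfaceDist_empty (x : Space) : interfaceDist ∅ x = 0 := by
  simp [interfaceDist]

namespace eulerFields

variable {v : Space → Space}

lemma contDiffOn (hv : v ∈ eulerFields) : ContDiffOn ℝ ∞ v closedHalfSpace := by
  obtain ⟨C, hC⟩ := hv.regular
  simpa using hC.smooth

lemma exists_bounds (hv : v ∈ eulerFields) :
    ∃ K : NNReal, LipschitzOnWith K v closedHalfSpace ∧ (∀ x ∈ closedHalfSpace, ‖v x‖ ≤ K) ∧
      (∀ x ∈ closedHalfSpace, ‖v x‖ ≤ K * (1 + ‖x‖)⁻¹) ∧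
      ∀ x ∈ closedHalfSpace, ‖fderivWithin ℝ v closedHalfSpace x‖ ≤ K * (1 + ‖x‖)⁻¹ ^ 2 := by
  obtain ⟨C, hC⟩ := hv.regular
  have hC0 : C ≤ Real.toNNReal C := Real.le_coe_toNNReal C
  have hinv : ∀ x : Space, (1 + ‖x‖)⁻¹ ≤ 1 := fun x =>
    inv_le_one_of_one_le₀ (by linarith [norm_nonneg x])
  have h0 : ∀ x ∈ closedHalfSpace, ‖v x‖ ≤ Real.toNNReal C * (1 + ‖x‖)⁻¹ := fun x hx =>
    (hC.bound_zero x hx).trans (by gcongr)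
  have h1 : ∀ x ∈ closedHalfSpace, ‖fderivWithin ℝ v closedHalfSpace x‖ ≤
      Real.toNNReal C * (1 + ‖x‖)⁻¹ ^ 2 := fun x hx => by
    have := hC.bound_one x (by simpa using hx)
    rw [interfaceDist_empty] at this
    simp only [inv_zero, add_zero, Real.log_one, mul_one] at this
    exact this.trans (by gcongr)
  refine ⟨Real.toNNReal C, ?_, fun x hx => (h0 x hx).trans ?_, h0, h1⟩
  · refine convex_closedHalfSpace.lipschitzOnWith_of_nnnorm_fderivWithin_le
      ((contDiffOn hv).differentiableOn (by simp)) fun x hx => ?_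
    rw [← NNReal.coe_le_coe, coe_nnnorm]
    refine (h1 x hx).trans (mul_le_of_le_one_right (NNReal.coe_nonneg _) ?_)
    exact pow_le_one₀ (by positivity) (hinv x)
  · exact mul_le_of_le_one_right (NNReal.coe_nonneg _) (hinv x)

lemma embed_trace (hv : v ∈ eulerFields) (p : Plane) : embed (trace v p) = v (embed p) :=
  embed_horizontal (hv.normal_eq_zero p)

lemma contDiff_trace (hv : v ∈ eulerFields) : ContDiff ℝ ∞ (trace v) := by
  have h : ContDiffOn ℝ ∞ (fun p => v (embed p)) univ :=
    (contDiffOn hv).comp contDiff_embed.contDiffOn fun p _ => embed_mem p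
  exact contDiff_horizontal.comp (contDiffOn_univ.1 h)

lemma norm_trace_sub_le (V : Plane → Plane) (hV : V = trace v) {K : NNReal}
    (hK : LipschitzOnWith K v closedHalfSpace) : LipschitzWith K V := by
  refine LipschitzWith.of_dist_le_mul fun p q => ?_
  have h1 := hK.dist_le_mul _ (embed_mem p) _ (embed_mem q)
  rw [isometry_embed.dist_eq] at h1
  refine le_trans ?_ h1
  rw [hV, dist_eq_norm, dist_eq_norm, trace, trace, ← horizontal_sub]
  exact norm_horizontal_le _

lemma norm_trace_le (p : Plane) : ‖trace v p‖ ≤ ‖v (embed p)‖ := norm_horizontal_le _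

/-- On the boundary the flow of a field in `𝒱` is the flow of its trace. -/
lemma flow_embed (hv : v ∈ eulerFields) {w : Space → Space} {S : Set Space} {K K' : NNReal}
    (hK : LipschitzOnWith K v closedHalfSpace) (hb : ∀ x ∈ closedHalfSpace, ‖v x‖ ≤ K)
    (hS : ∀ p, embed p ∈ S) (hw : LipschitzOnWith K' w S) (hwv : ∀ p, w (embed p) = v (embed p))
    {α : ℝ → Space} (hα : ∀ t, HasDerivAt α (w (α t)) t) (hαS : ∀ t, α t ∈ S) {t₀ : ℝ}
    (h₀ : α t₀ 2 = 0) (t : ℝ) : α t 2 = 0 := by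
  have hbV : ∀ p, ‖trace v p‖ ≤ K := fun p => (norm_trace_le p).trans (hb _ (embed_mem p))
  -- The integral curve of the trace through `α t₀`, placed in the boundary plane, also solves the
  -- equation for `w`, because `v` is tangent there. Uniqueness identifies it with `α`. The field
  -- `w` is either `v` itself or an extension of `v` beyond the half-space.
  obtain ⟨β, hβ0, hβ⟩ := exists_integralCurve (norm_trace_sub_le _ rfl hK) hbV
    (horizontal (α t₀))
  have h1 : ∀ s, HasDerivAt (fun s => embed (β (s - t₀))) (w (embed (β (s - t₀)))) s := fun s => by
    rw [hwv, ← embed_trace hv]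
    have h2 : HasDerivAt (fun s => β (s - t₀)) (trace v (β (s - t₀))) s :=
      HasDerivAt.comp_sub_const s t₀ (hβ (s - t₀))
    exact embedCLM.hasFDerivAt.comp_hasDerivAt s h2
  have := integralCurve_unique hw hα hαS h1 (fun s => hS _) (t₀ := t₀)
    (by simp [hβ0, embed_horizontal h₀])
  rw [congrFun this t, embed_apply_two]

lemma flow_trace (hv : v ∈ eulerFields) {ψ : ℝ → Space → Space} (hψ : IsFlow v ψ) (τ : ℝ)
    (p : Plane) : embed (trace (ψ τ) p) = ψ τ (embed p) := by
  obtain ⟨K, hK, hb, -⟩ := exists_bounds hv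
  refine embed_horizontal (flow_embed hv hK hb embed_mem hK (fun _ => rfl)
    (fun t => hψ.hasDerivAt t _ (embed_mem p)) (fun t => hψ.mapsTo t (embed_mem p)) (t₀ := 0) ?_ τ)
  rw [hψ.init _ (embed_mem p), embed_apply_two]

lemma hasDerivAt_flow_trace (hv : v ∈ eulerFields) {ψ : ℝ → Space → Space} (hψ : IsFlow v ψ)
    (τ : ℝ) (p : Plane) :
    HasDerivAt (fun σ => trace (ψ σ) p) (trace v (trace (ψ τ) p)) τ := by
  have h := horizontalCLM.hasFDerivAt.comp_hasDerivAt τ (hψ.hasDerivAt τ _ (embed_mem p))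
  rw [← flow_trace hv hψ] at h
  exact h

/-- Fields in `𝒱` have a flow on the closed half-space. -/
theorem exists_flow (hv : v ∈ eulerFields) : ∃ ψ, IsFlow v ψ := by
  obtain ⟨K, hK, hb, -⟩ := exists_bounds hv
  -- Composition with the projection onto the closed half-space extends `v` to a bounded Lipschitz
  -- field on all of space. The Lipschitz constant `2` used for `clip` is crude but sufficient.
  set clip : Space → Space := fun x => x - max (x 2) 0 • vertical with hclip
  have hclip_mem : ∀ x, clip x ∈ closedHalfSpace := fun x => by
    simp [hclip, closedHalfSpace]
  have hclip_of_mem : ∀ x ∈ closedHalfSpace, clip x = x := fun x hx => by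
    have : x 2 ≤ 0 := hx
    simp [hclip, this]
  have hclip_lip : LipschitzWith 2 clip := by
    refine LipschitzWith.of_dist_le_mul fun x y => ?_
    have h1 : clip x - clip y = (x - y) - (max (x 2) 0 - max (y 2) 0) • vertical := by
      simp only [hclip, sub_smul]; abel
    have h2 : |max (x 2) 0 - max (y 2) 0| ≤ ‖x - y‖ :=
      (abs_max_sub_max_le_abs _ _ _).trans (abs_coord_le (x - y) 2)
    rw [dist_eq_norm, dist_eq_norm, h1]
    refine (norm_sub_le _ _).trans ?_
    rw [norm_smul, norm_vertical, mul_one, Real.norm_eq_abs]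
    push_cast
    linarith
  set w : Space → Space := fun x => v (clip x) with hw
  have hw_lip : LipschitzWith (K * 2) w := by
    rw [← lipschitzOnWith_univ]
    exact hK.comp hclip_lip.lipschitzOnWith fun x _ => hclip_mem x
  choose ψ hψ0 hψ using fun x => exists_integralCurve hw_lip (L := K) (fun x => hb _ (hclip_mem x)) x
  have hmaps : ∀ τ, ∀ x ∈ closedHalfSpace, ψ x τ ∈ closedHalfSpace := by
    intro τ x hx
    -- A trajectory that got above the plane would have to meet it, and a trajectory that meets the
    -- plane stays in it for all times.
    by_contra hcon
    have hpos : 0 < ψ x τ 2 := not_le.1 hcon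
    have hcont : Continuous fun t => ψ x t 2 := by
      have : Continuous (ψ x) := continuous_iff_continuousAt.2 fun t => (hψ x t).continuousAt
      exact (EuclideanSpace.proj (𝕜 := ℝ) (2 : Fin 3)).continuous.comp this
    obtain ⟨t₀, ht₀⟩ := mem_range_of_exists_le_of_exists_ge hcont (c := 0)
      ⟨0, by rw [hψ0]; exact hx⟩ ⟨τ, hpos.le⟩
    have := flow_embed hv hK hb (S := univ) (w := w) (fun _ => mem_univ _)
      (hw_lip.lipschitzOnWith) (fun p => by rw [hw]; dsimp only; rw [hclip_of_mem _ (embed_mem p)])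
      (hψ x) (fun _ => mem_univ _) ht₀ τ
    linarith
  refine ⟨fun τ x => ψ x τ, fun τ x hx => hmaps τ x hx, fun x _ => hψ0 x, fun τ x hx => ?_⟩
  have := hψ x τ
  rw [hw] at this
  dsimp only at this
  rwa [hclip_of_mem _ (hmaps τ x hx)] at this

end eulerFields

/-! ### The differential of the perimeter -/

section FirstOrder

variable {V : Plane → Plane} {Ψ : ℝ → Plane → Plane} {K L : NNReal} {F : Set Plane}

/-- The second time derivative of the flow is `W = DV · V`, which is Lipschitz on the ball swept out
by `F` in unit time. Integrating the difference of two trajectories twice gives `τ²`. The essential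
feature is the factor `‖p - q‖` in the error: it controls Lipschitz constants and hence lengths. -/
lemma exists_flow_expansion_of_nonneg (hV : ContDiff ℝ ∞ V) (hK : LipschitzWith K V)
    (hL : ∀ p, ‖V p‖ ≤ L) (h0 : ∀ p, Ψ 0 p = p)
    (hΨ : ∀ t p, HasDerivAt (fun s => Ψ s p) (V (Ψ t p)) t) (hF : IsCompact F) :
    ∃ C : ℝ, 0 ≤ C ∧ ∀ τ ∈ Icc (0 : ℝ) 1, ∀ p ∈ F, ∀ q ∈ F,
      ‖(Ψ τ p - Ψ τ q) - (p - q) - τ • (V p - V q)‖ ≤ C * τ ^ 2 * ‖p - q‖ := by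
  obtain ⟨R, hR⟩ := hF.isBounded.subset_closedBall (0 : Plane)
  set W : Plane → Plane := fun x => fderiv ℝ V x (V x) with hW
  have hWc : ContDiff ℝ 1 W :=
    ((hV.fderiv_right (m := 1) (by norm_cast)).clm_apply (hV.of_le (by norm_cast)))
  obtain ⟨M, hM⟩ := hWc.locallyLipschitz.locallyLipschitzOn.exists_lipschitzOnWith_of_compact
    (isCompact_closedBall (0 : Plane) (R + L))
  have hmem : ∀ τ ∈ Icc (0 : ℝ) 1, ∀ p ∈ F, Ψ τ p ∈ Metric.closedBall (0 : Plane) (R + L) := by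
    intro τ hτ p hp
    have h1 : ‖Ψ τ p - Ψ 0 p‖ ≤ L * ‖τ - 0‖ :=
      convex_univ.norm_image_sub_le_of_norm_hasDerivWithin_le
        (fun t _ => (hΨ t p).hasDerivWithinAt) (fun t _ => hL _) (mem_univ _) (mem_univ _)
    have h2 := hR hp
    rw [mem_closedBall_zero_iff] at h2 ⊢
    rw [h0, sub_zero, Real.norm_eq_abs, abs_of_nonneg hτ.1] at h1
    have h3 : (L : ℝ) * τ ≤ L := mul_le_of_le_one_right L.2 hτ.2
    have h4 := norm_sub_norm_le (Ψ τ p) p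
    linarith
  refine ⟨M * Real.exp K, by positivity, fun τ hτ p hp q hq => ?_⟩
  have hVΨ : ∀ t p, HasDerivAt (fun s => V (Ψ s p)) (W (Ψ t p)) t := fun t p =>
    ((hV.differentiable (by simp) _).hasFDerivAt).comp_hasDerivAt t (hΨ t p)
  have step1 : ∀ σ ∈ Icc (0 : ℝ) 1,
      ‖(V (Ψ σ p) - V (Ψ σ q)) - (V p - V q)‖ ≤ M * Real.exp K * ‖p - q‖ * σ := by
    intro σ hσ
    have := (convex_Icc (0 : ℝ) 1).norm_image_sub_le_of_norm_hasDerivWithin_le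
      (f := fun s => V (Ψ s p) - V (Ψ s q)) (C := M * Real.exp K * ‖p - q‖)
      (fun t _ => ((hVΨ t p).sub (hVΨ t q)).hasDerivWithinAt)
      (fun t ht => by
        have h1 := hM.dist_le_mul _ (hmem t ht p hp) _ (hmem t ht q hq)
        have h2 := dist_flow_le_of_nonneg hK (fun t => hΨ t p) (fun t => hΨ t q) ht.1
        rw [h0, h0, dist_eq_norm, dist_eq_norm] at h2
        rw [dist_eq_norm, dist_eq_norm] at h1
        have h3 : Real.exp (K * t) ≤ Real.exp K :=
          Real.exp_le_exp.2 (mul_le_of_le_one_right K.2 ht.2)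
        calc _ ≤ (M : ℝ) * ‖Ψ t p - Ψ t q‖ := h1
          _ ≤ M * (‖p - q‖ * Real.exp K) := by gcongr; exact h2.trans (by gcongr)
          _ = _ := by ring)
      (left_mem_Icc.2 zero_le_one) hσ
    simpa [h0, abs_of_nonneg hσ.1] using this
  have hder : ∀ t, HasDerivAt (fun s => (Ψ s p - Ψ s q) - (p - q) - s • (V p - V q))
      ((V (Ψ t p) - V (Ψ t q)) - (V p - V q)) t := fun t => by
    have := (((hΨ t p).sub (hΨ t q)).sub_const (p - q)).sub
      ((hasDerivAt_id t).smul_const (V p - V q))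
    exact this.congr_deriv (by simp)
  have := (convex_Icc (0 : ℝ) τ).norm_image_sub_le_of_norm_hasDerivWithin_le
    (C := M * Real.exp K * ‖p - q‖ * τ) (fun t _ => (hder t).hasDerivWithinAt)
    (fun t ht => (step1 t ⟨ht.1, ht.2.trans hτ.2⟩).trans (by gcongr; exact ht.2))
    (left_mem_Icc.2 hτ.1) (right_mem_Icc.2 hτ.1)
  simp only [h0, zero_smul, sub_zero, sub_self, Real.norm_eq_abs, abs_of_nonneg hτ.1] at this
  refine this.trans_eq (by ring)

lemma exists_flow_expansion (hV : ContDiff ℝ ∞ V) (hK : LipschitzWith K V)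
    (hL : ∀ p, ‖V p‖ ≤ L) (h0 : ∀ p, Ψ 0 p = p)
    (hΨ : ∀ t p, HasDerivAt (fun s => Ψ s p) (V (Ψ t p)) t) (hF : IsCompact F) :
    ∃ C : ℝ, 0 ≤ C ∧ ∀ τ : ℝ, |τ| ≤ 1 → ∀ p ∈ F, ∀ q ∈ F,
      ‖(Ψ τ p - Ψ τ q) - ((p + τ • V p) - (q + τ • V q))‖ ≤ C * τ ^ 2 * ‖p - q‖ := by
  obtain ⟨C₁, hC₁, h₁⟩ := exists_flow_expansion_of_nonneg hV hK hL h0 hΨ hF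
  obtain ⟨C₂, hC₂, h₂⟩ := exists_flow_expansion_of_nonneg (V := fun p => -V p)
    (Ψ := fun t => Ψ (-t)) hV.neg hK.neg (fun p => by simpa using hL p) (fun p => by simpa using h0 p)
    (fun t p => hasDerivAt_reverse (fun t => hΨ t p) t) hF
  refine ⟨max C₁ C₂, le_max_of_le_left hC₁, fun τ hτ p hp q hq => ?_⟩
  rw [abs_le] at hτ
  have hrw : (Ψ τ p - Ψ τ q) - ((p + τ • V p) - (q + τ • V q)) =
      (Ψ τ p - Ψ τ q) - (p - q) - τ • (V p - V q) := by
    rw [smul_sub]; abel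
  rw [hrw]
  rcases le_total 0 τ with h | h
  · exact (h₁ τ ⟨h, hτ.2⟩ p hp q hq).trans (by gcongr; exact le_max_left _ _)
  · have := h₂ (-τ) ⟨by linarith, by linarith⟩ p hp q hq
    have hrw' : (-τ) • (-V p - -V q) = τ • (V p - V q) := by
      simp only [smul_sub, smul_neg, neg_smul, neg_neg]
    rw [neg_neg, neg_sq, hrw'] at this
    exact this.trans (by gcongr; exact le_max_right _ _)

/-- The second inequality ensures that `a` and `b` are infinite together, so the value `0` of
`toReal` at `⊤` does no harm. -/
lemma toReal_le_mul_of_le {a b : ENNReal} {k k' : NNReal} (h : a ≤ k * b) (h' : b ≤ k' * a) :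
    a.toReal ≤ k * b.toReal := by
  by_cases hb : b = ⊤
  · have ha : a = ⊤ := by
      by_contra ha
      rw [hb, top_le_iff] at h'
      exact ENNReal.mul_ne_top ENNReal.coe_ne_top ha h'
    simp [ha, hb]
  · have := ENNReal.toReal_mono (ENNReal.mul_ne_top ENNReal.coe_ne_top hb) h
    simpa using this

/-- The length of the image of a set under a flow agrees to first order with the length of its
image under `id + τ V`. -/
lemma hasDerivAt_hausdorffMeasure_flow (hV : ContDiff ℝ ∞ V) (hK : LipschitzWith K V)
    (hL : ∀ p, ‖V p‖ ≤ L) (h0 : ∀ p, Ψ 0 p = p)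
    (hΨ : ∀ t p, HasDerivAt (fun s => Ψ s p) (V (Ψ t p)) t) (hF : IsCompact F) {ℓ : ℝ}
    (hG : HasDerivAt
      (fun τ : ℝ => (Measure.hausdorffMeasure 1 ((fun p => p + τ • V p) '' F)).toReal) ℓ 0) :
    HasDerivAt (fun τ => (Measure.hausdorffMeasure 1 (Ψ τ '' F)).toReal) ℓ 0 := by
  obtain ⟨C, hC, hexp⟩ := exists_flow_expansion hV hK hL h0 hΨ hF
  set g : ℝ → ℝ := fun τ => (Measure.hausdorffMeasure 1 ((fun p => p + τ • V p) '' F)).toReal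
  set h : ℝ → ℝ := fun τ => (Measure.hausdorffMeasure 1 (Ψ τ '' F)).toReal
  have hg0 : ∀ τ, 0 ≤ g τ := fun τ => ENNReal.toReal_nonneg
  -- For `K |τ| ≤ 1 / 2` the map `id + τ V` shrinks distances at most by the factor `2`. The error
  -- `C τ² ‖p - q‖` thus becomes a relative one, and each image is a Lipschitz image of the other
  -- with constant `1 + O(τ²)`.
  have hcomp : ∀ τ : ℝ, |τ| ≤ 1 → K * |τ| ≤ 1 / 2 → 4 * C * τ ^ 2 ≤ 1 →
      h τ ≤ (1 + 2 * C * τ ^ 2) * g τ ∧ g τ ≤ (1 + 4 * C * τ ^ 2) * h τ := by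
    intro τ h1 h2 h3
    have hGlow : ∀ p q, ‖p - q‖ ≤ 2 * ‖(p + τ • V p) - (q + τ • V q)‖ := by
      intro p q
      have e1 : ‖τ • (V p - V q)‖ ≤ 1 / 2 * ‖p - q‖ := by
        have := hK.dist_le_mul p q
        rw [dist_eq_norm, dist_eq_norm] at this
        rw [norm_smul, Real.norm_eq_abs]
        calc |τ| * ‖V p - V q‖ ≤ |τ| * (K * ‖p - q‖) := by gcongr
          _ = K * |τ| * ‖p - q‖ := by ring
          _ ≤ _ := by gcongr
      have e2 := norm_sub_le ((p + τ • V p) - (q + τ • V q)) (τ • (V p - V q))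
      have e3 : (p + τ • V p) - (q + τ • V q) - τ • (V p - V q) = p - q := by
        rw [smul_sub]; abel
      rw [e3] at e2
      linarith
    have hkey1 : ∀ p ∈ F, ∀ q ∈ F, dist (Ψ τ p) (Ψ τ q) ≤
        (⟨1 + 2 * C * τ ^ 2, by positivity⟩ : NNReal) * dist (p + τ • V p) (q + τ • V q) := by
      intro p hp q hq
      have e1 := hexp τ h1 p hp q hq
      have e2 := norm_sub_norm_le (Ψ τ p - Ψ τ q) ((p + τ • V p) - (q + τ • V q))
      have e3 := hGlow p q
      have e4 : C * τ ^ 2 * ‖p - q‖ ≤ C * τ ^ 2 * (2 * ‖(p + τ • V p) - (q + τ • V q)‖) := by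
        gcongr
      rw [dist_eq_norm, dist_eq_norm]
      show _ ≤ (1 + 2 * C * τ ^ 2) * _
      linarith
    have hkey2 : ∀ p ∈ F, ∀ q ∈ F, dist (p + τ • V p) (q + τ • V q) ≤
        (⟨1 + 4 * C * τ ^ 2, by positivity⟩ : NNReal) * dist (Ψ τ p) (Ψ τ q) := by
      intro p hp q hq
      have e1 := hexp τ h1 p hp q hq
      have e2 := norm_sub_norm_le ((p + τ • V p) - (q + τ • V q)) (Ψ τ p - Ψ τ q)
      rw [norm_sub_rev] at e1
      have e3 := hGlow p q
      have e4 : C * τ ^ 2 * ‖p - q‖ ≤ C * τ ^ 2 * (2 * ‖(p + τ • V p) - (q + τ • V q)‖) := by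
        gcongr
      rw [dist_eq_norm, dist_eq_norm]
      show _ ≤ (1 + 4 * C * τ ^ 2) * _
      set x := ‖(p + τ • V p) - (q + τ • V q)‖
      set y := ‖Ψ τ p - Ψ τ q‖
      set c := C * τ ^ 2
      have hc : 0 ≤ c := by positivity
      have e5 : (1 - 2 * c) * x ≤ y := by linarith
      have e6 : 0 ≤ x := norm_nonneg _
      -- Here `(1 + 4c)(1 - 2c) = 1 + 2c (1 - 4c)`, which is at least `1` because `4c ≤ 1`.
      have e7 : x ≤ (1 + 4 * c) * ((1 - 2 * c) * x) := by
        have : 4 * c ≤ 1 := by linarith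
        nlinarith [mul_nonneg (mul_nonneg hc (by linarith : 0 ≤ 1 - 4 * c)) e6]
      calc x ≤ (1 + 4 * c) * ((1 - 2 * c) * x) := e7
        _ ≤ (1 + 4 * c) * y := by gcongr
        _ = _ := by ring
    exact ⟨toReal_le_mul_of_le (hausdorffMeasure_image_le_mul hkey1)
      (hausdorffMeasure_image_le_mul hkey2), toReal_le_mul_of_le
      (hausdorffMeasure_image_le_mul hkey2) (hausdorffMeasure_image_le_mul hkey1)⟩
  have hbig : (fun τ => h τ - g τ) =O[𝓝 0] fun τ => ‖τ - 0‖ ^ 2 := by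
    refine Asymptotics.IsBigO.of_bound (8 * C * (g 0 + 1)) ?_
    have ev1 : ∀ᶠ τ : ℝ in 𝓝 0, |τ| ≤ 1 := by
      have : Tendsto (fun τ : ℝ => |τ|) (𝓝 0) (𝓝 0) := by
        simpa using (continuous_abs (G := ℝ)).tendsto 0
      exact this.eventually (Iic_mem_nhds one_pos)
    have ev2 : ∀ᶠ τ : ℝ in 𝓝 0, K * |τ| ≤ 1 / 2 := by
      have : Tendsto (fun τ : ℝ => K * |τ|) (𝓝 0) (𝓝 0) := by
        have : Continuous fun τ : ℝ => K * |τ| := by fun_prop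
        simpa using this.tendsto 0
      exact this.eventually (Iic_mem_nhds (by norm_num))
    have ev3 : ∀ᶠ τ : ℝ in 𝓝 0, 4 * C * τ ^ 2 ≤ 1 := by
      have : Tendsto (fun τ : ℝ => 4 * C * τ ^ 2) (𝓝 0) (𝓝 0) := by
        have : Continuous fun τ : ℝ => 4 * C * τ ^ 2 := by fun_prop
        simpa using this.tendsto 0
      exact this.eventually (Iic_mem_nhds one_pos)
    have ev4 : ∀ᶠ τ in 𝓝 0, g τ ≤ g 0 + 1 :=
      hG.continuousAt.eventually (Iic_mem_nhds (by linarith))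
    filter_upwards [ev1, ev2, ev3, ev4] with τ h1 h2 h3 h4
    obtain ⟨a, b⟩ := hcomp τ h1 h2 h3
    rw [sub_zero, norm_pow, norm_norm, Real.norm_eq_abs, Real.norm_eq_abs, sq_abs, abs_le]
    have hc : 0 ≤ C * τ ^ 2 := by positivity
    have hgn := hg0 τ
    have hx : C * τ ^ 2 * g τ ≤ C * τ ^ 2 * (g 0 + 1) := by gcongr
    have hy : C * τ ^ 2 * h τ ≤ C * τ ^ 2 * (2 * g τ) := by
      gcongr
      nlinarith
    constructor <;> nlinarith
  have hzero : HasDerivAt (fun τ => h τ - g τ) 0 0 := by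
    have := (hbig.hasFDerivAt one_lt_two).hasDerivAt
    simpa using this
  have := hzero.add hG
  rw [zero_add] at this
  refine this.congr_of_eventuallyEq (Eventually.of_forall fun τ => ?_)
  simp

end FirstOrder

/-- The differential of the perimeter along the flow of a field in `𝒱`. -/
theorem hasDerivAt_perimeter {Ω : Set Plane} {m : ℕ} {γ : Fin m → ℝ → Plane}
    (hΩ : IsSmoothDomain Ω γ) {v : Space → Space} (hv : v ∈ eulerFields)
    {ψ : ℝ → Space → Space} (hψ : IsFlow v ψ) :
    HasDerivAt (fun τ => perimeter (trace (ψ τ) '' Ω))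
      (-∑ j, lineTension Ω γ (fun p => trace v p j) j) 0 := by
  obtain ⟨K, hK, hb, -⟩ := eulerFields.exists_bounds hv
  have hV := eulerFields.contDiff_trace hv
  have hKV : LipschitzWith K (trace v) := eulerFields.norm_trace_sub_le _ rfl hK
  have hbV : ∀ p, ‖trace v p‖ ≤ K := fun p =>
    (eulerFields.norm_trace_le p).trans (hb _ (embed_mem p))
  have h0 : ∀ p, trace (ψ 0) p = p := fun p => by
    rw [trace, hψ.init _ (embed_mem p), horizontal_embed]
  have hder := eulerFields.hasDerivAt_flow_trace hv hψ
  have hγ := hΩ.curves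
  have hper : ∀ τ, perimeter (trace (ψ τ) '' Ω) =
      (Measure.hausdorffMeasure 1 (trace (ψ τ) '' ⋃ i, range (γ i))).toReal := fun τ => by
    obtain ⟨e, he⟩ := exists_homeomorph_flow hKV (Ψ := fun τ => trace (ψ τ)) h0 hder τ
    rw [perimeter, ← hΩ.frontier_eq]
    rw [← he, e.image_frontier]
  simp_rw [hper]
  refine hasDerivAt_hausdorffMeasure_flow hV hKV hbV h0 hder hγ.isCompact_iUnion_range ?_
  rw [sum_lineTension_apply hγ hV.continuous]
  refine (hasDerivAt_length hγ hV).congr_of_eventuallyEq ?_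
  have ev : ∀ᶠ τ : ℝ in 𝓝 0, K * |τ| < 1 := by
    have : Tendsto (fun τ : ℝ => K * |τ|) (𝓝 0) (𝓝 0) := by
      have : Continuous fun τ : ℝ => K * |τ| := by fun_prop
      simpa using this.tendsto 0
    exact this.eventually (Iio_mem_nhds one_pos)
  filter_upwards [ev] with τ hτ
  -- For `K |τ| < 1` the perturbation of the identity is injective, so the displaced curves are
  -- still simple and disjoint, and the length formula applies.
  have hinj : Function.Injective fun p => p + τ • trace v p := by
    intro p q hpq
    by_contra hne
    have h1 : p - q = -(τ • (trace v p - trace v q)) := by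
      have : p + τ • trace v p = q + τ • trace v q := hpq
      rw [smul_sub, neg_sub, sub_eq_sub_iff_add_eq_add, this]
      abel
    have h2 := hKV.dist_le_mul p q
    rw [dist_eq_norm, dist_eq_norm] at h2
    have h3 : ‖p - q‖ ≤ K * |τ| * ‖p - q‖ := by
      conv_lhs => rw [h1]
      rw [norm_neg, norm_smul, Real.norm_eq_abs]
      calc |τ| * ‖trace v p - trace v q‖ ≤ |τ| * (K * ‖p - q‖) := by gcongr
        _ = _ := by ring
    have h4 : 0 < ‖p - q‖ := norm_pos_iff.2 (sub_ne_zero.2 hne)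
    nlinarith
  rw [image_iUnion]
  simp_rw [← range_comp]
  refine hausdorffMeasure_iUnion_range (c := fun i s => γ i s + τ • trace v (γ i s)) (fun i => ?_)
    (fun i s => ?_) fun i j s hs r hr hsr => ?_
  · have h1 : ContDiff ℝ ∞ fun s => γ i s + τ • trace v (γ i s) :=
      (hγ.smooth i).add ((hV.comp (hγ.smooth i)).const_smul τ)
    exact h1.of_le (by norm_cast)
  · simp only [hγ.periodic i s]
  · exact hγ.simple i j s hs r hr (hinj hsr)

/-! ### Integration over the half-space -/

/-- The point with horizontal part `q.1` and vertical coordinate `q.2`. -/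
def join (q : Plane × ℝ) : Space := embed q.1 + q.2 • vertical

@[simp] lemma join_apply_two (q : Plane × ℝ) : join q 2 = q.2 := by simp [join]

lemma contDiff_join {n : WithTop ℕ∞} : ContDiff ℝ n join :=
  (contDiff_embed.comp contDiff_fst).add (contDiff_snd.smul contDiff_const)

lemma continuous_join : Continuous join := contDiff_join (n := 0).continuous

/-- The identification of space with the product of the plane and the line. -/
def joinHomeomorph : Plane × ℝ ≃ₜ Space where
  toFun := join
  invFun x := (horizontal x, x 2)
  left_inv q := by
    refine Prod.ext ?_ (by simp)
    simp [join, horizontal_add, horizontal_smul]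
  right_inv x := embed_horizontal_add x
  continuous_toFun := continuous_join
  continuous_invFun := continuous_horizontal.prodMk
    (EuclideanSpace.proj (𝕜 := ℝ) (2 : Fin 3)).continuous

lemma measurePreserving_join : MeasurePreserving join volume volume := by
  have h1 : MeasurePreserving (Prod.map (@WithLp.ofLp 2 (Fin 2 → ℝ)) (id : ℝ → ℝ))
      ((volume : Measure Plane).prod volume) (volume.prod volume) :=
    (PiLp.volume_preserving_ofLp (Fin 2)).prod (MeasurePreserving.id volume)
  have h2 : MeasurePreserving (Prod.swap : (Fin 2 → ℝ) × ℝ → ℝ × (Fin 2 → ℝ))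
      (volume.prod volume) (volume.prod volume) := Measure.measurePreserving_swap
  have h3 := (volume_preserving_piFinSuccAbove (fun _ : Fin 3 => ℝ) 2).symm
  have h4 := PiLp.volume_preserving_toLp (Fin 3)
  have := h4.comp (h3.comp (h2.comp h1))
  have heq : (@WithLp.toLp 2 (Fin 3 → ℝ)) ∘
      ((MeasurableEquiv.piFinSuccAbove (fun _ : Fin 3 => ℝ) 2).symm ∘ (Prod.swap ∘
        Prod.map (@WithLp.ofLp 2 (Fin 2 → ℝ)) (id : ℝ → ℝ))) = join := by
    funext q
    ext i
    fin_cases i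
    · simp [join]; rfl
    · simp [join]; rfl
    · simp [join]
  rw [heq] at this
  exact this

lemma measurableEmbedding_join : MeasurableEmbedding join :=
  joinHomeomorph.measurableEmbedding

lemma integral_join (f : Space → ℝ) : ∫ q, f (join q) = ∫ x, f x :=
  measurePreserving_join.integral_comp measurableEmbedding_join f

lemma integrable_comp_join_iff {f : Space → ℝ} :
    Integrable (fun q => f (join q)) ↔ Integrable f :=
  measurePreserving_join.integrable_comp_emb measurableEmbedding_join

/-! ### Cutoff functions -/

section Cutoff

variable {E : Type*} [NormedAddCommGroup E] [InnerProductSpace ℝ E] [FiniteDimensional ℝ E]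

/-- Smooth cutoff functions with gradients bounded by `C / (1 + |x|)`. -/
lemma exists_cutoff : ∃ (χ : ℕ → E → ℝ) (C : ℝ), 0 ≤ C ∧ (∀ n, ContDiff ℝ ∞ (χ n)) ∧
    (∀ n, HasCompactSupport (χ n)) ∧ (∀ n x, χ n x ∈ Icc (0 : ℝ) 1) ∧
    (∀ n x, ‖fderiv ℝ (χ n) x‖ ≤ C * (1 + ‖x‖)⁻¹) ∧
    ∀ R : ℝ, ∀ᶠ n in atTop, ∀ x, ‖x‖ < R → χ n =ᶠ[𝓝 x] fun _ => 1 := by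
  let f : ContDiffBump (0 : E) := ⟨1, 2, one_pos, one_lt_two⟩
  have hfc : ContDiff ℝ ∞ f := f.contDiff
  have hfd : Continuous (fderiv ℝ f) := hfc.continuous_fderiv (by simp)
  obtain ⟨C, hC⟩ := (f.hasCompactSupport.fderiv (𝕜 := ℝ)).exists_bound_of_continuous hfd
  have hC0 : 0 ≤ C := (norm_nonneg _).trans (hC 0)
  have hpos : ∀ n : ℕ, (0 : ℝ) < n + 1 := fun n => by positivity
  have hderiv : ∀ (n : ℕ) x, fderiv ℝ (fun x => f ((n + 1 : ℝ)⁻¹ • x)) x =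
      (n + 1 : ℝ)⁻¹ • fderiv ℝ f ((n + 1 : ℝ)⁻¹ • x) := fun n x => by
    rw [fderiv_comp_smul]
  refine ⟨fun n x => f ((n + 1 : ℝ)⁻¹ • x), 3 * C, by positivity, fun n => ?_, fun n => ?_,
    fun n x => ⟨f.nonneg, f.le_one⟩, fun n x => ?_, fun R => ?_⟩
  · exact hfc.comp (contDiff_const_smul _)
  · exact f.hasCompactSupport.comp_smul (inv_ne_zero (hpos n).ne')
  · rw [hderiv]
    by_cases hx : (n + 1 : ℝ)⁻¹ • x ∈ tsupport f
    · rw [f.tsupport_eq, mem_closedBall_zero_iff, norm_smul, norm_inv, Real.norm_eq_abs,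
        abs_of_pos (hpos n), inv_mul_le_iff₀ (hpos n)] at hx
      have hx2 : ‖x‖ ≤ (n + 1) * 2 := hx
      rw [norm_smul, norm_inv, Real.norm_eq_abs, abs_of_pos (hpos n)]
      -- On the support `‖x‖ ≤ 2 (n + 1)`, hence `1 + ‖x‖ ≤ 3 (n + 1)`.
      have h1 : (n + 1 : ℝ)⁻¹ ≤ 3 * (1 + ‖x‖)⁻¹ := by
        rw [← div_eq_mul_inv, le_div_iff₀ (by positivity), inv_mul_le_iff₀ (hpos n)]
        linarith [n.cast_nonneg (α := ℝ)]
      calc (n + 1 : ℝ)⁻¹ * ‖fderiv ℝ f ((n + 1 : ℝ)⁻¹ • x)‖ ≤ 3 * (1 + ‖x‖)⁻¹ * C := by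
            gcongr
            exact hC _
        _ = _ := by ring
    · have : fderiv ℝ f ((n + 1 : ℝ)⁻¹ • x) = 0 := by
        by_contra h
        exact hx (support_fderiv_subset ℝ h)
      rw [this, smul_zero, norm_zero]
      positivity
  · obtain ⟨N, hN⟩ := exists_nat_gt R
    filter_upwards [eventually_ge_atTop N] with n hn x hx
    have hx' : ‖x‖ < n + 1 := by
      have : (N : ℝ) ≤ n := by exact_mod_cast hn
      linarith
    have hnear : ∀ᶠ y in 𝓝 x, ‖y‖ < n + 1 :=
      continuous_norm.continuousAt.eventually (Iio_mem_nhds hx')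
    filter_upwards [hnear] with y hy
    refine f.one_of_mem_closedBall ?_
    rw [mem_closedBall_zero_iff, norm_smul, norm_inv, Real.norm_eq_abs, abs_of_pos (hpos n),
      inv_mul_le_iff₀ (hpos n)]
    show ‖y‖ ≤ (n + 1) * 1
    linarith

end Cutoff

/-! ### Integration by parts -/

lemma continuous_mul_of_tsupport_subset {E : Type*} [TopologicalSpace E]
    {f g : E → ℝ} {U : Set E} (hU : IsOpen U)
    (hf : ContinuousOn f U) (hg : Continuous g) (hgU : tsupport g ⊆ U) :
    Continuous fun x => f x * g x := by
  rw [continuous_iff_continuousAt]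
  intro x
  by_cases hx : x ∈ U
  · exact (hf.continuousAt (hU.mem_nhds hx)).mul hg.continuousAt
  · have : (fun x => f x * g x) =ᶠ[𝓝 x] fun _ => 0 := by
      filter_upwards [(isClosed_tsupport g).isOpen_compl.mem_nhds fun h => hx (hgU h)] with y hy
      rw [image_eq_zero_of_notMem_tsupport hy, mul_zero]
    exact this.continuousAt

lemma tsupport_fderiv_apply_subset {E : Type*} [NormedAddCommGroup E]
    [NormedSpace ℝ E] (g : E → ℝ) (e : E) :
    tsupport (fun x => fderiv ℝ g x e) ⊆ tsupport g :=
  closure_minimal (fun x hx => support_fderiv_subset ℝ fun h => hx (by simp [h]))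
    (isClosed_tsupport g)

section IBP

variable {E : Type*} [NormedAddCommGroup E] [InnerProductSpace ℝ E] [FiniteDimensional ℝ E]
  [MeasurableSpace E] [BorelSpace E]

lemma integrable_mul_of_tsupport_subset {f g : E → ℝ} {U : Set E} (hU : IsOpen U)
    (hf : ContinuousOn f U) (hg : Continuous g) (hgc : HasCompactSupport g)
    (hgU : tsupport g ⊆ U) : Integrable fun x => f x * g x :=
  (continuous_mul_of_tsupport_subset hU hf hg hgU).integrable_of_hasCompactSupport hgc.mul_left

/-- Integration by parts against a test function supported in an open set. -/
lemma integral_mul_fderiv_eq_neg {f g : E → ℝ} {U : Set E} (hU : IsOpen U)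
    (hf : ContDiffOn ℝ 1 f U) (hg : ContDiff ℝ 1 g) (hgc : HasCompactSupport g)
    (hgU : tsupport g ⊆ U) (e : E) :
    ∫ x, f x * fderiv ℝ g x e = -∫ x, fderiv ℝ f x e * g x := by
  have hg' : Continuous fun x => fderiv ℝ g x e :=
    (hg.continuous_fderiv one_ne_zero).clm_apply continuous_const
  have hf' : ContinuousOn (fun x => fderiv ℝ f x e) U :=
    (hf.continuousOn_fderiv_of_isOpen hU le_rfl).clm_apply continuousOn_const
  refine integral_mul_fderiv_eq_neg_fderiv_mul_of_integrable
    (integrable_mul_of_tsupport_subset hU hf' hg.continuous hgc hgU)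
    (integrable_mul_of_tsupport_subset hU hf.continuousOn hg' (hgc.fderiv_apply (𝕜 := ℝ) e)
      ((tsupport_fderiv_apply_subset g e).trans hgU))
    (integrable_mul_of_tsupport_subset hU hf.continuousOn hg.continuous hgc hgU)
    (fun x hx => (hf.differentiableOn one_ne_zero).differentiableAt (hU.mem_nhds (hgU hx)))
    (fun x _ => hg.differentiable one_ne_zero x)

end IBP

/-! ### The divergence theorem in the half-space -/

/-- A cutoff in the vertical direction: `0` for `s ≤ 1` and `1` for `s ≥ 2`. -/
def step (s : ℝ) : ℝ := Real.smoothTransition (s - 1)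

lemma contDiff_step : ContDiff ℝ ∞ step :=
  Real.smoothTransition.contDiff.comp (contDiff_id.sub contDiff_const)

lemma step_of_le {s : ℝ} (hs : s ≤ 1) : step s = 0 :=
  Real.smoothTransition.zero_of_nonpos (by linarith)

lemma step_of_ge {s : ℝ} (hs : 2 ≤ s) : step s = 1 :=
  Real.smoothTransition.one_of_one_le (by linarith)

lemma step_mem (s : ℝ) : step s ∈ Icc (0 : ℝ) 1 :=
  ⟨Real.smoothTransition.nonneg _, Real.smoothTransition.le_one _⟩

lemma continuous_deriv_step : Continuous (deriv step) := contDiff_step.continuous_deriv (by simp)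

lemma deriv_step_of_notMem {s : ℝ} (hs : s ∉ Icc (1 : ℝ) 2) : deriv step s = 0 := by
  rw [mem_Icc, not_and_or, not_le, not_le] at hs
  rcases hs with h | h
  · have : step =ᶠ[𝓝 s] fun _ => 0 := by
      filter_upwards [Iio_mem_nhds h] with r hr using step_of_le (le_of_lt hr)
    rw [this.deriv_eq, deriv_const]
  · have : step =ᶠ[𝓝 s] fun _ => 1 := by
      filter_upwards [Ioi_mem_nhds h] with r hr using step_of_ge (le_of_lt hr)
    rw [this.deriv_eq, deriv_const]

lemma hasCompactSupport_deriv_step : HasCompactSupport (deriv step) :=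
  HasCompactSupport.intro isCompact_Icc fun _ hs => deriv_step_of_notMem hs

lemma integral_deriv_step : ∫ s, deriv step s = 1 := by
  have h1 : ∫ s, deriv step s = ∫ s in (0 : ℝ)..3, deriv step s := by
    rw [intervalIntegral.integral_of_le (by norm_num)]
    refine (setIntegral_eq_integral_of_forall_compl_eq_zero fun s hs => ?_).symm
    refine deriv_step_of_notMem fun h => hs ⟨by linarith [h.1], by linarith [h.2]⟩
  rw [h1, intervalIntegral.integral_deriv_eq_sub
    (fun s _ => contDiff_step.differentiable (by simp) s)
    (continuous_deriv_step.intervalIntegrable _ _), step_of_ge (by norm_num),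
    step_of_le (by norm_num), sub_zero]

lemma hasDerivAt_step_comp (n : ℝ) (x : Space) (e : Space) :
    fderiv ℝ (fun x : Space => step (-(n * x 2))) x e = -(n * e 2) * deriv step (-(n * x 2)) := by
  have h1 : HasFDerivAt (fun x : Space => -(n * x 2))
      (-(n • EuclideanSpace.proj (𝕜 := ℝ) (2 : Fin 3))) x :=
    ((EuclideanSpace.proj (𝕜 := ℝ) (2 : Fin 3)).hasFDerivAt.const_mul n).neg
  have h2 := (contDiff_step.differentiable (by simp) (-(n * x 2))).hasDerivAt.comp_hasFDerivAt x h1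
  have h3 : HasFDerivAt (fun x : Space => step (-(n * x 2))) _ x := h2
  rw [h3.fderiv]
  simp
  ring

/-- The divergence theorem in the half-space for fields which may be singular at the boundary. -/
theorem integral_divergence_halfSpace {X : Fin 3 → Space → ℝ}
    (hX : ∀ i, ContDiffOn ℝ 1 (X i) halfSpace)
    (hdiv : IntegrableOn (fun x => ∑ i, fderiv ℝ (X i) x (EuclideanSpace.single i 1)) halfSpace)
    (hdec : ∀ i, IntegrableOn (fun x => X i x * (1 + ‖x‖)⁻¹) halfSpace)
    {Y D : Plane → ℝ} (hD : Integrable D)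
    (hXD : ∀ᵐ p, ∀ s ∈ Ioc (0 : ℝ) 2, |X 2 (join (p, -s))| ≤ D p)
    (hY : ∀ᵐ p, Tendsto (fun s : ℝ => X 2 (join (p, -s))) (𝓝[>] 0) (𝓝 (Y p))) :
    ∫ x in halfSpace, ∑ i, fderiv ℝ (X i) x (EuclideanSpace.single i 1) = ∫ p, Y p := by
  obtain ⟨χ, C, hC, hχs, hχc, hχ01, hχd, hχ1⟩ := exists_cutoff (E := Space)
  set e : Fin 3 → Space := fun i => EuclideanSpace.single i 1 with he
  set d : Space → ℝ := fun x => ∑ i, fderiv ℝ (X i) x (e i) with hd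
  set N : ℕ → ℝ := fun n => n + 1 with hN
  have hNpos : ∀ n, 0 < N n := fun n => by simp only [hN]; positivity
  -- `θ n` vanishes down to depth `1 / N n` and equals one below depth `2 / N n`. It keeps the
  -- integration by parts away from the boundary, where `X` need not be differentiable; its
  -- derivative produces the boundary term `G`.
  set θ : ℕ → Space → ℝ := fun n x => step (-(N n * x 2)) with hθ
  have hθs : ∀ n, ContDiff ℝ ∞ (θ n) := fun n =>
    contDiff_step.comp ((contDiff_const.mul
      (EuclideanSpace.proj (𝕜 := ℝ) (2 : Fin 3)).contDiff).neg)
  set ρ : ℕ → Space → ℝ := fun n x => θ n x * χ n x with hρ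
  have hρs : ∀ n, ContDiff ℝ ∞ (ρ n) := fun n => (hθs n).mul (hχs n)
  have hρc : ∀ n, HasCompactSupport (ρ n) := fun n => (hχc n).mul_left
  have hθU : ∀ n, tsupport (θ n) ⊆ halfSpace := fun n => by
    have hcl : IsClosed {x : Space | N n * x 2 ≤ -1} :=
      isClosed_le (continuous_const.mul (EuclideanSpace.proj (𝕜 := ℝ) (2 : Fin 3)).continuous)
        continuous_const
    refine (closure_minimal (fun x hx => ?_) hcl).trans fun x hx => ?_
    · by_contra hcon
      have hcon' : ¬ (N n * x 2 ≤ -1) := hcon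
      exact hx (step_of_le (by linarith [not_le.1 hcon']))
    · have h1 : N n * x 2 ≤ -1 := hx
      by_contra hcon
      have h2 : 0 ≤ x 2 := not_lt.1 hcon
      nlinarith [hNpos n]
  have hρU : ∀ n, tsupport (ρ n) ⊆ halfSpace := fun n =>
    (tsupport_mul_subset_left).trans (hθU n)
  have hρ01 : ∀ n x, ρ n x ∈ Icc (0 : ℝ) 1 := fun n x =>
    ⟨mul_nonneg (step_mem _).1 (hχ01 n x).1,
      mul_le_one₀ (step_mem _).2 (hχ01 n x).1 (hχ01 n x).2⟩
  have hle : (1 : WithTop ℕ∞) ≤ ∞ := by norm_cast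
  have hdercont : ∀ i, ContinuousOn (fun x => fderiv ℝ (X i) x (e i)) halfSpace := fun i =>
    ((hX i).continuousOn_fderiv_of_isOpen isOpen_halfSpace le_rfl).clm_apply continuousOn_const
  -- the three terms of the integration by parts
  set A : ℕ → ℝ := fun n => ∫ x in halfSpace, d x * ρ n x with hA
  set B : ℕ → ℝ := fun n => ∫ x in halfSpace, ∑ i, X i x * (θ n x * fderiv ℝ (χ n) x (e i)) with hB
  set G : ℕ → ℝ := fun n => ∫ x, X 2 x * (N n * deriv step (-(N n * x 2)) * χ n x) with hG
  have hθ'c : ∀ n, Continuous fun x : Space => N n * deriv step (-(N n * x 2)) := fun n =>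
    continuous_const.mul (continuous_deriv_step.comp
      (continuous_const.mul (EuclideanSpace.proj (𝕜 := ℝ) (2 : Fin 3)).continuous).neg)
  have hθ'U : ∀ n, tsupport (fun x : Space => N n * deriv step (-(N n * x 2)) * χ n x) ⊆
      halfSpace := fun n => by
    have hcl : IsClosed {x : Space | N n * x 2 ≤ -1} :=
      isClosed_le (continuous_const.mul (EuclideanSpace.proj (𝕜 := ℝ) (2 : Fin 3)).continuous)
        continuous_const
    refine (closure_minimal (fun x hx => ?_) hcl).trans fun x hx => ?_
    · by_contra hcon
      have hcon' : ¬ (N n * x 2 ≤ -1) := hcon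
      refine hx ?_
      have h1 : deriv step (-(N n * x 2)) = 0 :=
        deriv_step_of_notMem fun h => by linarith [h.1, not_le.1 hcon']
      simp [h1]
    · have h1 : N n * x 2 ≤ -1 := hx
      by_contra hcon
      have h2 : 0 ≤ x 2 := not_lt.1 hcon
      nlinarith [hNpos n]
  have hGint : ∀ n, Integrable fun x => X 2 x * (N n * deriv step (-(N n * x 2)) * χ n x) :=
    fun n => integrable_mul_of_tsupport_subset isOpen_halfSpace (hX 2).continuousOn
      ((hθ'c n).mul (hχs n).continuous) (hχc n).mul_left (hθ'U n)
  have hIBP : ∀ n, A n = -B n + G n := by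
    intro n
    have h1 : ∀ i, ∫ x, X i x * fderiv ℝ (ρ n) x (e i) = -∫ x, fderiv ℝ (X i) x (e i) * ρ n x :=
      fun i => integral_mul_fderiv_eq_neg isOpen_halfSpace (hX i) ((hρs n).of_le hle) (hρc n)
        (hρU n) (e i)
    have hfd : ∀ i x, fderiv ℝ (ρ n) x (e i) = θ n x * fderiv ℝ (χ n) x (e i) -
        (e i 2) * (N n * deriv step (-(N n * x 2)) * χ n x) := fun i x => by
      have h2 := fderiv_fun_mul ((hθs n).differentiable (by simp) x)
        ((hχs n).differentiable (by simp) x)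
      have h3 := congrArg (fun L => L (e i)) h2
      simp only [add_apply, smul_apply, smul_eq_mul] at h3
      rw [hρ, h3, hθ]
      dsimp only
      rw [hasDerivAt_step_comp]
      ring
    have hi1 : ∀ i, Integrable fun x => fderiv ℝ (X i) x (e i) * ρ n x := fun i =>
      integrable_mul_of_tsupport_subset isOpen_halfSpace (hdercont i) (hρs n).continuous (hρc n)
        (hρU n)
    have hi2 : ∀ i, Integrable fun x => X i x * (θ n x * fderiv ℝ (χ n) x (e i)) := fun i => by
      have hc : Continuous fun x => fderiv ℝ (χ n) x (e i) :=
        ((hχs n).continuous_fderiv (by simp)).clm_apply continuous_const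
      exact integrable_mul_of_tsupport_subset isOpen_halfSpace (hX i).continuousOn
        ((hθs n).continuous.mul hc) ((hχc n).fderiv_apply (𝕜 := ℝ) (e i)).mul_left
        ((tsupport_mul_subset_left).trans (hθU n))
    have hAeq : A n = ∑ i, ∫ x, fderiv ℝ (X i) x (e i) * ρ n x := by
      rw [← integral_finsetSum _ fun i _ => hi1 i, hA]
      dsimp only
      rw [setIntegral_eq_integral_of_forall_compl_eq_zero]
      · simp_rw [hd, Finset.sum_mul]
      · intro x hx
        rw [image_eq_zero_of_notMem_tsupport fun h => hx (hρU n h), mul_zero]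
    have hBeq : B n = ∑ i, ∫ x, X i x * (θ n x * fderiv ℝ (χ n) x (e i)) := by
      rw [← integral_finsetSum _ fun i _ => hi2 i, hB]
      dsimp only
      rw [setIntegral_eq_integral_of_forall_compl_eq_zero]
      intro x hx
      have : θ n x = 0 := image_eq_zero_of_notMem_tsupport fun h => hx (hθU n h)
      simp [this]
    have hsplit : ∀ i, ∫ x, X i x * fderiv ℝ (ρ n) x (e i) =
        (∫ x, X i x * (θ n x * fderiv ℝ (χ n) x (e i))) -
          e i 2 * ∫ x, X i x * (N n * deriv step (-(N n * x 2)) * χ n x) := fun i => by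
      rw [← integral_const_mul, ← integral_sub (hi2 i)]
      · congr 1
        funext x
        rw [hfd]
        ring
      · refine Integrable.const_mul ?_ _
        exact integrable_mul_of_tsupport_subset isOpen_halfSpace (hX i).continuousOn
          ((hθ'c n).mul (hχs n).continuous) (hχc n).mul_left (hθ'U n)
    have hsum : ∑ i, ∫ x, X i x * fderiv ℝ (ρ n) x (e i) = B n - G n := by
      simp_rw [hsplit]
      rw [Finset.sum_sub_distrib, ← hBeq]
      congr 1
      simp [he, hG]
    have : ∑ i, ∫ x, X i x * fderiv ℝ (ρ n) x (e i) = -A n := by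
      rw [hAeq, ← Finset.sum_neg_distrib]
      exact Finset.sum_congr rfl fun i _ => h1 i
    linarith
  -- limits
  have hAlim : Tendsto A atTop (𝓝 (∫ x in halfSpace, d x)) := by
    refine tendsto_integral_of_dominated_convergence (fun x => ‖d x‖) (fun n => ?_) hdiv.norm
      (fun n => ?_) ?_
    · exact hdiv.aestronglyMeasurable.mul (hρs n).continuous.aestronglyMeasurable
    · refine Eventually.of_forall fun x => ?_
      rw [norm_mul]
      refine mul_le_of_le_one_right (norm_nonneg _) ?_
      rw [Real.norm_eq_abs, abs_of_nonneg (hρ01 n x).1]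
      exact (hρ01 n x).2
    · refine (ae_restrict_iff' isOpen_halfSpace.measurableSet).2 (Eventually.of_forall fun x hx => ?_)
      have hx2 : x 2 < 0 := hx
      refine tendsto_const_nhds.congr' ?_
      obtain ⟨M, hM⟩ := exists_nat_gt (2 / -(x 2))
      filter_upwards [hχ1 (‖x‖ + 1), eventually_ge_atTop M] with n hn hnM
      have h1 : χ n x = 1 := (hn x (by linarith)).eq_of_nhds
      have h2 : θ n x = 1 := by
        refine step_of_ge ?_
        have : (M : ℝ) ≤ n := by exact_mod_cast hnM
        rw [div_lt_iff₀ (by linarith)] at hM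
        simp only [hN]
        nlinarith
      simp [hρ, h1, h2]
  -- The gradient of `χ n` is at most `C / (1 + ‖x‖)` uniformly in `n` and eventually vanishes near
  -- each point; the hypothesis `hdec` is exactly the required domination.
  have hBlim : Tendsto B atTop (𝓝 0) := by
    have : (0 : ℝ) = ∫ x in halfSpace, (0 : ℝ) := by simp
    rw [this]
    refine tendsto_integral_of_dominated_convergence
      (fun x => ∑ i, C * ‖X i x * (1 + ‖x‖)⁻¹‖) (fun n => ?_)
      (integrable_finsetSum _ fun i _ => (hdec i).norm.const_mul C) (fun n => ?_) ?_
    · refine Finset.aestronglyMeasurable_fun_sum _ fun i _ => ?_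
      have hc : Continuous fun x => fderiv ℝ (χ n) x (e i) :=
        ((hχs n).continuous_fderiv (by simp)).clm_apply continuous_const
      exact ((hX i).continuousOn.aestronglyMeasurable isOpen_halfSpace.measurableSet).mul
        ((hθs n).continuous.mul hc).aestronglyMeasurable
    · refine Eventually.of_forall fun x => (norm_sum_le _ _).trans (Finset.sum_le_sum fun i _ => ?_)
      have h1 : ‖fderiv ℝ (χ n) x (e i)‖ ≤ C * (1 + ‖x‖)⁻¹ := by
        refine ((fderiv ℝ (χ n) x).le_opNorm _).trans ?_
        simpa [he] using hχd n x
      have h2 : ‖θ n x‖ ≤ 1 := by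
        rw [Real.norm_eq_abs, abs_of_nonneg (step_mem _).1]; exact (step_mem _).2
      have h3 : ‖(1 + ‖x‖)⁻¹‖ = (1 + ‖x‖)⁻¹ := by
        rw [norm_inv, Real.norm_eq_abs, abs_of_pos (by positivity)]
      rw [norm_mul, norm_mul, norm_mul, h3]
      calc ‖X i x‖ * (‖θ n x‖ * ‖fderiv ℝ (χ n) x (e i)‖)
          ≤ ‖X i x‖ * (1 * (C * (1 + ‖x‖)⁻¹)) := by gcongr
        _ = _ := by ring
    · refine Eventually.of_forall fun x => ?_
      refine tendsto_const_nhds.congr' ?_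
      filter_upwards [hχ1 (‖x‖ + 1)] with n hn
      have h1 : fderiv ℝ (χ n) x = 0 := by
        rw [(hn x (by linarith)).fderiv_eq, fderiv_fun_const]; rfl
      simp [h1]
  -- After rescaling depth by `N n`, the boundary term becomes an average of `X 2` over depths `s /
  -- N n`, with `s` in `[1, 2]`, against `deriv step`, whose integral is one. It therefore tends to
  -- the boundary value `Y`.
  set H : ℕ → Plane → ℝ → ℝ := fun n p s =>
    X 2 (join (p, -((N n)⁻¹ * s))) * (deriv step s * χ n (join (p, -((N n)⁻¹ * s)))) with hH
  have hGeq : ∀ n, G n = ∫ p, ∫ s, H n p s := by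
    intro n
    have h1 : G n = ∫ p : Plane, ∫ z : ℝ, X 2 (join (p, z)) *
        (N n * deriv step (-(N n * z)) * χ n (join (p, z))) := by
      rw [hG]
      dsimp only
      rw [← integral_join]
      have := integral_prod _ (integrable_comp_join_iff.2 (hGint n))
      simp only [join_apply_two] at this
      simp only [join_apply_two]; exact this
    rw [h1]
    congr 1
    funext p
    have h2 := Measure.integral_comp_mul_left (fun z : ℝ => X 2 (join (p, z)) *
        (N n * deriv step (-(N n * z)) * χ n (join (p, z)))) (-(N n)⁻¹)
    have h3 : |(-(N n)⁻¹)⁻¹| = N n := by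
      rw [inv_neg, inv_inv, abs_neg, abs_of_pos (hNpos n)]
    rw [h3, smul_eq_mul] at h2
    have h4 : ∀ s : ℝ, -(N n * (-(N n)⁻¹ * s)) = s := fun s => by
      have := (hNpos n).ne'
      field_simp
    simp only [h4] at h2
    have h5 : ∀ s, X 2 (join (p, -(N n)⁻¹ * s)) *
        (N n * deriv step s * χ n (join (p, -(N n)⁻¹ * s))) = N n * H n p s := fun s => by
      simp only [hH, neg_mul]; ring
    simp only [h5] at h2
    rw [integral_const_mul] at h2
    exact (mul_left_cancel₀ (hNpos n).ne' h2).symm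
  obtain ⟨S, hS⟩ := hasCompactSupport_deriv_step.exists_bound_of_continuous continuous_deriv_step
  have hmemB : ∀ n p, ∀ s ∈ Icc (1 : ℝ) 2, join (p, -((N n)⁻¹ * s)) ∈ halfSpace := fun n p s hs => by
    show join (p, -((N n)⁻¹ * s)) 2 < 0
    rw [join_apply_two, neg_lt_zero]
    have := hNpos n
    have := hs.1
    positivity
  have hscale : ∀ n, ∀ s ∈ Icc (1 : ℝ) 2, (N n)⁻¹ * s ∈ Ioc (0 : ℝ) 2 := fun n s hs => by
    have h1 := hNpos n
    have h2 : (N n)⁻¹ ≤ 1 := inv_le_one_of_one_le₀ (by simp [hN])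
    have h3 : 0 < (N n)⁻¹ := inv_pos.2 h1
    exact ⟨mul_pos h3 (by linarith [hs.1]), by nlinarith [hs.1, hs.2]⟩
  have hHcont : ∀ n p, Continuous fun s => H n p s := by
    intro n p
    have hj : Continuous fun s : ℝ => join (p, -((N n)⁻¹ * s)) :=
      continuous_join.comp (by fun_prop)
    have hopen : IsOpen ((fun s : ℝ => join (p, -((N n)⁻¹ * s))) ⁻¹' halfSpace) :=
      isOpen_halfSpace.preimage hj
    have h1 : ContinuousOn (fun s : ℝ => X 2 (join (p, -((N n)⁻¹ * s))))
        ((fun s : ℝ => join (p, -((N n)⁻¹ * s))) ⁻¹' halfSpace) :=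
      (hX 2).continuousOn.comp hj.continuousOn fun s hs => hs
    refine continuous_mul_of_tsupport_subset hopen h1
      (continuous_deriv_step.mul ((hχs n).continuous.comp hj)) ?_
    refine (closure_minimal (fun s hs => ?_) isClosed_Icc).trans (hmemB n p)
    by_contra hcon
    exact hs (by simp [deriv_step_of_notMem hcon])
  have hHbound : ∀ p, (∀ s ∈ Ioc (0 : ℝ) 2, |X 2 (join (p, -s))| ≤ D p) →
      ∀ n s, ‖H n p s‖ ≤ D p * ‖deriv step s‖ := by
    intro p hp n s
    by_cases hs : s ∈ Icc (1 : ℝ) 2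
    · have h1 := hp _ (hscale n s hs)
      have h2 : ‖χ n (join (p, -((N n)⁻¹ * s)))‖ ≤ 1 := by
        rw [Real.norm_eq_abs, abs_of_nonneg (hχ01 _ _).1]; exact (hχ01 _ _).2
      rw [hH]
      dsimp only
      rw [norm_mul, norm_mul]
      have hDp : 0 ≤ D p := (abs_nonneg _).trans h1
      calc _ ≤ D p * (‖deriv step s‖ * 1) := by gcongr; exact h1
        _ = _ := by rw [mul_one]
    · simp [hH, deriv_step_of_notMem hs]
  have hint_step : Integrable fun s => ‖deriv step s‖ :=
    (continuous_deriv_step.integrable_of_hasCompactSupport hasCompactSupport_deriv_step).norm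
  have hinner : ∀ᵐ p, Tendsto (fun n => ∫ s, H n p s) atTop (𝓝 (Y p)) := by
    filter_upwards [hXD, hY] with p hp1 hp2
    have : Y p = ∫ s, Y p * deriv step s := by rw [integral_const_mul, integral_deriv_step, mul_one]
    rw [this]
    refine tendsto_integral_of_dominated_convergence (fun s => D p * ‖deriv step s‖)
      (fun n => (hHcont n p).aestronglyMeasurable) (hint_step.const_mul _)
      (fun n => Eventually.of_forall fun s => hHbound p hp1 n s)
      (Eventually.of_forall fun s => ?_)
    by_cases hs : s ∈ Icc (1 : ℝ) 2
    · have hzero : Tendsto (fun n => (N n)⁻¹ * s) atTop (𝓝[>] 0) := by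
        refine tendsto_nhdsWithin_iff.2 ⟨?_, Eventually.of_forall fun n => (hscale n s hs).1⟩
        have : Tendsto (fun n : ℕ => (N n)⁻¹) atTop (𝓝 0) := by
          simpa [hN, one_div] using tendsto_one_div_add_atTop_nhds_zero_nat (𝕜 := ℝ)
        simpa using this.mul_const s
      have h1 := hp2.comp hzero
      have h2 : Tendsto (fun n => χ n (join (p, -((N n)⁻¹ * s)))) atTop (𝓝 1) := by
        refine tendsto_const_nhds.congr' ?_
        filter_upwards [hχ1 (‖p‖ + 3)] with n hn
        refine ((hn _ ?_).eq_of_nhds).symm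
        have h3 : ‖join (p, -((N n)⁻¹ * s))‖ ≤ ‖p‖ + 2 := by
          refine (norm_add_le _ _).trans ?_
          rw [norm_embed, norm_smul, norm_vertical, mul_one, Real.norm_eq_abs, abs_neg,
            abs_of_pos (hscale n s hs).1]
          linarith [(hscale n s hs).2]
        linarith
      have := h1.mul (h2.const_mul (deriv step s))
      rw [mul_one] at this
      exact this
    · simp [hH, deriv_step_of_notMem hs]
  have hGlim : Tendsto G atTop (𝓝 (∫ p, Y p)) := by
    simp_rw [funext hGeq]
    refine tendsto_integral_of_dominated_convergence (fun p => D p * ∫ s, ‖deriv step s‖)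
      (fun n => ?_) (hD.mul_const _) (fun n => ?_) hinner
    · have hmeas : Continuous fun q : Plane × ℝ => H n q.1 q.2 := by
        have hj : Continuous fun q : Plane × ℝ => join (q.1, -((N n)⁻¹ * q.2)) :=
          continuous_join.comp (by fun_prop)
        have hopen : IsOpen ((fun q : Plane × ℝ => join (q.1, -((N n)⁻¹ * q.2))) ⁻¹' halfSpace) :=
          isOpen_halfSpace.preimage hj
        have h1 : ContinuousOn (fun q : Plane × ℝ => X 2 (join (q.1, -((N n)⁻¹ * q.2))))
            ((fun q : Plane × ℝ => join (q.1, -((N n)⁻¹ * q.2))) ⁻¹' halfSpace) :=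
          (hX 2).continuousOn.comp hj.continuousOn fun s hs => hs
        refine continuous_mul_of_tsupport_subset hopen h1
          ((continuous_deriv_step.comp continuous_snd).mul ((hχs n).continuous.comp hj)) ?_
        refine (closure_minimal (t := Prod.snd ⁻¹' Icc (1 : ℝ) 2) (fun q hq => ?_)
          (isClosed_Icc.preimage continuous_snd)).trans fun q hq => hmemB n q.1 q.2 hq
        by_contra hcon
        exact hq (by simp [deriv_step_of_notMem hcon])
      exact (hmeas.stronglyMeasurable.integral_prod_right' (ν := volume)).aestronglyMeasurable
    · filter_upwards [hXD] with p hp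
      refine (norm_integral_le_of_norm_le (hint_step.const_mul (D p))
        (Eventually.of_forall fun s => hHbound p hp n s)).trans_eq ?_
      rw [integral_const_mul]
  have h1 : Tendsto A atTop (𝓝 (∫ p, Y p)) := by
    have := hBlim.neg.add hGlim
    rw [neg_zero, zero_add] at this
    exact this.congr fun n => (hIBP n).symm
  exact tendsto_nhds_unique hAlim h1

/-! ### Singular weights -/

/-- The logarithm is traded for an inverse square root. This is still integrable across a plane in
space and across a curve in the plane, and it can be handled by powers alone. -/
lemma one_add_log_le {d : ℝ} (hd : 0 ≤ d) : 1 + Real.log (1 + d⁻¹) ≤ 2 * (1 + (√d)⁻¹) := by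
  have h0 : 0 ≤ (√d)⁻¹ := by positivity
  have h1 : 1 + d⁻¹ ≤ (1 + (√d)⁻¹) ^ 2 := by
    have : d⁻¹ = (√d)⁻¹ ^ 2 := by rw [inv_pow, Real.sq_sqrt hd]
    nlinarith
  have h2 : Real.log (1 + d⁻¹) ≤ 2 * (√d)⁻¹ := by
    calc Real.log (1 + d⁻¹) ≤ Real.log ((1 + (√d)⁻¹) ^ 2) :=
          Real.log_le_log (by positivity) h1
      _ = 2 * Real.log (1 + (√d)⁻¹) := by rw [Real.log_pow]; norm_num
      _ ≤ 2 * (√d)⁻¹ := by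
          have := Real.log_le_sub_one_of_pos (x := 1 + (√d)⁻¹) (by positivity)
          linarith
  linarith

/-- Depth bounds the distance to the interface from below, so inside the half-space all singular
bounds can be expressed through `|x 2|`, whatever the interface is. -/
lemma abs_le_interfaceDist {Γ : Set Plane} (hΓ : Γ.Nonempty) (x : Space) :
    |x 2| ≤ interfaceDist Γ x := by
  refine (Metric.le_infDist (hΓ.image _)).2 ?_
  rintro _ ⟨q, -, rfl⟩
  rw [dist_eq_norm]
  simpa using abs_coord_le (x - embed q) 2

lemma inv_interfaceDist_le (Γ : Set Plane) {x : Space} (hx : x 2 ≠ 0) :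
    (interfaceDist Γ x)⁻¹ ≤ |x 2|⁻¹ := by
  rcases Γ.eq_empty_or_nonempty with rfl | hΓ
  · rw [interfaceDist_empty]; simp
  · exact inv_anti₀ (abs_pos.2 hx) (abs_le_interfaceDist hΓ x)

lemma infDist_le_interfaceDist (Γ : Set Plane) (x : Space) :
    Metric.infDist (horizontal x) Γ ≤ interfaceDist Γ x := by
  rcases Γ.eq_empty_or_nonempty with rfl | hΓ
  · rw [interfaceDist_empty]; simp
  · refine (Metric.le_infDist (hΓ.image _)).2 ?_
    rintro _ ⟨q, hq, rfl⟩
    refine (Metric.infDist_le_dist_of_mem hq).trans ?_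
    rw [dist_eq_norm, dist_eq_norm]
    simpa [horizontal_sub, horizontal_embed] using norm_horizontal_le (x - embed q)

lemma inv_sqrt_le_inv_sqrt {a b : ℝ} (h : b⁻¹ ≤ a⁻¹) : (√b)⁻¹ ≤ (√a)⁻¹ := by
  rw [← Real.sqrt_inv, ← Real.sqrt_inv]
  exact Real.sqrt_le_sqrt h

lemma integrableOn_ball_norm_rpow {E : Type*} [NormedAddCommGroup E] [InnerProductSpace ℝ E]
    [FiniteDimensional ℝ E] [Nontrivial E] [MeasurableSpace E] [BorelSpace E] {r : ℝ}
    (hr : -(Module.finrank ℝ E : ℝ) < r) (R : ℝ) :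
    IntegrableOn (fun q : E => ‖q‖ ^ r) (Metric.ball 0 R) := by
  rw [integrableOn_fun_norm_addHaar volume (f := fun y : ℝ => y ^ r)]
  have hpos : 0 < Module.finrank ℝ E := Module.finrank_pos
  have h1 : IntegrableOn (fun y : ℝ => y ^ (r + (Module.finrank ℝ E - 1 : ℕ))) (Ioo 0 R) := by
    rcases le_or_gt R 0 with hR | hR
    · simp [Ioo_eq_empty (not_lt.2 hR)]
    · rw [intervalIntegral.integrableOn_Ioo_rpow_iff hR]
      rw [Nat.cast_sub hpos]
      push_cast
      linarith
  refine h1.congr_fun (fun y hy => ?_) measurableSet_Ioo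
  simp only [smul_eq_mul]
  rw [Real.rpow_add hy.1, Real.rpow_natCast, mul_comm]

/-- The weight on the line. -/
lemma integrable_line_weight :
    Integrable fun z : ℝ => (1 + |z|) ^ (-(3 / 2) : ℝ) * (1 + (√|z|)⁻¹) := by
  have h1 : Integrable fun z : ℝ => (1 + ‖z‖) ^ (-(3 / 2) : ℝ) :=
    integrable_one_add_norm (by norm_num)
  have h2 : Integrable ((Metric.ball (0 : ℝ) 1).indicator fun z : ℝ => ‖z‖ ^ (-(1 / 2) : ℝ)) :=
    (integrable_indicator_iff measurableSet_ball).2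
      (integrableOn_ball_norm_rpow (by norm_num) 1)
  refine ((h1.const_mul 2).add h2).mono' (Measurable.aestronglyMeasurable (by fun_prop))
    (Eventually.of_forall fun z => ?_)
  have h0 : 0 ≤ (1 + |z|) ^ (-(3 / 2) : ℝ) := by positivity
  rw [Real.norm_eq_abs, abs_of_nonneg (by positivity), Pi.add_apply]
  rw [Real.norm_eq_abs]
  by_cases hz : |z| < 1
  · rw [indicator_of_mem (by simpa using hz), Real.norm_eq_abs, Real.rpow_neg (abs_nonneg z),
      ← Real.sqrt_eq_rpow]
    have h3 : (1 + |z|) ^ (-(3 / 2) : ℝ) ≤ 1 :=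
      Real.rpow_le_one_of_one_le_of_nonpos (by linarith [abs_nonneg z]) (by norm_num)
    have h4 : 0 ≤ (√|z|)⁻¹ := by positivity
    nlinarith
  · rw [indicator_of_notMem (by simpa using hz), add_zero]
    have h4 : (√|z|)⁻¹ ≤ 1 := inv_le_one_of_one_le₀ (Real.one_le_sqrt.2 (not_lt.1 hz))
    nlinarith

lemma inv_pow_eq_rpow {y : ℝ} (n : ℕ) (hy : 0 ≤ y) : y⁻¹ ^ n = y ^ (-(n : ℝ)) := by
  rw [Real.rpow_neg hy, Real.rpow_natCast, inv_pow]

/-- The weight in space. -/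
lemma integrable_space_weight :
    Integrable fun x : Space => (1 + ‖x‖)⁻¹ ^ 4 * (1 + (√|x 2|)⁻¹) := by
  rw [← integrable_comp_join_iff]
  have h1 : Integrable fun p : Plane => (1 + ‖p‖) ^ (-(5 / 2) : ℝ) :=
    integrable_one_add_norm (by simp; norm_num)
  refine (h1.mul_prod integrable_line_weight).mono' ?_ (Eventually.of_forall fun q => ?_)
  · have h3 : Measurable fun x : Space => (1 + ‖x‖)⁻¹ ^ 4 * (1 + (√|x 2|)⁻¹) := by
      fun_prop
    exact (h3.comp continuous_join.measurable).aestronglyMeasurable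
  · rw [Real.norm_eq_abs, abs_of_nonneg (by positivity), inv_pow_eq_rpow 4 (by positivity),
      join_apply_two, ← mul_assoc]
    refine mul_le_mul_of_nonneg_right ?_ (by positivity)
    have hz : |q.2| ≤ ‖join q‖ := by simpa using abs_coord_le (join q) 2
    have hp : ‖q.1‖ ≤ ‖join q‖ := by
      simpa [join, horizontal_add, horizontal_smul, horizontal_embed, horizontal_vertical]
        using norm_horizontal_le (join q)
    -- The decay of order four is shared out: `5 / 2 > 2` for the plane and `3 / 2 > 1` for the
    -- vertical line.
    have h4 : (-((4 : ℕ) : ℝ)) = -(5 / 2) + -(3 / 2) := by norm_num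
    rw [h4, Real.rpow_add (by positivity)]
    refine mul_le_mul ?_ ?_ (by positivity) (by positivity)
    · exact Real.rpow_le_rpow_of_nonpos (by positivity) (by linarith) (by norm_num)
    · exact Real.rpow_le_rpow_of_nonpos (by positivity) (by linarith) (by norm_num)

lemma exists_lipschitz_curve {c : ℝ → Plane} (hc : ContDiff ℝ ∞ c) (a b : ℝ) :
    ∃ L : ℝ, 0 ≤ L ∧ ∀ s ∈ Icc a b, ∀ r ∈ Icc a b, ‖c s - c r‖ ≤ L * |s - r| := by
  obtain ⟨L, hL⟩ := isCompact_Icc.exists_bound_of_continuousOn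
    (hc.continuous_deriv (by simp)).continuousOn (s := Icc a b)
  refine ⟨max L 0, le_max_right _ _, fun s hs r hr => ?_⟩
  exact (convex_Icc a b).norm_image_sub_le_of_norm_deriv_le
    (fun x _ => hc.differentiable (by simp) x) (fun x hx => (hL x hx).trans (le_max_left _ _)) hr hs

/-- The singularity at a curve of the inverse square root of the distance is integrable. -/
lemma exists_integrable_inv_sqrt_infDist {c : ℝ → Plane} (hc : ContDiff ℝ ∞ c)
    (hp : Function.Periodic c 1) :
    ∃ g : Plane → ℝ, Integrable g ∧ (∀ p, 0 ≤ g p) ∧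
      ∀ p, (√(Metric.infDist p (range c)))⁻¹ ≤ 1 + g p := by
  obtain ⟨L, hL0, hL⟩ := exists_lipschitz_curve hc 0 2
  -- The majorant is the integral of `‖p - c s‖ ^ (-3/2)` over the curve parameter. It is integrable
  -- in `p` because `3 / 2 < 2`. At distance `r` from the curve, a parameter interval of length `r`
  -- contributes about `r * r ^ (-3/2)`, the inverse square root of the distance. Truncation to a
  -- ball of radius `1 + L` is harmless, since only `r < 1` matters.
  set k : Plane → ℝ := (Metric.ball 0 (1 + L)).indicator fun q => ‖q‖ ^ (-(3 / 2) : ℝ) with hk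
  have hkint : Integrable k := (integrable_indicator_iff measurableSet_ball).2
    (integrableOn_ball_norm_rpow (by simp; norm_num) _)
  have hkm : Measurable k := Measurable.indicator (by fun_prop) measurableSet_ball
  have hk0 : ∀ q, 0 ≤ k q := fun q => indicator_nonneg (fun q _ => by positivity) q
  have hjoint : Integrable (fun q : Plane × ℝ => k (q.1 - c q.2))
      (volume.prod (volume.restrict (Icc 0 2))) := by
    refine (integrable_prod_iff' ?_).2 ⟨Eventually.of_forall fun s => ?_, ?_⟩
    · exact (hkm.comp (continuous_fst.sub (hc.continuous.comp continuous_snd)).measurable).aestronglyMeasurable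
    · exact hkint.comp_sub_right (c s)
    · have : ∀ s, ∫ p, ‖k (p - c s)‖ = ∫ p, ‖k p‖ := fun s =>
        integral_sub_right_eq_self (fun p => ‖k p‖) (c s)
      simp_rw [this]
      exact integrable_const _
  -- The parameter runs over `[0, 2]` rather than one period, so that `[s₀, s₀ + r]` fits for every
  -- `s₀ < 1` and `r < 1`.
  refine ⟨fun p => (1 + L) ^ (3 / 2 : ℝ) * ∫ s in Icc (0 : ℝ) 2, k (p - c s),
    hjoint.integral_prod_left.const_mul _, fun p => ?_, fun p => ?_⟩
  · exact mul_nonneg (by positivity) (integral_nonneg fun s => hk0 _)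
  have hg0 : 0 ≤ ∫ s in Icc (0 : ℝ) 2, k (p - c s) := integral_nonneg fun s => hk0 _
  set r := Metric.infDist p (range c) with hr
  have hr0 : 0 ≤ r := Metric.infDist_nonneg
  rcases hr0.eq_or_lt with h0 | h0
  · rw [← h0]; simp; positivity
  rcases le_or_gt 1 r with h1 | h1
  · have : (√r)⁻¹ ≤ 1 := inv_le_one_of_one_le₀ (Real.one_le_sqrt.2 h1)
    have : 0 ≤ (1 + L) ^ (3 / 2 : ℝ) * ∫ s in Icc (0 : ℝ) 2, k (p - c s) := by positivity
    linarith
  have hcomp : IsCompact (range c) := by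
    have : range c = c '' Icc 0 1 := by
      refine Subset.antisymm ?_ (image_subset_range _ _)
      rw [range_eq_image_Ico hp]
      exact image_mono Ico_subset_Icc_self
    rw [this]
    exact isCompact_Icc.image hc.continuous
  obtain ⟨y, hy, hpy⟩ := hcomp.exists_infDist_eq_dist (range_nonempty c) p
  rw [range_eq_image_Ico hp] at hy
  obtain ⟨s₀, hs₀, rfl⟩ := hy
  have hnorm : ∀ s ∈ Icc s₀ (s₀ + r), ‖p - c s‖ ≤ (1 + L) * r := fun s hs => by
    have h2 := hL s₀ ⟨hs₀.1, by linarith [hs₀.2]⟩ s ⟨by linarith [hs.1, hs₀.1], by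
      linarith [hs.2, hs₀.2]⟩
    have h3 : |s₀ - s| ≤ r := by rw [abs_le]; constructor <;> linarith [hs.1, hs.2]
    have h4 : ‖p - c s₀‖ = r := by rw [← dist_eq_norm, ← hpy]
    calc ‖p - c s‖ = ‖(p - c s₀) + (c s₀ - c s)‖ := by congr 1; abel
      _ ≤ r + L * r := (norm_add_le _ _).trans (by rw [h4]; gcongr; exact h2.trans (by gcongr))
      _ = (1 + L) * r := by ring
  have hnorm' : ∀ s, r ≤ ‖p - c s‖ := fun s => by
    rw [← dist_eq_norm]; exact Metric.infDist_le_dist_of_mem ⟨s, rfl⟩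
  have hkle : ∀ s, k (p - c s) ≤ r ^ (-(3 / 2) : ℝ) := fun s => by
    refine indicator_le_self' (fun _ _ => by positivity) _ |>.trans ?_
    exact Real.rpow_le_rpow_of_nonpos h0 (hnorm' s) (by norm_num)
  have hkint' : IntegrableOn (fun s => k (p - c s)) (Icc 0 2) := by
    refine Measure.integrableOn_of_bounded (M := r ^ (-(3 / 2) : ℝ)) (by simp)
      (hkm.comp (continuous_const.sub hc.continuous).measurable).aestronglyMeasurable
      (Eventually.of_forall fun s => ?_)
    rw [Real.norm_eq_abs, abs_of_nonneg (hk0 _)]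
    exact hkle s
  have hsub : Icc s₀ (s₀ + r) ⊆ Icc (0 : ℝ) 2 :=
    Icc_subset_Icc hs₀.1 (by linarith [hs₀.2])
  have hlow : r * ((1 + L) * r) ^ (-(3 / 2) : ℝ) ≤ ∫ s in Icc (0 : ℝ) 2, k (p - c s) := by
    calc r * ((1 + L) * r) ^ (-(3 / 2) : ℝ)
        = ∫ s in Icc s₀ (s₀ + r), ((1 + L) * r) ^ (-(3 / 2) : ℝ) := by simp [h0.le]
      _ ≤ ∫ s in Icc s₀ (s₀ + r), k (p - c s) := by
          refine setIntegral_mono_on (by simp) (hkint'.mono_set hsub) measurableSet_Icc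
            fun s hs => ?_
          have h5 := hnorm s hs
          rw [hk, indicator_of_mem]
          · exact Real.rpow_le_rpow_of_nonpos (h0.trans_le (hnorm' s)) h5 (by norm_num)
          · rw [mem_ball_zero_iff]
            nlinarith
      _ ≤ _ := setIntegral_mono_set hkint' (Eventually.of_forall fun s => hk0 _)
          (LE.le.eventuallyLE hsub)
  have heq : (√r)⁻¹ = (1 + L) ^ (3 / 2 : ℝ) * (r * ((1 + L) * r) ^ (-(3 / 2) : ℝ)) := by
    rw [Real.mul_rpow (by positivity) hr0, Real.sqrt_eq_rpow, ← Real.rpow_neg hr0]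
    have h6 : (1 + L) ^ (3 / 2 : ℝ) * (1 + L) ^ (-(3 / 2) : ℝ) = 1 := by
      rw [← Real.rpow_add (by positivity)]; simp
    have h7 : r * r ^ (-(3 / 2) : ℝ) = r ^ (-(1 / 2) : ℝ) := by
      nth_rewrite 1 [← Real.rpow_one r]
      rw [← Real.rpow_add h0]; norm_num
    rw [← h7]
    linear_combination (-r * r ^ (-(3 / 2) : ℝ)) * h6
  rw [heq]
  have : (1 + L) ^ (3 / 2 : ℝ) * (r * ((1 + L) * r) ^ (-(3 / 2) : ℝ)) ≤
      (1 + L) ^ (3 / 2 : ℝ) * ∫ s in Icc (0 : ℝ) 2, k (p - c s) := by gcongr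
  linarith

/-- The weight on the plane. -/
lemma integrable_plane_weight_rpow {m : ℕ} {γ : Fin m → ℝ → Plane} (hγ : IsCurveSystem γ) {r : ℝ}
    (hr : 2 < r) : Integrable fun p : Plane =>
      (1 + ‖p‖) ^ (-r) * (1 + (√(Metric.infDist p (⋃ i, range (γ i))))⁻¹) := by
  choose g hg hg0 hgle using fun i =>
    exists_integrable_inv_sqrt_infDist (hγ.smooth i) (hγ.periodic i)
  have h1 : Integrable fun p : Plane => (1 + ‖p‖) ^ (-r) :=
    integrable_one_add_norm (by simpa using hr)
  have hm : Measurable fun p : Plane =>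
      (1 + ‖p‖) ^ (-r) * (1 + (√(Metric.infDist p (⋃ i, range (γ i))))⁻¹) := by
    have : Measurable fun p : Plane => Metric.infDist p (⋃ i, range (γ i)) :=
      (Metric.continuous_infDist_pt _).measurable
    fun_prop
  refine ((h1.const_mul 2).add (integrable_finsetSum Finset.univ fun i _ => hg i)).mono'
    hm.aestronglyMeasurable (Eventually.of_forall fun p => ?_)
  rw [Real.norm_eq_abs, abs_of_nonneg (by positivity)]
  have h2 : (√(Metric.infDist p (⋃ i, range (γ i))))⁻¹ ≤ 1 + ∑ i, g i p := by
    rcases (⋃ i, range (γ i)).eq_empty_or_nonempty with h | h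
    · rw [h]; simp
      exact add_nonneg zero_le_one (Finset.sum_nonneg fun i _ => hg0 i p)
    obtain ⟨y, hy, hpy⟩ := hγ.isCompact_iUnion_range.exists_infDist_eq_dist h p
    obtain ⟨i, hi⟩ := mem_iUnion.1 hy
    have h3 : Metric.infDist p (⋃ i, range (γ i)) = Metric.infDist p (range (γ i)) := by
      refine le_antisymm (Metric.infDist_le_infDist_of_subset (subset_iUnion (fun i => range (γ i)) i)
        (range_nonempty _)) ?_
      rw [hpy]; exact Metric.infDist_le_dist_of_mem hi
    rw [h3]
    refine (hgle i p).trans ?_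
    gcongr
    exact Finset.single_le_sum (f := fun i => g i p) (fun i _ => hg0 i p) (Finset.mem_univ i)
  have h4 : (1 + ‖p‖) ^ (-r) ≤ 1 :=
    Real.rpow_le_one_of_one_le_of_nonpos (by linarith [norm_nonneg p]) (by linarith)
  have h5 : 0 ≤ ∑ i, g i p := Finset.sum_nonneg fun i _ => hg0 i p
  have h6 : (0 : ℝ) ≤ (1 + ‖p‖) ^ (-r) := by positivity
  rw [Pi.add_apply]
  calc (1 + ‖p‖) ^ (-r) * (1 + (√(Metric.infDist p (⋃ i, range (γ i))))⁻¹)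
      ≤ (1 + ‖p‖) ^ (-r) * (2 + ∑ i, g i p) := by
        refine mul_le_mul_of_nonneg_left ?_ h6
        linarith
    _ ≤ 2 * (1 + ‖p‖) ^ (-r) + ∑ i, g i p := by nlinarith

lemma integrable_plane_weight {m : ℕ} {γ : Fin m → ℝ → Plane} (hγ : IsCurveSystem γ) :
    Integrable fun p : Plane =>
      (1 + ‖p‖)⁻¹ ^ 3 * (1 + (√(Metric.infDist p (⋃ i, range (γ i))))⁻¹) := by
  refine (integrable_plane_weight_rpow hγ (r := (3 : ℕ)) (by norm_num)).congr
    (Eventually.of_forall fun p => ?_)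
  simp only [inv_pow_eq_rpow 3 (show (0 : ℝ) ≤ 1 + ‖p‖ by positivity)]

/-- The curves of a curve system form a null set. -/
lemma IsCurveSystem.volume_iUnion_range {m : ℕ} {γ : Fin m → ℝ → Plane} (hγ : IsCurveSystem γ) :
    volume (⋃ i, range (γ i)) = 0 := by
  refine measure_iUnion_null_iff.2 fun i => ?_
  -- A curve is the image of the plane under a map that depends on one coordinate only. Its
  -- derivative is singular everywhere, so the image is null.
  have h1 : ∀ q : Plane, HasFDerivAt (fun q : Plane => γ i (q 0))
      ((EuclideanSpace.proj (𝕜 := ℝ) (0 : Fin 2)).smulRight (deriv (γ i) (q 0))) q := fun q => by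
    have := ((hγ.smooth i).differentiable (by simp) (q 0)).hasDerivAt.hasFDerivAt.comp q
      (EuclideanSpace.proj (𝕜 := ℝ) (0 : Fin 2)).hasFDerivAt
    refine this.congr_fderiv ?_
    ext1 w
    simp
  have h2 : range (γ i) = (fun q : Plane => γ i (q 0)) '' univ := by
    rw [image_univ]
    refine Subset.antisymm ?_ (range_subset_iff.2 fun q => ⟨q 0, rfl⟩)
    rintro _ ⟨s, rfl⟩
    exact ⟨EuclideanSpace.single 0 s, by simp⟩
  rw [h2]
  refine addHaar_image_eq_zero_of_det_fderivWithin_eq_zero volume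
    (fun q _ => (h1 q).hasFDerivWithinAt) fun q _ => ?_
  by_contra h
  have h4 : Function.Injective
      ((EuclideanSpace.proj (𝕜 := ℝ) (0 : Fin 2)).smulRight (deriv (γ i) (q 0)) : Plane →L[ℝ] Plane) :=
    (LinearMap.equivOfDetNeZero _ h).injective
  have h5 := h4 (a₁ := EuclideanSpace.single 1 1) (a₂ := 0) (by simp)
  have := congrArg (fun w : Plane => w 1) h5
  simp at this

/-! ### Fields with an interface -/

lemma fderivWithin_closedHalfSpace {F : Type*} [NormedAddCommGroup F] [NormedSpace ℝ F]
    (f : Space → F) {x : Space} (hx : x ∈ halfSpace) :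
    fderivWithin ℝ f closedHalfSpace x = fderiv ℝ f x :=
  fderivWithin_of_mem_nhds (closedHalfSpace_mem_nhds hx)

lemma isClosed_embed_image {Γ : Set Plane} (hΓ : IsClosed Γ) : IsClosed (embed '' Γ) :=
  isometry_embed.isClosedEmbedding.isClosedMap _ hΓ

lemma sum_fderiv_coord {P : Space → ℝ} {x w : Space} :
    fderiv ℝ P x w = ∑ i, fderiv ℝ P x (EuclideanSpace.single i 1) * w i := by
  have : w = ∑ i : Fin 3, w i • (EuclideanSpace.single i (1 : ℝ) : Space) := by
    ext j; fin_cases j <;> simp [Fin.sum_univ_three]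
  nth_rewrite 1 [this]
  rw [map_sum]
  refine Finset.sum_congr rfl fun i _ => ?_
  rw [map_smul, smul_eq_mul, mul_comm]

namespace IsRegularField

variable {Γ : Set Plane} {C : ℝ} {u : Space → Space}

lemma const_nonneg (hu : IsRegularField Γ C u) : 0 ≤ C := by
  have h := hu.bound_zero 0 (by simp [closedHalfSpace])
  simp only [norm_zero, add_zero, inv_one, mul_one] at h
  exact (norm_nonneg _).trans h

lemma contDiffOn_halfSpace (hu : IsRegularField Γ C u) : ContDiffOn ℝ ∞ u halfSpace :=
  hu.smooth.mono fun _ hx => mem_diff_of_mem_halfSpace hx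

lemma continuousOn_fderivWithin (hu : IsRegularField Γ C u) (hΓ : IsClosed Γ) :
    ContinuousOn (fderivWithin ℝ u closedHalfSpace) (closedHalfSpace \ embed '' Γ) := by
  have hopen : IsOpen (embed '' Γ)ᶜ := (isClosed_embed_image hΓ).isOpen_compl
  have h1 : UniqueDiffOn ℝ (closedHalfSpace \ embed '' Γ) :=
    uniqueDiffOn_closedHalfSpace.inter hopen
  refine (hu.smooth.continuousOn_fderivWithin h1 (by simp)).congr fun x hx => ?_
  exact (fderivWithin_inter (hopen.mem_nhds hx.2)).symm

/-- The bound in terms of depth serves for integrals over the half-space. The companion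
`norm_fderivWithin_le`, in terms of the horizontal distance to `Γ`, holds up to the boundary and
dominates traces uniformly in depth. -/
lemma norm_fderiv_le (hu : IsRegularField Γ C u) {x : Space} (hx : x ∈ halfSpace) :
    ‖fderiv ℝ u x‖ ≤ 2 * C * (1 + ‖x‖)⁻¹ ^ 2 * (1 + (√|x 2|)⁻¹) := by
  have hx' : x 2 < 0 := hx
  have h1 := hu.bound_one x (mem_diff_of_mem_halfSpace hx)
  rw [fderivWithin_closedHalfSpace u hx] at h1
  have h2 := one_add_log_le (d := interfaceDist Γ x) Metric.infDist_nonneg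
  have h3 := inv_sqrt_le_inv_sqrt (inv_interfaceDist_le Γ hx'.ne)
  have hC := hu.const_nonneg
  calc ‖fderiv ℝ u x‖ ≤ C * (1 + ‖x‖)⁻¹ ^ 2 * (1 + Real.log (1 + (interfaceDist Γ x)⁻¹)) := h1
    _ ≤ C * (1 + ‖x‖)⁻¹ ^ 2 * (2 * (1 + (√|x 2|)⁻¹)) := by
        gcongr
        linarith
    _ = _ := by ring

lemma norm_fderivWithin_le (hu : IsRegularField Γ C u) (hΓ : IsClosed Γ) {x : Space}
    (hx : x ∈ closedHalfSpace) (hx' : horizontal x ∉ Γ) :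
    ‖fderivWithin ℝ u closedHalfSpace x‖ ≤
      2 * C * (1 + ‖x‖)⁻¹ ^ 2 * (1 + (√(Metric.infDist (horizontal x) Γ))⁻¹) := by
  have hmem : x ∈ closedHalfSpace \ embed '' Γ := by
    refine ⟨hx, ?_⟩
    rintro ⟨q, hq, rfl⟩
    exact hx' (by rwa [horizontal_embed])
  have h1 := hu.bound_one x hmem
  have h2 := one_add_log_le (d := interfaceDist Γ x) Metric.infDist_nonneg
  have h3 : (√(interfaceDist Γ x))⁻¹ ≤ (√(Metric.infDist (horizontal x) Γ))⁻¹ := by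
    refine inv_sqrt_le_inv_sqrt ?_
    rcases Γ.eq_empty_or_nonempty with rfl | hne
    · rw [interfaceDist_empty]; simp
    · exact inv_anti₀ ((hΓ.notMem_iff_infDist_pos hne).1 hx') (infDist_le_interfaceDist Γ x)
  have hC := hu.const_nonneg
  calc _ ≤ C * (1 + ‖x‖)⁻¹ ^ 2 * (1 + Real.log (1 + (interfaceDist Γ x)⁻¹)) := h1
    _ ≤ C * (1 + ‖x‖)⁻¹ ^ 2 * (2 * (1 + (√(Metric.infDist (horizontal x) Γ))⁻¹)) := by
        gcongr
        linarith
    _ = _ := by ring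

lemma norm_iteratedFDeriv_le (hu : IsRegularField Γ C u) {x : Space} (hx : x ∈ halfSpace) :
    ‖iteratedFDeriv ℝ 2 u x‖ ≤ C * (1 + ‖x‖)⁻¹ ^ 3 * (1 + |x 2|⁻¹) := by
  have hx' : x 2 < 0 := hx
  have h1 := hu.bound_two x (mem_diff_of_mem_halfSpace hx)
  have h2 : closedHalfSpace =ᶠ[𝓝 x] univ := eventuallyEq_univ.2 (closedHalfSpace_mem_nhds hx)
  rw [iteratedFDerivWithin_congr_set h2, iteratedFDerivWithin_univ] at h1
  have hC := hu.const_nonneg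
  refine h1.trans (mul_le_mul_of_nonneg_left ?_ (by positivity))
  linarith [inv_interfaceDist_le Γ hx'.ne]

lemma norm_laplacian_le (hu : IsRegularField Γ C u) {x : Space} (hx : x ∈ halfSpace) :
    ‖Laplacian.laplacian u x‖ ≤ 3 * C * (1 + ‖x‖)⁻¹ ^ 3 * (1 + |x 2|⁻¹) := by
  rw [InnerProductSpace.laplacian_eq_iteratedFDeriv_orthonormalBasis u
    (EuclideanSpace.basisFun (Fin 3) ℝ)]
  refine (norm_sum_le _ _).trans ?_
  have h : ∀ i : Fin 3, ‖iteratedFDeriv ℝ 2 u x ![EuclideanSpace.basisFun (Fin 3) ℝ i,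
      EuclideanSpace.basisFun (Fin 3) ℝ i]‖ ≤ C * (1 + ‖x‖)⁻¹ ^ 3 * (1 + |x 2|⁻¹) := fun i => by
    refine ((iteratedFDeriv ℝ 2 u x).le_opNorm _).trans ?_
    simpa [Fin.prod_univ_two] using hu.norm_iteratedFDeriv_le hx
  refine (Finset.sum_le_sum fun i _ => h i).trans_eq ?_
  simp
  ring

end IsRegularField

lemma laplacian_eq_sum_fderiv {u : Space → Space} {x : Space} (hu : ContDiffAt ℝ 2 u x) :
    Laplacian.laplacian u x = ∑ i : Fin 3, fderiv ℝ
      (fun y => fderiv ℝ u y (EuclideanSpace.single i 1)) x (EuclideanSpace.single i 1) := by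
  rw [InnerProductSpace.laplacian_eq_iteratedFDeriv_orthonormalBasis u
    (EuclideanSpace.basisFun (Fin 3) ℝ)]
  have hd : DifferentiableAt ℝ (fderiv ℝ u) x :=
    (hu.fderiv_right (m := 1) (by norm_num)).differentiableAt (by simp)
  refine Finset.sum_congr rfl fun i _ => ?_
  rw [iteratedFDeriv_two_apply, fderiv_clm_apply hd (differentiableAt_const _)]
  simp

/-! ### Decay of the pressure -/

/-- This function is a barrier for vertical integration: its rate of decrease dominates the bound
for the pressure gradient (`pressure_barrier_le`), and it has the decay and the singularity expected
of the pressure. -/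
lemma hasDerivAt_pressure_barrier {a t : ℝ} (ha : 0 < a) (ht : 0 < t) :
    HasDerivAt (fun t => (a + t)⁻¹ ^ 2 * (1 + (√t)⁻¹))
      (-(2 * (a + t)⁻¹ ^ 3 * (1 + (√t)⁻¹) + (a + t)⁻¹ ^ 2 * (2⁻¹ * (√t)⁻¹ ^ 3))) t := by
  have h1 : HasDerivAt (fun t => (a + t)⁻¹) (-1 / (a + t) ^ 2) t :=
    ((hasDerivAt_id t).const_add a).inv (by simp only [id]; positivity)
  have h2 : HasDerivAt (fun t => (√t)⁻¹) (-(1 / (2 * √t)) / √t ^ 2) t :=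
    (Real.hasDerivAt_sqrt ht.ne').inv (Real.sqrt_pos.2 ht).ne'
  have h3 := (h1.fun_pow 2).fun_mul (h2.const_add 1)
  refine h3.congr_deriv ?_
  have := Real.sqrt_pos.2 ht
  rw [show (2 - 1 : ℕ) = 1 from rfl, pow_one]
  push_cast
  field_simp
  ring

/-- With `σ = (√t)⁻¹` and `w = (a + t)⁻¹ ≤ 1`, replacing `w²` by `w³` reduces the claim to `σ (σ -
2)² ≥ 0`. -/
lemma pressure_barrier_le {a t : ℝ} (ha : 1 ≤ a) (ht : 0 < t) :
    (a + t)⁻¹ ^ 3 * (1 + t⁻¹) ≤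
      2 * (a + t)⁻¹ ^ 3 * (1 + (√t)⁻¹) + (a + t)⁻¹ ^ 2 * (2⁻¹ * (√t)⁻¹ ^ 3) := by
  have h1 : t⁻¹ = (√t)⁻¹ ^ 2 := by rw [inv_pow, Real.sq_sqrt ht.le]
  have hσ : 0 < (√t)⁻¹ := inv_pos.2 (Real.sqrt_pos.2 ht)
  have hw : 0 < (a + t)⁻¹ := inv_pos.2 (by linarith)
  have hw1 : (a + t)⁻¹ ≤ 1 := inv_le_one_of_one_le₀ (by linarith)
  rw [h1]
  generalize (√t)⁻¹ = σ at *
  generalize (a + t)⁻¹ = w at *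
  have h2 : w ^ 3 ≤ w ^ 2 := pow_le_pow_of_le_one hw.le hw1 (by norm_num)
  have h3 : w ^ 3 * (2⁻¹ * σ ^ 3) ≤ w ^ 2 * (2⁻¹ * σ ^ 3) := by gcongr
  have h4 : 0 ≤ w ^ 3 * (σ * (σ - 2) ^ 2) := by positivity
  have h5 : 0 ≤ w ^ 3 * (1 + σ ^ 2) := by positivity
  nlinarith

lemma norm_join_le (p : Plane) (z : ℝ) : ‖join (p, z)‖ ≤ ‖p‖ + |z| := by
  refine (norm_add_le _ _).trans ?_
  rw [norm_embed, norm_smul, norm_vertical, mul_one, Real.norm_eq_abs]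

@[simp] lemma horizontal_join (p : Plane) (z : ℝ) : horizontal (join (p, z)) = p := by
  rw [join, horizontal_add, horizontal_smul, horizontal_embed, horizontal_vertical, smul_zero,
    add_zero]

lemma norm_le_norm_join (p : Plane) (z : ℝ) : ‖p‖ ≤ ‖join (p, z)‖ := by
  simpa using norm_horizontal_le (join (p, z))

lemma abs_le_norm_join (p : Plane) (z : ℝ) : |z| ≤ ‖join (p, z)‖ := by
  simpa using abs_coord_le (join (p, z)) 2

lemma hasDerivAt_join_neg (p : Plane) (t : ℝ) :
    HasDerivAt (fun t : ℝ => join (p, -t)) (-vertical) t := by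
  have := ((hasDerivAt_id t).neg.smul_const vertical).const_add (embed p)
  simpa [join] using this

lemma join_neg_mem (p : Plane) {t : ℝ} (ht : 0 < t) : join (p, -t) ∈ halfSpace := by
  show join (p, -t) 2 < 0
  simpa using ht

lemma abs_sub_le_vertical {P : Space → ℝ} (hP : ContDiffOn ℝ 1 P halfSpace) {K : ℝ} (hK : 0 ≤ K)
    (hb : ∀ x ∈ halfSpace, ‖fderiv ℝ P x‖ ≤ K * (1 + ‖x‖)⁻¹ ^ 3 * (1 + |x 2|⁻¹))
    (p : Plane) {y Y : ℝ} (hy : 0 < y) (hyY : y ≤ Y) :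
    |P (join (p, -Y)) - P (join (p, -y))| ≤ 8 * K * ((1 + ‖p‖ + y)⁻¹ ^ 2 * (1 + (√y)⁻¹)) := by
  set q : ℝ → ℝ := fun t => (1 + ‖p‖ + t)⁻¹ ^ 2 * (1 + (√t)⁻¹) with hq
  have ha : 1 ≤ 1 + ‖p‖ := by linarith [norm_nonneg p]
  have hqd : ∀ t ∈ Icc y Y, HasDerivAt (fun t => 8 * K * (q y - q t))
      (8 * K * (2 * (1 + ‖p‖ + t)⁻¹ ^ 3 * (1 + (√t)⁻¹) +
        (1 + ‖p‖ + t)⁻¹ ^ 2 * (2⁻¹ * (√t)⁻¹ ^ 3))) t := fun t ht => by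
    have := ((hasDerivAt_pressure_barrier (a := 1 + ‖p‖) (by linarith)
      (hy.trans_le ht.1)).const_sub (q y)).const_mul (8 * K)
    exact this.congr_deriv (by ring)
  have hPd : ∀ t ∈ Icc y Y, HasDerivAt (fun t => P (join (p, -t)) - P (join (p, -y)))
      (fderiv ℝ P (join (p, -t)) (-vertical)) t := fun t ht => by
    have h1 : DifferentiableAt ℝ P (join (p, -t)) :=
      (hP.differentiableOn one_ne_zero).differentiableAt
        (isOpen_halfSpace.mem_nhds (join_neg_mem p (hy.trans_le ht.1)))
    exact (h1.hasFDerivAt.comp_hasDerivAt t (hasDerivAt_join_neg p t)).sub_const _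
  have key := image_norm_le_of_norm_deriv_right_le_deriv_boundary'
    (f := fun t => P (join (p, -t)) - P (join (p, -y)))
    (f' := fun t => fderiv ℝ P (join (p, -t)) (-vertical)) (a := y) (b := Y)
    (fun t ht => (hPd t ht).continuousAt.continuousWithinAt)
    (fun t ht => (hPd t (Ico_subset_Icc_self ht)).hasDerivWithinAt)
    (B := fun t => 8 * K * (q y - q t)) (by simp)
    (fun t ht => (hqd t ht).continuousAt.continuousWithinAt)
    (fun t ht => (hqd t (Ico_subset_Icc_self ht)).hasDerivWithinAt) (fun t ht => ?_)
    (right_mem_Icc.2 hyY)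
  · refine (show |P (join (p, -Y)) - P (join (p, -y))| ≤ 8 * K * (q y - q Y) from key).trans ?_
    have : 0 ≤ q Y := by simp only [hq]; positivity
    have h8 : 0 ≤ 8 * K := by positivity
    nlinarith
  · have ht0 : 0 < t := hy.trans_le ht.1
    refine ((fderiv ℝ P (join (p, -t))).le_opNorm _).trans ?_
    rw [norm_neg, norm_vertical, mul_one]
    refine (hb _ (join_neg_mem p ht0)).trans ?_
    -- Both `‖p‖` and `t` are at most the norm of the point. The cube of this factor `2` is the
    -- constant `8`.
    have h2 : (1 + ‖join (p, -t)‖)⁻¹ ≤ 2 * (1 + ‖p‖ + t)⁻¹ := by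
      rw [← div_eq_mul_inv, inv_le_comm₀ (by positivity) (by positivity), inv_div,
        div_le_iff₀ (by norm_num)]
      have h3 := norm_le_norm_join p (-t)
      have h4 := abs_le_norm_join p (-t)
      rw [abs_neg, abs_of_pos ht0] at h4
      linarith
    have h5 : |join (p, -t) 2| = t := by simp [abs_of_pos ht0]
    rw [h5]
    calc K * (1 + ‖join (p, -t)‖)⁻¹ ^ 3 * (1 + t⁻¹)
        ≤ K * (2 * (1 + ‖p‖ + t)⁻¹) ^ 3 * (1 + t⁻¹) := by gcongr
      _ = 8 * K * ((1 + ‖p‖ + t)⁻¹ ^ 3 * (1 + t⁻¹)) := by ring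
      _ ≤ _ := mul_le_mul_of_nonneg_left (pressure_barrier_le ha ht0) (by positivity)

/-- Moving sideways at great depth costs little, so the limits of `P` along all vertical lines
agree. -/
lemma abs_sub_le_horizontal {P : Space → ℝ} (hP : ContDiffOn ℝ 1 P halfSpace) {K : ℝ} (hK : 0 ≤ K)
    (hb : ∀ x ∈ halfSpace, ‖fderiv ℝ P x‖ ≤ K * (1 + ‖x‖)⁻¹ ^ 3 * (1 + |x 2|⁻¹))
    (p q : Plane) {y : ℝ} (hy : 1 ≤ y) :
    |P (join (p, -y)) - P (join (q, -y))| ≤ 2 * K * y⁻¹ * ‖p - q‖ := by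
  have hconv : Convex ℝ {x : Space | x 2 ≤ -y} :=
    convex_halfSpace_le (EuclideanSpace.proj (𝕜 := ℝ) (2 : Fin 3)).isLinear _
  have hsub : ∀ x ∈ {x : Space | x 2 ≤ -y}, x ∈ halfSpace := fun x hx => by
    have : x 2 ≤ -y := hx
    show x 2 < 0
    linarith
  have key := hconv.norm_image_sub_le_of_norm_fderiv_le (𝕜 := ℝ) (f := P) (C := 2 * K * y⁻¹)
    (fun x hx => (hP.differentiableOn one_ne_zero).differentiableAt
        (isOpen_halfSpace.mem_nhds (hsub x hx))) (fun x hx => ?_)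
    (show join (q, -y) ∈ {x : Space | x 2 ≤ -y} by simp)
    (show join (p, -y) ∈ {x : Space | x 2 ≤ -y} by simp)
  · have h1 : ‖join (p, -y) - join (q, -y)‖ = ‖p - q‖ := by
      rw [← norm_embed, embed_sub]; simp [join]
    rwa [h1] at key
  · have hx2 : x 2 ≤ -y := hx
    refine (hb x (hsub x hx)).trans ?_
    have h2 : y ≤ |x 2| := by rw [abs_of_nonpos (by linarith)]; linarith
    have h3 : |x 2| ≤ ‖x‖ := abs_coord_le x 2
    have h4 : (1 + ‖x‖)⁻¹ ^ 3 ≤ y⁻¹ := by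
      have h5 : (1 + ‖x‖)⁻¹ ≤ 1 := inv_le_one_of_one_le₀ (by linarith [norm_nonneg x])
      have h6 : (1 + ‖x‖)⁻¹ ≤ y⁻¹ := inv_anti₀ (by linarith) (by linarith)
      calc (1 + ‖x‖)⁻¹ ^ 3 ≤ (1 + ‖x‖)⁻¹ ^ 1 :=
            pow_le_pow_of_le_one (by positivity) h5 (by norm_num)
        _ ≤ y⁻¹ := by rwa [pow_one]
    have h7 : 1 + |x 2|⁻¹ ≤ 2 := by
      have : |x 2|⁻¹ ≤ 1 := inv_le_one_of_one_le₀ (by linarith)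
      linarith
    calc K * (1 + ‖x‖)⁻¹ ^ 3 * (1 + |x 2|⁻¹) ≤ K * y⁻¹ * 2 := by gcongr
      _ = _ := by ring

/-- A function whose gradient has the decay of the second derivatives of a velocity field is
constant at infinity, and approaches this constant like the first derivatives. -/
lemma exists_limit_pressure {P : Space → ℝ} (hP : ContDiffOn ℝ 1 P halfSpace) {K : ℝ} (hK : 0 ≤ K)
    (hb : ∀ x ∈ halfSpace, ‖fderiv ℝ P x‖ ≤ K * (1 + ‖x‖)⁻¹ ^ 3 * (1 + |x 2|⁻¹)) :
    ∃ c, ∀ x ∈ halfSpace, |P x - c| ≤ 8 * K * (1 + ‖x‖)⁻¹ ^ 2 * (1 + (√|x 2|)⁻¹) := by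
  set N : ℕ → ℝ := fun n => n + 1 with hN
  have hN1 : ∀ n, 1 ≤ N n := fun n => by simp [hN]
  set a : ℕ → ℝ := fun n => P (join (0, -N n)) with ha
  have hNlim : Tendsto (fun n => (N n)⁻¹) atTop (𝓝 0) := by
    simpa [hN, one_div] using tendsto_one_div_add_atTop_nhds_zero_nat (𝕜 := ℝ)
  have hNt : Tendsto N atTop atTop := tendsto_atTop_add_const_right _ _ tendsto_natCast_atTop_atTop
  have hcauchy : CauchySeq a := by
    refine cauchySeq_of_le_tendsto_0' (fun n => 16 * K * (N n)⁻¹) (fun n k hnk => ?_) ?_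
    · have h1 := abs_sub_le_vertical hP hK hb 0 (y := N n) (Y := N k) (by linarith [hN1 n])
        (by simp only [hN]; gcongr)
      rw [dist_comm, Real.dist_eq]
      refine h1.trans ?_
      rw [norm_zero, add_zero]
      have h2 : (1 + N n)⁻¹ ^ 2 ≤ (N n)⁻¹ := by
        have h3 : (1 + N n)⁻¹ ≤ 1 := inv_le_one_of_one_le₀ (by linarith [hN1 n])
        have h4 : (1 + N n)⁻¹ ≤ (N n)⁻¹ := inv_anti₀ (by linarith [hN1 n]) (by linarith)
        have h5 : 0 ≤ (1 + N n)⁻¹ := inv_nonneg.2 (by linarith [hN1 n])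
        nlinarith
      have h6 : (√(N n))⁻¹ ≤ 1 := inv_le_one_of_one_le₀ (Real.one_le_sqrt.2 (hN1 n))
      have h7 : 0 ≤ (N n)⁻¹ := inv_nonneg.2 (by linarith [hN1 n])
      calc 8 * K * ((1 + N n)⁻¹ ^ 2 * (1 + (√(N n))⁻¹)) ≤ 8 * K * ((N n)⁻¹ * (1 + 1)) := by gcongr
        _ = _ := by ring
    · simpa using hNlim.const_mul (16 * K)
  obtain ⟨c, hc⟩ := cauchySeq_tendsto_of_complete hcauchy
  refine ⟨c, fun x hx => ?_⟩
  have hx2 : x 2 < 0 := hx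
  have hxj : x = join (horizontal x, -(-x 2)) := by
    rw [neg_neg]; exact (embed_horizontal_add x).symm
  set p := horizontal x with hp
  set y := -x 2 with hy
  have hy0 : 0 < y := by linarith
  have hlim : Tendsto (fun n => 8 * K * ((1 + ‖p‖ + y)⁻¹ ^ 2 * (1 + (√y)⁻¹)) +
      2 * K * (N n)⁻¹ * ‖p - 0‖) atTop (𝓝 (8 * K * ((1 + ‖p‖ + y)⁻¹ ^ 2 * (1 + (√y)⁻¹)))) := by
    have := ((hNlim.const_mul (2 * K)).mul_const ‖p - 0‖).const_add
      (8 * K * ((1 + ‖p‖ + y)⁻¹ ^ 2 * (1 + (√y)⁻¹)))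
    simpa using this
  -- The path goes straight down from `x` to depth `N n` and then across to the axis; the second
  -- part disappears in the limit.
  have hle : |P x - c| ≤ 8 * K * ((1 + ‖p‖ + y)⁻¹ ^ 2 * (1 + (√y)⁻¹)) := by
    refine le_of_tendsto_of_tendsto (hc.const_sub (P x)).abs hlim ?_
    filter_upwards [hNt.eventually_ge_atTop y] with n hn
    have h1 := abs_sub_le_vertical hP hK hb p hy0 hn
    have h2 := abs_sub_le_horizontal hP hK hb p 0 (hN1 n)
    rw [← hxj] at h1
    calc |P x - a n| = |-(P (join (p, -N n)) - P x) + (P (join (p, -N n)) - a n)| := by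
          congr 1; ring
      _ ≤ |P (join (p, -N n)) - P x| + |P (join (p, -N n)) - a n| := by
          refine (abs_add_le _ _).trans_eq ?_
          rw [abs_neg]
      _ ≤ _ := add_le_add h1 h2
  refine hle.trans ?_
  have h3 : ‖x‖ ≤ ‖p‖ + y := by
    have := norm_join_le p (-y)
    rwa [← hxj, abs_neg, abs_of_pos hy0] at this
  have h4 : |x 2| = y := abs_of_neg hx2
  have h5 : (1 + ‖p‖ + y)⁻¹ ≤ (1 + ‖x‖)⁻¹ := inv_anti₀ (by positivity) (by linarith)
  rw [h4, mul_assoc (8 * K)]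
  gcongr

/-! ### The stress at the boundary of a Stokes flow -/

namespace eulerFields

variable {v : Space → Space}

/-- The normal component of a field vanishes linearly at the boundary. -/
lemma abs_normal_le (hv : v ∈ eulerFields) {K : ℝ}
    (hK : ∀ x ∈ closedHalfSpace, ‖fderivWithin ℝ v closedHalfSpace x‖ ≤ K * (1 + ‖x‖)⁻¹ ^ 2)
    (p : Plane) {s : ℝ} (hs : 0 ≤ s) :
    |v (join (p, -s)) 2| ≤ K * (1 + ‖p‖)⁻¹ ^ 2 * s := by
  have hK0 : 0 ≤ K := by
    have := (norm_nonneg _).trans (hK 0 (by simp [closedHalfSpace]))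
    simpa using this
  have hmem : ∀ t ∈ Icc 0 s, join (p, -t) ∈ closedHalfSpace := fun t ht => by
    show join (p, -t) 2 ≤ 0
    simpa using ht.1
  have h1 : ∀ t ∈ Icc 0 s, HasDerivWithinAt (fun t : ℝ => v (join (p, -t)))
      (fderivWithin ℝ v closedHalfSpace (join (p, -t)) (-vertical)) (Icc 0 s) t := fun t ht =>
    ((((contDiffOn hv).differentiableOn (by simp)) _
      (hmem t ht)).hasFDerivWithinAt).comp_hasDerivWithinAt t
      (hasDerivAt_join_neg p t).hasDerivWithinAt hmem
  have h2 := norm_image_sub_le_of_norm_deriv_le_segment' (C := K * (1 + ‖p‖)⁻¹ ^ 2) h1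
    (fun t ht => ?_) s (right_mem_Icc.2 hs)
  · have h3 := (abs_coord_le (v (join (p, -s)) - v (join (p, -0))) 2).trans h2
    have h4 : v (join (p, -0)) 2 = 0 := by
      have := hv.normal_eq_zero p
      simpa [join] using this
    rwa [PiLp.sub_apply, h4, sub_zero, sub_zero] at h3
  · refine ((fderivWithin ℝ v closedHalfSpace (join (p, -t))).le_opNorm _).trans ?_
    rw [norm_neg, norm_vertical, mul_one]
    refine (hK _ (hmem t (Ico_subset_Icc_self ht))).trans ?_
    have := norm_le_norm_join p (-t)
    have h5 : (1 + ‖join (p, -t)‖)⁻¹ ≤ (1 + ‖p‖)⁻¹ := inv_anti₀ (by positivity) (by linarith)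
    gcongr

end eulerFields

lemma inner_space (x y : Space) : inner ℝ x y = x 0 * y 0 + x 1 * y 1 + x 2 * y 2 := by
  simp [PiLp.inner_apply, Fin.sum_univ_three]; ring

/-- In a Stokes flow, the energy pairing with a field of `𝒱` is the work of the surface stress. -/
theorem integral_inner_fderiv_eq {m : ℕ} {γ : Fin m → ℝ → Plane} (hγ : IsCurveSystem γ)
    {C : ℝ} {u : Space → Space} (hu : IsRegularField (⋃ i, range (γ i)) C u)
    {P : Space → ℝ} (hP : ContDiffOn ℝ ∞ P halfSpace)
    (hS : ∀ x ∈ halfSpace, Laplacian.laplacian u x = gradient P x)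
    {v : Space → Space} (hv : v ∈ eulerFields) :
    ∫ x in halfSpace, ∑ i : Fin 3, inner ℝ (fderiv ℝ u x (EuclideanSpace.single i 1))
      (fderiv ℝ v x (EuclideanSpace.single i 1)) =
    -∫ p, inner ℝ (surfaceStress u p) (trace v p) := by
  obtain ⟨K, -, -, hK0, hK1⟩ := eulerFields.exists_bounds hv
  set Γ := ⋃ i, range (γ i) with hΓdef
  have hΓ : IsClosed Γ := hγ.isCompact_iUnion_range.isClosed
  have hC := hu.const_nonneg
  have hle : (1 : WithTop ℕ∞) ≤ ∞ := by norm_cast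
  have hgrad : ∀ x w, fderiv ℝ P x w = inner ℝ (gradient P x) w := fun x w => by
    rw [← toDual_gradient]; rfl
  have hPb : ∀ x ∈ halfSpace, ‖fderiv ℝ P x‖ ≤ 3 * C * (1 + ‖x‖)⁻¹ ^ 3 * (1 + |x 2|⁻¹) :=
    fun x hx => by
      rw [← toDual_gradient, LinearIsometryEquiv.norm_map, ← hS x hx]
      exact hu.norm_laplacian_le hx
  -- Subtracting the limit at infinity leaves the gradient unchanged and gives the flux `X` the
  -- decay that the divergence theorem asks for.
  obtain ⟨c, hc⟩ := exists_limit_pressure (hP.of_le hle) (by positivity) hPb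
  set e : Fin 3 → Space := fun i => EuclideanSpace.single i 1 with he
  have hne : ∀ i, ‖e i‖ = 1 := fun i => by simp [he]
  have huB := hu.contDiffOn_halfSpace
  have hvB : ContDiffOn ℝ ∞ v halfSpace := (eulerFields.contDiffOn hv).mono halfSpace_subset
  have hduB : ∀ i, ContDiffOn ℝ ∞ (fun x => fderiv ℝ u x (e i)) halfSpace := fun i =>
    (huB.fderiv_of_isOpen isOpen_halfSpace (by simp)).clm_apply contDiffOn_const
  have hdvB : ∀ i, ContDiffOn ℝ ∞ (fun x => fderiv ℝ v x (e i)) halfSpace := fun i =>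
    (hvB.fderiv_of_isOpen isOpen_halfSpace (by simp)).clm_apply contDiffOn_const
  have hvi : ∀ i : Fin 3, ContDiffOn ℝ ∞ (fun x => v x i) halfSpace := fun i =>
    (EuclideanSpace.proj (𝕜 := ℝ) i).contDiff.comp_contDiffOn hvB
  -- The divergence of this flux is `∇u : ∇v`: the term `Δu · v` cancels `∇P · v`, and `(P - c) div
  -- v` is zero.
  set X : Fin 3 → Space → ℝ := fun i x => inner ℝ (fderiv ℝ u x (e i)) (v x) - (P x - c) * v x i
    with hX
  have hXs : ∀ i, ContDiffOn ℝ ∞ (X i) halfSpace := fun i =>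
    ((hduB i).inner ℝ hvB).sub ((hP.sub contDiffOn_const).mul (hvi i))
  have hnhds : ∀ x ∈ halfSpace, halfSpace ∈ 𝓝 x := fun x hx => isOpen_halfSpace.mem_nhds hx
  have hdivX : ∀ x ∈ halfSpace, ∑ i, fderiv ℝ (X i) x (e i) =
      ∑ i, inner ℝ (fderiv ℝ u x (e i)) (fderiv ℝ v x (e i)) := fun x hx => by
    have h1 : ∀ i, fderiv ℝ (X i) x (e i) =
        inner ℝ (fderiv ℝ (fun y => fderiv ℝ u y (e i)) x (e i)) (v x) +
        inner ℝ (fderiv ℝ u x (e i)) (fderiv ℝ v x (e i)) -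
        (fderiv ℝ P x (e i) * v x i + (P x - c) * fderiv ℝ v x (e i) i) := fun i => by
      have a1 := ((hduB i).differentiableOn (by simp)).differentiableAt (hnhds x hx)
      have a2 := (hvB.differentiableOn (by simp)).differentiableAt (hnhds x hx)
      have a3 := (hP.differentiableOn (by simp)).differentiableAt (hnhds x hx)
      have a4 := a1.hasFDerivAt.inner ℝ a2.hasFDerivAt
      have a5 := (a3.hasFDerivAt.sub_const c).mul
        ((EuclideanSpace.proj (𝕜 := ℝ) i).hasFDerivAt.comp x a2.hasFDerivAt)
      have a6 : fderiv ℝ (X i) x = _ := (a4.sub a5).fderiv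
      rw [a6]
      simp
      ring
    rw [Finset.sum_congr rfl fun i _ => h1 i, Finset.sum_sub_distrib, Finset.sum_add_distrib,
      Finset.sum_add_distrib, ← sum_inner, ← Finset.mul_sum, ← sum_fderiv_coord,
      ← laplacian_eq_sum_fderiv ((huB.contDiffAt (hnhds x hx)).of_le (by norm_cast)),
      hS x hx, hgrad]
    have : ∑ i, fderiv ℝ v x (e i) i = 0 := hv.divergence_eq_zero x hx
    rw [this]
    ring
  have h2 : ∫ x in halfSpace, ∑ i, inner ℝ (fderiv ℝ u x (e i)) (fderiv ℝ v x (e i)) =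
      ∫ x in halfSpace, ∑ i, fderiv ℝ (X i) x (e i) :=
    setIntegral_congr_fun isOpen_halfSpace.measurableSet fun x hx => (hdivX x hx).symm
  rw [h2]
  have hv1 : ∀ x ∈ halfSpace, ‖fderiv ℝ v x‖ ≤ K * (1 + ‖x‖)⁻¹ ^ 2 := fun x hx => by
    rw [← fderivWithin_closedHalfSpace v hx]; exact hK1 x (halfSpace_subset hx)
  have hXle : ∀ i x, |X i x| ≤ ‖fderiv ℝ u x (e i)‖ * ‖v x‖ + |P x - c| * |v x i| := fun i x => by
    refine (abs_sub _ _).trans (add_le_add (abs_real_inner_le_norm _ _) ?_)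
    rw [abs_mul]
  have hdu : ∀ i x, ‖fderiv ℝ u x (e i)‖ ≤ ‖fderiv ℝ u x‖ := fun i x => by
    simpa [hne] using (fderiv ℝ u x).le_opNorm (e i)
  have hdv : ∀ i x, ‖fderiv ℝ v x (e i)‖ ≤ ‖fderiv ℝ v x‖ := fun i x => by
    simpa [hne] using (fderiv ℝ v x).le_opNorm (e i)
  rw [integral_divergence_halfSpace
    (Y := fun p => inner ℝ (fderivWithin ℝ u closedHalfSpace (embed p) vertical) (v (embed p)))
    -- The constant is `2 + 24 * 4`: `2` from the viscous part, and `24` from the pressure part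
    -- times the bound `4` for `s + √s` on `(0, 2]`.
    (D := fun p => 98 * C * K * ((1 + ‖p‖)⁻¹ ^ 3 * (1 + (√(Metric.infDist p Γ))⁻¹)))
    (fun i => (hXs i).of_le hle) ?_ ?_ ((integrable_plane_weight hγ).const_mul _) ?_ ?_]
  · rw [← integral_neg]
    congr 1
    funext p
    rw [inner_space, inner_plane, hv.normal_eq_zero p]
    simp [surfaceStress, trace]
    ring
  · refine ((integrable_space_weight.integrableOn (s := halfSpace)).const_mul (6 * C * K)).mono' ?_ ?_
    · refine ContinuousOn.aestronglyMeasurable ?_ isOpen_halfSpace.measurableSet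
      refine continuousOn_finsetSum _ fun i _ => ?_
      exact (((hXs i).fderiv_of_isOpen isOpen_halfSpace (m := ∞) (by simp)).clm_apply
        contDiffOn_const).continuousOn
    · refine (ae_restrict_iff' isOpen_halfSpace.measurableSet).2
        (Eventually.of_forall fun x hx => ?_)
      dsimp only
      rw [hdivX x hx]
      refine (norm_sum_le _ _).trans ?_
      have h3 : ∀ i, ‖inner ℝ (fderiv ℝ u x (e i)) (fderiv ℝ v x (e i))‖ ≤
          2 * C * K * ((1 + ‖x‖)⁻¹ ^ 4 * (1 + (√|x 2|)⁻¹)) := fun i => by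
        refine (norm_inner_le_norm _ _).trans ?_
        calc ‖fderiv ℝ u x (e i)‖ * ‖fderiv ℝ v x (e i)‖
            ≤ (2 * C * (1 + ‖x‖)⁻¹ ^ 2 * (1 + (√|x 2|)⁻¹)) * (K * (1 + ‖x‖)⁻¹ ^ 2) := by
              gcongr
              · exact (hdu i x).trans (hu.norm_fderiv_le hx)
              · exact (hdv i x).trans (hv1 x hx)
          _ = _ := by ring
      refine (Finset.sum_le_sum fun i _ => h3 i).trans_eq ?_
      simp
      ring
  · intro i
    refine ((integrable_space_weight.integrableOn (s := halfSpace)).const_mul (26 * C * K)).mono' ?_ ?_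
    · refine ContinuousOn.aestronglyMeasurable ?_ isOpen_halfSpace.measurableSet
      refine (hXs i).continuousOn.mul (Continuous.continuousOn ?_)
      exact Continuous.inv₀ (by fun_prop) fun x => by positivity
    · refine (ae_restrict_iff' isOpen_halfSpace.measurableSet).2
        (Eventually.of_forall fun x hx => ?_)
      have h3 : |v x i| ≤ K * (1 + ‖x‖)⁻¹ := (abs_coord_le _ _).trans (hK0 x (halfSpace_subset hx))
      have h4 : |X i x| ≤ 26 * C * K * ((1 + ‖x‖)⁻¹ ^ 3 * (1 + (√|x 2|)⁻¹)) := by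
        refine (hXle i x).trans ?_
        calc _ ≤ (2 * C * (1 + ‖x‖)⁻¹ ^ 2 * (1 + (√|x 2|)⁻¹)) * (K * (1 + ‖x‖)⁻¹) +
              (8 * (3 * C) * (1 + ‖x‖)⁻¹ ^ 2 * (1 + (√|x 2|)⁻¹)) * (K * (1 + ‖x‖)⁻¹) := by
              gcongr
              · exact (hdu i x).trans (hu.norm_fderiv_le hx)
              · exact hK0 x (halfSpace_subset hx)
              · exact hc x hx
          _ = _ := by ring
      rw [norm_mul, Real.norm_eq_abs, Real.norm_eq_abs, abs_of_nonneg (a := (1 + ‖x‖)⁻¹)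
        (by positivity)]
      calc _ ≤ 26 * C * K * ((1 + ‖x‖)⁻¹ ^ 3 * (1 + (√|x 2|)⁻¹)) * (1 + ‖x‖)⁻¹ := by gcongr
        _ = _ := by ring
  all_goals
    have hae : ∀ᵐ p : Plane, p ∉ Γ := measure_eq_zero_iff_ae_notMem.1 hγ.volume_iUnion_range
    filter_upwards [hae] with p hp
  · intro s hs
    have hx := join_neg_mem p hs.1
    have hhor : horizontal (join (p, -s)) = p := horizontal_join _ _
    have hinv : (1 + ‖join (p, -s)‖)⁻¹ ≤ (1 + ‖p‖)⁻¹ :=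
      inv_anti₀ (by positivity) (by linarith [norm_le_norm_join p (-s)])
    have hj2 : |join (p, -s) 2| = s := by simp [abs_of_pos hs.1]
    have h3 := hu.norm_fderivWithin_le hΓ (halfSpace_subset hx) (by rwa [hhor])
    rw [fderivWithin_closedHalfSpace u hx, hhor] at h3
    have h4 := hc _ hx
    rw [hj2] at h4
    have h5 := eulerFields.abs_normal_le hv hK1 p hs.1.le
    have hσ : 0 ≤ (√(Metric.infDist p Γ))⁻¹ := by positivity
    have hb1 : (1 + ‖p‖)⁻¹ ≤ 1 := inv_le_one_of_one_le₀ (by linarith [norm_nonneg p])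
    set b := (1 + ‖p‖)⁻¹ with hb
    have hb0 : 0 ≤ b := by positivity
    have hs0 : 0 ≤ s := hs.1.le
    have hsq : (1 + (√s)⁻¹) * s ≤ 4 := by
      have h6 : (√s)⁻¹ * s = √s := by
        have := Real.sqrt_pos.2 hs.1
        field_simp
        exact (Real.sq_sqrt hs.1.le).symm
      have h7 : √s ≤ 2 := by rw [Real.sqrt_le_left (by norm_num)]; linarith [hs.2]
      nlinarith [hs.2]
    refine (hXle 2 _).trans ?_
    have h8 : b ^ 4 ≤ b ^ 3 := pow_le_pow_of_le_one hb0 hb1 (by norm_num)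
    have hKn : (0 : ℝ) ≤ K := K.2
    calc _ ≤ (2 * C * b ^ 2 * (1 + (√(Metric.infDist p Γ))⁻¹)) * (K * b) +
          (8 * (3 * C) * b ^ 2 * (1 + (√s)⁻¹)) * (K * b ^ 2 * s) := by
          gcongr
          · refine (hdu 2 _).trans (h3.trans ?_)
            gcongr
          · refine (hK0 _ (halfSpace_subset hx)).trans ?_
            gcongr
          · refine h4.trans ?_
            gcongr
      _ = 2 * C * K * (b ^ 3 * (1 + (√(Metric.infDist p Γ))⁻¹)) +
          24 * C * K * (b ^ 4 * ((1 + (√s)⁻¹) * s)) := by ring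
      _ ≤ 2 * C * K * (b ^ 3 * (1 + (√(Metric.infDist p Γ))⁻¹)) +
          24 * C * K * (b ^ 3 * 4) := by gcongr
      _ ≤ 2 * C * K * (b ^ 3 * (1 + (√(Metric.infDist p Γ))⁻¹)) +
          24 * C * K * (b ^ 3 * (4 * (1 + (√(Metric.infDist p Γ))⁻¹))) := by
          gcongr
          linarith
      _ = _ := by ring
  · have hmem : embed p ∈ closedHalfSpace \ embed '' Γ := embed_mem_diff hp
    have hj0 : Tendsto (fun s : ℝ => join (p, -s)) (𝓝[>] 0) (𝓝 (embed p)) := by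
      have : Continuous fun s : ℝ => join (p, -s) := continuous_join.comp (by fun_prop)
      have := (this.tendsto 0).mono_left (nhdsWithin_le_nhds (s := Ioi 0))
      simpa [join] using this
    have hj : Tendsto (fun s : ℝ => join (p, -s)) (𝓝[>] 0)
        (𝓝[closedHalfSpace \ embed '' Γ] (embed p)) := by
      refine tendsto_nhdsWithin_iff.2 ⟨hj0, ?_⟩
      filter_upwards [self_mem_nhdsWithin] with s hs
      exact mem_diff_of_mem_halfSpace (join_neg_mem p hs)
    have t1 : Tendsto (fun s : ℝ => fderivWithin ℝ u closedHalfSpace (join (p, -s)) vertical)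
        (𝓝[>] 0) (𝓝 (fderivWithin ℝ u closedHalfSpace (embed p) vertical)) :=
      (((hu.continuousOn_fderivWithin hΓ).clm_apply continuousOn_const) _ hmem).tendsto.comp hj
    have t2 : Tendsto (fun s : ℝ => v (join (p, -s))) (𝓝[>] 0) (𝓝 (v (embed p))) :=
      ((eulerFields.contDiffOn hv).continuousOn.mono sdiff_subset _ hmem).tendsto.comp hj
    -- The pressure may blow up like `s ^ (-1/2)` at depth `s`, but the normal component of `v`
    -- vanishes linearly, so the pressure does no work at the boundary.
    have t3 : Tendsto (fun s : ℝ => (P (join (p, -s)) - c) * v (join (p, -s)) 2) (𝓝[>] 0)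
        (𝓝 0) := by
      have hlim : Tendsto (fun s : ℝ => 24 * C * K * (s + √s)) (𝓝[>] 0) (𝓝 0) := by
        have : Continuous fun s : ℝ => 24 * C * K * (s + √s) := by fun_prop
        have := (this.tendsto 0).mono_left (nhdsWithin_le_nhds (s := Ioi 0))
        simpa using this
      refine squeeze_zero_norm' ?_ hlim
      filter_upwards [self_mem_nhdsWithin] with s hs
      have hs0 : 0 < s := hs
      have hx := join_neg_mem p hs0
      have h4 := hc _ hx
      rw [show |join (p, -s) 2| = s by simp [abs_of_pos hs0]] at h4
      have h5 := eulerFields.abs_normal_le hv hK1 p hs0.le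
      have hw : ∀ r : ℝ, 0 ≤ r → (1 + r)⁻¹ ^ 2 ≤ 1 := fun r hr =>
        pow_le_one₀ (by positivity) (inv_le_one_of_one_le₀ (by linarith))
      have h6 : (√s)⁻¹ * s = √s := by
        have := Real.sqrt_pos.2 hs0
        field_simp
        exact (Real.sq_sqrt hs0.le).symm
      rw [norm_mul, Real.norm_eq_abs, Real.norm_eq_abs]
      have hKn : (0 : ℝ) ≤ K := K.2
      calc _ ≤ (8 * (3 * C) * 1 * (1 + (√s)⁻¹)) * (K * 1 * s) := by
            gcongr
            · refine h4.trans ?_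
              gcongr
              exact hw _ (norm_nonneg _)
            · refine h5.trans ?_
              gcongr
              exact hw _ (norm_nonneg _)
        _ = 24 * C * K * (s + (√s)⁻¹ * s) := by ring
        _ = _ := by rw [h6]
    have := (t1.inner t2 (𝕜 := ℝ)).sub t3
    rw [sub_zero] at this
    refine this.congr' ?_
    filter_upwards [self_mem_nhdsWithin] with s hs
    rw [fderivWithin_closedHalfSpace u (join_neg_mem p hs), vertical_eq_single]

/-! ### Stream functions -/

/-- The rotated gradient of a stream function. -/
def perpGrad (g : Plane → ℝ) (p : Plane) : Plane :=
  !₂[fderiv ℝ g p (EuclideanSpace.single 1 1), -fderiv ℝ g p (EuclideanSpace.single 0 1)]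

@[simp] lemma perpGrad_zero (g : Plane → ℝ) (p : Plane) :
    perpGrad g p 0 = fderiv ℝ g p (EuclideanSpace.single 1 1) := rfl

@[simp] lemma perpGrad_one (g : Plane → ℝ) (p : Plane) :
    perpGrad g p 1 = -fderiv ℝ g p (EuclideanSpace.single 0 1) := rfl

lemma contDiff_fderiv_apply {E F : Type*} [NormedAddCommGroup E] [NormedSpace ℝ E]
    [NormedAddCommGroup F] [NormedSpace ℝ F] {g : E → F} (hg : ContDiff ℝ ∞ g) (e : E) :
    ContDiff ℝ ∞ fun p => fderiv ℝ g p e :=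
  (hg.fderiv_right (m := ∞) (by simp)).clm_apply contDiff_const

lemma contDiff_perpGrad {g : Plane → ℝ} (hg : ContDiff ℝ ∞ g) : ContDiff ℝ ∞ (perpGrad g) := by
  rw [contDiff_euclidean]
  intro i
  fin_cases i
  · exact contDiff_fderiv_apply hg _
  · exact (contDiff_fderiv_apply hg _).neg

lemma contDiff_coord {n : ℕ} {E : Type*} [NormedAddCommGroup E] [NormedSpace ℝ E]
    {V : E → EuclideanSpace ℝ (Fin n)} (hV : ContDiff ℝ ∞ V) (i : Fin n) :
    ContDiff ℝ ∞ fun p => V p i := contDiff_euclidean.1 hV i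

lemma fderiv_coord {n : ℕ} {E : Type*} [NormedAddCommGroup E] [NormedSpace ℝ E]
    {V : E → EuclideanSpace ℝ (Fin n)} {p : E} (hV : DifferentiableAt ℝ V p) (i : Fin n) (e : E) :
    fderiv ℝ (fun p => V p i) p e = fderiv ℝ V p e i := by
  have := ((EuclideanSpace.proj (𝕜 := ℝ) i).hasFDerivAt.comp p hV.hasFDerivAt)
  have h2 : HasFDerivAt (fun p => V p i) _ p := this
  rw [h2.fderiv]
  rfl

lemma hasCompactSupport_perpGrad {g : Plane → ℝ} (hg : HasCompactSupport g) :
    HasCompactSupport (perpGrad g) := by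
  refine (hg.fderiv (𝕜 := ℝ)).mono fun p hp => ?_
  contrapose! hp
  simp only [Function.mem_support, not_not] at hp ⊢
  ext i
  fin_cases i <;> simp [hp]

lemma fderiv_fderiv_comm {E : Type*} [NormedAddCommGroup E] [NormedSpace ℝ E] {g : E → ℝ}
    {p : E} (hg : ContDiffAt ℝ 2 g p) (a b : E) :
    fderiv ℝ (fun p => fderiv ℝ g p a) p b = fderiv ℝ (fun p => fderiv ℝ g p b) p a := by
  have hd : DifferentiableAt ℝ (fderiv ℝ g) p :=
    (hg.fderiv_right (m := 1) (by norm_num)).differentiableAt (by simp)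
  rw [fderiv_clm_apply hd (differentiableAt_const _), fderiv_clm_apply hd (differentiableAt_const _)]
  simpa using (hg.isSymmSndFDerivAt (by simp)).eq b a

lemma fderiv_perpGrad {g : Plane → ℝ} (hg : ContDiff ℝ ∞ g) (p : Plane) :
    fderiv ℝ (fun p => perpGrad g p 1) p (EuclideanSpace.single 1 1) =
      -fderiv ℝ (fun p => perpGrad g p 0) p (EuclideanSpace.single 0 1) := by
  simp only [perpGrad_zero, perpGrad_one]
  rw [fderiv_fun_neg, neg_apply, fderiv_fderiv_comm
    (hg.contDiffAt.of_le (by norm_cast))]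

lemma surfaceDivergence_perpGrad {g : Plane → ℝ} (hg : ContDiff ℝ ∞ g) (p : Plane) :
    surfaceDivergence (perpGrad g) p = 0 := by
  have hd : DifferentiableAt ℝ (perpGrad g) p := (contDiff_perpGrad hg).differentiable (by simp) p
  have := fderiv_perpGrad hg p
  rw [fderiv_coord hd, fderiv_coord hd] at this
  simp [surfaceDivergence, Fin.sum_univ_two, this]

lemma plane_eq (w : Plane) :
    w = w 0 • EuclideanSpace.single 0 (1 : ℝ) + w 1 • EuclideanSpace.single 1 (1 : ℝ) := by
  ext j; fin_cases j <;> simp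

/-- A smooth divergence free vector field in the plane has a stream function. -/
lemma exists_streamFunction {V : Plane → Plane} (hV : ContDiff ℝ ∞ V)
    (hdiv : ∀ p, surfaceDivergence V p = 0) :
    ∃ g : Plane → ℝ, ContDiff ℝ ∞ g ∧ g 0 = 0 ∧ perpGrad g = V ∧ ∀ p, ‖fderiv ℝ g p‖ ≤ ‖V p‖ := by
  -- The form `V₀ dy - V₁ dx` is closed precisely because `V` is divergence free; its primitive is
  -- the stream function.
  set w₁ : Plane → Plane →L[ℝ] ℝ := fun p =>
    V p 0 • EuclideanSpace.proj (𝕜 := ℝ) (1 : Fin 2) - V p 1 • EuclideanSpace.proj (𝕜 := ℝ) (0 : Fin 2)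
    with hw₁
  have hws : ContDiff ℝ ∞ w₁ :=
    ((contDiff_coord hV 0).smul contDiff_const).sub ((contDiff_coord hV 1).smul contDiff_const)
  have hVd : Differentiable ℝ V := hV.differentiable (by simp)
  have hsymm : ∀ a ∈ (univ : Set Plane), ∀ x y, fderiv ℝ w₁ a x y = fderiv ℝ w₁ a y x := by
    intro a _ x y
    have h0 : ∀ i : Fin 2, HasFDerivAt (fun p => V p i)
        ((EuclideanSpace.proj (𝕜 := ℝ) i).comp (fderiv ℝ V a)) a := fun i =>
      (EuclideanSpace.proj (𝕜 := ℝ) i).hasFDerivAt.comp a (hVd a).hasFDerivAt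
    have h1 : fderiv ℝ w₁ a = _ := (((h0 0).smul_const (EuclideanSpace.proj (𝕜 := ℝ) (1 : Fin 2))).sub
      ((h0 1).smul_const (EuclideanSpace.proj (𝕜 := ℝ) (0 : Fin 2)))).fderiv
    have h2 := hdiv a
    simp only [surfaceDivergence, Fin.sum_univ_two] at h2
    have h3 : ∀ w : Plane, ∀ i, fderiv ℝ V a w i =
        w 0 * fderiv ℝ V a (EuclideanSpace.single 0 1) i +
          w 1 * fderiv ℝ V a (EuclideanSpace.single 1 1) i := fun w i => by
      nth_rewrite 1 [plane_eq w]
      simp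
    rw [h1]
    simp only [sub_apply, ContinuousLinearMap.smulRight_apply, ContinuousLinearMap.comp_apply,
      PiLp.proj_apply, smul_apply, smul_eq_mul]
    rw [h3 x 0, h3 x 1, h3 y 0, h3 y 1]
    linear_combination (x 0 * y 1 - x 1 * y 0) * h2
  obtain ⟨f, hf⟩ := convex_univ.exists_forall_hasFDerivAt_of_fderiv_symmetric isOpen_univ
    (hws.differentiable (by simp)).differentiableOn hsymm
  have hfd : ∀ p, fderiv ℝ (fun p => f p - f 0) p = w₁ p := fun p =>
    ((hf p (mem_univ p)).sub_const _).fderiv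
  refine ⟨fun p => f p - f 0, ?_, by simp, ?_, fun p => ?_⟩
  · rw [contDiff_infty_iff_fderiv]
    refine ⟨fun p => ((hf p (mem_univ p)).sub_const _).differentiableAt, ?_⟩
    rw [funext hfd]
    exact hws
  · funext p
    ext i
    fin_cases i <;> simp [hfd, hw₁]
  · rw [hfd]
    refine ContinuousLinearMap.opNorm_le_bound _ (norm_nonneg _) fun w => ?_
    have : w₁ p w = inner ℝ (!₂[-V p 1, V p 0] : Plane) w := by
      rw [inner_plane]; simp [hw₁]; ring
    rw [this]
    refine (norm_inner_le_norm _ _).trans_eq ?_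
    congr 1
    rw [EuclideanSpace.norm_eq, EuclideanSpace.norm_eq]
    simp [Fin.sum_univ_two, add_comm]

/-- Integrating the gradient bound along a ray would give logarithmic growth. The square root is
cruder, has a convenient derivative for the comparison, and is enough for the cutoff argument. -/
lemma abs_streamFunction_le {g : Plane → ℝ} (hg : ContDiff ℝ ∞ g) (h0 : g 0 = 0) {K : ℝ}
    (hK : ∀ p, ‖fderiv ℝ g p‖ ≤ K * (1 + ‖p‖)⁻¹) (p : Plane) : |g p| ≤ 2 * K * √(1 + ‖p‖) := by
  have hK0 : 0 ≤ K := by simpa using (norm_nonneg _).trans (hK 0)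
  have hpos : ∀ t ∈ Icc (0 : ℝ) 1, 1 ≤ 1 + t * ‖p‖ := fun t ht => by
    have := mul_nonneg ht.1 (norm_nonneg p)
    linarith
  have hgd : ∀ t : ℝ, HasDerivAt (fun t : ℝ => g (t • p)) (fderiv ℝ g (t • p) p) t := fun t => by
    have h1 : HasDerivAt (fun t : ℝ => t • p) p t := by
      simpa using (hasDerivAt_id t).smul_const p
    exact (hg.differentiable (by simp) _).hasFDerivAt.comp_hasDerivAt t h1
  have hBd : ∀ t ∈ Icc (0 : ℝ) 1, HasDerivAt (fun t : ℝ => 2 * K * √(1 + t * ‖p‖))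
      (2 * K * (‖p‖ / (2 * √(1 + t * ‖p‖)))) t := fun t ht => by
    have h1 : HasDerivAt (fun t : ℝ => 1 + t * ‖p‖) ‖p‖ t := by
      simpa using ((hasDerivAt_id t).mul_const ‖p‖).const_add 1
    exact (h1.sqrt (by linarith [hpos t ht])).const_mul _
  have key := image_norm_le_of_norm_deriv_right_le_deriv_boundary'
    (f := fun t : ℝ => g (t • p)) (f' := fun t => fderiv ℝ g (t • p) p) (a := 0) (b := 1)
    (fun t _ => (hgd t).continuousAt.continuousWithinAt) (fun t _ => (hgd t).hasDerivWithinAt)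
    (B := fun t => 2 * K * √(1 + t * ‖p‖)) (by simpa [h0] using hK0)
    (fun t ht => (hBd t ht).continuousAt.continuousWithinAt)
    (fun t ht => (hBd t (Ico_subset_Icc_self ht)).hasDerivWithinAt) (fun t ht => ?_)
    (right_mem_Icc.2 zero_le_one)
  · simpa using key
  · have h1 := hpos t (Ico_subset_Icc_self ht)
    refine ((fderiv ℝ g (t • p)).le_opNorm p).trans ?_
    have h2 : ‖t • p‖ = t * ‖p‖ := by rw [norm_smul, Real.norm_eq_abs, abs_of_nonneg ht.1]
    have h3 := hK (t • p)
    rw [h2] at h3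
    have h4 : √(1 + t * ‖p‖) ≤ 1 + t * ‖p‖ := by
      rw [Real.sqrt_le_left (by linarith)]; nlinarith
    have h5 : 0 < √(1 + t * ‖p‖) := Real.sqrt_pos.2 (by linarith)
    have h6 : (1 + t * ‖p‖)⁻¹ ≤ (√(1 + t * ‖p‖))⁻¹ := inv_anti₀ h5 h4
    calc ‖fderiv ℝ g (t • p)‖ * ‖p‖ ≤ (K * (√(1 + t * ‖p‖))⁻¹) * ‖p‖ := by
          gcongr
          exact h3.trans (by gcongr)
      _ = _ := by field_simp

/-! ### The force balance tested with divergence free fields -/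

namespace IsRegularField

variable {Γ : Set Plane} {C : ℝ} {u : Space → Space}

lemma continuousOn_surfaceStress (hu : IsRegularField Γ C u) (hΓ : IsClosed Γ) :
    ContinuousOn (surfaceStress u) Γᶜ := by
  have h1 : ContinuousOn (fun p => fderivWithin ℝ u closedHalfSpace (embed p) vertical) Γᶜ :=
    ((hu.continuousOn_fderivWithin hΓ).clm_apply continuousOn_const).comp
      continuous_embed.continuousOn fun p hp => embed_mem_diff hp
  exact (continuous_horizontal.comp_continuousOn h1).neg

lemma norm_surfaceStress_le (hu : IsRegularField Γ C u) (hΓ : IsClosed Γ) {p : Plane} (hp : p ∉ Γ) :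
    ‖surfaceStress u p‖ ≤ 2 * C * (1 + ‖p‖)⁻¹ ^ 2 * (1 + (√(Metric.infDist p Γ))⁻¹) := by
  have h1 := hu.norm_fderivWithin_le hΓ (embed_mem p) (by rwa [horizontal_embed])
  rw [horizontal_embed, norm_embed] at h1
  refine le_trans ?_ h1
  rw [surfaceStress, norm_neg]
  refine (norm_horizontal_le _).trans ?_
  simpa using (fderivWithin ℝ u closedHalfSpace (embed p)).le_opNorm vertical

end IsRegularField

lemma aestronglyMeasurable_of_continuousOn_compl {F : Type*} [NormedAddCommGroup F] {f : Plane → F}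
    {Γ : Set Plane} (hΓ : IsClosed Γ) (h0 : volume Γ = 0) (hf : ContinuousOn f Γᶜ)
    [SecondCountableTopologyEither Plane F] : AEStronglyMeasurable f := by
  have h1 := hf.aestronglyMeasurable hΓ.measurableSet.compl (μ := volume)
  have h2 : ∀ᵐ p : Plane, p ∈ Γᶜ := measure_eq_zero_iff_ae_notMem.1 h0
  rwa [Measure.restrict_eq_self_of_ae_mem h2] at h1

lemma lineTension_congr {Ω : Set Plane} {m : ℕ} {γ : Fin m → ℝ → Plane} {f g : Plane → ℝ}
    (h : ∀ i s, f (γ i s) = g (γ i s)) : lineTension Ω γ f = lineTension Ω γ g := by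
  simp only [lineTension, h]

/-- The force balance in a weak form, without the surface pressure. -/
theorem ForceBalance.integral_inner_eq {Ω : Set Plane} {m : ℕ} {γ : Fin m → ℝ → Plane}
    (hγ : IsCurveSystem γ) {C : ℝ} {u : Space → Space}
    (hu : IsRegularField (⋃ i, range (γ i)) C u) {ϖ : Plane → ℝ} (h : ForceBalance ϖ u Ω γ)
    {v : Space → Space} (hv : v ∈ eulerFields) :
    (∫ p, inner ℝ (surfaceStress u p) (trace v p)) +
      ∑ j, lineTension Ω γ (fun p => trace v p j) j = 0 := by
  obtain ⟨K, -, -, hK0, -⟩ := eulerFields.exists_bounds hv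
  set Γ := ⋃ i, range (γ i) with hΓdef
  have hΓc : IsCompact Γ := hγ.isCompact_iUnion_range
  have hΓ : IsClosed Γ := hΓc.isClosed
  have hΓ0 : volume Γ = 0 := hγ.volume_iUnion_range
  have hC := hu.const_nonneg
  set V := trace v with hVdef
  have hVK : ∀ p, ‖V p‖ ≤ K * (1 + ‖p‖)⁻¹ := fun p => by
    refine (eulerFields.norm_trace_le p).trans ?_
    simpa using hK0 _ (embed_mem p)
  have hVs : ContDiff ℝ ∞ V := eulerFields.contDiff_trace hv
  obtain ⟨g, hgs, hg0, hgV, hgd⟩ := exists_streamFunction hVs fun p =>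
    hv.surfaceDivergence_eq_zero p (notMem_empty p)
  have hgb := abs_streamFunction_le hgs hg0 fun p => (hgd p).trans (hVK p)
  obtain ⟨χ, A, hA, hχs, hχc, hχ01, hχd, hχ1⟩ := exists_cutoff (E := Plane)
  -- Cutting off the stream function instead of the field keeps the truncated fields divergence
  -- free.
  set W : ℕ → Plane → Plane := fun n => perpGrad fun p => χ n p * g p with hW
  have hprods : ∀ n, ContDiff ℝ ∞ fun p => χ n p * g p := fun n => (hχs n).mul hgs
  have hWs : ∀ n, ContDiff ℝ ∞ (W n) := fun n => contDiff_perpGrad (hprods n)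
  have hWc : ∀ n, HasCompactSupport (W n) := fun n =>
    hasCompactSupport_perpGrad ((hχc n).mul_right (f' := g))
  have hWic : ∀ n i, HasCompactSupport fun p => W n p i := fun n i =>
    (hWc n).comp_left (g := fun w : Plane => w i) rfl
  -- the force balance for the truncated fields
  have hbal : ∀ n, ∑ i, ((∫ p, surfaceStress u p i * W n p i) +
      lineTension Ω γ (fun p => W n p i) i) = 0 := fun n => by
    simp only [← h _ (contDiff_coord (hWs n) _) (hWic n _), Fin.sum_univ_two]
    -- The two pressure terms combine to the integral of `ϖ` against the divergence of `W n`, which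
    -- is zero.
    have : ∀ p, ϖ p * fderiv ℝ (fun p => W n p 1) p (EuclideanSpace.single 1 1) =
        -(ϖ p * fderiv ℝ (fun p => W n p 0) p (EuclideanSpace.single 0 1)) := fun p => by
      rw [hW, fderiv_perpGrad (hprods n), mul_neg]
    simp_rw [this]
    rw [integral_neg]
    ring
  have hWeq : ∀ R : ℝ, ∀ᶠ n in atTop, ∀ p : Plane, ‖p‖ < R → W n p = V p := fun R => by
    filter_upwards [hχ1 R] with n hn p hp
    have h1 : (fun p => χ n p * g p) =ᶠ[𝓝 p] g := by
      filter_upwards [hn p hp] with q hq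
      rw [hq, one_mul]
    rw [← hgV]
    ext i
    fin_cases i <;> simp [hW, perpGrad, h1.fderiv_eq]
  -- The worst term is the stream function times the gradient of the cutoff, of order `√(1 + ‖p‖) /
  -- (1 + ‖p‖)`.
  have hWb : ∀ n p i, |W n p i| ≤ (K + 2 * K * A) * (√(1 + ‖p‖))⁻¹ := fun n p i => by
    have h1 : ‖fderiv ℝ (fun p => χ n p * g p) p‖ ≤ (K + 2 * K * A) * (√(1 + ‖p‖))⁻¹ := by
      have h2 : fderiv ℝ (fun p => χ n p * g p) p = χ n p • fderiv ℝ g p + g p • fderiv ℝ (χ n) p :=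
        fderiv_fun_mul ((hχs n).differentiable (by simp) p) (hgs.differentiable (by simp) p)
      have h5 : 0 < √(1 + ‖p‖) := Real.sqrt_pos.2 (by positivity)
      have h6 : √(1 + ‖p‖) * (1 + ‖p‖)⁻¹ = (√(1 + ‖p‖))⁻¹ := by
        have := Real.sq_sqrt (show 0 ≤ 1 + ‖p‖ by positivity)
        have h0 : 1 + ‖p‖ ≠ 0 := by positivity
        field_simp
        exact this
      have h7 : (1 + ‖p‖)⁻¹ ≤ (√(1 + ‖p‖))⁻¹ := by
        refine inv_anti₀ h5 ?_
        rw [Real.sqrt_le_left (by positivity)]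
        nlinarith [norm_nonneg p]
      have hKn : (0 : ℝ) ≤ K := K.2
      have hχ1' : |χ n p| ≤ 1 := by
        rw [abs_of_nonneg (hχ01 n p).1]; exact (hχ01 n p).2
      rw [h2]
      calc _ ≤ |χ n p| * ‖fderiv ℝ g p‖ + |g p| * ‖fderiv ℝ (χ n) p‖ := by
            refine (norm_add_le _ _).trans ?_
            rw [norm_smul, norm_smul, Real.norm_eq_abs, Real.norm_eq_abs]
        _ ≤ 1 * (K * (√(1 + ‖p‖))⁻¹) + (2 * K * √(1 + ‖p‖)) * (A * (1 + ‖p‖)⁻¹) := by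
            gcongr
            · exact (hgd p).trans ((hVK p).trans (by gcongr))
            · exact hgb p
            · exact hχd n p
        _ = K * (√(1 + ‖p‖))⁻¹ + 2 * K * A * (√(1 + ‖p‖) * (1 + ‖p‖)⁻¹) := by ring
        _ = _ := by rw [h6]; ring
    have h3 : ∀ j : Fin 2, |fderiv ℝ (fun p => χ n p * g p) p (EuclideanSpace.single j 1)| ≤
        ‖fderiv ℝ (fun p => χ n p * g p) p‖ := fun j => by
      simpa using (fderiv ℝ (fun p => χ n p * g p) p).le_opNorm (EuclideanSpace.single j 1)
    fin_cases i
    · exact (h3 1).trans h1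
    · simp only [hW]
      exact (abs_neg _).trans_le ((h3 0).trans h1)
  have hSm : ∀ i : Fin 2, AEStronglyMeasurable fun p => surfaceStress u p i := fun i =>
    aestronglyMeasurable_of_continuousOn_compl hΓ hΓ0
      ((EuclideanSpace.proj (𝕜 := ℝ) i).continuous.comp_continuousOn
        (hu.continuousOn_surfaceStress hΓ))
  have hae : ∀ᵐ p : Plane, p ∉ Γ := measure_eq_zero_iff_ae_notMem.1 hΓ0
  -- The stress contributes decay of order `2` and the truncated fields `1 / 2`; the total `5 / 2`
  -- exceeds the dimension of the plane.
  set D : Plane → ℝ := fun p => 2 * C * (K + 2 * K * A) *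
    ((1 + ‖p‖) ^ (-(5 / 2) : ℝ) * (1 + (√(Metric.infDist p Γ))⁻¹)) with hD
  have hDint : Integrable D := (integrable_plane_weight_rpow hγ (by norm_num)).const_mul _
  have hdom : ∀ i (x : Plane → ℝ), (∀ p, |x p| ≤ (K + 2 * K * A) * (√(1 + ‖p‖))⁻¹) →
      ∀ᵐ p, ‖surfaceStress u p i * x p‖ ≤ D p := fun i x hx => by
    filter_upwards [hae] with p hp
    have h1 : |surfaceStress u p i| ≤ _ :=
      (PiLp.norm_apply_le (surfaceStress u p) i).trans (hu.norm_surfaceStress_le hΓ hp)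
    have h2 : (1 + ‖p‖)⁻¹ ^ 2 * (√(1 + ‖p‖))⁻¹ = (1 + ‖p‖) ^ (-(5 / 2) : ℝ) := by
      rw [inv_pow_eq_rpow 2 (by positivity), Real.sqrt_eq_rpow, ← Real.rpow_neg (by positivity),
        ← Real.rpow_add (by positivity)]
      norm_num
    rw [norm_mul, Real.norm_eq_abs, Real.norm_eq_abs]
    calc _ ≤ (2 * C * (1 + ‖p‖)⁻¹ ^ 2 * (1 + (√(Metric.infDist p Γ))⁻¹)) *
          ((K + 2 * K * A) * (√(1 + ‖p‖))⁻¹) := mul_le_mul h1 (hx p) (abs_nonneg _) (by positivity)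
      _ = 2 * C * (K + 2 * K * A) * (((1 + ‖p‖)⁻¹ ^ 2 * (√(1 + ‖p‖))⁻¹) *
          (1 + (√(Metric.infDist p Γ))⁻¹)) := by ring
      _ = D p := by rw [h2]
  have hVb : ∀ i p, |V p i| ≤ (K + 2 * K * A) * (√(1 + ‖p‖))⁻¹ := fun i p => by
    obtain ⟨n, hn⟩ := (hWeq (‖p‖ + 1)).exists
    rw [← hn p (by linarith)]
    exact hWb n p i
  have hlim : ∀ i, Tendsto (fun n => ∫ p, surfaceStress u p i * W n p i) atTop
      (𝓝 (∫ p, surfaceStress u p i * V p i)) := fun i => by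
    refine tendsto_integral_of_dominated_convergence D (fun n => (hSm i).mul
      (contDiff_coord (hWs n) i).continuous.aestronglyMeasurable) hDint
      (fun n => hdom i _ fun p => hWb n p i) (Eventually.of_forall fun p => ?_)
    refine tendsto_const_nhds.congr' ?_
    filter_upwards [hWeq (‖p‖ + 1)] with n hn
    rw [hn p (by linarith)]
  have hLT : ∀ᶠ n in atTop, ∀ i, lineTension Ω γ (fun p => W n p i) i =
      lineTension Ω γ (fun p => V p i) i := by
    obtain ⟨R, hR⟩ := hΓc.isBounded.exists_norm_le
    filter_upwards [hWeq (R + 1)] with n hn i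
    have : ∀ k s, W n (γ k s) i = V (γ k s) i := fun k s => by
      rw [hn (γ k s) (by linarith [hR (γ k s) (mem_iUnion.2 ⟨k, s, rfl⟩)])]
    exact congrArg (fun w : Plane => w i)
      (lineTension_congr (f := fun p => W n p i) (g := fun p => V p i) this)
  have hzero : ∑ i, ((∫ p, surfaceStress u p i * V p i) + lineTension Ω γ (fun p => V p i) i) = 0 := by
    have h1 : Tendsto (fun n => ∑ i, ((∫ p, surfaceStress u p i * W n p i) +
        lineTension Ω γ (fun p => V p i) i)) atTop
        (𝓝 (∑ i, ((∫ p, surfaceStress u p i * V p i) + lineTension Ω γ (fun p => V p i) i))) :=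
      tendsto_finsetSum _ fun i _ => (hlim i).add_const _
    refine tendsto_nhds_unique h1 (tendsto_const_nhds.congr' ?_)
    filter_upwards [hLT] with n hn
    rw [← hbal n]
    exact Finset.sum_congr rfl fun i _ => by rw [hn i]
  rw [Finset.sum_add_distrib] at hzero
  rw [← hzero, ← integral_finsetSum]
  · congr 2
    funext p
    rw [inner_plane, Fin.sum_univ_two]
  · intro i _
    exact hDint.mono' ((hSm i).mul (contDiff_coord hVs i).continuous.aestronglyMeasurable)
      (hdom i _ fun p => hVb i p)

/-! ### Uniqueness of trajectories -/

/-- Osgood's uniqueness criterion for a logarithmic modulus of continuity. -/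
lemma osgood_unique {E : Type*} [NormedAddCommGroup E] [NormedSpace ℝ E] {f f' : ℝ → E} {b M : ℝ}
    (hb : 0 ≤ b) (hM : 0 < M) (hf : ContinuousOn f (Icc 0 b))
    (hf' : ∀ t ∈ Ico 0 b, HasDerivWithinAt f (f' t) (Ici t) t) (h0 : f 0 = 0)
    (hle : ∀ t ∈ Ico 0 b, ‖f' t‖ ≤ M * (‖f t‖ * (2 + Real.log (1 + ‖f t‖⁻¹)))) : f b = 0 := by
  -- `exp (-(L exp (-3 M t)))` is a strict barrier for the logarithmic differential inequality: with
  -- `y = L exp (-3 M t)`, the inequality needed is `3 + y < 3 y`, and `y ≥ 4` is ample. Letting `L`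
  -- tend to infinity pushes the barrier to zero.
  have hbound : ∀ L : ℝ, 4 ≤ L * Real.exp (-(3 * M * b)) →
      ‖f b‖ ≤ Real.exp (-(L * Real.exp (-(3 * M * b)))) := by
    intro L hL
    have hL0 : 0 < L := by
      by_contra h
      have := Real.exp_pos (-(3 * M * b))
      nlinarith
    set y : ℝ → ℝ := fun t => L * Real.exp (-(3 * M * t)) with hy
    have hyd : ∀ t, HasDerivAt y (-(3 * M) * y t) t := fun t => by
      have h1 : HasDerivAt (fun t : ℝ => -(3 * M * t)) (-(3 * M)) t := by
        simpa using ((hasDerivAt_id t).const_mul (3 * M)).fun_neg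
      refine (h1.exp.const_mul L).congr_deriv ?_
      simp only [hy]; ring
    have hBd : ∀ t, HasDerivAt (fun t => Real.exp (-(y t))) (Real.exp (-(y t)) * (3 * M * y t)) t :=
      fun t => (hyd t).fun_neg.exp.congr_deriv (by ring)
    refine image_norm_le_of_norm_deriv_right_lt_deriv_boundary hf hf' (B := fun t => Real.exp (-(y t)))
      (by simpa [h0] using (Real.exp_pos _).le) hBd (fun t ht hft => ?_) (right_mem_Icc.2 hb)
    have hyt : 4 ≤ y t := by
      refine hL.trans ?_
      simp only [hy]
      gcongr
      exact ht.2.le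
    refine (hle t ht).trans_lt ?_
    rw [hft]
    have hlog : Real.log (1 + (Real.exp (-(y t)))⁻¹) ≤ 1 + y t := by
      rw [Real.exp_neg, inv_inv]
      have h1 : 1 + Real.exp (y t) ≤ Real.exp 1 * Real.exp (y t) := by
        have h2 : 1 ≤ Real.exp (y t) := Real.one_le_exp (by linarith)
        have h3 : 2 ≤ Real.exp 1 := by
          have := Real.add_one_le_exp 1
          linarith
        nlinarith
      calc Real.log (1 + Real.exp (y t)) ≤ Real.log (Real.exp 1 * Real.exp (y t)) :=
            Real.log_le_log (by positivity) h1
        _ = 1 + y t := by rw [← Real.exp_add, Real.log_exp]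
    have hB0 := Real.exp_pos (-(y t))
    have : M * (Real.exp (-(y t)) * (2 + Real.log (1 + (Real.exp (-(y t)))⁻¹))) ≤
        M * (Real.exp (-(y t)) * (2 + (1 + y t))) := by gcongr
    refine this.trans_lt ?_
    have h4 : M * (Real.exp (-(y t)) * (2 + (1 + y t))) = Real.exp (-(y t)) * (M * (3 + y t)) := by ring
    rw [h4]
    refine mul_lt_mul_of_pos_left ?_ hB0
    nlinarith
  have hlim : Tendsto (fun L : ℝ => Real.exp (-(L * Real.exp (-(3 * M * b))))) atTop (𝓝 0) :=
    Real.tendsto_exp_atBot.comp (tendsto_neg_atTop_atBot.comp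
      (tendsto_id.atTop_mul_const (Real.exp_pos _)))
  have hev : ∀ᶠ L : ℝ in atTop, 4 ≤ L * Real.exp (-(3 * M * b)) :=
    (tendsto_id.atTop_mul_const (Real.exp_pos _)).eventually_ge_atTop 4
  have := ge_of_tendsto hlim (hev.mono hbound)
  exact norm_le_zero_iff.1 this

/-- The modulus `s (2 + log (1 + s⁻¹))` is chosen so that its derivative is at least `1 + log (1 +
s⁻¹)`, the bound for the velocity gradient at depth `s`. -/
lemma hasDerivAt_mul_log {s : ℝ} (hs : 0 < s) :
    HasDerivAt (fun s => s * (2 + Real.log (1 + s⁻¹))) (2 + Real.log (1 + s⁻¹) - (s + 1)⁻¹) s := by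
  have h1 : HasDerivAt (fun s : ℝ => 1 + s⁻¹) (-(s ^ 2)⁻¹) s := (hasDerivAt_inv hs.ne').const_add 1
  have h2 := (h1.log (by positivity)).const_add 2
  have h3 := (hasDerivAt_id s).mul h2
  refine h3.congr_deriv ?_
  simp only [id]
  field_simp
  ring

namespace IsRegularField

variable {Γ : Set Plane} {C : ℝ} {u : Space → Space}

lemma norm_fderiv_le_log (hu : IsRegularField Γ C u) {x : Space} (hx : x ∈ halfSpace) :
    ‖fderiv ℝ u x‖ ≤ C * (1 + Real.log (1 + |x 2|⁻¹)) := by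
  have hx' : x 2 < 0 := hx
  have h1 := hu.bound_one x (mem_diff_of_mem_halfSpace hx)
  rw [fderivWithin_closedHalfSpace u hx] at h1
  have hd : 0 ≤ (interfaceDist Γ x)⁻¹ := inv_nonneg.2 Metric.infDist_nonneg
  have hlog0 : 0 ≤ Real.log (1 + (interfaceDist Γ x)⁻¹) := Real.log_nonneg (by linarith)
  have hlog : Real.log (1 + (interfaceDist Γ x)⁻¹) ≤ Real.log (1 + |x 2|⁻¹) :=
    Real.log_le_log (by positivity) (by linarith [inv_interfaceDist_le Γ hx'.ne])
  have hw : (1 + ‖x‖)⁻¹ ^ 2 ≤ 1 :=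
    pow_le_one₀ (by positivity) (inv_le_one_of_one_le₀ (by linarith [norm_nonneg x]))
  have hC := hu.const_nonneg
  calc ‖fderiv ℝ u x‖ ≤ C * (1 + ‖x‖)⁻¹ ^ 2 * (1 + Real.log (1 + (interfaceDist Γ x)⁻¹)) := h1
    _ ≤ C * 1 * (1 + Real.log (1 + |x 2|⁻¹)) := by gcongr
    _ = _ := by ring

/-- The gradient is not controlled at the boundary itself, as `p` may lie on the interface. The
estimate is made from depth `ε` to depth `r`, and `ε` tends to zero by continuity of `u`. -/
lemma norm_sub_vertical_le (hu : IsRegularField Γ C u) (p : Plane) {r : ℝ} (hr : 0 < r) :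
    ‖u (join (p, -r)) - u (embed p)‖ ≤ C * (r * (2 + Real.log (1 + r⁻¹))) := by
  have hC := hu.const_nonneg
  set B : ℝ → ℝ := fun s => s * (2 + Real.log (1 + s⁻¹)) with hB
  have hB0 : ∀ s, 0 < s → 0 ≤ B s := fun s hs => by
    have : 0 ≤ Real.log (1 + s⁻¹) := Real.log_nonneg (by linarith [inv_pos.2 hs])
    simp only [hB]; positivity
  have hudiff : ∀ t, 0 < t → HasDerivAt (fun t : ℝ => u (join (p, -t)))
      (fderiv ℝ u (join (p, -t)) (-vertical)) t := fun t ht => by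
    have h1 : DifferentiableAt ℝ u (join (p, -t)) :=
      (hu.contDiffOn_halfSpace.differentiableOn (by simp)).differentiableAt
        (isOpen_halfSpace.mem_nhds (join_neg_mem p ht))
    exact h1.hasFDerivAt.comp_hasDerivAt t (hasDerivAt_join_neg p t)
  have hstep : ∀ ε ∈ Ioc 0 r, ‖u (join (p, -r)) - u (join (p, -ε))‖ ≤ C * B r := fun ε hε => by
    have hBd : ∀ t ∈ Icc ε r, HasDerivAt (fun t => C * (B t - B ε))
        (C * (2 + Real.log (1 + t⁻¹) - (t + 1)⁻¹)) t := fun t ht =>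
      ((hasDerivAt_mul_log (hε.1.trans_le ht.1)).sub_const _).const_mul C
    have key := image_norm_le_of_norm_deriv_right_le_deriv_boundary'
      (f := fun t => u (join (p, -t)) - u (join (p, -ε)))
      (f' := fun t => fderiv ℝ u (join (p, -t)) (-vertical)) (a := ε) (b := r)
      (fun t ht => ((hudiff t (hε.1.trans_le ht.1)).sub_const _).continuousAt.continuousWithinAt)
      (fun t ht => ((hudiff t (hε.1.trans_le ht.1)).sub_const _).hasDerivWithinAt)
      (B := fun t => C * (B t - B ε)) (by simp)
      (fun t ht => (hBd t ht).continuousAt.continuousWithinAt)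
      (fun t ht => (hBd t (Ico_subset_Icc_self ht)).hasDerivWithinAt) (fun t ht => ?_)
      (right_mem_Icc.2 hε.2)
    · refine (show ‖u (join (p, -r)) - u (join (p, -ε))‖ ≤ C * (B r - B ε) from key).trans ?_
      have := hB0 ε hε.1
      gcongr
      linarith
    · have ht0 : 0 < t := hε.1.trans_le ht.1
      refine ((fderiv ℝ u (join (p, -t))).le_opNorm _).trans ?_
      rw [norm_neg, norm_vertical, mul_one]
      refine (hu.norm_fderiv_le_log (join_neg_mem p ht0)).trans ?_
      rw [show |join (p, -t) 2| = t by simp [abs_of_pos ht0]]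
      have : (t + 1)⁻¹ ≤ 1 := inv_le_one_of_one_le₀ (by linarith)
      refine mul_le_mul_of_nonneg_left ?_ hC
      linarith
  have hlim : Tendsto (fun ε : ℝ => ‖u (join (p, -r)) - u (join (p, -ε))‖) (𝓝[>] 0)
      (𝓝 ‖u (join (p, -r)) - u (embed p)‖) := by
    have hj0 : Tendsto (fun s : ℝ => join (p, -s)) (𝓝[>] 0) (𝓝 (embed p)) := by
      have : Continuous fun s : ℝ => join (p, -s) := continuous_join.comp (by fun_prop)
      have := (this.tendsto 0).mono_left (nhdsWithin_le_nhds (s := Ioi 0))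
      simpa [join] using this
    have hj : Tendsto (fun s : ℝ => join (p, -s)) (𝓝[>] 0) (𝓝[closedHalfSpace] (embed p)) := by
      refine tendsto_nhdsWithin_iff.2 ⟨hj0, ?_⟩
      filter_upwards [self_mem_nhdsWithin] with s hs
      exact halfSpace_subset (join_neg_mem p hs)
    exact (tendsto_const_nhds.sub ((hu.continuousOn _ (embed_mem p)).tendsto.comp hj)).norm
  refine le_of_tendsto hlim ?_
  filter_upwards [Ioc_mem_nhdsGT hr] with ε hε
  exact hstep ε hε

/-- The surface velocity is log-Lipschitz. -/
lemma norm_trace_sub_le (hu : IsRegularField Γ C u) (p q : Plane) :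
    ‖trace u p - trace u q‖ ≤
      3 * C * (‖p - q‖ * (2 + Real.log (1 + ‖p - q‖⁻¹))) := by
  have hC := hu.const_nonneg
  rcases (norm_nonneg (p - q)).eq_or_lt with h0 | h0
  · have : p = q := sub_eq_zero.1 (norm_eq_zero.1 h0.symm)
    simp [this]
  set r := ‖p - q‖ with hr
  have h1 : ‖trace u p - trace u q‖ ≤ ‖u (embed p) - u (embed q)‖ := by
    rw [trace, trace, ← horizontal_sub]; exact norm_horizontal_le _
  refine h1.trans ?_
  have hconv : Convex ℝ {x : Space | x 2 ≤ -r} :=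
    convex_halfSpace_le (EuclideanSpace.proj (𝕜 := ℝ) (2 : Fin 3)).isLinear _
  have hsub : ∀ x ∈ {x : Space | x 2 ≤ -r}, x ∈ halfSpace := fun x hx => by
    have : x 2 ≤ -r := hx
    show x 2 < 0
    linarith
  -- The two boundary points are joined by going down to depth `r = ‖p - q‖`, across, and up again.
  -- Each of the three parts costs at most `C r (2 + log (1 + r⁻¹))`.
  have hhor := hconv.norm_image_sub_le_of_norm_fderiv_le (𝕜 := ℝ) (f := u)
    (C := C * (1 + Real.log (1 + r⁻¹)))
    (fun x hx => (hu.contDiffOn_halfSpace.differentiableOn (by simp)).differentiableAt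
        (isOpen_halfSpace.mem_nhds (hsub x hx))) (fun x hx => ?_)
    (show join (q, -r) ∈ {x : Space | x 2 ≤ -r} by simp)
    (show join (p, -r) ∈ {x : Space | x 2 ≤ -r} by simp)
  · have h2 : ‖join (p, -r) - join (q, -r)‖ = r := by
      rw [hr, ← norm_embed, embed_sub]; simp [join]
    rw [h2] at hhor
    have hp := hu.norm_sub_vertical_le p h0
    have hq := hu.norm_sub_vertical_le q h0
    have h3 : u (embed p) - u (embed q) = -(u (join (p, -r)) - u (embed p)) +
        (u (join (p, -r)) - u (join (q, -r))) + (u (join (q, -r)) - u (embed q)) := by abel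
    rw [h3]
    refine (norm_add₃_le).trans ?_
    rw [norm_neg]
    have : C * (1 + Real.log (1 + r⁻¹)) * r ≤ C * (r * (2 + Real.log (1 + r⁻¹))) := by
      have : 0 ≤ C * r := by positivity
      nlinarith
    linarith
  · have hx2 : x 2 ≤ -r := hx
    refine (hu.norm_fderiv_le_log (hsub x hx)).trans ?_
    have : |x 2|⁻¹ ≤ r⁻¹ := inv_anti₀ h0 (by rw [abs_of_nonpos (by linarith)]; linarith)
    gcongr

end IsRegularField

/-! ### Liouville's theorem -/

/-- The derivative of the determinant depends only on the matrix and its velocity, so it may be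
computed along any other curve with the same value and velocity. -/
lemma exists_hasDerivAt_det {n : ℕ} (A B : Matrix (Fin n) (Fin n) ℝ) :
    ∃ D : ℝ, ∀ (M : ℝ → Matrix (Fin n) (Fin n) ℝ) (t : ℝ), M t = A →
      (∀ i j, HasDerivAt (fun t => M t i j) (B i j) t) → HasDerivAt (fun t => (M t).det) D t := by
  refine ⟨∑ σ : Equiv.Perm (Fin n), ((Equiv.Perm.sign σ : ℤ) : ℝ) *
    ∑ i, (∏ j ∈ Finset.univ.erase i, A (σ j) j) • B (σ i) i, fun M t hM hd => ?_⟩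
  simp_rw [Matrix.det_apply']
  refine HasDerivAt.fun_sum fun σ _ => HasDerivAt.const_mul _ ?_
  rw [← hM]
  exact HasDerivAt.fun_finsetProd fun i _ => hd (σ i) i

/-- The curve `h ↦ (1 + h L) M(t)` has the same value and velocity, and its determinant is `(1 + h
tr L + O(h²)) det M(t)`. -/
lemma hasDerivAt_det_of_trace_eq_zero {n : ℕ} {M : ℝ → Matrix (Fin n) (Fin n) ℝ}
    {L : Matrix (Fin n) (Fin n) ℝ} {t : ℝ} (hL : L.trace = 0)
    (hM : ∀ i j, HasDerivAt (fun t => M t i j) ((L * M t) i j) t) :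
    HasDerivAt (fun t => (M t).det) 0 t := by
  obtain ⟨D, hD⟩ := exists_hasDerivAt_det (M t) (L * M t)
  have h1 := hD M t rfl hM
  have h2 := hD (fun h => (1 + h • L) * M t) 0 (by simp) fun i j => by
    have : ∀ h : ℝ, ((1 + h • L) * M t) i j = M t i j + h * (L * M t) i j := fun h => by
      rw [add_mul, one_mul, smul_mul_assoc]; rfl
    simp_rw [this]
    simpa using ((hasDerivAt_id (0 : ℝ)).mul_const ((L * M t) i j)).const_add (M t i j)
  have h3 : HasDerivAt (fun h : ℝ => ((1 + h • L) * M t).det) 0 0 := by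
    simp only [fun h : ℝ => Matrix.det_mul (1 + h • L) (M t)]
    simp only [fun h : ℝ => Matrix.det_one_add_smul h L, hL]
    set q := (Matrix.det (1 + (Polynomial.X : Polynomial ℝ) • L.map Polynomial.C)).divX.divX
    have h4 : HasDerivAt (fun h : ℝ => 1 + 0 * h + q.eval h * h ^ 2) 0 0 := by
      have h5 := (q.hasDerivAt (0 : ℝ)).fun_mul (hasDerivAt_pow 2 (0 : ℝ))
      have h6 := ((hasDerivAt_id (0 : ℝ)).const_mul 0).const_add 1
      exact (h6.add h5).congr_deriv (by simp)
    exact (h4.mul_const _).congr_deriv (by simp)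
  rwa [h2.unique h3] at h1

lemma det_eq_matrix_det {n : ℕ} (A : EuclideanSpace ℝ (Fin n) →L[ℝ] EuclideanSpace ℝ (Fin n)) :
    A.det = (Matrix.of fun i j => A (EuclideanSpace.single j 1) i).det := by
  rw [ContinuousLinearMap.det, ← LinearMap.det_toMatrix (EuclideanSpace.basisFun (Fin n) ℝ).toBasis]
  congr 1

/-- The flow of a divergence free field has Jacobian determinant one. -/
theorem det_fderiv_eq_one {n : ℕ} {U : Set (EuclideanSpace ℝ (Fin n))} (hU : IsOpen U) {T : ℝ}
    {F u : ℝ → EuclideanSpace ℝ (Fin n) → EuclideanSpace ℝ (Fin n)}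
    (hF : ContDiffOn ℝ ∞ (fun q : ℝ × EuclideanSpace ℝ (Fin n) => F q.1 q.2) (Ico 0 T ×ˢ U))
    {x : EuclideanSpace ℝ (Fin n)} (hx : x ∈ U)
    (hflow : ∀ t ∈ Ioo 0 T, ∀ y ∈ U, HasDerivAt (fun τ => F τ y) (u t (F t y)) t)
    (hu : ∀ t ∈ Ioo 0 T, DifferentiableAt ℝ (u t) (F t x))
    (hdiv : ∀ t ∈ Ioo 0 T, ∑ i, fderiv ℝ (u t) (F t x) (EuclideanSpace.single i 1) i = 0)
    (h0 : ∀ y ∈ U, F 0 y = y) {t : ℝ} (ht : t ∈ Ico 0 T) : (fderiv ℝ (F t) x).det = 1 := by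
  set G : ℝ × EuclideanSpace ℝ (Fin n) → EuclideanSpace ℝ (Fin n) := fun q => F q.1 q.2 with hG
  set e : Fin n → EuclideanSpace ℝ (Fin n) := fun i => EuclideanSpace.single i 1 with he
  -- the spatial derivative
  have hslice : ∀ τ ∈ Ico 0 T, ∀ y ∈ U, HasFDerivAt (F τ)
      ((fderivWithin ℝ G (Ico 0 T ×ˢ U) (τ, y)).comp
        (ContinuousLinearMap.inr ℝ ℝ (EuclideanSpace ℝ (Fin n)))) y := by
    intro τ hτ y hy
    have h1 := (hF.differentiableOn (by simp) (τ, y) ⟨hτ, hy⟩).hasFDerivWithinAt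
    have h2 : HasFDerivWithinAt (fun y : EuclideanSpace ℝ (Fin n) => (τ, y))
        (ContinuousLinearMap.inr ℝ ℝ (EuclideanSpace ℝ (Fin n))) U y :=
      (hasFDerivAt_prodMk_right τ y).hasFDerivWithinAt
    have h3 := h1.comp y h2 fun z hz => ⟨hτ, hz⟩
    exact h3.hasFDerivAt (hU.mem_nhds hy)
  set M : ℝ → Matrix (Fin n) (Fin n) ℝ := fun τ => Matrix.of fun i j => fderiv ℝ (F τ) x (e j) i
    with hM
  have hdet : ∀ τ, (fderiv ℝ (F τ) x).det = (M τ).det := fun τ => det_eq_matrix_det _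
  rw [hdet]
  have hcont : ContinuousOn (fun τ => (M τ).det) (Ico 0 T) := by
    have hunique : UniqueDiffOn ℝ (Ico 0 T ×ˢ U) :=
      (uniqueDiffOn_Ico 0 T).prod hU.uniqueDiffOn
    have h1 : ContinuousOn (fun τ => fderivWithin ℝ G (Ico 0 T ×ˢ U) (τ, x)) (Ico 0 T) :=
      (hF.continuousOn_fderivWithin hunique (by simp)).comp
        (by fun_prop) fun τ hτ => ⟨hτ, hx⟩
    have h2 : ∀ i j, ContinuousOn (fun τ => M τ i j) (Ico 0 T) := fun i j => by
      have h3 : ContinuousOn (fun τ => fderivWithin ℝ G (Ico 0 T ×ˢ U) (τ, x) (0, e j) i) (Ico 0 T) :=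
        (EuclideanSpace.proj (𝕜 := ℝ) i).continuous.comp_continuousOn
          (h1.clm_apply continuousOn_const)
      refine h3.congr fun τ hτ => ?_
      show fderiv ℝ (F τ) x (e j) i = _
      rw [(hslice τ hτ x hx).fderiv]
      simp
    simp_rw [Matrix.det_apply']
    exact continuousOn_finsetSum _ fun σ _ => continuousOn_const.mul
      (continuousOn_finsetProd _ fun i _ => h2 _ _)
  have hderiv : ∀ τ ∈ Ioo 0 T, HasDerivAt (fun τ => (M τ).det) 0 τ := by
    intro τ hτ
    set L : Matrix (Fin n) (Fin n) ℝ :=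
      Matrix.of fun i j => fderiv ℝ (u τ) (F τ x) (e j) i with hL
    refine hasDerivAt_det_of_trace_eq_zero (L := L) (hdiv τ hτ) fun i j => ?_
    have hopen : IsOpen (Ioo 0 T ×ˢ U) := isOpen_Ioo.prod hU
    have hGo : ContDiffOn ℝ ∞ G (Ioo 0 T ×ˢ U) :=
      hF.mono (prod_mono Ioo_subset_Ico_self Subset.rfl)
    have hfd : ∀ σ ∈ Ioo 0 T, ∀ y ∈ U, HasFDerivAt G (fderiv ℝ G (σ, y)) (σ, y) :=
      fun σ hσ y hy => ((hGo.differentiableOn (by simp)).differentiableAt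
        (hopen.mem_nhds ⟨hσ, hy⟩)).hasFDerivAt
    have hGat : ContDiffAt ℝ ∞ G (τ, x) := hGo.contDiffAt (hopen.mem_nhds ⟨hτ, hx⟩)
    have hspace : ∀ σ ∈ Ioo 0 T, ∀ w, fderiv ℝ (F σ) x w = fderiv ℝ G (σ, x) (0, w) := by
      intro σ hσ w
      have h3 : HasFDerivAt (F σ) _ x := (hfd σ hσ x hx).comp x (hasFDerivAt_prodMk_right σ x)
      rw [h3.fderiv]
      simp
    have htime : ∀ y ∈ U, fderiv ℝ G (τ, y) (1, 0) = u τ (F τ y) := by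
      intro y hy
      have h3 := (hfd τ hτ y hy).comp_hasDerivAt τ ((hasDerivAt_id' τ).prodMk (hasDerivAt_const τ y))
      exact h3.unique (hflow τ hτ y hy)
    have hd2 : DifferentiableAt ℝ (fderiv ℝ G) (τ, x) :=
      (hGat.fderiv_right (m := 1) (by norm_cast)).differentiableAt (by simp)
    have hmain : HasDerivAt (fun σ => fderiv ℝ G (σ, x) (0, e j))
        (fderiv ℝ (fderiv ℝ G) (τ, x) (1, 0) (0, e j)) τ := by
      have h4 : HasDerivAt (fun σ => fderiv ℝ G (σ, x)) (fderiv ℝ (fderiv ℝ G) (τ, x) (1, 0)) τ :=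
        hd2.hasFDerivAt.comp_hasDerivAt τ ((hasDerivAt_id' τ).prodMk (hasDerivAt_const τ x))
      simpa using h4.clm_apply (hasDerivAt_const τ ((0 : ℝ), e j))
    -- Symmetry of second derivatives exchanges time and space: the time derivative of the Jacobian
    -- is the spatial derivative of `u ∘ F`, that is `Du · DF`.
    have hsymm : fderiv ℝ (fderiv ℝ G) (τ, x) (1, 0) (0, e j) =
        fderiv ℝ (u τ) (F τ x) (fderiv ℝ (F τ) x (e j)) := by
      have h5 := (hGat.isSymmSndFDerivAt (by simp; norm_cast)).eq (1, 0) (0, e j)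
      rw [h5]
      have h6 : HasFDerivAt (fun y => fderiv ℝ G (τ, y) (1, 0))
          (((fderiv ℝ (fderiv ℝ G) (τ, x)).comp
            (ContinuousLinearMap.inr ℝ ℝ (EuclideanSpace ℝ (Fin n)))).flip (1, 0)) x := by
        have h7 : HasFDerivAt (fun y => fderiv ℝ G (τ, y)) _ x :=
          hd2.hasFDerivAt.comp x (hasFDerivAt_prodMk_right τ x)
        refine (h7.clm_apply (hasFDerivAt_const ((1 : ℝ), (0 : EuclideanSpace ℝ (Fin n))) x)).congr_fderiv ?_
        ext1 w
        simp
      have h8 : HasFDerivAt (fun y => fderiv ℝ G (τ, y) (1, 0))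
          ((fderiv ℝ (u τ) (F τ x)).comp (fderiv ℝ (F τ) x)) x := by
        have h9 : HasFDerivAt (fun y => u τ (F τ y)) _ x :=
          (hu τ hτ).hasFDerivAt.comp x (hslice τ (Ioo_subset_Ico_self hτ) x hx).differentiableAt.hasFDerivAt
        refine h9.congr_of_eventuallyEq ?_
        filter_upwards [hU.mem_nhds hx] with y hy using htime y hy
      have h10 := congrArg (fun A => A (e j)) (h6.unique h8)
      simpa using h10
    rw [hsymm] at hmain
    have hent : HasDerivAt (fun σ => fderiv ℝ G (σ, x) (0, e j) i)
        (fderiv ℝ (u τ) (F τ x) (fderiv ℝ (F τ) x (e j)) i) τ :=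
      (EuclideanSpace.proj (𝕜 := ℝ) i).hasFDerivAt.comp_hasDerivAt τ hmain
    have heq : (L * M τ) i j = fderiv ℝ (u τ) (F τ x) (fderiv ℝ (F τ) x (e j)) i := by
      have h11 : fderiv ℝ (F τ) x (e j) = ∑ k, fderiv ℝ (F τ) x (e j) k • e k := by
        ext l
        simp [he, Pi.single_apply]
      rw [Matrix.mul_apply]
      conv_rhs => rw [h11]
      simp [hL, hM, mul_comm]
    rw [heq]
    refine hent.congr_of_eventuallyEq ?_
    filter_upwards [isOpen_Ioo.mem_nhds hτ] with σ hσ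
    show fderiv ℝ (F σ) x (e j) i = _
    rw [hspace σ hσ]
  have hzero : (M 0).det = 1 := by
    rw [← hdet]
    have h1 : F 0 =ᶠ[𝓝 x] id := by
      filter_upwards [hU.mem_nhds hx] with y hy using h0 y hy
    rw [h1.fderiv_eq, fderiv_id]
    simp [ContinuousLinearMap.det]
  -- The equation for the determinant holds in the open time interval only; continuity up to `0` and
  -- the mean value theorem carry over the initial value.
  rcases ht.1.eq_or_lt with h | h
  · rw [← h, hzero]
  · obtain ⟨c, hc, hcd⟩ := exists_deriv_eq_slope (fun τ => (M τ).det) h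
      (hcont.mono fun τ hτ => ⟨hτ.1, hτ.2.trans_lt ht.2⟩)
      fun τ hτ => (hderiv τ ⟨hτ.1, hτ.2.trans ht.2⟩).differentiableAt.differentiableWithinAt
    rw [(hderiv c ⟨hc.1, hc.2.trans ht.2⟩).deriv, eq_comm, div_eq_zero_iff] at hcd
    rcases hcd with h1 | h1
    · linarith
    · linarith

/-! ### Properties of motions -/

namespace IsMotion

variable {T : ℝ} {Ω₀ : Set Plane} {m : ℕ} {γ₀ : Fin m → ℝ → Plane} {φ u : ℝ → Space → Space}

lemma hasDerivWithinAt_trace (hφ : IsMotion T Ω₀ γ₀ φ u) {t : ℝ} (ht : t ∈ Ico 0 T) (p : Plane) :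
    HasDerivWithinAt (fun τ => trace (φ τ) p) (trace (u t) (trace (φ t) p)) (Ico 0 T) t := by
  have h1 := hφ.flow t ht (embed p) (embed_mem p)
  rw [← (hφ.diffeo t ht).embed_trace] at h1
  exact horizontalCLM.hasFDerivAt.comp_hasDerivWithinAt t h1

lemma trace_zero (hφ : IsMotion T Ω₀ γ₀ φ u) (p : Plane) : trace (φ 0) p = p := by
  rw [trace, hφ.init _ (embed_mem p), horizontal_embed]

lemma timeDeriv_eq (hφ : IsMotion T Ω₀ γ₀ φ u) {t : ℝ} (ht : t ∈ Ico 0 T) {x : Space}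
    (hx : x ∈ closedHalfSpace) : timeDeriv T φ t x = u t (φ t x) :=
  (hφ.flow t ht x hx).derivWithin (uniqueDiffOn_Ico 0 T t ht)

/-- A point of the plane which moves with the surface velocity moves with the motion. -/
lemma eq_trace_of_hasDerivWithinAt (hφ : IsMotion T Ω₀ γ₀ φ u) {α : ℝ → Plane}
    (hα : ∀ t ∈ Ico 0 T, HasDerivWithinAt α (trace (u t) (α t)) (Ico 0 T) t) {t : ℝ}
    (ht : t ∈ Ico 0 T) : α t = trace (φ t) (α 0) := by
  obtain ⟨C, hC⟩ := hφ.velocity t ht.2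
  have hC0 : 0 ≤ C := (hC t ⟨ht.1, le_rfl⟩).const_nonneg
  have hd : ∀ s ∈ Ico 0 T, HasDerivWithinAt (fun τ => α τ - trace (φ τ) (α 0))
      (trace (u s) (α s) - trace (u s) (trace (φ s) (α 0))) (Ico 0 T) s := fun s hs =>
    (hα s hs).fun_sub (hφ.hasDerivWithinAt_trace hs _)
  have hsub : ∀ s ∈ Icc 0 t, s ∈ Ico 0 T := fun s hs => ⟨hs.1, hs.2.trans_lt ht.2⟩
  refine sub_eq_zero.1 (osgood_unique (f := fun τ => α τ - trace (φ τ) (α 0)) ht.1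
    -- The log-Lipschitz constant is `3 * C`; adding `1` makes it positive, as Osgood's criterion
    -- requires.
    (M := 3 * C + 1) (by positivity)
    (fun s hs => ((hd s (hsub s hs)).continuousWithinAt).mono hsub)
    (fun s hs => (hd s (hsub s (Ico_subset_Icc_self hs))).mono_of_mem_nhdsWithin ?_) ?_
    fun s hs => ?_)
  · have hs' := hsub s (Ico_subset_Icc_self hs)
    exact mem_of_superset (Ico_mem_nhdsGE hs'.2) (Ico_subset_Ico_left hs'.1)
  · rw [hφ.trace_zero, sub_self]
  · refine ((hC s (Ico_subset_Icc_self hs)).norm_trace_sub_le _ _).trans ?_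
    have : 0 ≤ Real.log (1 + ‖α s - trace (φ s) (α 0)‖⁻¹) :=
      Real.log_nonneg (by linarith [inv_nonneg.2 (norm_nonneg (α s - trace (φ s) (α 0)))])
    gcongr
    linarith

lemma det_fderiv (hφ : IsMotion T Ω₀ γ₀ φ u)
    (hdiv : ∀ t ∈ Ico 0 T, ∀ x ∈ halfSpace, divergence (u t) x = 0) {t : ℝ} (ht : t ∈ Ico 0 T)
    {x : Space} (hx : x ∈ halfSpace) : (fderiv ℝ (φ t) x).det = 1 := by
  have hmem : ∀ s ∈ Ioo 0 T, φ s x ∈ halfSpace := fun s hs =>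
    (hφ.diffeo s (Ioo_subset_Ico_self hs)).bijOn_open.mapsTo hx
  refine det_fderiv_eq_one (u := u) isOpen_halfSpace hφ.smooth hx (fun s hs y hy => ?_) (fun s hs => ?_)
    (fun s hs => ?_) (fun y hy => hφ.init y (halfSpace_subset hy)) ht
  · exact (hφ.flow s (Ioo_subset_Ico_self hs) y (halfSpace_subset hy)).hasDerivAt
      (Ico_mem_nhds hs.1 hs.2)
  · obtain ⟨C, hC⟩ := hφ.velocity s hs.2
    exact ((hC s ⟨hs.1.le, le_rfl⟩).contDiffOn_halfSpace.differentiableOn (by simp)).differentiableAt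
      (isOpen_halfSpace.mem_nhds (hmem s hs))
  · exact hdiv s (Ioo_subset_Ico_self hs) _ (hmem s hs)

end IsMotion

lemma IsSmoothDomain.volume_frontier {Ω : Set Plane} {m : ℕ} {γ : Fin m → ℝ → Plane}
    (h : IsSmoothDomain Ω γ) : volume (frontier Ω) = 0 := by
  rw [h.frontier_eq]; exact h.curves.volume_iUnion_range

lemma IsRegularField.contDiffOn_trace {Γ : Set Plane} {C : ℝ} {u : Space → Space}
    (hu : IsRegularField Γ C u) : ContDiffOn ℝ ∞ (trace u) Γᶜ :=
  contDiff_horizontal.comp_contDiffOn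
    (hu.smooth.comp contDiff_embed.contDiffOn fun _ hp => embed_mem_diff hp)

/-- Liouville's theorem applies only off `frontier Ω₀`, where the trace is known to be smooth. The
excluded set and its image are null, so the change of variables formula still yields the area of
every image. -/
lemma IsMotion.measurePreserving_trace {T : ℝ} {Ω₀ : Set Plane} {m : ℕ} {γ₀ : Fin m → ℝ → Plane}
    {φ u : ℝ → Space → Space} (hφ : IsMotion T Ω₀ γ₀ φ u)
    (hdiv : ∀ t ∈ Ico 0 T, ∀ p ∉ interface Ω₀ φ t, surfaceDivergence (trace (u t)) p = 0)
    (hnull : ∀ t ∈ Ico 0 T, volume (interface Ω₀ φ t) = 0) {t : ℝ} (ht : t ∈ Ico 0 T) :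
    MeasurePreserving (trace (φ t)) (volume : Measure Plane) volume := by
  have h0 : (0 : ℝ) ∈ Ico 0 T := ⟨le_rfl, ht.1.trans_lt ht.2⟩
  set F := frontier Ω₀ with hF
  have hFc : IsClosed F := isClosed_frontier
  have hF0 : volume F = 0 := by
    have h1 : interface Ω₀ φ 0 = F := by
      have : trace (φ 0) = id := funext fun p => hφ.trace_zero p
      rw [interface, this, image_id]
    rw [← h1]; exact hnull 0 h0
  have hinj : ∀ s ∈ Ico 0 T, Function.Injective (trace (φ s)) := fun s hs =>
    (hφ.diffeo s hs).traceHomeomorph.injective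
  have hmem : ∀ s ∈ Ico 0 T, ∀ p ∈ Fᶜ, trace (φ s) p ∉ interface Ω₀ φ s := fun s hs p hp hcon => by
    obtain ⟨q, hq, hqp⟩ := hcon
    exact hp (hinj s hs hqp ▸ hq)
  have hopenI : ∀ s ∈ Ico 0 T, IsOpen (interface Ω₀ φ s)ᶜ := fun s hs => by
    rw [interface, ← (hφ.diffeo s hs).coe_traceHomeomorph]
    exact ((hφ.diffeo s hs).traceHomeomorph.isClosedMap _ hFc).isOpen_compl
  have hdet : ∀ p ∈ Fᶜ, (fderiv ℝ (trace (φ t)) p).det = 1 := fun p hp => by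
    have hud : ∀ s ∈ Ioo 0 T, DifferentiableAt ℝ (trace (u s)) (trace (φ s) p) := fun s hs => by
      obtain ⟨C, hC⟩ := hφ.velocity s hs.2
      have hs' := Ioo_subset_Ico_self hs
      exact ((hC s ⟨hs.1.le, le_rfl⟩).contDiffOn_trace.differentiableOn (by simp)).differentiableAt
        ((hopenI s hs').mem_nhds (hmem s hs' p hp))
    refine det_fderiv_eq_one (F := fun s => trace (φ s)) (u := fun s => trace (u s))
      hFc.isOpen_compl hφ.smooth_trace hp (fun s hs y _ => ?_) hud (fun s hs => ?_)
      (fun y _ => hφ.trace_zero y) ht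
    · exact (hφ.hasDerivWithinAt_trace (Ioo_subset_Ico_self hs) y).hasDerivAt
        (Ico_mem_nhds hs.1 hs.2)
    · have hs' := Ioo_subset_Ico_self hs
      exact hdiv s hs' _ (hmem s hs' p hp)
  have hslice : ContDiffOn ℝ ∞ (trace (φ t)) Fᶜ :=
    hφ.smooth_trace.comp (contDiff_prodMk_right t).contDiffOn fun p hp => ⟨ht, hp⟩
  have himage : ∀ A : Set Plane, MeasurableSet A → volume (trace (φ t) '' A) = volume A := by
    intro A hA
    have h1 : volume (trace (φ t) '' (A ∩ Fᶜ)) = volume (A ∩ Fᶜ) := by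
      rw [← lintegral_abs_det_fderiv_eq_addHaar_image volume (hA.inter hFc.measurableSet.compl)
        (f' := fun p => fderiv ℝ (trace (φ t)) p)
        (fun p hp => ((hslice.differentiableOn (by simp)).differentiableAt
          (hFc.isOpen_compl.mem_nhds hp.2)).hasFDerivAt.hasFDerivWithinAt) ((hinj t ht).injOn)]
      rw [setLIntegral_congr_fun (g := fun _ => 1) (hA.inter hFc.measurableSet.compl)
        fun p hp => by simp [hdet p hp.2]]
      simp
    have h2 : volume (A ∩ F) = 0 := measure_mono_null inter_subset_right hF0
    have h3 : volume (trace (φ t) '' (A ∩ F)) = 0 :=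
      measure_mono_null (image_mono inter_subset_right) (hnull t ht)
    have hunion : ∀ B N : Set Plane, volume N = 0 → volume (N ∪ B) = volume B := fun B N hN =>
      le_antisymm ((measure_union_le _ _).trans_eq (by rw [hN, zero_add]))
        (measure_mono subset_union_right)
    have h4 : A ∩ F ∪ A ∩ Fᶜ = A := inter_union_compl A F
    calc volume (trace (φ t) '' A) = volume (trace (φ t) '' (A ∩ F) ∪ trace (φ t) '' (A ∩ Fᶜ)) := by
          rw [← image_union, h4]
      _ = volume (trace (φ t) '' (A ∩ Fᶜ)) := hunion _ _ h3
      _ = volume (A ∩ Fᶜ) := h1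
      _ = volume (A ∩ F ∪ A ∩ Fᶜ) := (hunion _ _ h2).symm
      _ = volume A := by rw [h4]
  have hmeas : Measurable (trace (φ t)) := (hφ.diffeo t ht).traceHomeomorph.continuous.measurable
  refine ⟨hmeas, Measure.ext fun s hs => ?_⟩
  rw [Measure.map_apply hmeas hs, ← himage _ (hmeas hs),
    image_preimage_eq _ (f := trace (φ t)) (hφ.diffeo t ht).traceHomeomorph.surjective]

/-! ### The metric in Eulerian coordinates -/

lemma IsHalfSpaceDiffeo.fderiv_comp_invFunOn {φ a w : Space → Space} (hφ : IsHalfSpaceDiffeo φ)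
    (ha : ∀ x ∈ closedHalfSpace, a x = w (φ x)) {x : Space} (hx : x ∈ halfSpace) :
    fderiv ℝ (a ∘ Function.invFunOn φ closedHalfSpace) x = fderiv ℝ w x := by
  refine Filter.EventuallyEq.fderiv_eq ?_
  filter_upwards [closedHalfSpace_mem_nhds hx] with y hy
  rw [Function.comp_apply, ha _ (hφ.invFunOn_mem hy), hφ.apply_invFunOn hy]

lemma IsHalfSpaceDiffeo.metric_eq {φ a b v w : Space → Space} (hφ : IsHalfSpaceDiffeo φ)
    (ha : ∀ x ∈ closedHalfSpace, a x = v (φ x)) (hb : ∀ x ∈ closedHalfSpace, b x = w (φ x)) :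
    metric φ a b = ∫ x in halfSpace, ∑ i : Fin 3, inner ℝ
      (fderiv ℝ v x (EuclideanSpace.single i 1)) (fderiv ℝ w x (EuclideanSpace.single i 1)) :=
  setIntegral_congr_fun isOpen_halfSpace.measurableSet fun x hx => by
    simp only [hφ.fderiv_comp_invFunOn ha hx, hφ.fderiv_comp_invFunOn hb hx]

lemma IsHalfSpaceDiffeo.energy_comp {φ ψ : Space → Space} (hφ : IsHalfSpaceDiffeo φ)
    (Ω₀ : Set Plane) : energy Ω₀ (ψ ∘ φ) = perimeter (trace ψ '' (trace φ '' Ω₀)) := by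
  rw [energy, image_image]
  congr 2
  funext p
  rw [trace, trace, hφ.embed_trace, Function.comp_apply]

/-! ### Solutions of the free boundary model are gradient flows -/

/-- The advected boundary points must follow `Φ`, so `Ω t` and `Φ(t)(Ω₀)` are smooth domains with
the same boundary curves, hence equal. After that, the work of the stress, the force balance and the
first variation of the perimeter combine to the weak equation. -/
theorem IsSolution.isGradientFlow {T : ℝ} {Ω₀ : Set Plane} {m : ℕ} {γ₀ : Fin m → ℝ → Plane}
    {φ u : ℝ → Space → Space} (hφ : IsMotion T Ω₀ γ₀ φ u) {Ω : ℝ → Set Plane} (hΩ : Ω 0 = Ω₀)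
    {P : ℝ → Space → ℝ} {ϖ : ℝ → Plane → ℝ} {n : ℕ} {Γ : ℝ → Fin n → ℝ → Plane}
    (h : IsSolution T u P ϖ Ω Γ) :
    IsGradientFlow T Ω₀ φ ∧ ∀ t ∈ Ico 0 T, Ω t = trace (φ t) '' Ω₀ := by
  have hΓ : ∀ t ∈ Ico 0 T, ∀ i s, Γ t i s = trace (φ t) (Γ 0 i s) := fun t ht i s =>
    hφ.eq_trace_of_hasDerivWithinAt (fun τ hτ => h.kinematic τ hτ i s) ht
  have hdom : ∀ t ∈ Ico 0 T, Ω t = trace (φ t) '' Ω₀ := fun t ht => by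
    have h0 : (0 : ℝ) ∈ Ico 0 T := ⟨le_rfl, ht.1.trans_lt ht.2⟩
    have hd0 := h.domain 0 h0
    rw [hΩ] at hd0
    have hdt := h.domain t ht
    have hcomp : (fun i => (hφ.diffeo t ht).traceHomeomorph ∘ Γ 0 i) = Γ t := by
      funext i s
      exact (hΓ t ht i s).symm
    -- The image is taken with the parametrization `Γ 0` of the boundary of `Ω₀`, which may differ
    -- from `γ₀` even in the number of curves. Regularity of the transported curves therefore comes
    -- from the solution and not from the motion.
    have himg := hd0.image (hφ.diffeo t ht).traceHomeomorph
      (fun i => by rw [congrFun hcomp i]; exact hdt.smooth i)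
      (fun i => by rw [congrFun hcomp i]; exact hdt.regular i)
    rw [hcomp] at himg
    exact hdt.eq_of_frontier_eq himg
  have hint : ∀ t ∈ Ico 0 T, interface Ω₀ φ t = frontier (Ω t) := fun t ht => by
    rw [hdom t ht, (hφ.diffeo t ht).frontier_image]; rfl
  have hvel : ∀ t ∈ Ico 0 T, ∃ C, IsRegularField (interface Ω₀ φ t) C (u t) := fun t ht => by
    obtain ⟨C, hC⟩ := hφ.velocity t ht.2
    exact ⟨C, hC t ⟨ht.1, le_rfl⟩⟩
  have hsurf : ∀ t ∈ Ico 0 T, ∀ p ∉ interface Ω₀ φ t, surfaceDivergence (trace (u t)) p = 0 :=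
    fun t ht p hp => h.surface_incompressible t ht p (by rwa [← hint t ht])
  have hnull : ∀ t ∈ Ico 0 T, volume (interface Ω₀ φ t) = 0 := fun t ht => by
    rw [hint t ht]; exact (h.domain t ht).volume_frontier
  refine ⟨⟨fun t ht => ⟨hφ.diffeo t ht, fun x hx => hφ.det_fderiv h.incompressible ht hx,
    hφ.measurePreserving_trace hsurf hnull ht⟩, fun t ht => ?_, fun t ht v hv => ?_⟩, hdom⟩
  · exact ⟨u t, ⟨hvel t ht, h.incompressible t ht, h.normal_velocity t ht, hsurf t ht⟩,
      fun x hx => hφ.timeDeriv_eq ht hx⟩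
  · obtain ⟨C, hC⟩ := hvel t ht
    have hdt := h.domain t ht
    rw [hint t ht, hdt.frontier_eq] at hC
    obtain ⟨ψ, hψ⟩ := eulerFields.exists_flow hv
    refine ⟨ψ, hψ, ?_⟩
    have hper := hasDerivAt_perimeter hdt hv hψ
    have h1 := integral_inner_fderiv_eq hdt.curves hC (h.pressure_smooth t ht) (h.stokes t ht) hv
    have h2 := (h.force_balance t ht).integral_inner_eq hdt.curves hC hv
    rw [(hφ.diffeo t ht).metric_eq (a := timeDeriv T φ t) (b := v ∘ φ t) (w := v)
      (fun x hx => hφ.timeDeriv_eq ht hx) (fun x _ => rfl), h1]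
    have h3 : -∑ j, lineTension (Ω t) (Γ t) (fun p => trace v p j) j =
        - -∫ p, inner ℝ (surfaceStress (u t) p) (trace v p) := by linarith
    rw [← h3]
    simp_rw [(hφ.diffeo t ht).energy_comp, ← hdom t ht]
    exact hper

/-! ### Test fields with compact support -/

lemma mem_eulerFields_of_hasCompactSupport {v : Space → Space} (hv : ContDiff ℝ ∞ v)
    (hc : HasCompactSupport v) (hdiv : ∀ x ∈ halfSpace, divergence v x = 0)
    (hn : ∀ p, v (embed p) 2 = 0) (hs : ∀ p, surfaceDivergence (trace v) p = 0) :
    v ∈ eulerFields := by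
  have hle : ((2 : ℕ) : WithTop ℕ∞) ≤ ∞ := by norm_cast
  have hbound : ∀ (k : ℕ) {F : Type} [NormedAddCommGroup F] (f : Space → F), Continuous f →
      HasCompactSupport f → ∃ C, ∀ x, ‖f x‖ ≤ C * (1 + ‖x‖)⁻¹ ^ k := by
    intro k F _ f hf hfc
    obtain ⟨C, hC⟩ := (hfc.norm.mul_right (f' := fun x => (1 + ‖x‖) ^ k)).exists_bound_of_continuous
      (hf.norm.mul (by fun_prop))
    refine ⟨C, fun x => ?_⟩
    have h1 := (le_abs_self _).trans (hC x)
    rw [inv_pow, ← div_eq_mul_inv, le_div_iff₀ (by positivity)]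
    exact h1
  obtain ⟨C₀, h0⟩ := hbound 1 v hv.continuous hc
  obtain ⟨C₁, h1⟩ := hbound 2 (fderiv ℝ v) (hv.continuous_fderiv (by simp)) (hc.fderiv (𝕜 := ℝ))
  obtain ⟨C₂, h2⟩ := hbound 3 (iteratedFDeriv ℝ 2 v) (hv.continuous_iteratedFDeriv hle)
    (hc.iteratedFDeriv 2)
  refine ⟨⟨max C₀ (max C₁ C₂), hv.continuous.continuousOn, hv.contDiffOn, fun x _ => ?_,
    fun x hx => ?_, fun x hx => ?_⟩, hdiv, hn, fun p _ => hs p⟩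
  · refine (h0 x).trans ?_
    rw [pow_one]
    gcongr
    exact le_max_left _ _
  · rw [(hv.differentiable (by simp) x).fderivWithin (uniqueDiffOn_closedHalfSpace x hx.1),
      interfaceDist_empty]
    simp only [inv_zero, add_zero, Real.log_one, mul_one]
    refine (h1 x).trans ?_
    gcongr
    exact (le_max_left _ _).trans (le_max_right _ _)
  · rw [iteratedFDerivWithin_eq_iteratedFDeriv uniqueDiffOn_closedHalfSpace
      (hv.contDiffAt.of_le hle) hx.1, interfaceDist_empty]
    simp only [inv_zero, add_zero, mul_one]
    refine (h2 x).trans ?_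
    gcongr
    exact (le_max_right _ _).trans (le_max_right _ _)

/-! ### The bulk pressure -/

lemma contDiffOn_laplacian {u : Space → Space} (hu : ContDiffOn ℝ ∞ u halfSpace) :
    ContDiffOn ℝ ∞ (Laplacian.laplacian u) halfSpace := by
  have h1 : ∀ i : Fin 3, ContDiffOn ℝ ∞ (fun x => fderiv ℝ
      (fun y => fderiv ℝ u y (EuclideanSpace.single i 1)) x (EuclideanSpace.single i 1))
      halfSpace := fun i =>
    ((((hu.fderiv_of_isOpen isOpen_halfSpace (m := ∞) (by simp)).clm_apply
      contDiffOn_const).fderiv_of_isOpen isOpen_halfSpace (m := ∞) (by simp)).clm_apply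
      contDiffOn_const)
  refine (ContDiffOn.sum fun i (_ : i ∈ Finset.univ) => h1 i).congr fun x hx => ?_
  exact laplacian_eq_sum_fderiv ((hu.contDiffAt (isOpen_halfSpace.mem_nhds hx)).of_le (by norm_cast))

/-- Integration by parts with a test field supported in the open half-space. -/
lemma integral_inner_fderiv_eq_laplacian {u : Space → Space} (hu : ContDiffOn ℝ ∞ u halfSpace)
    {v : Space → Space} (hv : ContDiff ℝ ∞ v) (hc : HasCompactSupport v)
    (hsub : tsupport v ⊆ halfSpace) :
    ∫ x in halfSpace, ∑ i : Fin 3, inner ℝ (fderiv ℝ u x (EuclideanSpace.single i 1))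
      (fderiv ℝ v x (EuclideanSpace.single i 1)) =
    -∫ x, inner ℝ (Laplacian.laplacian u x) (v x) := by
  have hle : (1 : WithTop ℕ∞) ≤ ∞ := by norm_cast
  set e : Fin 3 → Space := fun i => EuclideanSpace.single i 1 with he
  set f : Fin 3 → Fin 3 → Space → ℝ := fun i k x => fderiv ℝ u x (e i) k with hf
  have hduB : ∀ i, ContDiffOn ℝ ∞ (fun x => fderiv ℝ u x (e i)) halfSpace := fun i =>
    (hu.fderiv_of_isOpen isOpen_halfSpace (by simp)).clm_apply contDiffOn_const
  have hfs : ∀ i k, ContDiffOn ℝ ∞ (f i k) halfSpace := fun i k =>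
    (EuclideanSpace.proj (𝕜 := ℝ) k).contDiff.comp_contDiffOn (hduB i)
  have hvk : ∀ k : Fin 3, ContDiff ℝ ∞ fun x => v x k := contDiff_coord hv
  have hvc : ∀ k : Fin 3, HasCompactSupport fun x => v x k := fun k =>
    hc.comp_left (g := fun w : Space => w k) rfl
  have hvs : ∀ k : Fin 3, tsupport (fun x => v x k) ⊆ halfSpace := fun k =>
    (closure_mono (fun x (hx : v x k ≠ 0) (h : v x = 0) => hx (by rw [h]; rfl))).trans hsub
  have hdf : ∀ i k, ContinuousOn (fun x => fderiv ℝ (f i k) x (e i)) halfSpace := fun i k =>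
    (((hfs i k).fderiv_of_isOpen isOpen_halfSpace (m := ∞) (by simp)).clm_apply
      contDiffOn_const).continuousOn
  have hI1 : ∀ i k, Integrable fun x => f i k x * fderiv ℝ (fun x => v x k) x (e i) := fun i k =>
    integrable_mul_of_tsupport_subset isOpen_halfSpace (hfs i k).continuousOn
      (contDiff_fderiv_apply (hvk k) _).continuous ((hvc k).fderiv_apply (𝕜 := ℝ) _)
      ((tsupport_fderiv_apply_subset _ _).trans (hvs k))
  have hI2 : ∀ i k, Integrable fun x => fderiv ℝ (f i k) x (e i) * v x k := fun i k =>
    integrable_mul_of_tsupport_subset isOpen_halfSpace (hdf i k) (hvk k).continuous (hvc k) (hvs k)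
  have hibp : ∀ i k, ∫ x, f i k x * fderiv ℝ (fun x => v x k) x (e i) =
      -∫ x, fderiv ℝ (f i k) x (e i) * v x k := fun i k =>
    integral_mul_fderiv_eq_neg isOpen_halfSpace ((hfs i k).of_le hle) ((hvk k).of_le hle) (hvc k)
      (hvs k) (e i)
  have hl : ∀ x, ∑ i, inner ℝ (fderiv ℝ u x (e i)) (fderiv ℝ v x (e i)) =
      ∑ i, ∑ k, f i k x * fderiv ℝ (fun x => v x k) x (e i) := fun x => by
    refine Finset.sum_congr rfl fun i _ => ?_
    rw [PiLp.inner_apply]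
    refine Finset.sum_congr rfl fun k _ => ?_
    rw [fderiv_coord (hv.differentiable (by simp) x)]
    simp [hf, mul_comm]
  have hr : ∀ x, inner ℝ (Laplacian.laplacian u x) (v x) =
      ∑ i, ∑ k, fderiv ℝ (f i k) x (e i) * v x k := fun x => by
    by_cases hx : x ∈ halfSpace
    · have hat := hu.contDiffAt (isOpen_halfSpace.mem_nhds hx)
      rw [laplacian_eq_sum_fderiv (hat.of_le (by norm_cast)), sum_inner]
      refine Finset.sum_congr rfl fun i _ => ?_
      rw [PiLp.inner_apply]
      refine Finset.sum_congr rfl fun k _ => ?_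
      rw [fderiv_coord (((hduB i).differentiableOn (by simp)).differentiableAt
        (isOpen_halfSpace.mem_nhds hx))]
      exact mul_comm _ _
    · have : v x = 0 := image_eq_zero_of_notMem_tsupport fun h => hx (hsub h)
      simp [this]
  rw [setIntegral_eq_integral_of_forall_compl_eq_zero]
  · refine (integral_congr_ae (ae_of_all _ hl)).trans ?_
    rw [integral_congr_ae (ae_of_all _ hr),
      integral_finsetSum _ fun i _ => integrable_finsetSum _ fun k _ => hI1 i k,
      integral_finsetSum _ fun i _ => integrable_finsetSum _ fun k _ => hI2 i k,
      ← Finset.sum_neg_distrib]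
    refine Finset.sum_congr rfl fun i _ => ?_
    rw [integral_finsetSum _ fun k _ => hI1 i k, integral_finsetSum _ fun k _ => hI2 i k,
      ← Finset.sum_neg_distrib]
    exact Finset.sum_congr rfl fun k _ => hibp i k
  · intro x hx
    have : fderiv ℝ v x = 0 := image_eq_zero_of_notMem_tsupport fun h =>
      hx (hsub (tsupport_fderiv_subset ℝ h))
    simp [this]

/-- If the Dirichlet pairing with the compactly supported divergence free fields vanishes, then the
Laplacian is a gradient. -/
theorem exists_pressure {u : Space → Space} (hu : ContDiffOn ℝ ∞ u halfSpace)
    (hw : ∀ v ∈ eulerFields, tsupport v ⊆ halfSpace →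
      ∫ x in halfSpace, ∑ i : Fin 3, inner ℝ (fderiv ℝ u x (EuclideanSpace.single i 1))
        (fderiv ℝ v x (EuclideanSpace.single i 1)) = 0) :
    ∃ P : Space → ℝ, ContDiffOn ℝ ∞ P halfSpace ∧
      ∀ x ∈ halfSpace, Laplacian.laplacian u x = gradient P x := by
  have hle : (1 : WithTop ℕ∞) ≤ ∞ := by norm_cast
  set e : Fin 3 → Space := fun i => EuclideanSpace.single i 1 with he
  set w := Laplacian.laplacian u with hwdef
  have hws : ContDiffOn ℝ ∞ w halfSpace := contDiffOn_laplacian hu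
  have hwk : ∀ k : Fin 3, ContDiffOn ℝ ∞ (fun x => w x k) halfSpace := fun k =>
    (EuclideanSpace.proj (𝕜 := ℝ) k).contDiff.comp_contDiffOn hws
  have hdw : ∀ k l, ContinuousOn (fun x => fderiv ℝ (fun x => w x k) x (e l)) halfSpace := fun k l =>
    (((hwk k).fderiv_of_isOpen isOpen_halfSpace (m := ∞) (by simp)).clm_apply
      contDiffOn_const).continuousOn
  have hcurl : ∀ a b, ∀ x ∈ halfSpace,
      fderiv ℝ (fun x => w x a) x (e b) = fderiv ℝ (fun x => w x b) x (e a) := by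
    intro a b
    have hcont : ContinuousOn (fun x => fderiv ℝ (fun x => w x a) x (e b) -
        fderiv ℝ (fun x => w x b) x (e a)) halfSpace := (hdw a b).sub (hdw b a)
    have hae := isOpen_halfSpace.ae_eq_zero_of_integral_contDiff_smul_eq_zero (μ := volume)
      (hcont.locallyIntegrableOn isOpen_halfSpace.measurableSet) fun f hf hfc hfs => ?_
    · have h1 := (ae_restrict_iff' isOpen_halfSpace.measurableSet).2 hae
      have h2 := Measure.eqOn_open_of_ae_eq h1 isOpen_halfSpace hcont continuousOn_const
      intro x hx
      exact sub_eq_zero.1 (h2 hx)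
    · set v : Space → Space := fun x => fderiv ℝ f x (e b) • e a - fderiv ℝ f x (e a) • e b with hv
      have hvs : ContDiff ℝ ∞ v := ((contDiff_fderiv_apply hf _).smul contDiff_const).sub
        ((contDiff_fderiv_apply hf _).smul contDiff_const)
      have hv0 : ∀ x ∉ tsupport f, v x = 0 := fun x hx => by
        have : fderiv ℝ f x = 0 := image_eq_zero_of_notMem_tsupport fun h =>
          hx (tsupport_fderiv_subset ℝ h)
        simp [hv, this]
      have hvt : tsupport v ⊆ tsupport f :=
        closure_minimal (fun x hx => by by_contra h; exact hx (hv0 x h)) (isClosed_tsupport f)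
      have hvc : HasCompactSupport v := HasCompactSupport.intro hfc hv0
      have hvz : ∀ p, v =ᶠ[𝓝 (embed p)] fun _ => 0 := fun p => by
        filter_upwards [(isClosed_tsupport v).isOpen_compl.mem_nhds
          fun h => embed_notMem_halfSpace p (hfs (hvt h))] with y hy
        exact image_eq_zero_of_notMem_tsupport hy
      have hmem : v ∈ eulerFields := by
        refine mem_eulerFields_of_hasCompactSupport hvs hvc (fun x _ => ?_)
          (fun p => by rw [(hvz p).eq_of_nhds]; rfl) fun p => ?_
        · have h1 : HasFDerivAt v ((fderiv ℝ (fun x => fderiv ℝ f x (e b)) x).smulRight (e a) -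
              (fderiv ℝ (fun x => fderiv ℝ f x (e a)) x).smulRight (e b)) x :=
            (((contDiff_fderiv_apply hf (e b)).differentiable (by simp) x).hasFDerivAt.smul_const
              (e a)).sub
            (((contDiff_fderiv_apply hf (e a)).differentiable (by simp) x).hasFDerivAt.smul_const
              (e b))
          have h2 : ∀ c : Fin 3, ∀ g : Space →L[ℝ] ℝ,
              ∑ i : Fin 3, (g (EuclideanSpace.single i 1) • e c) i = g (e c) := fun c g => by
            rw [Finset.sum_eq_single c]
            · simp [he]
            · intro i _ hi
              simp [he, hi]
            · simp
          simp only [divergence, h1.fderiv, sub_apply, PiLp.sub_apply,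
            ContinuousLinearMap.smulRight_apply, Finset.sum_sub_distrib]
          rw [h2, h2, fderiv_fderiv_comm (hf.contDiffAt.of_le (by norm_cast)), sub_self]
        · have h1 : trace v =ᶠ[𝓝 p] fun _ => 0 := by
            filter_upwards [continuous_embed.continuousAt.eventually (hvz p)] with q hq
            rw [trace, hq]
            ext i; fin_cases i <;> simp
          simp [surfaceDivergence, h1.fderiv_eq]
      have h0 := hw v hmem (hvt.trans hfs)
      rw [integral_inner_fderiv_eq_laplacian hu hvs hvc (hvt.trans hfs), neg_eq_zero] at h0
      have hin : ∀ x, inner ℝ (w x) (v x) = w x a * fderiv ℝ f x (e b) - w x b * fderiv ℝ f x (e a) :=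
        fun x => by
          simp only [hv, inner_sub_right, inner_smul_right, he]
          rw [EuclideanSpace.inner_single_right, EuclideanSpace.inner_single_right]
          simp [mul_comm]
      have hI : ∀ c d, Integrable fun x => w x c * fderiv ℝ f x (e d) := fun c d =>
        integrable_mul_of_tsupport_subset isOpen_halfSpace (hwk c).continuousOn
          (contDiff_fderiv_apply hf _).continuous (hfc.fderiv_apply (𝕜 := ℝ) _)
          ((tsupport_fderiv_apply_subset _ _).trans hfs)
      have hI' : ∀ c d, Integrable fun x => fderiv ℝ (fun x => w x c) x (e d) * f x := fun c d =>
        integrable_mul_of_tsupport_subset isOpen_halfSpace (hdw c d) hf.continuous hfc hfs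
      have hibp : ∀ c d, ∫ x, w x c * fderiv ℝ f x (e d) =
          -∫ x, fderiv ℝ (fun x => w x c) x (e d) * f x := fun c d =>
        integral_mul_fderiv_eq_neg isOpen_halfSpace ((hwk c).of_le hle) (hf.of_le hle) hfc hfs (e d)
      rw [show (fun x => inner ℝ (w x) (v x)) = _ from funext hin, integral_sub (hI _ _) (hI _ _),
        hibp, hibp] at h0
      have h3 : ∀ x, f x • (fderiv ℝ (fun x => w x a) x (e b) - fderiv ℝ (fun x => w x b) x (e a)) =
          fderiv ℝ (fun x => w x a) x (e b) * f x - fderiv ℝ (fun x => w x b) x (e a) * f x :=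
        fun x => by rw [smul_eq_mul]; ring
      simp_rw [h3]
      rw [integral_sub (hI' _ _) (hI' _ _)]
      linarith
  set η : Space → Space →L[ℝ] ℝ := fun x => innerSL ℝ (w x) with hη
  have hηs : ContDiffOn ℝ ∞ η halfSpace := (innerSL ℝ (E := Space)).contDiff.comp_contDiffOn hws
  -- Poincaré's lemma on the convex half-space: the form `w · dx` is closed.
  obtain ⟨P, hP⟩ := convex_halfSpace.exists_forall_hasFDerivAt_of_fderiv_symmetric isOpen_halfSpace
    (hηs.differentiableOn (by simp)) fun a ha x y => by
      have hwd : DifferentiableAt ℝ w a :=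
        (hws.differentiableOn (by simp)).differentiableAt (isOpen_halfSpace.mem_nhds ha)
      have h1 : HasFDerivAt η ((innerSL ℝ (E := Space)).comp (fderiv ℝ w a)) a :=
        (innerSL ℝ (E := Space)).hasFDerivAt.comp a hwd.hasFDerivAt
      have h2 : ∀ k l, fderiv ℝ w a (e l) k = fderiv ℝ w a (e k) l := fun k l => by
        have := hcurl k l a ha
        rwa [fderiv_coord hwd, fderiv_coord hwd] at this
      have h3 : ∀ z : Space, fderiv ℝ w a z =
          z 0 • fderiv ℝ w a (e 0) + z 1 • fderiv ℝ w a (e 1) + z 2 • fderiv ℝ w a (e 2) :=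
        fun z => by
          have : z = z 0 • e 0 + z 1 • e 1 + z 2 • e 2 := by
            ext j; fin_cases j <;> simp [he]
          nth_rewrite 1 [this]
          simp only [map_add, map_smul]
      rw [h1.fderiv]
      simp only [ContinuousLinearMap.comp_apply, innerSL_apply_apply]
      rw [inner_space, inner_space, h3 x, h3 y]
      simp only [PiLp.add_apply, PiLp.smul_apply, smul_eq_mul]
      rw [h2 0 1, h2 0 2, h2 1 2]
      ring
  refine ⟨P, ?_, fun x hx => ?_⟩
  · rw [contDiffOn_infty_iff_fderiv_of_isOpen isOpen_halfSpace]
    exact ⟨fun x hx => (hP x hx).differentiableAt.differentiableWithinAt,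
      hηs.congr fun x hx => (hP x hx).fderiv⟩
  · refine (HasGradientAt.gradient ?_).symm
    rw [hasGradientAt_iff_hasFDerivAt]
    exact hP x hx

/-! ### Extension of plane stream functions -/

/-- The extension `χ(z) (∇^⊥ g, 0)` is horizontal, so its divergence is `χ(z)` times the surface
divergence, which vanishes at every height. -/
lemma exists_extension {g : Plane → ℝ} (hg : ContDiff ℝ ∞ g) (hc : HasCompactSupport g) :
    ∃ v ∈ eulerFields, trace v = perpGrad g := by
  obtain ⟨χ, hχs, hχ1, hχ2⟩ : ∃ χ : ℝ → ℝ, ContDiff ℝ ∞ χ ∧ χ 0 = 1 ∧ ∀ s, 2 ≤ |s| → χ s = 0 := by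
    let χ : ContDiffBump (0 : ℝ) := ⟨1, 2, one_pos, one_lt_two⟩
    refine ⟨χ, χ.contDiff, χ.one_of_mem_closedBall (by simpa using χ.rIn_pos.le), fun s hs =>
      χ.zero_of_le_dist ?_⟩
    rw [Real.dist_eq, sub_zero]
    exact hs
  set v : Space → Space := fun x => χ (x 2) • embed (perpGrad g (horizontal x)) with hv
  have hc2 : ContDiff ℝ ∞ fun x : Space => χ (x 2) :=
    hχs.comp (EuclideanSpace.proj (𝕜 := ℝ) (2 : Fin 3)).contDiff
  have hgs := contDiff_perpGrad hg
  have hvs : ContDiff ℝ ∞ v :=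
    hc2.smul (contDiff_embed.comp (hgs.comp contDiff_horizontal))
  have htr : trace v = perpGrad g := by
    funext p
    simp [trace, hv, hχ1, horizontal_embed]
  obtain ⟨R, hR⟩ := (hasCompactSupport_perpGrad hc).isCompact.isBounded.exists_norm_le
  have hvc : HasCompactSupport v := by
    refine HasCompactSupport.intro (isCompact_closedBall 0 (R + 2)) fun x hx => ?_
    rw [mem_closedBall_zero_iff, not_le] at hx
    have h1 : ‖x‖ ≤ ‖horizontal x‖ + |x 2| := by
      have := norm_join_le (horizontal x) (x 2)
      rwa [show join (horizontal x, x 2) = x from embed_horizontal_add x] at this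
    by_cases h2 : ‖horizontal x‖ ≤ R
    · simp [hv, hχ2 (x 2) (by linarith)]
    · have : perpGrad g (horizontal x) = 0 :=
        image_eq_zero_of_notMem_tsupport fun h => h2 (hR _ h)
      simp only [hv, this]
      rw [show embed 0 = 0 from embedCLM.map_zero, smul_zero]
  refine ⟨v, mem_eulerFields_of_hasCompactSupport hvs hvc (fun x _ => ?_) (fun p => ?_)
    (fun p => by rw [htr]; exact surfaceDivergence_perpGrad hg p), htr⟩
  · have h1 : HasFDerivAt v _ x := ((hc2.differentiable (by simp) x).hasFDerivAt).smul
      (embedCLM.hasFDerivAt.comp x ((hgs.differentiable (by simp) (horizontal x)).hasFDerivAt.comp x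
        horizontalCLM.hasFDerivAt))
    have h2 := surfaceDivergence_perpGrad hg (horizontal x)
    simp only [surfaceDivergence, Fin.sum_univ_two] at h2
    have h3 : ∀ i : Fin 3, i ≠ 2 → fderiv ℝ (fun x : Space => χ (x 2)) x
        (EuclideanSpace.single i 1) = 0 := fun i hi => by
      have h4 : HasFDerivAt (fun x : Space => χ (x 2)) _ x :=
        (hχs.differentiable (by simp) (x 2)).hasFDerivAt.comp x
          (EuclideanSpace.proj (𝕜 := ℝ) (2 : Fin 3)).hasFDerivAt
      rw [h4.fderiv]
      simp [hi.symm]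
    have h5 : horizontal (EuclideanSpace.single 0 1) = EuclideanSpace.single 0 1 := by
      ext i; fin_cases i <;> simp
    have h6 : horizontal (EuclideanSpace.single 1 1) = EuclideanSpace.single 1 1 := by
      ext i; fin_cases i <;> simp
    simp only [divergence, Fin.sum_univ_three, h1.fderiv]
    simp [h3, h5, h6]
    rw [← mul_add, h2, mul_zero]
  · simp [hv]

/-! ### Homotopy operators in the plane -/

/-- The first coordinate vector of the plane. -/
abbrev e₀ : Plane := EuclideanSpace.single 0 1

/-- The second coordinate vector of the plane. -/
abbrev e₁ : Plane := EuclideanSpace.single 1 1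

section LineConv

variable {E : Type} [NormedAddCommGroup E] [NormedSpace ℝ E]

/-- Convolution with a kernel along horizontal lines. -/
def lineConv (K : ℝ → ℝ) (f : Plane → E) (p : Plane) : E := ∫ t, K t • f (p - t • e₀)

lemma integrable_lineConv {K : ℝ → ℝ} (hK : Measurable K) (hK1 : ∀ t, |K t| ≤ 1) {f : Plane → E}
    (hf : Continuous f) (hc : HasCompactSupport f) (p : Plane) :
    Integrable fun t => K t • f (p - t • e₀) := by
  have h1 : Integrable fun t : ℝ => f (p - t • e₀) := by
    refine Continuous.integrable_of_hasCompactSupport (by fun_prop) ?_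
    obtain ⟨R, hR⟩ := hc.isCompact.isBounded.exists_norm_le
    refine HasCompactSupport.intro (isCompact_Icc (a := -(R + ‖p‖)) (b := R + ‖p‖)) fun t ht => ?_
    refine image_eq_zero_of_notMem_tsupport fun h => ht ?_
    have h2 := hR _ h
    have h3 : ‖t • e₀‖ ≤ R + ‖p‖ := by
      have := norm_sub_le p (p - t • e₀)
      rw [sub_sub_cancel] at this
      linarith
    rw [norm_smul, PiLp.norm_single, norm_one, mul_one, Real.norm_eq_abs] at h3
    exact abs_le.1 h3
  exact h1.bdd_smul 1 hK.aestronglyMeasurable (ae_of_all _ hK1)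

lemma hasFDerivAt_lineConv {K : ℝ → ℝ} (hK : Measurable K) (hK1 : ∀ t, |K t| ≤ 1) {f : Plane → E}
    (hf : ContDiff ℝ 1 f) (hc : HasCompactSupport f) (p : Plane) :
    HasFDerivAt (lineConv K f) (lineConv K (fderiv ℝ f) p) p := by
  obtain ⟨R, hR⟩ := hc.isCompact.isBounded.exists_norm_le
  have hf' : Continuous (fderiv ℝ f) := hf.continuous_fderiv (by simp)
  obtain ⟨C, hC⟩ := (hc.fderiv (𝕜 := ℝ)).exists_bound_of_continuous hf'
  refine hasFDerivAt_integral_of_dominated_of_fderiv_le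
    (F' := fun q t => K t • fderiv ℝ f (q - t • e₀))
    (bound := (Icc (-(R + ‖p‖ + 1)) (R + ‖p‖ + 1)).indicator fun _ => C)
    (Metric.ball_mem_nhds p one_pos)
    (Eventually.of_forall fun q => (integrable_lineConv hK hK1 hf.continuous hc q).1)
    (integrable_lineConv hK hK1 hf.continuous hc p)
    (integrable_lineConv hK hK1 hf' (hc.fderiv (𝕜 := ℝ)) p).1
    (ae_of_all _ fun t q hq => ?_) ?_ (ae_of_all _ fun t q _ => ?_)
  · by_cases ht : t ∈ Icc (-(R + ‖p‖ + 1)) (R + ‖p‖ + 1)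
    · rw [indicator_of_mem ht, norm_smul]
      exact (mul_le_of_le_one_left (norm_nonneg _) (hK1 t)).trans (hC _)
    · have : fderiv ℝ f (q - t • e₀) = 0 := by
        refine image_eq_zero_of_notMem_tsupport fun h => ht ?_
        have h2 := hR _ (tsupport_fderiv_subset ℝ h)
        have h4 : ‖q‖ ≤ ‖p‖ + 1 := by
          have := norm_sub_norm_le q p
          rw [mem_ball_iff_norm] at hq
          linarith
        have h3 : ‖t • e₀‖ ≤ R + ‖p‖ + 1 := by
          have := norm_sub_le q (q - t • e₀)
          rw [sub_sub_cancel] at this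
          linarith
        rw [norm_smul, PiLp.norm_single, norm_one, mul_one, Real.norm_eq_abs] at h3
        exact abs_le.1 h3
      rw [this, smul_zero, norm_zero, indicator_of_notMem ht]
  · exact (integrable_indicator_iff measurableSet_Icc).2 (integrableOn_const (by simp))
  · have h1 : HasFDerivAt (fun q => f (q - t • e₀)) (fderiv ℝ f (q - t • e₀)) q :=
      ((hf.differentiable (by simp) _).hasFDerivAt.comp q ((hasFDerivAt_id q).sub_const (t • e₀)))
    exact h1.const_smul (K t)

end LineConv

/-- Differentiation passes from `lineConv K f` to `f` but changes the space of values, so the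
induction runs over all target spaces at once. -/
lemma contDiff_lineConv {K : ℝ → ℝ} (hK : Measurable K) (hK1 : ∀ t, |K t| ≤ 1) (n : ℕ) :
    ∀ {E : Type} [NormedAddCommGroup E] [NormedSpace ℝ E] {f : Plane → E},
      ContDiff ℝ ∞ f → HasCompactSupport f → ContDiff ℝ n (lineConv K f) := by
  induction n with
  | zero =>
    intro E _ _ f hf hc
    rw [Nat.cast_zero, contDiff_zero]
    exact continuous_iff_continuousAt.2 fun p =>
      (hasFDerivAt_lineConv hK hK1 (hf.of_le (by norm_cast)) hc p).continuousAt
  | succ n ih =>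
    intro E _ _ f hf hc
    have h1 := hasFDerivAt_lineConv hK hK1 (hf.of_le (by norm_cast)) hc
    rw [Nat.cast_add, Nat.cast_one, contDiff_succ_iff_fderiv]
    refine ⟨fun p => (h1 p).differentiableAt, by simp, ?_⟩
    rw [funext fun p => (h1 p).fderiv]
    exact ih (hf.fderiv_right (m := ∞) (by simp)) (hc.fderiv (𝕜 := ℝ))

lemma fderiv_lineConv {K : ℝ → ℝ} (hK : Measurable K) (hK1 : ∀ t, |K t| ≤ 1) {f : Plane → ℝ}
    (hf : ContDiff ℝ ∞ f) (hc : HasCompactSupport f) (p e : Plane) :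
    fderiv ℝ (lineConv K f) p e = lineConv K (fun p => fderiv ℝ f p e) p := by
  rw [(hasFDerivAt_lineConv hK hK1 (hf.of_le (by norm_cast)) hc p).fderiv, lineConv,
    ContinuousLinearMap.integral_apply (integrable_lineConv hK hK1
      (hf.continuous_fderiv (by simp)) (hc.fderiv (𝕜 := ℝ)) p)]
  rfl

/-- The indicator function of the positive half-line. -/
def heaviside (t : ℝ) : ℝ := (Ioi (0 : ℝ)).indicator 1 t

lemma measurable_heaviside : Measurable heaviside :=
  measurable_one.indicator measurableSet_Ioi

lemma heaviside_of_pos {t : ℝ} (ht : 0 < t) : heaviside t = 1 := indicator_of_mem (by exact ht) _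

lemma heaviside_of_nonpos {t : ℝ} (ht : t ≤ 0) : heaviside t = 0 :=
  indicator_of_notMem (by simpa using ht) _

lemma heaviside_mem (t : ℝ) : heaviside t ∈ Icc (0 : ℝ) 1 := by
  rcases lt_or_ge 0 t with h | h
  · simp [heaviside_of_pos h]
  · simp [heaviside_of_nonpos h]

lemma abs_heaviside_le (t : ℝ) : |heaviside t| ≤ 1 := by
  rw [abs_of_nonneg (heaviside_mem t).1]; exact (heaviside_mem t).2

lemma integral_deriv_eq_zero {g : ℝ → ℝ} (hg : ContDiff ℝ 1 g) (hc : HasCompactSupport g) :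
    ∫ t, deriv g t = 0 := by
  have hi : Integrable (deriv g) :=
    (hg.continuous_deriv le_rfl).integrable_of_hasCompactSupport hc.deriv
  rw [← intervalIntegral.integral_Iic_add_Ioi hi.integrableOn hi.integrableOn (b := 0),
    hc.integral_Iic_deriv_eq hg, hc.integral_Ioi_deriv_eq hg, add_neg_cancel]

lemma integral_heaviside_mul_deriv {g : ℝ → ℝ} (hg : ContDiff ℝ 1 g) (hc : HasCompactSupport g)
    (y : ℝ) : ∫ t, heaviside (y - t) * deriv g t = g y := by
  have h1 : (fun t => heaviside (y - t) * deriv g t) = (Iio y).indicator (deriv g) := by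
    funext t
    rcases lt_or_ge t y with h | h
    · rw [heaviside_of_pos (by linarith), indicator_of_mem (by exact h), one_mul]
    · rw [heaviside_of_nonpos (by linarith), indicator_of_notMem (by simpa using h), zero_mul]
  rw [h1, integral_indicator measurableSet_Iio, ← integral_Iic_eq_integral_Iio]
  exact hc.integral_Iic_deriv_eq hg y

lemma hasCompactSupport_line {f : Plane → ℝ} (hc : HasCompactSupport f) (p : Plane) {e : Plane}
    (he : ‖e‖ = 1) : HasCompactSupport fun t : ℝ => f (p + t • e) := by
  obtain ⟨R, hR⟩ := hc.isCompact.isBounded.exists_norm_le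
  refine HasCompactSupport.intro (isCompact_Icc (a := -(R + ‖p‖)) (b := R + ‖p‖)) fun t ht => ?_
  refine image_eq_zero_of_notMem_tsupport fun h => ht ?_
  have h2 := hR _ h
  have h3 : ‖t • e‖ ≤ R + ‖p‖ := by
    have := norm_sub_le (p + t • e) p
    rw [add_sub_cancel_left] at this
    linarith
  rw [norm_smul, he, mul_one, Real.norm_eq_abs] at h3
  exact abs_le.1 h3

lemma hasDerivAt_line {f : Plane → ℝ} (hf : ContDiff ℝ 1 f) (p e : Plane) (t : ℝ) :
    HasDerivAt (fun t : ℝ => f (p + t • e)) (fderiv ℝ f (p + t • e) e) t := by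
  have h1 : HasDerivAt (fun t : ℝ => p + t • e) e t := by
    simpa using ((hasDerivAt_id t).smul_const e).const_add p
  exact (hf.differentiable (by simp) _).hasFDerivAt.comp_hasDerivAt t h1

lemma integral_fderiv_line {f : Plane → ℝ} (hf : ContDiff ℝ 1 f) (hc : HasCompactSupport f)
    (p : Plane) {e : Plane} (he : ‖e‖ = 1) : ∫ t : ℝ, fderiv ℝ f (p + t • e) e = 0 := by
  have := integral_deriv_eq_zero (g := fun t : ℝ => f (p + t • e)) (by fun_prop)
    (hasCompactSupport_line hc p he)
  rwa [funext fun t => (hasDerivAt_line hf p e t).deriv] at this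

lemma integral_heaviside_mul_fderiv_line {f : Plane → ℝ} (hf : ContDiff ℝ 1 f)
    (hc : HasCompactSupport f) (p : Plane) {e : Plane} (he : ‖e‖ = 1) (y : ℝ) :
    ∫ t : ℝ, heaviside (y - t) * fderiv ℝ f (p + t • e) e = f (p + y • e) := by
  have := integral_heaviside_mul_deriv (g := fun t : ℝ => f (p + t • e)) (by fun_prop)
    (hasCompactSupport_line hc p he) y
  rwa [funext fun t => (hasDerivAt_line hf p e t).deriv] at this

lemma norm_e₀ : ‖e₀‖ = 1 := by simp

lemma norm_e₁ : ‖e₁‖ = 1 := by simp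

lemma lineConv_one (f : Plane → ℝ) (p : Plane) :
    lineConv (fun _ => 1) f p = ∫ t : ℝ, f (p + t • e₀) := by
  rw [lineConv, ← integral_neg_eq_self]
  simp [sub_eq_add_neg]

lemma lineConv_heaviside (f : Plane → ℝ) (p : Plane) :
    lineConv heaviside f p = ∫ t : ℝ, heaviside (0 - t) * f (p + t • e₀) := by
  rw [lineConv, ← integral_neg_eq_self]
  simp [sub_eq_add_neg]

lemma lineConv_one_fderiv {f : Plane → ℝ} (hf : ContDiff ℝ 1 f) (hc : HasCompactSupport f)
    (p : Plane) : lineConv (fun _ => 1) (fun p => fderiv ℝ f p e₀) p = 0 := by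
  rw [lineConv_one]
  exact integral_fderiv_line hf hc p norm_e₀

lemma lineConv_heaviside_fderiv {f : Plane → ℝ} (hf : ContDiff ℝ 1 f) (hc : HasCompactSupport f)
    (p : Plane) : lineConv heaviside (fun p => fderiv ℝ f p e₀) p = f p := by
  rw [lineConv_heaviside, integral_heaviside_mul_fderiv_line hf hc p norm_e₀]
  simp

/-- The compactly supported antiderivative of `f - step' m(f)` in the first variable, where
`m(f)` are the integrals of `f` along horizontal lines. -/
def antideriv (f : Plane → ℝ) (p : Plane) : ℝ :=
  ∫ t, (heaviside t - step (p 0)) * f (p - t • e₀)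

lemma antideriv_eq {f : Plane → ℝ} (hf : Continuous f) (hc : HasCompactSupport f) (p : Plane) :
    antideriv f p = lineConv heaviside f p - step (p 0) * lineConv (fun _ => 1) f p := by
  have h1 := integrable_lineConv measurable_heaviside abs_heaviside_le hf hc p
  have h2 := integrable_lineConv (K := fun _ => 1) measurable_const (by simp) hf hc p
  rw [lineConv, lineConv, ← integral_const_mul, ← integral_sub h1 (h2.const_mul _)]
  simp [antideriv, sub_mul]

lemma contDiff_antideriv {f : Plane → ℝ} (hf : ContDiff ℝ ∞ f) (hc : HasCompactSupport f) :
    ContDiff ℝ ∞ (antideriv f) := by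
  rw [funext (antideriv_eq hf.continuous hc)]
  have h1 : ContDiff ℝ ∞ (lineConv heaviside f) := contDiff_infty.2 fun n =>
    contDiff_lineConv measurable_heaviside abs_heaviside_le n hf hc
  have h2 : ContDiff ℝ ∞ (lineConv (fun _ => 1) f) := contDiff_infty.2 fun n =>
    contDiff_lineConv measurable_const (by simp) n hf hc
  exact h1.sub ((contDiff_step.comp (contDiff_coord contDiff_id 0)).mul h2)

/-- Far to the left both `heaviside t` and `step` are `0` wherever `f` is seen, and far to the right
both are `1`: the subtracted term removes the constant tail of the antiderivative. -/
lemma hasCompactSupport_antideriv {f : Plane → ℝ} (hc : HasCompactSupport f) :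
    HasCompactSupport (antideriv f) := by
  obtain ⟨R, hR⟩ := hc.isCompact.isBounded.exists_norm_le
  have hR' : ∀ q : Plane, (R < |q 0| ∨ R < |q 1|) → f q = 0 := fun q hq => by
    refine image_eq_zero_of_notMem_tsupport fun h => ?_
    have h1 := hR _ h
    have h2 := PiLp.norm_apply_le q 0
    have h3 := PiLp.norm_apply_le q 1
    rw [Real.norm_eq_abs] at h2 h3
    rcases hq with h | h <;> linarith
  refine HasCompactSupport.intro (isCompact_closedBall 0 (|R| + 2 + |R|)) fun p hp => ?_
  rw [mem_closedBall_zero_iff, not_le] at hp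
  have hnorm : ‖p‖ ≤ |p 0| + |p 1| := by
    nth_rewrite 1 [plane_eq p]
    refine (norm_add_le _ _).trans_eq ?_
    simp [norm_smul]
  have hz : ∀ t, (heaviside t - step (p 0)) * f (p - t • e₀) = 0 := fun t => by
    by_cases h1 : R < |p 1|
    · rw [hR' _ (Or.inr (by simpa using h1)), mul_zero]
    · have h0 : |R| + 2 < |p 0| := by
        have := le_abs_self R
        linarith
      by_cases h2 : R < |p 0 - t|
      · rw [hR' _ (Or.inl (by simpa using h2)), mul_zero]
      · have h3 := abs_le.1 (not_lt.1 h2)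
        have h4 := le_abs_self R
        rcases lt_abs.1 h0 with h5 | h5
        · rw [heaviside_of_pos (by linarith [abs_nonneg R]),
            step_of_ge (by linarith [abs_nonneg R]), sub_self, zero_mul]
        · rw [heaviside_of_nonpos (by linarith [abs_nonneg R]),
            step_of_le (by linarith [abs_nonneg R]), sub_self, zero_mul]
  simp [antideriv, hz]

lemma antideriv_fderiv_zero {f : Plane → ℝ} (hf : ContDiff ℝ ∞ f) (hc : HasCompactSupport f)
    (p : Plane) : antideriv (fun p => fderiv ℝ f p e₀) p = f p := by
  rw [antideriv_eq (contDiff_fderiv_apply hf _).continuous (hc.fderiv_apply (𝕜 := ℝ) _),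
    lineConv_one_fderiv (hf.of_le (by norm_cast)) hc,
    lineConv_heaviside_fderiv (hf.of_le (by norm_cast)) hc]
  simp

/-- Convolution commutes with derivatives; the only correction comes from the factor `step (p 0)`.
In the vertical direction there is none, and in the horizontal direction it is the defect by which
`antideriv` fails to invert the derivative. -/
lemma fderiv_antideriv {f : Plane → ℝ} (hf : ContDiff ℝ ∞ f) (hc : HasCompactSupport f)
    (p e : Plane) : fderiv ℝ (antideriv f) p e =
      antideriv (fun p => fderiv ℝ f p e) p - e 0 * deriv step (p 0) * lineConv (fun _ => 1) f p := by
  have hle : (1 : WithTop ℕ∞) ≤ ∞ := by norm_cast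
  have h1 := hasFDerivAt_lineConv measurable_heaviside abs_heaviside_le (hf.of_le hle) hc p
  have h2 := hasFDerivAt_lineConv (K := fun _ => 1) measurable_const (by simp) (hf.of_le hle) hc p
  have h3 : HasFDerivAt (fun p : Plane => step (p 0))
      (deriv step (p 0) • EuclideanSpace.proj (𝕜 := ℝ) (0 : Fin 2)) p :=
    (contDiff_step.differentiable (by simp) _).hasDerivAt.comp_hasFDerivAt p
      (EuclideanSpace.proj (𝕜 := ℝ) (0 : Fin 2)).hasFDerivAt
  have h4 := h1.sub (h3.mul h2)
  rw [funext (antideriv_eq hf.continuous hc), antideriv_eq (contDiff_fderiv_apply hf _).continuous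
    (hc.fderiv_apply (𝕜 := ℝ) _), ← fderiv_lineConv measurable_heaviside abs_heaviside_le hf hc,
    ← fderiv_lineConv measurable_const (by simp) hf hc, h1.fderiv, h2.fderiv]
  refine (congrArg (· e) h4.fderiv).trans ?_
  simp
  ring

lemma fderiv_antideriv_one {f : Plane → ℝ} (hf : ContDiff ℝ ∞ f) (hc : HasCompactSupport f)
    (p : Plane) : fderiv ℝ (antideriv f) p e₁ = antideriv (fun p => fderiv ℝ f p e₁) p := by
  rw [fderiv_antideriv hf hc]
  simp

lemma fderiv_antideriv_zero {f : Plane → ℝ} (hf : ContDiff ℝ ∞ f) (hc : HasCompactSupport f)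
    (p : Plane) : fderiv ℝ (antideriv f) p e₀ =
      f p - deriv step (p 0) * lineConv (fun _ => 1) f p := by
  rw [fderiv_antideriv hf hc, antideriv_fderiv_zero hf hc]
  simp

/-! ### Integration along the coordinates of the plane -/

lemma measurePreserving_pair :
    MeasurePreserving (fun q : ℝ × ℝ => (!₂[q.1, q.2] : Plane)) volume volume := by
  have h := (PiLp.volume_preserving_toLp (Fin 2)).comp (volume_preserving_finTwoArrow ℝ).symm
  have heq : (@WithLp.toLp 2 (Fin 2 → ℝ)) ∘ (MeasurableEquiv.finTwoArrow (α := ℝ)).symm =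
      fun q : ℝ × ℝ => (!₂[q.1, q.2] : Plane) := by
    funext q
    ext i
    fin_cases i <;> rfl
  rwa [heq] at h

lemma pair_eq (s t : ℝ) : (!₂[s, t] : Plane) = t • e₁ + s • e₀ := by
  ext i; fin_cases i <;> simp

lemma measurableEmbedding_pair : MeasurableEmbedding fun q : ℝ × ℝ => (!₂[q.1, q.2] : Plane) := by
  have h := (MeasurableEquiv.toLp 2 (Fin 2 → ℝ)).measurableEmbedding.comp
    (MeasurableEquiv.finTwoArrow (α := ℝ)).symm.measurableEmbedding
  have heq : (MeasurableEquiv.toLp 2 (Fin 2 → ℝ)) ∘ (MeasurableEquiv.finTwoArrow (α := ℝ)).symm =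
      fun q : ℝ × ℝ => (!₂[q.1, q.2] : Plane) := by
    funext q
    ext i
    fin_cases i <;> rfl
  rwa [heq] at h

lemma integral_plane {f : Plane → ℝ} (hf : Integrable f) :
    ∫ p, f p = ∫ t : ℝ, ∫ s : ℝ, f (t • e₁ + s • e₀) := by
  rw [← measurePreserving_pair.integral_comp measurableEmbedding_pair f]
  have h := (measurePreserving_pair.integrable_comp_emb measurableEmbedding_pair).2 hf
  rw [Measure.volume_eq_prod] at h ⊢
  refine (integral_prod_symm _ h).trans ?_
  simp only [Function.comp, pair_eq]

lemma integral_plane_symm {f : Plane → ℝ} (hf : Integrable f) :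
    ∫ p, f p = ∫ s : ℝ, ∫ t : ℝ, f (s • e₀ + t • e₁) := by
  rw [← measurePreserving_pair.integral_comp measurableEmbedding_pair f]
  have h := (measurePreserving_pair.integrable_comp_emb measurableEmbedding_pair).2 hf
  rw [Measure.volume_eq_prod] at h ⊢
  refine (integral_prod _ h).trans ?_
  simp only [Function.comp, pair_eq, add_comm (_ • e₀)]

/-- The integrals along horizontal lines, recovered from the vertical derivative. -/
def meanAntideriv (h : Plane → ℝ) (p : Plane) : ℝ :=
  deriv step (p 0) * ∫ q : Plane, (heaviside (p 1 - q 1) - step (p 1)) * h q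

lemma integrable_heaviside_mul {h : Plane → ℝ} (hh : Continuous h) (hc : HasCompactSupport h)
    (y : ℝ) : Integrable fun q : Plane => heaviside (y - q 1) * h q :=
  (hh.integrable_of_hasCompactSupport hc).bdd_mul (c := 1)
    (measurable_heaviside.comp (by fun_prop)).aestronglyMeasurable
    (ae_of_all _ fun _ => abs_heaviside_le _)

/-- A horizontal derivative has zero integral along every horizontal line, and `meanAntideriv`
depends on its argument only through these integrals. -/
lemma meanAntideriv_fderiv_zero {f : Plane → ℝ} (hf : ContDiff ℝ ∞ f) (hc : HasCompactSupport f)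
    (p : Plane) : meanAntideriv (fun p => fderiv ℝ f p e₀) p = 0 := by
  have h1 := (contDiff_fderiv_apply hf e₀).continuous
  have h2 := hc.fderiv_apply (𝕜 := ℝ) e₀
  have h3 := h1.integrable_of_hasCompactSupport h2 (μ := volume)
  have hz : ∀ q, ∫ t : ℝ, fderiv ℝ f (q + t • e₀) e₀ = 0 := fun q =>
    integral_fderiv_line (hf.of_le (by norm_cast)) hc q norm_e₀
  rw [meanAntideriv]
  simp only [sub_mul]
  rw [integral_sub (integrable_heaviside_mul h1 h2 _) (h3.const_mul _), integral_const_mul,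
    integral_plane (integrable_heaviside_mul h1 h2 _), integral_plane h3]
  simp [integral_const_mul, hz]

/-- The line integrals of a vertical derivative are the derivative of the line integrals, and
integrating in the vertical variable restores them. This is precisely the defect left by `antideriv`
in `fderiv_antideriv_zero`. -/
lemma meanAntideriv_fderiv_one {f : Plane → ℝ} (hf : ContDiff ℝ ∞ f) (hc : HasCompactSupport f)
    (p : Plane) : meanAntideriv (fun p => fderiv ℝ f p e₁) p =
      deriv step (p 0) * lineConv (fun _ => 1) f p := by
  have hle : (1 : WithTop ℕ∞) ≤ ∞ := by norm_cast
  have h1 := (contDiff_fderiv_apply hf e₁).continuous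
  have h2 := hc.fderiv_apply (𝕜 := ℝ) e₁
  have h3 := h1.integrable_of_hasCompactSupport h2 (μ := volume)
  have hz : ∀ q, ∫ t : ℝ, fderiv ℝ f (q + t • e₁) e₁ = 0 := fun q =>
    integral_fderiv_line (hf.of_le hle) hc q norm_e₁
  have hy : ∀ q, ∫ t : ℝ, heaviside (p 1 - t) * fderiv ℝ f (q + t • e₁) e₁ = f (q + p 1 • e₁) :=
    fun q => integral_heaviside_mul_fderiv_line (hf.of_le hle) hc q norm_e₁ _
  rw [meanAntideriv]
  simp only [sub_mul]
  rw [integral_sub (integrable_heaviside_mul h1 h2 _) (h3.const_mul _), integral_const_mul,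
    integral_plane_symm (integrable_heaviside_mul h1 h2 _), integral_plane_symm h3, lineConv_one,
    ← integral_add_left_eq_self _ (p 0)]
  have h4 : ∀ t : ℝ, p + t • e₀ = (p 0 + t) • e₀ + p 1 • e₁ := fun t => by
    ext i; fin_cases i <;> simp
  simp [hz, hy, h4]

/-! ### Densities of images of measures -/

section Density

variable {M : Type*} [MeasurableSpace M] {μ : Measure M} {G : M → Plane}

/-- The image under `G` of the measure with density `b` is locally finite by `hint` and absolutely
continuous by `hnull`, so Radon–Nikodym supplies `ρ`. -/
lemma exists_density_nnreal (hG : Measurable G) {b : M → NNReal} (hb : Measurable b)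
    (hnull : ∀ N : Set Plane, MeasurableSet N → volume N = 0 → ∀ᵐ m ∂μ, b m ≠ 0 → G m ∉ N)
    (hint : ∀ R : ℝ, ∫⁻ m in G ⁻¹' Metric.closedBall 0 R, b m ∂μ ≠ ⊤) :
    ∃ ρ : Plane → ℝ, LocallyIntegrable ρ ∧ ∀ h : Plane → ℝ, Continuous h →
      ∫ p, ρ p * h p = ∫ m, b m * h (G m) ∂μ := by
  set ν : Measure Plane := (μ.withDensity fun m => b m).map G with hν
  have hball : ∀ R, ν (Metric.closedBall 0 R) < ⊤ := fun R => by
    rw [hν, Measure.map_apply hG measurableSet_closedBall,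
      withDensity_apply _ (hG measurableSet_closedBall)]
    exact lt_top_iff_ne_top.2 (hint R)
  have hnear : ∀ p : Plane, Metric.closedBall 0 (‖p‖ + 1) ∈ 𝓝 p := fun p =>
    mem_of_superset (Metric.ball_mem_nhds p one_pos) fun q hq => by
      rw [mem_closedBall_zero_iff]
      rw [mem_ball_iff_norm] at hq
      linarith [norm_sub_norm_le q p]
  have : IsLocallyFiniteMeasure ν := ⟨fun p => ⟨_, hnear p, hball _⟩⟩
  have hac : ν ≪ volume := Measure.AbsolutelyContinuous.mk fun N hN hN0 => by
    rw [hν, Measure.map_apply hG hN, withDensity_apply _ (hG hN), lintegral_eq_zero_iff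
      hb.coe_nnreal_ennreal]
    refine (ae_restrict_iff' (hG hN)).2 ?_
    filter_upwards [hnull N hN hN0] with m hm hmN
    by_contra hcon
    exact hm (fun h => hcon (by simp [h])) hmN
  refine ⟨fun p => (ν.rnDeriv volume p).toReal, fun p => ⟨_, hnear p, ?_⟩, fun h hh => ?_⟩
  · exact integrable_toReal_of_lintegral_ne_top (Measure.measurable_rnDeriv _ _).aemeasurable
      ((Measure.setLIntegral_rnDeriv_le _).trans_lt (hball _)).ne
  · rw [integral_toReal_rnDeriv_mul hac, hν, integral_map hG.aemeasurable
      hh.aestronglyMeasurable, integral_withDensity_eq_integral_smul hb]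
    rfl

lemma integrable_mul_comp_of_hasCompactSupport (hG : Measurable G) {b : M → ℝ}
    (hint : ∀ R : ℝ, IntegrableOn b (G ⁻¹' Metric.closedBall 0 R) μ) {h : Plane → ℝ}
    (hh : Continuous h) (hc : HasCompactSupport h) : Integrable (fun m => b m * h (G m)) μ := by
  obtain ⟨R, hR⟩ := hc.isCompact.isBounded.exists_norm_le
  obtain ⟨C, hC⟩ := hc.exists_bound_of_continuous hh
  have h1 : IntegrableOn (fun m => b m * h (G m)) (G ⁻¹' Metric.closedBall 0 R) μ :=
    (hint R).mul_bdd (c := C) (hh.measurable.comp hG).aestronglyMeasurable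
      (ae_of_all _ fun m => hC _)
  refine h1.integrable_of_forall_notMem_eq_zero fun m hm => ?_
  rw [image_eq_zero_of_notMem_tsupport fun h => hm (mem_closedBall_zero_iff.2 (hR _ h)), mul_zero]

lemma exists_density (hG : Measurable G) {b : M → ℝ} (hb : Measurable b)
    (hnull : ∀ N : Set Plane, MeasurableSet N → volume N = 0 → ∀ᵐ m ∂μ, b m ≠ 0 → G m ∉ N)
    (hint : ∀ R : ℝ, IntegrableOn b (G ⁻¹' Metric.closedBall 0 R) μ) :
    ∃ ρ : Plane → ℝ, LocallyIntegrable ρ ∧ ∀ h : Plane → ℝ, Continuous h → HasCompactSupport h →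
      ∫ p, ρ p * h p = ∫ m, b m * h (G m) ∂μ := by
  have key : ∀ b' : M → ℝ, Measurable b' → (∀ m, b' m ≠ 0 → b m ≠ 0) →
      (∀ R : ℝ, IntegrableOn b' (G ⁻¹' Metric.closedBall 0 R) μ) →
      ∃ ρ : Plane → ℝ, LocallyIntegrable ρ ∧ ∀ h : Plane → ℝ, Continuous h →
        ∫ p, ρ p * h p = ∫ m, (b' m).toNNReal * h (G m) ∂μ := fun b' hb' hbb' hint' =>
    exists_density_nnreal hG hb'.real_toNNReal
      (fun N hN hN0 => (hnull N hN hN0).mono fun m hm h0 => hm (hbb' m fun h => h0 (by simp [h])))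
      fun R => (hint' R).lintegral_lt_top.ne
  obtain ⟨ρ₁, h1, h1'⟩ := key b hb (fun _ => id) hint
  obtain ⟨ρ₂, h2, h2'⟩ := key (-b) hb.neg (fun m hm h0 => hm (by simp [h0])) fun R => (hint R).neg
  refine ⟨fun p => ρ₁ p - ρ₂ p, h1.sub h2, fun h hh hc => ?_⟩
  have hi := integrable_mul_comp_of_hasCompactSupport hG hint hh hc
  have hj : ∀ b' : M → ℝ, Measurable b' → (∀ m, |b' m| ≤ |b m|) →
      Integrable (fun m => b' m * h (G m)) μ := fun b' hb' hle =>
    hi.mono (hb'.mul (hh.measurable.comp hG)).aestronglyMeasurable (ae_of_all _ fun m => by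
      rw [Real.norm_eq_abs, Real.norm_eq_abs, abs_mul, abs_mul]
      exact mul_le_mul_of_nonneg_right (hle m) (abs_nonneg _))
  have hpos : ∀ x : ℝ, |(x.toNNReal : ℝ)| ≤ |x| := fun x => by
    rw [Real.coe_toNNReal', abs_of_nonneg (le_max_right _ _)]
    exact max_le (le_abs_self x) (abs_nonneg x)
  have h3 : Integrable fun p => ρ₁ p * h p := h1.integrable_smul_right_of_hasCompactSupport hh hc
  have h4 : Integrable fun p => ρ₂ p * h p := h2.integrable_smul_right_of_hasCompactSupport hh hc
  simp_rw [sub_mul]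
  rw [integral_sub h3 h4, h1' h hh, h2' h hh,
    ← integral_sub (hj _ hb.real_toNNReal.coe_nnreal_real fun m => hpos _)
      (hj _ hb.neg.real_toNNReal.coe_nnreal_real fun m => (hpos _).trans_eq (abs_neg _))]
  refine integral_congr_ae (ae_of_all _ fun m => ?_)
  show _ - _ = _
  rw [← sub_mul, Real.coe_toNNReal', Real.coe_toNNReal']
  congr 1
  exact max_zero_sub_max_neg_zero_eq_self (b m)

end Density

lemma abs_heaviside_sub_step_le (s t : ℝ) : |heaviside t - step s| ≤ 1 := by
  have h1 := heaviside_mem t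
  have h2 := step_mem s
  exact abs_le.2 ⟨by linarith [h1.1, h2.2], by linarith [h1.2, h2.1]⟩

/-- The weight vanishes when `s` and `t` are both far out on the same side. Thus, if the image point
is bounded, so is the base point; this is what makes the image measures locally finite. -/
lemma abs_le_of_heaviside_sub_step_ne_zero {s t R : ℝ} (h : heaviside t - step s ≠ 0)
    (hR : |s - t| ≤ R) : |s| ≤ R + 2 := by
  have h1 := abs_le.1 hR
  refine abs_le.2 ⟨?_, ?_⟩ <;> by_contra hcon <;> refine h ?_
  · rw [heaviside_of_nonpos (by linarith), step_of_le (by linarith), sub_self]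
  · rw [heaviside_of_pos (by linarith), step_of_ge (by linarith), sub_self]

lemma ae_ae_pair_notMem {N : Set Plane} (hN : volume N = 0) :
    ∀ᵐ y : ℝ, ∀ᵐ s : ℝ, (!₂[s, y] : Plane) ∉ N := by
  have h1 : ∀ᵐ q : ℝ × ℝ, (!₂[q.1, q.2] : Plane) ∉ N :=
    measurePreserving_pair.quasiMeasurePreserving.ae (measure_eq_zero_iff_ae_notMem.1 hN)
  have h2 : ∀ᵐ q : ℝ × ℝ, (!₂[q.2, q.1] : Plane) ∉ N :=
    (Measure.measurePreserving_swap (μ := (volume : Measure ℝ))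
      (ν := (volume : Measure ℝ))).quasiMeasurePreserving.ae h1
  exact Measure.ae_ae_of_ae_prod h2

section Pressure

variable {A : Type*} [MeasurableSpace A] {α : Measure A} [SFinite α] {x : A → Plane} {c : A → ℝ}

/-- Dually, `antideriv` spreads the mass `c a` at `x a` along the horizontal line through `x a`. The
result has a density provided that the heights carrying mass do not concentrate on a null set, which
is the hypothesis `hac`: almost every horizontal line meets a planar null set in a null set. -/
lemma exists_density_antideriv (hx : Measurable x) (hc : Measurable c)
    (hint : ∀ R : ℝ, IntegrableOn c (x ⁻¹' Metric.closedBall 0 R) α)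
    (hac : ∀ Z : Set ℝ, volume Z = 0 → ∀ᵐ a ∂α, c a ≠ 0 → x a 1 ∉ Z) :
    ∃ ρ : Plane → ℝ, LocallyIntegrable ρ ∧ ∀ h : Plane → ℝ, Continuous h → HasCompactSupport h →
      ∫ p, ρ p * h p = ∫ a, c a * antideriv h (x a) ∂α := by
  have hx0 : Measurable fun a => x a 0 :=
    (EuclideanSpace.proj (𝕜 := ℝ) (0 : Fin 2)).measurable.comp hx
  set G : A × ℝ → Plane := fun m => x m.1 - m.2 • e₀ with hGdef
  set b : A × ℝ → ℝ := fun m => c m.1 * (heaviside m.2 - step (x m.1 0)) with hbdef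
  have hG : Measurable G := (hx.comp measurable_fst).sub (measurable_snd.smul_const _)
  have hb : Measurable b := (hc.comp measurable_fst).mul
    ((measurable_heaviside.comp measurable_snd).sub
      (contDiff_step.continuous.measurable.comp (hx0.comp measurable_fst)))
  have hintG : ∀ R : ℝ, IntegrableOn b (G ⁻¹' Metric.closedBall 0 R) (α.prod volume) := fun R => by
    have h1 : Integrable ((x ⁻¹' Metric.closedBall 0 (|R| + 2 + |R|)).indicator c) α :=
      (hint _).integrable_indicator (hx measurableSet_closedBall)
    have h2 : Integrable ((Icc (-(|R| + 2 + |R|)) (|R| + 2 + |R|)).indicator fun _ : ℝ => (1 : ℝ)) :=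
      (integrable_indicator_iff measurableSet_Icc).2 (integrableOn_const (by simp))
    refine IntegrableOn.congr_fun_ae (f := b) ?_ (ae_of_all _ fun _ => rfl)
    refine ((h1.mul_prod h2).norm.integrableOn).mono' hb.aestronglyMeasurable.restrict
      ((ae_restrict_iff' (hG measurableSet_closedBall)).2 (ae_of_all _ fun m hm => ?_))
    rw [mem_preimage, mem_closedBall_zero_iff] at hm
    by_cases h0 : heaviside m.2 - step (x m.1 0) = 0
    · simp only [hbdef, h0, mul_zero, norm_zero]
      exact norm_nonneg _
    have h3 : |x m.1 0 - m.2| ≤ |R| := by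
      have := (PiLp.norm_apply_le (G m) 0).trans (hm.trans (le_abs_self R))
      simpa [hGdef] using this
    have h4 : |x m.1 1| ≤ |R| := by
      have := (PiLp.norm_apply_le (G m) 1).trans (hm.trans (le_abs_self R))
      simpa [hGdef] using this
    have h5 := abs_le_of_heaviside_sub_step_ne_zero h0 h3
    have h6 : ‖x m.1‖ ≤ |R| + 2 + |R| := by
      rw [plane_eq (x m.1)]
      refine (norm_add_le _ _).trans ?_
      simp only [norm_smul, PiLp.norm_single, norm_one, mul_one, Real.norm_eq_abs]
      linarith
    have h7 : m.2 ∈ Icc (-(|R| + 2 + |R|)) (|R| + 2 + |R|) := by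
      have h8 := abs_le.1 h3
      have h9 := abs_le.1 h5
      exact ⟨by linarith [h8.1, h9.1], by linarith⟩
    rw [indicator_of_mem (by simpa using h6), indicator_of_mem h7, mul_one, hbdef, norm_mul]
    exact mul_le_of_le_one_right (norm_nonneg _) (abs_heaviside_sub_step_le _ _)
  have hnull : ∀ N : Set Plane, MeasurableSet N → volume N = 0 →
      ∀ᵐ m ∂(α.prod volume), b m ≠ 0 → G m ∉ N := by
    intro N hN hN0
    have hms : MeasurableSet {m : A × ℝ | b m ≠ 0 → G m ∉ N} := by
      have : {m : A × ℝ | b m ≠ 0 → G m ∉ N} = {m | b m = 0} ∪ (G ⁻¹' N)ᶜ := by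
        ext m
        simp only [mem_ofPred_eq, mem_union, mem_compl_iff, mem_preimage]
        tauto
      rw [this]
      exact (hb (measurableSet_singleton 0)).union (hG hN).compl
    rw [Measure.ae_prod_iff_ae_ae hms]
    filter_upwards [hac _ (ae_iff.1 (ae_ae_pair_notMem hN0))] with a ha
    by_cases hca : c a = 0
    · exact ae_of_all _ fun t h => absurd (by simp [hbdef, hca]) h
    · have h1 : ∀ᵐ s : ℝ, (!₂[s, x a 1] : Plane) ∉ N := by
        by_contra hcon
        exact ha hca hcon
      have h2 : ∀ᵐ t : ℝ, (!₂[x a 0 - t, x a 1] : Plane) ∉ N :=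
        (Measure.measurePreserving_sub_left volume (x a 0)).quasiMeasurePreserving.ae h1
      filter_upwards [h2] with t ht _
      have : G (a, t) = !₂[x a 0 - t, x a 1] := by
        ext i; fin_cases i <;> simp [hGdef]
      rwa [this]
  obtain ⟨ρ, hρ, h⟩ := exists_density hG hb hnull hintG
  refine ⟨ρ, hρ, fun h' hh hhc => ?_⟩
  rw [h h' hh hhc, integral_prod _ (integrable_mul_comp_of_hasCompactSupport hG hintG hh hhc)]
  refine integral_congr_ae (ae_of_all _ fun a => ?_)
  simp only [hbdef, hGdef, mul_assoc, integral_const_mul, antideriv]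

/-- Here the mass is spread over a two-dimensional region, so absolute continuity needs no condition
on `x`. -/
lemma exists_density_meanAntideriv (hx : Measurable x) (hc : Measurable c)
    (hint : ∀ R : ℝ, IntegrableOn c (x ⁻¹' Metric.closedBall 0 R) α) :
    ∃ ρ : Plane → ℝ, LocallyIntegrable ρ ∧ ∀ h : Plane → ℝ, Continuous h → HasCompactSupport h →
      ∫ p, ρ p * h p = ∫ a, c a * meanAntideriv h (x a) ∂α := by
  have hx0 : Measurable fun a => x a 0 :=
    (EuclideanSpace.proj (𝕜 := ℝ) (0 : Fin 2)).measurable.comp hx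
  have hx1 : Measurable fun a => x a 1 :=
    (EuclideanSpace.proj (𝕜 := ℝ) (1 : Fin 2)).measurable.comp hx
  have hproj : Measurable fun q : Plane => q 1 :=
    (EuclideanSpace.proj (𝕜 := ℝ) (1 : Fin 2)).measurable
  obtain ⟨K, hK⟩ := hasCompactSupport_deriv_step.exists_bound_of_continuous continuous_deriv_step
  set b : A × Plane → ℝ := fun m =>
    c m.1 * (deriv step (x m.1 0) * (heaviside (x m.1 1 - m.2 1) - step (x m.1 1))) with hbdef
  have hb : Measurable b := (hc.comp measurable_fst).mul
    ((continuous_deriv_step.measurable.comp (hx0.comp measurable_fst)).mul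
    ((measurable_heaviside.comp ((hx1.comp measurable_fst).sub (hproj.comp measurable_snd))).sub
      (contDiff_step.continuous.measurable.comp (hx1.comp measurable_fst))))
  have hintG : ∀ R : ℝ, IntegrableOn b (Prod.snd ⁻¹' Metric.closedBall 0 R) (α.prod volume) :=
    fun R => by
    have h1 : Integrable ((x ⁻¹' Metric.closedBall 0 (2 + (|R| + 2))).indicator c) α :=
      (hint _).integrable_indicator (hx measurableSet_closedBall)
    have h2 : Integrable ((Metric.closedBall (0 : Plane) R).indicator fun _ => K) :=
      (integrable_indicator_iff measurableSet_closedBall).2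
        (integrableOn_const measure_closedBall_lt_top.ne)
    refine IntegrableOn.congr_fun_ae (f := b) ?_ (ae_of_all _ fun _ => rfl)
    refine ((h1.mul_prod h2).norm.integrableOn).mono' hb.aestronglyMeasurable.restrict
      ((ae_restrict_iff' (measurable_snd measurableSet_closedBall)).2 (ae_of_all _ fun m hm => ?_))
    have hm' : ‖m.2‖ ≤ R := by simpa using hm
    by_cases h0 : heaviside (x m.1 1 - m.2 1) - step (x m.1 1) = 0
    · simp only [hbdef, h0, mul_zero, norm_zero]
      exact norm_nonneg _
    by_cases h0' : x m.1 0 ∈ Icc (1 : ℝ) 2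
    · have h3 : |x m.1 1 - (x m.1 1 - m.2 1)| ≤ |R| := by
        rw [sub_sub_cancel]
        exact (PiLp.norm_apply_le m.2 1).trans (hm'.trans (le_abs_self R))
      have h5 := abs_le_of_heaviside_sub_step_ne_zero h0 h3
      have h4 : |x m.1 0| ≤ 2 := abs_le.2 ⟨by linarith [h0'.1], h0'.2⟩
      have h6 : ‖x m.1‖ ≤ 2 + (|R| + 2) := by
        rw [plane_eq (x m.1)]
        refine (norm_add_le _ _).trans ?_
        simp only [norm_smul, PiLp.norm_single, norm_one, mul_one, Real.norm_eq_abs]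
        linarith
      rw [indicator_of_mem (by simpa using h6), indicator_of_mem (by exact hm), hbdef, norm_mul,
        norm_mul, norm_mul]
      gcongr
      refine (mul_le_of_le_one_right (norm_nonneg _) (abs_heaviside_sub_step_le _ _)).trans ?_
      exact (hK _).trans (le_abs_self K)
    · simp only [hbdef, deriv_step_of_notMem h0', zero_mul, mul_zero, norm_zero]
      exact norm_nonneg _
  have hnull : ∀ N : Set Plane, MeasurableSet N → volume N = 0 →
      ∀ᵐ m ∂(α.prod volume), b m ≠ 0 → m.2 ∉ N := by
    intro N hN hN0
    have h1 : ∀ᵐ m ∂(α.prod (volume : Measure Plane)), m.2 ∉ N :=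
      Measure.quasiMeasurePreserving_snd.ae (measure_eq_zero_iff_ae_notMem.1 hN0)
    exact h1.mono fun m hm _ => hm
  obtain ⟨ρ, hρ, h⟩ := exists_density measurable_snd hb hnull hintG
  refine ⟨ρ, hρ, fun h' hh hhc => ?_⟩
  rw [h h' hh hhc, integral_prod _
    (integrable_mul_comp_of_hasCompactSupport measurable_snd hintG hh hhc)]
  refine integral_congr_ae (ae_of_all _ fun a => ?_)
  simp only [hbdef, mul_assoc, integral_const_mul, meanAntideriv]

end Pressure

/-! ### The surface pressure -/

/-- Where the derivative is nonzero, `c` is locally injective, and by the change of variables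
formula `|c'|` has zero integral over the preimage of a null set. -/
lemma ae_deriv_ne_zero_imp_notMem {c : ℝ → ℝ} (hc : ContDiff ℝ 1 c) {Z : Set ℝ}
    (hZ : volume Z = 0) : ∀ᵐ s, deriv c s ≠ 0 → c s ∉ Z := by
  -- `Z` is arbitrary, so it is replaced by a measurable null set containing it.
  set S : Set ℝ := {s | deriv c s ≠ 0 ∧ c s ∈ toMeasurable volume Z} with hS
  have hd : Continuous (deriv c) := hc.continuous_deriv le_rfl
  have hopen : IsOpen {s | deriv c s ≠ 0} := isOpen_ne_fun hd continuous_const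
  suffices h : volume S = 0 by
    filter_upwards [measure_eq_zero_iff_ae_notMem.1 h] with s hs h1 h2
    exact hs ⟨h1, subset_toMeasurable _ _ h2⟩
  refine measure_null_of_locally_null S fun s hs => ?_
  obtain ⟨ε, hε, hball⟩ := Metric.isOpen_iff.1 hopen s hs.1
  refine ⟨S ∩ Metric.ball s ε, inter_mem_nhdsWithin _ (Metric.ball_mem_nhds s hε), ?_⟩
  have hms : MeasurableSet (S ∩ Metric.ball s ε) :=
    (hopen.measurableSet.inter (hc.continuous.measurable (measurableSet_toMeasurable _ _))).inter
      measurableSet_ball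
  have hinj : InjOn c (S ∩ Metric.ball s ε) := by
    have key : ∀ a ∈ Metric.ball s ε, ∀ b ∈ Metric.ball s ε, c a = c b → ¬a < b := by
      intro a ha b hb hab hlt
      obtain ⟨ξ, hξ, h0⟩ := exists_deriv_eq_zero hlt hc.continuous.continuousOn hab
      have hmem : ξ ∈ Metric.ball s ε := by
        rw [Real.ball_eq_Ioo] at ha hb ⊢
        exact ⟨ha.1.trans hξ.1, hξ.2.trans hb.2⟩
      exact hball hmem h0
    intro a ha b hb hab
    exact le_antisymm (not_lt.1 (key b hb.2 a ha.2 hab.symm)) (not_lt.1 (key a ha.2 b hb.2 hab))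
  have h1 := lintegral_image_eq_lintegral_abs_deriv_mul hms
    (fun x _ => (hc.differentiable (by simp) x).hasDerivAt.hasDerivWithinAt) hinj 1
  have h2 : volume (c '' (S ∩ Metric.ball s ε)) = 0 :=
    measure_mono_null (by rintro _ ⟨a, ha, rfl⟩; exact ha.1.2) ((measure_toMeasurable Z).trans hZ)
  simp only [Pi.one_apply, mul_one, lintegral_const, Measure.restrict_apply_univ, one_mul] at h1
  rw [h2] at h1
  have h3 := (lintegral_eq_zero_iff (hd.abs.measurable.ennreal_ofReal)).1 h1.symm
  rw [EventuallyEq, ae_restrict_iff' hms] at h3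
  rw [measure_eq_zero_iff_ae_notMem]
  filter_upwards [h3] with a ha hmem
  have := ha hmem
  simp only [Pi.zero_apply, ENNReal.ofReal_eq_zero, abs_nonpos_iff] at this
  exact hmem.1.1 this

lemma ae_coord_notMem {Z : Set ℝ} (hZ : volume Z = 0) : ∀ᵐ p : Plane, p 1 ∉ Z := by
  rw [← measurePreserving_pair.map_eq, measurableEmbedding_pair.ae_map_iff]
  exact Measure.quasiMeasurePreserving_snd.ae (measure_eq_zero_iff_ae_notMem.1 hZ)

section Force

variable {m : ℕ} {γ : Fin m → ℝ → Plane} {C : ℝ} {u : Space → Space}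

lemma integrableOn_surfaceStress (hγ : IsCurveSystem γ)
    (hu : IsRegularField (⋃ i, range (γ i)) C u) (j : Fin 2) (R : ℝ) :
    IntegrableOn (fun p => surfaceStress u p j) (Metric.closedBall 0 R) := by
  have hΓ : IsClosed (⋃ i, range (γ i)) := hγ.isCompact_iUnion_range.isClosed
  have hm : AEStronglyMeasurable fun p => surfaceStress u p j :=
    aestronglyMeasurable_of_continuousOn_compl hΓ hγ.volume_iUnion_range
      ((EuclideanSpace.proj (𝕜 := ℝ) j).continuous.comp_continuousOn
        (hu.continuousOn_surfaceStress hΓ))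
  have hC := hu.const_nonneg
  refine (((integrable_plane_weight hγ).const_mul (2 * C * (1 + R))).integrableOn).mono'
    hm.restrict ((ae_restrict_iff' measurableSet_closedBall).2 ?_)
  filter_upwards [measure_eq_zero_iff_ae_notMem.1 hγ.volume_iUnion_range] with p hp hpR
  rw [mem_closedBall_zero_iff] at hpR
  refine ((PiLp.norm_apply_le _ j).trans (hu.norm_surfaceStress_le hΓ hp)).trans ?_
  have h1 : (1 + ‖p‖)⁻¹ ^ 2 ≤ (1 + R) * (1 + ‖p‖)⁻¹ ^ 3 := by
    have h2 : (1 + ‖p‖)⁻¹ ^ 2 = (1 + ‖p‖) * (1 + ‖p‖)⁻¹ ^ 3 := by field_simp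
    rw [h2]
    gcongr
  calc 2 * C * (1 + ‖p‖)⁻¹ ^ 2 * (1 + (√(Metric.infDist p (⋃ i, range (γ i))))⁻¹)
      ≤ 2 * C * ((1 + R) * (1 + ‖p‖)⁻¹ ^ 3) *
        (1 + (√(Metric.infDist p (⋃ i, range (γ i))))⁻¹) := by gcongr
    _ = _ := by ring

lemma integrable_surfaceStress_mul (hγ : IsCurveSystem γ)
    (hu : IsRegularField (⋃ i, range (γ i)) C u) (j : Fin 2) {f : Plane → ℝ} (hf : Continuous f)
    (hc : HasCompactSupport f) : Integrable fun p => surfaceStress u p j * f p :=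
  integrable_mul_comp_of_hasCompactSupport measurable_id (integrableOn_surfaceStress hγ hu j) hf hc

/-- The component `j` of the force on the surface, tested with `f`. -/
def force (u : Space → Space) (γ : Fin m → ℝ → Plane) (j : Fin 2) (f : Plane → ℝ) : ℝ :=
  (∫ p, surfaceStress u p j * f p) +
    ∑ k, ∫ s in (0 : ℝ)..1, deriv (unitTangent (γ k)) s j * f (γ k s)

lemma force_eq (hγ : IsCurveSystem γ) (Ω : Set Plane) (j : Fin 2) {f : Plane → ℝ}
    (hf : Continuous f) :
    force u γ j f = (∫ p, surfaceStress u p j * f p) + lineTension Ω γ f j := by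
  rw [force, lineTension_apply hγ hf]
  simp only [mul_comm (f _)]

lemma continuous_deriv_unitTangent (hγ : IsCurveSystem γ) (k : Fin m) (j : Fin 2) :
    Continuous fun s => deriv (unitTangent (γ k)) s j :=
  (EuclideanSpace.proj (𝕜 := ℝ) j).continuous.comp
    ((contDiff_unitTangent (hγ.smooth k) (hγ.regular k)).continuous_deriv (by simp))

lemma force_sub (hγ : IsCurveSystem γ) (hu : IsRegularField (⋃ i, range (γ i)) C u) (j : Fin 2)
    {f g : Plane → ℝ} (hf : Continuous f) (hfc : HasCompactSupport f) (hg : Continuous g)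
    (hgc : HasCompactSupport g) :
    force u γ j (fun p => f p - g p) = force u γ j f - force u γ j g := by
  have hI : ∀ k, ∀ h : Plane → ℝ, Continuous h → IntervalIntegrable
      (fun s => deriv (unitTangent (γ k)) s j * h (γ k s)) volume 0 1 := fun k h hh =>
    ((continuous_deriv_unitTangent hγ k j).mul
      (hh.comp (hγ.smooth k).continuous)).intervalIntegrable _ _
  simp only [force, mul_sub]
  rw [integral_sub (integrable_surfaceStress_mul hγ hu j hf hfc)
    (integrable_surfaceStress_mul hγ hu j hg hgc)]
  simp only [fun k => intervalIntegral.integral_sub (hI k f hf) (hI k g hg),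
    Finset.sum_sub_distrib]
  ring

lemma exists_density_force (hγ : IsCurveSystem γ) (hu : IsRegularField (⋃ i, range (γ i)) C u)
    (j : Fin 2) (W : (Plane → ℝ) → Plane → ℝ)
    (hplane : ∀ c : Plane → ℝ, Measurable c → (∀ R, IntegrableOn c (Metric.closedBall 0 R)) →
      ∃ ρ : Plane → ℝ, LocallyIntegrable ρ ∧ ∀ h : Plane → ℝ, Continuous h → HasCompactSupport h →
        ∫ p, ρ p * h p = ∫ p, c p * W h p)
    (hcurve : ∀ k, ∃ ρ : Plane → ℝ, LocallyIntegrable ρ ∧ ∀ h : Plane → ℝ, Continuous h →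
      HasCompactSupport h → ∫ p, ρ p * h p =
        ∫ s in Ioc (0 : ℝ) 1, deriv (unitTangent (γ k)) s j * W h (γ k s)) :
    ∃ ρ : Plane → ℝ, LocallyIntegrable ρ ∧ ∀ h : Plane → ℝ, Continuous h → HasCompactSupport h →
      ∫ p, ρ p * h p = force u γ j (W h) := by
  have hΓ : IsClosed (⋃ i, range (γ i)) := hγ.isCompact_iUnion_range.isClosed
  have hm : AEStronglyMeasurable fun p => surfaceStress u p j :=
    aestronglyMeasurable_of_continuousOn_compl hΓ hγ.volume_iUnion_range
      ((EuclideanSpace.proj (𝕜 := ℝ) j).continuous.comp_continuousOn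
        (hu.continuousOn_surfaceStress hΓ))
  obtain ⟨ρ, hρ, h1⟩ := hplane _ hm.stronglyMeasurable_mk.measurable fun R =>
    (integrableOn_surfaceStress hγ hu j R).congr (ae_restrict_of_ae hm.ae_eq_mk)
  choose ρ' hρ' h2 using hcurve
  refine ⟨fun p => ρ p + ∑ k, ρ' k p, hρ.add ?_, fun h hh hc => ?_⟩
  · exact locallyIntegrable_finsetSum _ fun k _ => hρ' k
  · have hi : Integrable fun p => ρ p * h p := hρ.integrable_smul_right_of_hasCompactSupport hh hc
    have hi' : ∀ k, Integrable fun p => ρ' k p * h p := fun k =>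
      (hρ' k).integrable_smul_right_of_hasCompactSupport hh hc
    simp only [add_mul, Finset.sum_mul]
    rw [integral_add hi (integrable_finsetSum _ fun k _ => hi' k),
      integral_finsetSum _ fun k _ => hi' k, h1 h hh hc, force]
    congr 1
    · refine integral_congr_ae ?_
      filter_upwards [hm.ae_eq_mk] with p hp
      rw [hp]
    · refine Finset.sum_congr rfl fun k _ => ?_
      rw [h2 k h hh hc, intervalIntegral.integral_of_le zero_le_one]

/-- The line force is spread along horizontal lines, which could fail to give a density only where
the curve has a horizontal tangent. There the first component of `T' = turning • n` vanishes,
because that of the normal is the vertical component of the tangent. -/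
lemma exists_density_force_antideriv (hγ : IsCurveSystem γ)
    (hu : IsRegularField (⋃ i, range (γ i)) C u) :
    ∃ ρ : Plane → ℝ, LocallyIntegrable ρ ∧ ∀ h : Plane → ℝ, Continuous h → HasCompactSupport h →
      ∫ p, ρ p * h p = force u γ 0 (antideriv h) := by
  refine exists_density_force hγ hu 0 antideriv (fun c hc hint => ?_) fun k => ?_
  · exact exists_density_antideriv measurable_id hc hint fun Z hZ =>
      (ae_coord_notMem hZ).mono fun _ h _ => h
  · refine exists_density_antideriv (hγ.smooth k).continuous.measurable
      (continuous_deriv_unitTangent hγ k 0).measurable (fun R => ?_) fun Z hZ => ?_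
    · exact ((continuous_deriv_unitTangent hγ k 0).integrableOn_Ioc).integrableOn
    · have hd : ∀ s, HasDerivAt (fun s => γ k s 1) (deriv (γ k) s 1) s := fun s =>
        hasDerivAt_coord (((hγ.smooth k).differentiable (by simp) s).hasDerivAt) 1
      have h1 := ae_deriv_ne_zero_imp_notMem (c := fun s => γ k s 1)
        ((contDiff_coord (hγ.smooth k) 1).of_le (by norm_cast)) hZ
      refine ae_restrict_of_ae (h1.mono fun s hs h0 => hs fun hzero => h0 ?_)
      rw [(hd s).deriv] at hzero
      rw [deriv_unitTangent_eq (hγ.smooth k) (hγ.regular k)]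
      simp [rightNormal, unitTangent, hzero]

lemma exists_density_force_meanAntideriv (hγ : IsCurveSystem γ)
    (hu : IsRegularField (⋃ i, range (γ i)) C u) :
    ∃ ρ : Plane → ℝ, LocallyIntegrable ρ ∧ ∀ h : Plane → ℝ, Continuous h → HasCompactSupport h →
      ∫ p, ρ p * h p = force u γ 1 (meanAntideriv h) := by
  refine exists_density_force hγ hu 1 meanAntideriv (fun c hc hint => ?_) fun k => ?_
  · exact exists_density_meanAntideriv measurable_id hc hint
  · exact exists_density_meanAntideriv (hγ.smooth k).continuous.measurable
      (continuous_deriv_unitTangent hγ k 1).measurable fun R =>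
      ((continuous_deriv_unitTangent hγ k 1).integrableOn_Ioc).integrableOn

/-- A force that does no work on divergence free fields is the gradient of a surface pressure. -/
theorem exists_surfacePressure (hγ : IsCurveSystem γ) (hu : IsRegularField (⋃ i, range (γ i)) C u)
    (Ω : Set Plane)
    (hF : ∀ ψ : Plane → ℝ, ContDiff ℝ ∞ ψ → HasCompactSupport ψ →
      (∫ p, inner ℝ (surfaceStress u p) (perpGrad ψ p)) +
        ∑ j, lineTension Ω γ (fun p => perpGrad ψ p j) j = 0) :
    ∃ ϖ : Plane → ℝ, LocallyIntegrable ϖ ∧ ForceBalance ϖ u Ω γ := by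
  obtain ⟨ρ₀, hρ₀, h0⟩ := exists_density_force_antideriv hγ hu
  obtain ⟨ρ₁, hρ₁, h1⟩ := exists_density_force_meanAntideriv hγ hu
  -- The pressure tested with `h` is minus the sum of `F₀(antideriv h)` and `F₁(meanAntideriv h)`.
  -- For `h = ∂₀ f` this leaves `-F₀(f)`, because `antideriv` undoes the horizontal derivative and
  -- `meanAntideriv` kills it.
  refine ⟨fun p => -(ρ₀ p + ρ₁ p), (hρ₀.add hρ₁).neg, fun f hf hc j => ?_⟩
  have hdc : ∀ (g : Plane → ℝ), ContDiff ℝ ∞ g → ∀ e, Continuous fun p => fderiv ℝ g p e :=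
    fun g hg e => (contDiff_fderiv_apply hg e).continuous
  have hds : ∀ (g : Plane → ℝ), HasCompactSupport g → ∀ e,
      HasCompactSupport fun p => fderiv ℝ g p e := fun g hg e => hg.fderiv_apply (𝕜 := ℝ) e
  rw [← force_eq hγ Ω j hf.continuous]
  have hsplit : ∀ e, -∫ p, -(ρ₀ p + ρ₁ p) * fderiv ℝ f p e =
      force u γ 0 (antideriv fun p => fderiv ℝ f p e) +
        force u γ 1 (meanAntideriv fun p => fderiv ℝ f p e) := fun e => by
    have hi₀ : Integrable fun p => ρ₀ p * fderiv ℝ f p e :=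
      hρ₀.integrable_smul_right_of_hasCompactSupport (hdc f hf e) (hds f hc e)
    have hi₁ : Integrable fun p => ρ₁ p * fderiv ℝ f p e :=
      hρ₁.integrable_smul_right_of_hasCompactSupport (hdc f hf e) (hds f hc e)
    rw [← h0 _ (hdc f hf e) (hds f hc e), ← h1 _ (hdc f hf e) (hds f hc e), ← integral_add hi₀ hi₁,
      ← integral_neg]
    refine integral_congr_ae (ae_of_all _ fun p => ?_)
    ring
  refine (hsplit _).trans ?_
  fin_cases j
  · show force u γ 0 (antideriv fun p => fderiv ℝ f p e₀) +
      force u γ 1 (meanAntideriv fun p => fderiv ℝ f p e₀) = force u γ 0 f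
    rw [funext (antideriv_fderiv_zero hf hc), funext (meanAntideriv_fderiv_zero hf hc)]
    simp [force]
  · show force u γ 0 (antideriv fun p => fderiv ℝ f p e₁) +
      force u γ 1 (meanAntideriv fun p => fderiv ℝ f p e₁) = force u γ 1 f
    have hψ := contDiff_antideriv hf hc
    have hψc := hasCompactSupport_antideriv hc
    -- For `h = ∂₁ f` the hypothesis is used with the stream function `antideriv f`. It turns `F₀(∂₁
    -- antideriv f)` into `F₁(∂₀ antideriv f)`, and `meanAntideriv` of `∂₁ f` supplies the missing
    -- `f - ∂₀ antideriv f`.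
    have h2 : force u γ 0 (fun p => fderiv ℝ (antideriv f) p e₁) -
        force u γ 1 (fun p => fderiv ℝ (antideriv f) p e₀) = 0 := by
      have h3 := hF _ hψ hψc
      have h4 : ∀ p, inner ℝ (surfaceStress u p) (perpGrad (antideriv f) p) =
          surfaceStress u p 0 * fderiv ℝ (antideriv f) p e₁ -
            surfaceStress u p 1 * fderiv ℝ (antideriv f) p e₀ := fun p => by
        rw [inner_plane, perpGrad_zero, perpGrad_one]; ring
      have h5 : lineTension Ω γ (fun p => -fderiv ℝ (antideriv f) p e₀) 1 =
          -lineTension Ω γ (fun p => fderiv ℝ (antideriv f) p e₀) 1 := by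
        rw [lineTension_apply hγ (hdc _ hψ _).fun_neg, lineTension_apply hγ (hdc _ hψ _)]
        simp
      simp only [Fin.sum_univ_two, perpGrad_zero, perpGrad_one, h4] at h3
      rw [integral_sub (integrable_surfaceStress_mul hγ hu 0 (hdc _ hψ _) (hds _ hψc _))
        (integrable_surfaceStress_mul hγ hu 1 (hdc _ hψ _) (hds _ hψc _)), h5] at h3
      rw [force_eq hγ Ω 0 (hdc _ hψ _), force_eq hγ Ω 1 (hdc _ hψ _)]
      linarith
    rw [← funext (fderiv_antideriv_one hf hc)]
    have h6 : (meanAntideriv fun p => fderiv ℝ f p e₁) =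
        fun p => f p - fderiv ℝ (antideriv f) p e₀ := by
      funext p
      rw [meanAntideriv_fderiv_one hf hc, fderiv_antideriv_zero hf hc, sub_sub_cancel]
    rw [h6, force_sub hγ hu 1 hf.continuous hc (hdc _ hψ _) (hds _ hψc _)]
    linarith

end Force

/-! ### Gradient flows solve the free boundary model -/

lemma lineTension_zero (Ω : Set Plane) {m : ℕ} (γ : Fin m → ℝ → Plane) :
    lineTension Ω γ (fun _ => 0) = 0 := by
  simp [lineTension]

lemma divergence_congr {u v : Space → Space} (h : EqOn u v closedHalfSpace) {x : Space}
    (hx : x ∈ halfSpace) : divergence u x = divergence v x := by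
  have h1 : u =ᶠ[𝓝 x] v := by
    filter_upwards [isOpen_halfSpace.mem_nhds hx] with y hy
    exact h (le_of_lt hy : y 2 ≤ 0)
  simp only [divergence, h1.fderiv_eq]

lemma trace_congr {u v : Space → Space} (h : EqOn u v closedHalfSpace) : trace u = trace v := by
  funext p
  rw [trace, trace, h (embed_mem p)]

/-- The velocity of a gradient flow and its relation to the line tension. -/
lemma IsGradientFlow.velocity {T : ℝ} {Ω₀ : Set Plane} {m : ℕ} {γ₀ : Fin m → ℝ → Plane}
    {φ u : ℝ → Space → Space} (hΩ₀ : IsSmoothDomain Ω₀ γ₀) (hφ : IsMotion T Ω₀ γ₀ φ u)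
    (h : IsGradientFlow T Ω₀ φ) {t : ℝ} (ht : t ∈ Ico 0 T) :
    IsSmoothDomain (trace (φ t) '' Ω₀) (fun i => trace (φ t) ∘ γ₀ i) ∧
      IsVelocityField (frontier (trace (φ t) '' Ω₀)) (u t) ∧
      ∀ v ∈ eulerFields, ∫ x in halfSpace, ∑ i : Fin 3,
        inner ℝ (fderiv ℝ (u t) x (EuclideanSpace.single i 1))
          (fderiv ℝ v x (EuclideanSpace.single i 1)) =
        ∑ j, lineTension (trace (φ t) '' Ω₀) (fun i => trace (φ t) ∘ γ₀ i)
          (fun p => trace v p j) j := by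
  have hd := hφ.diffeo t ht
  have hdom : IsSmoothDomain (trace (φ t) '' Ω₀) (fun i => trace (φ t) ∘ γ₀ i) :=
    hΩ₀.image hd.traceHomeomorph (hφ.smooth_interface t ht) (hφ.regular_interface t ht)
  have hint : interface Ω₀ φ t = frontier (trace (φ t) '' Ω₀) := by
    rw [hd.frontier_image]; rfl
  refine ⟨hdom, ?_, fun v hv => ?_⟩
  · obtain ⟨v, hv, hvt⟩ := h.tangent t ht
    have heq : EqOn (u t) v closedHalfSpace := fun y hy => by
      obtain ⟨x, hx, rfl⟩ := hd.bijOn_closed.surjOn hy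
      rw [← hφ.timeDeriv_eq ht hx, hvt x hx]
    obtain ⟨C, hC⟩ := hφ.velocity t ht.2
    rw [← hint]
    refine ⟨⟨C, hC t ⟨ht.1, le_rfl⟩⟩, fun x hx => ?_, fun p => ?_, fun p hp => ?_⟩
    · rw [divergence_congr heq hx, hv.divergence_eq_zero x hx]
    · rw [heq (embed_mem p), hv.normal_eq_zero]
    · rw [trace_congr heq, hv.surfaceDivergence_eq_zero p hp]
  · obtain ⟨ψ, hψ, hder⟩ := h.weak t ht v hv
    have h1 := hasDerivAt_perimeter hdom hv hψ
    simp_rw [hd.energy_comp] at hder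
    have h2 := hder.unique h1
    rw [hd.metric_eq (a := timeDeriv T φ t) (b := v ∘ φ t) (w := v)
      (fun x hx => hφ.timeDeriv_eq ht hx) (fun x _ => rfl)] at h2
    exact neg_injective h2

/-- Test fields supported inside the half-space see neither stress nor line tension at the boundary
and give the bulk pressure. Extensions of rotated gradients then see only the boundary forces and
give the surface pressure. -/
theorem IsGradientFlow.exists_isSolution {T : ℝ} {Ω₀ : Set Plane} {m : ℕ}
    {γ₀ : Fin m → ℝ → Plane} {φ u : ℝ → Space → Space} (hΩ₀ : IsSmoothDomain Ω₀ γ₀)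
    (hφ : IsMotion T Ω₀ γ₀ φ u) (h : IsGradientFlow T Ω₀ φ) {Ω : ℝ → Set Plane}
    (hΩ : ∀ t ∈ Ico 0 T, Ω t = trace (φ t) '' Ω₀) :
    ∃ (P : ℝ → Space → ℝ) (ϖ : ℝ → Plane → ℝ),
      IsSolution T u P ϖ Ω fun t i => trace (φ t) ∘ γ₀ i := by
  -- The pressures are chosen for each time separately, since no regularity in time is asked of
  -- them; outside `[0, T)` they are zero.
  have key : ∀ t, ∃ (P : Space → ℝ) (ϖ : Plane → ℝ), t ∈ Ico 0 T →
      ContDiffOn ℝ ∞ P halfSpace ∧ (∀ x ∈ halfSpace, Laplacian.laplacian (u t) x = gradient P x) ∧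
      LocallyIntegrable ϖ ∧ ForceBalance ϖ (u t) (Ω t) fun i => trace (φ t) ∘ γ₀ i := fun t => by
    by_cases ht : t ∈ Ico 0 T
    swap
    · exact ⟨0, 0, fun h => absurd h ht⟩
    obtain ⟨hdom, hvel, hw⟩ := h.velocity hΩ₀ hφ ht
    obtain ⟨C, hC⟩ := hvel.regular
    rw [hdom.frontier_eq] at hC
    obtain ⟨P, hP, hS⟩ := exists_pressure (u := u t) hC.contDiffOn_halfSpace fun v hv hsub => by
      have h0 : trace v = fun _ => 0 := funext fun p => by
        rw [trace, image_eq_zero_of_notMem_tsupport fun hp => embed_notMem_halfSpace p (hsub hp)]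
        ext i; fin_cases i <;> simp
      rw [hw v hv, h0]
      simp [lineTension_zero]
    obtain ⟨ϖ, hϖ, hb⟩ := exists_surfacePressure hdom.curves hC (trace (φ t) '' Ω₀)
      fun g hg hgc => by
        obtain ⟨v, hv, hvt⟩ := exists_extension hg hgc
        have h1 := integral_inner_fderiv_eq hdom.curves hC hP hS hv
        rw [hw v hv, hvt] at h1
        rw [h1]
        ring
    refine ⟨P, ϖ, fun _ => ⟨hP, hS, hϖ, ?_⟩⟩
    rw [hΩ t ht]
    exact hb
  choose P ϖ hPϖ using key
  refine ⟨P, ϖ, ⟨fun t ht => ?_, fun t ht => (hPϖ t ht).1, fun t ht => ?_, fun t ht =>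
    (hPϖ t ht).2.1, fun t ht => ?_, fun t ht => (hPϖ t ht).2.2.1, fun t ht => (hPϖ t ht).2.2.2,
    fun t ht p hp => ?_, fun t ht i s => hφ.hasDerivWithinAt_trace ht (γ₀ i s)⟩⟩
  · rw [hΩ t ht]
    exact (h.velocity hΩ₀ hφ ht).1
  · exact (h.velocity hΩ₀ hφ ht).2.1.divergence_eq_zero
  · exact (h.velocity hΩ₀ hφ ht).2.1.normal_eq_zero
  · rw [hΩ t ht] at hp
    exact (h.velocity hΩ₀ hφ ht).2.1.surfaceDivergence_eq_zero p hp

end ILLSS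

end

/-! ### The equivalence of the gradient flow and the free boundary model -/

theorem mainTheorem1 (T : ℝ) (hT : 0 < T) (Ω₀ : Set ILLSS.Plane) {m : ℕ}
    (γ₀ : Fin m → ℝ → ILLSS.Plane) (hΩ₀ : ILLSS.IsSmoothDomain Ω₀ γ₀)
    (φ u : ℝ → ILLSS.Space → ILLSS.Space) (hφ : ILLSS.IsMotion T Ω₀ γ₀ φ u)
    (Ω : ℝ → Set ILLSS.Plane) :
    (ILLSS.IsGradientFlow T Ω₀ φ ∧ ∀ t ∈ Set.Ico 0 T, Ω t = ILLSS.trace (φ t) '' Ω₀) ↔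
      (Ω 0 = Ω₀ ∧
        ∃ (P : ℝ → ILLSS.Space → ℝ) (ϖ : ℝ → ILLSS.Plane → ℝ) (n : ℕ)
          (Γ : ℝ → Fin n → ℝ → ILLSS.Plane), ILLSS.IsSolution T u P ϖ Ω Γ) := by
  constructor
  · rintro ⟨h, hΩ⟩
    refine ⟨?_, ?_⟩
    · rw [hΩ 0 ⟨le_rfl, hT⟩, funext hφ.trace_zero, Set.image_id']
    · obtain ⟨P, ϖ, hs⟩ := h.exists_isSolution hΩ₀ hφ hΩ
      exact ⟨P, ϖ, m, _, hs⟩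
  · rintro ⟨hΩ, P, ϖ, n, Γ, h⟩
    exact h.isGradientFlow hφ hΩ
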